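/- **Setting.** Let $k\ge 2$, $T>0$, $\Omega=[0,2\pi]^2$, let $f_1,f_2:\mathbb R\to\mathbb R$ and the $2\pi$-periodic $u_0$ be $C^\infty$, and let $u$ be a classical solution, $2\pi$-periodic in $x$ and $y$ and continuous up to $t=0$, of $$u_t+\partial_xf_1(u)+\partial_yf_2(u)=\Delta u\quad(0<t\le T),\qquad u(0)=u_0 .$$ Divide $\Omega$ into $N_x\times N_y$ congruent cells $\tau=\tau_{i,j}=\tau^x_i\times\tau^y_j$ with side lengths $h^x=2\pi/N_x$, $h^y=2\pi/N_y$, indexed cyclically, and let $h$ be the diameter of a cell. Let $V_h^k$ be the space of functions that are, on each cell, polynomials of degree at most $k$ in each variable. At an interface, $[w]=w^+-w^-$ (in the positive coordinate direction) and $\{w\}=\frac12(w^-+w^+)$, and $$\widehat{w_x}=\tfrac{\beta_0}{h^x}[w]+\{w_x\}+\beta_1h^x[w_{xx}],\qquad \widehat{w_y}=\tfrac{\beta_0}{h^y}[w]+\{w_y\}+\beta_1h^y[w_{yy}],$$ with $$\beta_1=\frac1{2k(k+1)},\qquad \beta_0\ge\Gamma(\beta_1)=\sup_{0\ne v\in\mathbb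 P^{k-1}}\frac{2\,(v(1)-2\beta_1v'(1))^2}{\int_{-1}^1v^2}.$$ Let $\hat f_1,\hat f_2:\mathbb R^2\to\mathbb R$ be locally Lipschitz E-fluxes: $\operatorname{sign}(b-a)(\hat f_m(a,b)-f_m(w))\le0$ for all $w$ between $a$ and $b$. The DDG solution $u_h(t)\in V_h^k$ is continuous on $[0,T]$ and satisfies, for $0<t\le T$, each cell $\tau$ with outward normal $n$ and each $v\in V_h^k$, $$(\partial_tu_h,v)_\tau=(f(u_h)-\nabla u_h,\nabla v)_\tau-\int_{\partial\tau}v\,(\widehat{f(u_h)}-\widehat{\nabla u_h})\cdot n\,ds-\frac12\int_{\partial\tau}[u_h]\,\nabla v\cdot n\,ds ,$$ where $\widehat{f(u_h)}=(\hat f_1(u_h^-,u_h^+),\hat f_2(u_h^-,u_h^+))$ and in the last integral $[u_h]$ is the exterior minus the interior trace. **The special projection.** For a periodic smooth $v(x)$ let $P^{(x)}v$ be the piecewise polynomial of degree $\le k$ with $\int_{\tau^x_i}(P^{(x)}v-v)w''\,dx=0$ for all $w\in\mathbb P^k$, $\widehat{(P^{(x)}v)_x}=v'$ and $\{P^{(x)}v\}=v$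 at all nodes; define $P^{(y)}$ likewise, and $\Pi_h=P^{(x)}\otimes P^{(y)}$. Put $\omega_0=u-P^{(x)}u$. For each $y$ let $\omega_1$ be the function, polynomial of degree $\le k$ in $x$ on each $\tau_i^x$, with $$\int_{\tau_i^x}\omega_1v''\,dx=\int_{\tau_i^x}\big[(\partial_t-\partial_y^2)\omega_0\,v-f_1'(u)\,\omega_0\,v'+\partial_y(f_2'(u)\,\omega_0)\,v\big]dx$$ for all $v\in\mathbb P^k$ such that $v$ and $v'$ vanish at the left end point of $\tau_i^x$, and with $\{\omega_1\}=0$ and $\widehat{(\omega_1)_x}=\alpha_1[\omega_0]$ at all nodes in $x$, where $\alpha_1=[u_h]^{-1}\big(\hat f_1(u_h^-,u_h^+)-f_1(\{u_h\})\big)$ (and $\alpha_1=0$ where $[u_h]=0$). Let $\bar\omega_1$ be defined in the same way with $x$ and $y$ (and the indices 1 and 2) interchanged. Let $Q_h^y$ be the cellwise projection to $\mathbb P^k$ in $y$ that keeps the end point values and the moments against $\mathbb P^{k-2}$, let $Q_h^x$ be its analogue in $x$, and set $u_I=\Pi_hu-Q_h^y\omega_1-Q_h^x\bar\omega_1$.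 **Theorem.** Assume that $u(t)$ belongs to the periodic Sobolev space $H^{k+4}(\Omega)$ for all $t\in[0,T]$, with norms bounded in $t$. Let $\rho,C_0,K$ be constants. Then for each fixed $t\in(0,T]$ there is a constant $C$, independent of the mesh, such that for all meshes with $h^x\le\rho h^y$ and $h^y\le\rho h^x$ and all DDG solutions $u_h$ whose initial value satisfies $|u_h(0)|\le K$ on every cell and $$\|u_h(0)-u_I(0)\|_{L^2(\Omega)}\le C_0h^{k+2}\|u_0\|_{H^{k+4}},$$ one has $$\Big(\frac1{N_xN_yk^2}\sum_\tau\sum_{z\in\mathcal G_\tau}|\nabla(u-u_h)(z,t)|^2\Big)^{1/2}\le C\,h^{k+1}\sup_{0\le s\le t}\|u(s)\|_{H^{k+4}},$$ $$\Big(\frac1{N_xN_y(k+1)^2}\sum_\tau\sum_{z\in\mathcal L_\tau}|(u-u_h)(z,t)|^2\Big)^{1/2}\le C\,h^{k+2}\sup_{0\le s\le t}\|u(s)\|_{H^{k+4}}.$$ Here $\mathcal G_\tau$ and $\mathcal L_\tau$ are the tensor Gauss and Lobatto points of the cell $\tau$: the images, under the affine map of $[-1,1]^2$ onto $\tau$,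 of the pairs of zeros of the Legendre polynomial $L_k$, respectively of $\int_{-1}^sL_k$; on each cell $u_h$ is evaluated from inside the cell. -/

import Mathlib

open Set MeasureTheory Polynomial
open scoped ContDiff

noncomputable section

namespace DDG

/-! ### Periodic Sobolev spaces on the square `[0, 2π]²` -/

/-- The square `[0, 2π]²`. -/
def square : Set (ℝ × ℝ) := Icc 0 (2 * Real.pi) ×ˢ Icc 0 (2 * Real.pi)

/-- `2π`-periodicity in each variable. -/
def Periodic2 (g : ℝ → ℝ → ℝ) : Prop :=
  ∀ x y, g (x + 2 * Real.pi) y = g x y ∧ g x (y + 2 * Real.pi) = g x y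

/-- The classical derivative `∂ₓᵃ ∂ᵧᵇ φ`. -/
def mixedDeriv (a b : ℕ) (φ : ℝ → ℝ → ℝ) (x y : ℝ) : ℝ :=
  iteratedDeriv a (fun x' => iteratedDeriv b (fun y' => φ x' y') y) x

/-- `d` is a periodic, locally square integrable weak derivative `∂ₓᵃ ∂ᵧᵇ g`. -/
structure IsWeakDeriv (a b : ℕ) (g d : ℝ → ℝ → ℝ) : Prop where
  periodic : Periodic2 d
  memLp : MemLp (Function.uncurry d) 2 (volume.restrict square)
  integral_eq : ∀ φ : ℝ → ℝ → ℝ, ContDiff ℝ ∞ (Function.uncurry φ) →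
    HasCompactSupport (Function.uncurry φ) →
      ∫ p : ℝ × ℝ, g p.1 p.2 * mixedDeriv a b φ p.1 p.2 =
        (-1) ^ (a + b) * ∫ p : ℝ × ℝ, d p.1 p.2 * φ p.1 p.2

/-- Membership in the periodic Sobolev space `H^m`. -/
def MemH (m : ℕ) (g : ℝ → ℝ → ℝ) : Prop :=
  Periodic2 g ∧ MemLp (Function.uncurry g) 2 (volume.restrict square) ∧
    ∀ a b : ℕ, a + b ≤ m → ∃ d, IsWeakDeriv a b g d

/-- The weak derivative `∂ₓᵃ ∂ᵧᵇ g` (unique almost everywhere where it exists). -/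
def weakDeriv (a b : ℕ) (g : ℝ → ℝ → ℝ) : ℝ → ℝ → ℝ :=
  Classical.epsilon (IsWeakDeriv a b g)

/-- The norm `‖g‖_m` of `H^m`. -/
def normH (m : ℕ) (g : ℝ → ℝ → ℝ) : ℝ :=
  √(∑ a ∈ Finset.range (m + 1), ∑ b ∈ Finset.range (m + 1 - a),
    ∫ p in square, (weakDeriv a b g p.1 p.2) ^ 2)

/-- `sup_{0 ≤ s ≤ t} ‖u(s)‖_m`. -/
def supNormH (m : ℕ) (u : ℝ → ℝ → ℝ → ℝ) (t : ℝ) : ℝ :=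
  sSup ((fun s => normH m (u s)) '' Icc 0 t)

/-! ### The convection-diffusion equation -/

/-- `u = u(t, x, y)` is a periodic classical solution of
`u_t + ∂ₓ f₁(u) + ∂ᵧ f₂(u) = Δ u` for `0 < t ≤ T` with `u(0) = u₀`. -/
structure IsSolution (T : ℝ) (f₁ f₂ : ℝ → ℝ) (u₀ : ℝ → ℝ → ℝ) (u : ℝ → ℝ → ℝ → ℝ) : Prop where
  continuousOn : ContinuousOn (fun p : ℝ × ℝ × ℝ => u p.1 p.2.1 p.2.2) (Icc 0 T ×ˢ univ)
  periodic : ∀ t ∈ Icc 0 T, Periodic2 (u t)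
  contDiff : ∀ t ∈ Ioc 0 T, ContDiff ℝ 2 (Function.uncurry (u t))
  equation : ∀ t ∈ Ioc 0 T, ∀ x y : ℝ,
    HasDerivWithinAt (fun s => u s x y)
      (iteratedDeriv 2 (fun x' => u t x' y) x + iteratedDeriv 2 (fun y' => u t x y') y
        - deriv (fun x' => f₁ (u t x' y)) x - deriv (fun y' => f₂ (u t x y')) y)
      (Icc 0 T) t
  initial : u 0 = u₀

/-! ### Uniform periodic partitions of `[0, 2π]` into `N` cells, indexed cyclically by `Fin N` -/

/-- Cell length. -/
def step (N : ℕ) : ℝ := 2 * Real.pi / N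

/-- Left end point of cell `i`. -/
def left (N : ℕ) (i : Fin N) : ℝ := step N * (i : ℕ)

/-- Right end point of cell `i`. -/
def right (N : ℕ) (i : Fin N) : ℝ := step N * ((i : ℕ) + 1)

/-- Diameter of the cells of the `Nx × Ny` mesh. -/
def meshSize (Nx Ny : ℕ) : ℝ := √(step Nx ^ 2 + step Ny ^ 2)

/-- Trace from the left at the interface between the cells `i` and `i + 1`
of a cellwise defined function. -/
def traceL {N : ℕ} (g : Fin N → ℝ → ℝ) (i : Fin N) : ℝ := g i (right N i)

/-- Trace from the right at the interface between the cells `i` and `i + 1` (cyclically). -/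
def traceR {N : ℕ} [NeZero N] (g : Fin N → ℝ → ℝ) (i : Fin N) : ℝ := g (i + 1) (left N (i + 1))

/-- The jump at the interface between the cells `i` and `i + 1`. -/
def jump {N : ℕ} [NeZero N] (g : Fin N → ℝ → ℝ) (i : Fin N) : ℝ := traceR g i - traceL g i

/-- The average at the interface between the cells `i` and `i + 1`. -/
def avg {N : ℕ} [NeZero N] (g : Fin N → ℝ → ℝ) (i : Fin N) : ℝ := (traceL g i + traceR g i) / 2

/-- The diffusion flux `β₀ h⁻¹ [g] + {g'} + β₁ h [g'']` at the interface between the cells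
`i` and `i + 1`. -/
def diffFlux {N : ℕ} [NeZero N] (β₀ β₁ : ℝ) (g : Fin N → ℝ → ℝ) (i : Fin N) : ℝ :=
  β₀ * (step N)⁻¹ * jump g i + avg (fun m => deriv (g m)) i
    + β₁ * step N * jump (fun m => deriv (deriv (g m))) i

/-- `Γ(β₁)`: the supremum of `2 (v(1) - 2 β₁ v'(1))² / ∫_{-1}^1 v²` over polynomials `v ≠ 0` of
degree at most `k - 1`. -/
def Gam (k : ℕ) (β₁ : ℝ) : ℝ :=
  sSup {r : ℝ | ∃ v : ℝ[X], v ≠ 0 ∧ v.natDegree ≤ k - 1 ∧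
    r = 2 * (v.eval 1 - 2 * β₁ * (derivative v).eval 1) ^ 2 / ∫ s in (-1 : ℝ)..1, (v.eval s) ^ 2}

/-! ### The direct discontinuous Galerkin scheme -/

/-- The E-flux (entropy flux) condition for a numerical flux `g` of `f`. -/
def IsEFlux (f : ℝ → ℝ) (g : ℝ → ℝ → ℝ) : Prop :=
  ∀ a b : ℝ, ∀ w ∈ uIcc a b, Real.sign (b - a) * (g a b - f w) ≤ 0

/-- Coefficients of a polynomial in `ℚ_k`, of degree at most `k` in each variable. -/
abbrev Coef (k : ℕ) : Type := Fin (k + 1) → Fin (k + 1) → ℝ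

/-- The polynomial function with coefficients `c`. -/
def val {k : ℕ} (c : Coef k) (x y : ℝ) : ℝ :=
  ∑ a : Fin (k + 1), ∑ b : Fin (k + 1), c a b * x ^ (a : ℕ) * y ^ (b : ℕ)

/-- The discontinuous finite element space `V_h^k`: one polynomial in `ℚ_k` for each cell. The
traces on the boundary of a cell of a function and its derivatives are those of the polynomial. -/
abbrev Vh (Nx Ny k : ℕ) : Type := Fin Nx → Fin Ny → Coef k

/-- Restriction of `w ∈ V_h^k` to a horizontal line through the `j`-th row of cells. -/
def lineX {Nx Ny k : ℕ} (w : Vh Nx Ny k) (j : Fin Ny) (y : ℝ) : Fin Nx → ℝ → ℝ :=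
  fun i x => val (w i j) x y

/-- Restriction of `w ∈ V_h^k` to a vertical line through the `i`-th column of cells. -/
def lineY {Nx Ny k : ℕ} (w : Vh Nx Ny k) (i : Fin Nx) (x : ℝ) : Fin Ny → ℝ → ℝ :=
  fun j y => val (w i j) x y

/-- The normal component of `f̂(w) - ∇̂w` at the interface between the cells `i` and `i + 1`
of a one-dimensional partition. -/
def totalFlux {N : ℕ} [NeZero N] (β₀ β₁ : ℝ) (g : ℝ → ℝ → ℝ) (w : Fin N → ℝ → ℝ) (i : Fin N) : ℝ :=
  g (traceL w i) (traceR w i) - diffFlux β₀ β₁ w i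

/-- The right-hand side of the scheme on the cell `(i, j)` with the test function `v = val c`:
`(f(w) - ∇w, ∇v)_τ - ∫_{∂τ} v (f̂(w) - ∇̂w)·n ds - ½ ∫_{∂τ} [w] ∇v·n ds`,
where `[w]` is the exterior minus the interior trace for the outward normal `n`. -/
def schemeRHS {Nx Ny k : ℕ} [NeZero Nx] [NeZero Ny] (β₀ β₁ : ℝ) (f₁ f₂ : ℝ → ℝ)
    (g₁ g₂ : ℝ → ℝ → ℝ) (w : Vh Nx Ny k) (i : Fin Nx) (j : Fin Ny) (c : Coef k) : ℝ :=
  let v : ℝ → ℝ → ℝ := val c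
  let vx : ℝ → ℝ → ℝ := fun x y => deriv (fun x' => v x' y) x
  let vy : ℝ → ℝ → ℝ := fun x y => deriv (fun y' => v x y') y
  let W : ℝ → ℝ → ℝ := val (w i j)
  (∫ x in left Nx i..right Nx i, ∫ y in left Ny j..right Ny j,
      ((f₁ (W x y) - deriv (fun x' => W x' y) x) * vx x y
        + (f₂ (W x y) - deriv (fun y' => W x y') y) * vy x y))
  - ((∫ y in left Ny j..right Ny j,
        (v (right Nx i) y * totalFlux β₀ β₁ g₁ (lineX w j y) i
          - v (left Nx i) y * totalFlux β₀ β₁ g₁ (lineX w j y) (i - 1)))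
    + ∫ x in left Nx i..right Nx i,
        (v x (right Ny j) * totalFlux β₀ β₁ g₂ (lineY w i x) j
          - v x (left Ny j) * totalFlux β₀ β₁ g₂ (lineY w i x) (j - 1)))
  - (1 / 2) * ((∫ y in left Ny j..right Ny j,
        (jump (lineX w j y) i * vx (right Nx i) y + jump (lineX w j y) (i - 1) * vx (left Nx i) y))
    + ∫ x in left Nx i..right Nx i,
        (jump (lineY w i x) j * vy x (right Ny j) + jump (lineY w i x) (j - 1) * vy x (left Ny j)))

/-- `uh` solves the semi-discrete scheme for `0 < t ≤ T`. -/
def IsDDGSolution {Nx Ny k : ℕ} [NeZero Nx] [NeZero Ny] (T β₀ β₁ : ℝ) (f₁ f₂ : ℝ → ℝ)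
    (g₁ g₂ : ℝ → ℝ → ℝ) (uh : ℝ → Vh Nx Ny k) : Prop :=
  ContinuousOn uh (Icc 0 T) ∧
  ∀ t ∈ Ioc 0 T, ∃ d : Vh Nx Ny k, HasDerivWithinAt uh d (Icc 0 T) t ∧
    ∀ (i : Fin Nx) (j : Fin Ny) (c : Coef k),
      ∫ x in left Nx i..right Nx i, ∫ y in left Ny j..right Ny j, val (d i j) x y * val c x y =
        schemeRHS β₀ β₁ f₁ f₂ g₁ g₂ (uh t) i j c

/-! ### The special projection `u_I = Π_h u - ω` of the exact solution -/

/-- A cellwise polynomial as a cellwise function. -/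
def pfun {N : ℕ} (p : Fin N → ℝ[X]) : Fin N → ℝ → ℝ := fun i x => (p i).eval x

/-- The conditions defining the one-dimensional global projection `P v`. -/
structure IsProj {N : ℕ} [NeZero N] (k : ℕ) (β₀ β₁ : ℝ) (v : ℝ → ℝ) (p : Fin N → ℝ[X]) : Prop where
  degree : ∀ i, (p i).natDegree ≤ k
  orth : ∀ i, ∀ w : ℝ[X], w.natDegree ≤ k →
    ∫ x in left N i..right N i, ((p i).eval x - v x) * (derivative (derivative w)).eval x = 0
  flux : ∀ i, diffFlux β₀ β₁ (pfun p) i = deriv v (right N i)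
  average : ∀ i, avg (pfun p) i = v (right N i)

/-- The one-dimensional global projection `P v`. -/
def proj (N : ℕ) [NeZero N] (k : ℕ) (β₀ β₁ : ℝ) (v : ℝ → ℝ) : Fin N → ℝ[X] :=
  Classical.epsilon (IsProj k β₀ β₁ v)

/-- The tensor product projection `Π_h v = P⁽ˣ⁾ ⊗ P⁽ʸ⁾ v` on the cell `(i, j)`. -/
def tensorProj (Nx Ny : ℕ) [NeZero Nx] [NeZero Ny] (k : ℕ) (β₀ β₁ : ℝ) (v : ℝ → ℝ → ℝ)
    (i : Fin Nx) (j : Fin Ny) (x y : ℝ) : ℝ :=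
  (proj Nx k β₀ β₁ (fun x' => (proj Ny k β₀ β₁ (fun y' => v x' y') j).eval y) i).eval x

/-- `E^x v = v - P⁽ˣ⁾ v` on the `i`-th column of cells. -/
def projErr (N : ℕ) [NeZero N] (k : ℕ) (β₀ β₁ : ℝ) (v : ℝ → ℝ → ℝ) (i : Fin N) (x y : ℝ) : ℝ :=
  v x y - (proj N k β₀ β₁ (fun x' => v x' y) i).eval x

/-- The form `⟨(∂_t - ∂ᵧ²) w, v⟩ - ⟨f₁'(u) w, v'⟩ + ⟨∂ᵧ (f₂'(u) w), v⟩` on the `i`-th cell in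
`x`, for `w = E^x u`, at the time `t` and the height `y`. -/
def corrForm (N : ℕ) [NeZero N] (k : ℕ) (T β₀ β₁ : ℝ) (f₁ f₂ : ℝ → ℝ) (u : ℝ → ℝ → ℝ → ℝ)
    (t y : ℝ) (i : Fin N) (v : ℝ[X]) : ℝ :=
  let w : ℝ → ℝ → ℝ → ℝ := fun s x y' => projErr N k β₀ β₁ (u s) i x y'
  ∫ x in left N i..right N i,
    ((derivWithin (fun s => w s x y) (Icc 0 T) t - iteratedDeriv 2 (fun y' => w t x y') y)
        * v.eval x
      - deriv f₁ (u t x y) * w t x y * (derivative v).eval x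
      + deriv (fun y' => deriv f₂ (u t x y') * w t x y') y * v.eval x)

/-- `α = [w]⁻¹ (f̂(w⁻, w⁺) - f({w}))`. -/
def alpha (f : ℝ → ℝ) (g : ℝ → ℝ → ℝ) (a b : ℝ) : ℝ := (g a b - f ((a + b) / 2)) / (b - a)

/-- The conditions defining a one-dimensional correction: `⟨ω, v''⟩ = B(v)` on each cell for all
`v` in the complement of `ℙ¹` in `ℙᵏ` that consists of the twofold integrals, from the left end
point, of polynomials of degree at most `k - 2`; prescribed diffusion flux; vanishing averages. -/
structure IsCorrection {N : ℕ} [NeZero N] (k : ℕ) (β₀ β₁ : ℝ) (B : Fin N → ℝ[X] → ℝ)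
    (q : Fin N → ℝ) (p : Fin N → ℝ[X]) : Prop where
  degree : ∀ i, (p i).natDegree ≤ k
  form : ∀ i, ∀ v : ℝ[X], v.natDegree ≤ k → v.eval (left N i) = 0 →
    (derivative v).eval (left N i) = 0 →
      ∫ x in left N i..right N i, (p i).eval x * (derivative (derivative v)).eval x = B i v
  flux : ∀ i, diffFlux β₀ β₁ (pfun p) i = q i
  average : ∀ i, avg (pfun p) i = 0

/-- The correction function `ω₁` for `E^x u` at the time `t`, on the line of height `y` through
the `j`-th row of cells; `α₁` is taken at the discrete function `w`. -/
def omega {Nx Ny k : ℕ} [NeZero Nx] (T β₀ β₁ : ℝ) (f₁ f₂ : ℝ → ℝ) (g₁ : ℝ → ℝ → ℝ)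
    (u : ℝ → ℝ → ℝ → ℝ) (w : Vh Nx Ny k) (t : ℝ) (j : Fin Ny) (y : ℝ) : Fin Nx → ℝ[X] :=
  Classical.epsilon (IsCorrection k β₀ β₁ (corrForm Nx k T β₀ β₁ f₁ f₂ u t y)
    (fun i => alpha f₁ g₁ (traceL (lineX w j y) i) (traceR (lineX w j y) i)
      * jump (fun m x => projErr Nx k β₀ β₁ (u t) m x y) i))

/-- The conditions defining the Gauss-Lobatto projection of `v` to `ℙᵏ` on `[a, b]`, `k ≥ 2`. -/
structure IsLobattoProj (k : ℕ) (a b : ℝ) (v : ℝ → ℝ) (p : ℝ[X]) : Prop where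
  degree : p.natDegree ≤ k
  eval_left : p.eval a = v a
  eval_right : p.eval b = v b
  orth : ∀ q : ℝ[X], q.natDegree ≤ k - 2 → ∫ x in a..b, (v x - p.eval x) * q.eval x = 0

/-- The Gauss-Lobatto projection. -/
def lobattoProj (k : ℕ) (a b : ℝ) (v : ℝ → ℝ) : ℝ[X] := Classical.epsilon (IsLobattoProj k a b v)

/-- `Q_h^y ω₁` on the cell `(i, j)`. -/
def corrX {Nx Ny k : ℕ} [NeZero Nx] (T β₀ β₁ : ℝ) (f₁ f₂ : ℝ → ℝ) (g₁ : ℝ → ℝ → ℝ)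
    (u : ℝ → ℝ → ℝ → ℝ) (w : Vh Nx Ny k) (t : ℝ) (i : Fin Nx) (j : Fin Ny) (x y : ℝ) : ℝ :=
  (lobattoProj k (left Ny j) (right Ny j)
    (fun y' => (omega T β₀ β₁ f₁ f₂ g₁ u w t j y' i).eval x)).eval y

/-- `Q_h^x ω̄₁` on the cell `(i, j)`: the same construction with the roles of `x` and `y`
interchanged. -/
def corrY {Nx Ny k : ℕ} [NeZero Ny] (T β₀ β₁ : ℝ) (f₁ f₂ : ℝ → ℝ) (g₂ : ℝ → ℝ → ℝ)
    (u : ℝ → ℝ → ℝ → ℝ) (w : Vh Nx Ny k) (t : ℝ) (i : Fin Nx) (j : Fin Ny) (x y : ℝ) : ℝ :=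
  corrX (Nx := Ny) (Ny := Nx) (k := k) T β₀ β₁ f₂ f₁ g₂ (fun s y' x' => u s x' y')
    (fun n m a b => w m n b a) t j i y x

/-- `u_I = Π_h u - (Q_h^y ω₁ + Q_h^x ω̄₁)` at the time `t`, on the cell `(i, j)`. -/
def uI {Nx Ny k : ℕ} [NeZero Nx] [NeZero Ny] (T β₀ β₁ : ℝ) (f₁ f₂ : ℝ → ℝ) (g₁ g₂ : ℝ → ℝ → ℝ)
    (u : ℝ → ℝ → ℝ → ℝ) (w : Vh Nx Ny k) (t : ℝ) (i : Fin Nx) (j : Fin Ny) (x y : ℝ) : ℝ :=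
  tensorProj Nx Ny k β₀ β₁ (u t) i j x y
    - (corrX T β₀ β₁ f₁ f₂ g₁ u w t i j x y + corrY T β₀ β₁ f₁ f₂ g₂ u w t i j x y)

/-- `L²` norm over the square of a cellwise defined function. -/
def normL2 {Nx Ny : ℕ} (w : Fin Nx → Fin Ny → ℝ → ℝ → ℝ) : ℝ :=
  √(∑ i, ∑ j, ∫ x in left Nx i..right Nx i, ∫ y in left Ny j..right Ny j, (w i j x y) ^ 2)

/-! ### Gauss and Lobatto points and the discrete errors -/

/-- The Legendre polynomial of degree `n` on `[-1, 1]`. -/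
def legendre (n : ℕ) : ℝ[X] :=
  C (1 / (2 ^ n * (n.factorial : ℝ))) * derivative^[n] ((X ^ 2 - 1) ^ n)

/-- The antiderivative of a polynomial that vanishes at `-1`. -/
def primitive (p : ℝ[X]) : ℝ[X] :=
  let q : ℝ[X] := p.sum fun n a => C (a / (n + 1)) * X ^ (n + 1)
  q - C (q.eval (-1))

/-- The Gauss points of degree `k` on `[-1, 1]`: the zeros of `L_k`. -/
def gaussPts (k : ℕ) : Finset ℝ := (legendre k).roots.toFinset

/-- The Lobatto points of degree `k + 1` on `[-1, 1]`: the zeros of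
`φ_{k+1}(s) = ∫_{-1}^s L_k`. -/
def lobattoPts (k : ℕ) : Finset ℝ := (primitive (legendre k)).roots.toFinset

/-- The point of the cell `i` with the reference coordinate `s ∈ [-1, 1]`. -/
def pt (N : ℕ) (i : Fin N) (s : ℝ) : ℝ := (left N i + right N i) / 2 + step N / 2 * s

/-- Root-mean-square error of the gradient over the tensor Gauss points. -/
def errGauss {Nx Ny k : ℕ} (v : ℝ → ℝ → ℝ) (w : Vh Nx Ny k) : ℝ :=
  √(1 / ((Nx : ℝ) * Ny * (k : ℝ) ^ 2) * ∑ i, ∑ j, ∑ r ∈ gaussPts k, ∑ s ∈ gaussPts k,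
    ((deriv (fun x => v x (pt Ny j s) - val (w i j) x (pt Ny j s)) (pt Nx i r)) ^ 2
      + (deriv (fun y => v (pt Nx i r) y - val (w i j) (pt Nx i r) y) (pt Ny j s)) ^ 2))

/-- Root-mean-square error over the tensor Lobatto points. -/
def errLobatto {Nx Ny k : ℕ} (v : ℝ → ℝ → ℝ) (w : Vh Nx Ny k) : ℝ :=
  √(1 / ((Nx : ℝ) * Ny * ((k : ℝ) + 1) ^ 2) * ∑ i, ∑ j, ∑ r ∈ lobattoPts k, ∑ s ∈ lobattoPts k,
    (v (pt Nx i r) (pt Ny j s) - val (w i j) (pt Nx i r) (pt Ny j s)) ^ 2)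

end DDG

end

open Set MeasureTheory Polynomial
open scoped ContDiff

noncomputable section

namespace DDG

open Function (uncurry)
open Finset (sum_congr sum_add_distrib sum_nonneg mul_sum sum_sub_distrib sum_le_sum single_le_sum sum_comm
  sum_eq_single sum_mul)
open scoped Real
open Real (pi_pos exp sin cos smoothTransition norm_eq_abs norm_of_nonneg)
open Complex (I norm_real)
open intervalIntegral renaming integral_const_mul → ii_const_mul, integral_add → ii_add, integral_sub → ii_sub,
  integral_finsetSum → ii_sum, integral_mono_on → ii_mono, integral_nonneg → ii_nonneg, integral_const → ii_const,
  integral_mul_const → ii_mul_const, integral_congr → ii_congr, integral_neg → ii_neg,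
  continuous_parametric_intervalIntegral_of_continuous' → continuous_ii
local notation "𝒟" => derivative
local notation "C∞" => ContDiff ℝ ∞
local notation "cell" N:max i:max => Icc (left N i) (right N i)
local notation "∮" x:max N:max i:max "," e:60 => intervalIntegral (fun x => e) (left N i) (right N i) volume
local notation "∮₁" x:max "," e:60 => intervalIntegral (fun x => e) (-1 : ℝ) 1 volume
local notation "Fn" => ℝ → ℝ
local notation "Fn₂" => ℝ → ℝ → ℝ
local notation "Pw" N:max => Fin N → ℝ[X]
local notation "C₂" f:max => Continuous (uncurry f)
local notation "pos!" => by positivity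
local notation "num!" => by norm_num
local notation "fp!" => by fun_prop
local notation "om!" => by omega
variable {N Nx Ny k m n : ℕ} [NeZero N] [NeZero Nx] [NeZero Ny] {β θ M : ℝ} {f f1 f2 : Fn} {g : Fn₂}

lemma scale_le {a b c : ℝ} (h : b ≤ c) (ha : 0 ≤ a) : a * b ≤ a * c := mul_le_mul_of_nonneg_left h ha

lemma cont₂ (h : Continuous fun p : ℝ × ℝ => g p.1 p.2) : C₂ g := h

lemma ii {E : Type*} [NormedAddCommGroup E] {f : ℝ → E} (h : Continuous f) {a b : ℝ} :
    IntervalIntegrable f volume a b :=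
  h.intervalIntegrable a b

lemma _root_.ContDiff.hd (h : C∞ f) (x : ℝ) : HasDerivAt f (deriv f x) x :=
  (h.differentiable (by simp)).differentiableAt.hasDerivAt

lemma _root_.ContDiff.drv (h : C∞ f) : C∞ (deriv f) := (contDiff_infty_iff_deriv.1 h).2

/-- A function of two variables together with its partial derivatives. -/
abbrev Jet : Type := ℕ → ℕ → Fn₂


/-! ### Legendre polynomials -/

lemma eval_iterate_derivative_eq_taylor (p : ℝ[X]) (n : ℕ) (r : ℝ) :
    (𝒟^[n] p).eval r = n.factorial * (taylor r p).coeff n := by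
  rw [taylor_coeff, ← factorial_smul_hasseDeriv]; simp [nsmul_eq_mul]

lemma taylor_rodrigues (n : ℕ) {r : ℝ} (hr : r ^ 2 = 1) :
    taylor r ((X ^ 2 - 1 : ℝ[X]) ^ n) = X ^ n * (X + C (2 * r)) ^ n := by
  rw [taylor_apply]; simp only [pow_comp, sub_comp, X_comp, one_comp]; rw [← mul_pow]; congr 1
  have : (C (r ^ 2) : ℝ[X]) = 1 := by rw [hr]; simp
  rw [C_pow] at this; rw [C_mul]; have h2 : (C (2:ℝ) : ℝ[X]) = 2 := rfl; rw [h2]; linear_combination this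

lemma eval_derivative_legendre (n j : ℕ) {r : ℝ} (hr : r ^ 2 = 1) :
    (𝒟^[j] (legendre n)).eval r = (n + j).factorial * (n.choose j) * (2 * r) ^ (n - j) / (2 ^ n * n.factorial) := by
  have h : 𝒟^[j] (legendre n) = C (1 / (2 ^ n * (n.factorial : ℝ))) * 𝒟^[j + n] ((X ^ 2 - 1) ^ n) := by
    rw [legendre, iterate_derivative_C_mul, Function.iterate_add_apply]
  rw [h, eval_mul, eval_C, eval_iterate_derivative_eq_taylor, taylor_rodrigues n hr]
  rw [coeff_X_pow_mul, coeff_X_add_C_pow, add_comm j n]; ring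

lemma legendre_one (n : ℕ) : (legendre n).eval 1 = 1 := by
  have := eval_derivative_legendre n 0 (r := 1) num!
  simp only [Function.iterate_zero, id, add_zero, Nat.choose_zero_right, Nat.sub_zero] at this; rw [this]
  have : (n.factorial : ℝ) ≠ 0 := pos!; field_simp; simp

lemma legendre_neg_one (n : ℕ) : (legendre n).eval (-1) = (-1) ^ n := by
  have := eval_derivative_legendre n 0 (r := -1) num!
  simp only [Function.iterate_zero, id, add_zero, Nat.choose_zero_right, Nat.sub_zero] at this
  rw [this, mul_pow]; have : (n.factorial : ℝ) ≠ 0 := pos!; field_simp; simp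

lemma legendre_deriv_end (n : ℕ) {r : ℝ} (hr : r ^ 2 = 1) :
    (𝒟 (legendre n)).eval r = n * (n + 1) / 2 * r ^ (n + 1) := by
  have := eval_derivative_legendre n 1 hr; simp only [Function.iterate_one] at this; rw [this]
  rcases n with _ | n
  · simp
  · have h0 : ((n + 1).factorial : ℝ) ≠ 0 := pos!
    rw [Nat.factorial_succ (n + 1), Nat.choose_one_right, Nat.add_sub_cancel, mul_pow]
    have : r ^ (n + 1 + 1) = r ^ n := by rw [add_assoc, pow_add]; simp [hr]
    rw [this]; push_cast; field_simp; ring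

lemma legendre_deriv2_end (n : ℕ) {r : ℝ} (hr : r ^ 2 = 1) :
    (𝒟 (𝒟 (legendre n))).eval r = ((n : ℝ) - 1) * n * (n + 1) * (n + 2) / 8 * r ^ n := by
  have := eval_derivative_legendre n 2 hr
  simp only [Function.iterate_succ, Function.iterate_zero, Function.comp, id] at this; rw [this]
  rcases n with _ | _ | n
  · simp
  · simp
  · have h0 : ((n + 2).factorial : ℝ) ≠ 0 := pos!
    have h1 : ((n + 2 + 2).factorial : ℝ) = (n + 4) * (n + 3) * (n + 2).factorial := by
      rw [Nat.factorial_succ (n + 3), Nat.factorial_succ (n + 2)]; push_cast; ring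
    have h2 : (((n + 1 + 1).choose 2 : ℕ) : ℝ) = (n + 2) * (n + 1) / 2 := by rw [Nat.cast_choose_two]; push_cast; ring
    have e : n + 1 + 1 - 2 = n := om!; rw [h1, h2, e, mul_pow]
    have : r ^ (n + 1 + 1) = r ^ n := by rw [add_assoc, pow_add]; simp [hr]
    rw [this]; have h0' := h0; push_cast; field_simp; ring

lemma rodrigues_eval_eq_zero {n m : ℕ} (h : m < n) {r : ℝ} (hr : r ^ 2 = 1) :
    (𝒟^[m] ((X ^ 2 - 1 : ℝ[X]) ^ n)).eval r = 0 := by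
  rw [eval_iterate_derivative_eq_taylor, taylor_rodrigues n hr, coeff_X_pow_mul']; simp [h]

lemma poly_integral_parts (p q : ℝ[X]) (a b : ℝ) : ∫ x in a..b, (𝒟 p).eval x * q.eval x =
      p.eval b * q.eval b - p.eval a * q.eval a - ∫ x in a..b, p.eval x * (𝒟 q).eval x := by
  rw [eq_sub_iff_add_eq, ← ii_add]
  · exact intervalIntegral.integral_deriv_mul_eq_sub (u := fun x => p.eval x)
      (v := fun x => q.eval x) (u' := fun x => (𝒟 p).eval x)
      (v' := fun x => (𝒟 q).eval x)
      (fun x _ => p.hasDerivAt x) (fun x _ => q.hasDerivAt x)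
      (by apply ii; fun_prop)
      (by apply ii; fun_prop)
  · apply ii; fun_prop
  · apply ii; fun_prop

lemma rodrigues_orth {n m : ℕ} (hm : m ≤ n) : ∀ q : ℝ[X], q.natDegree < m →
    ∮₁ x, (𝒟^[m] ((X ^ 2 - 1 : ℝ[X]) ^ n)).eval x * q.eval x = 0 := by
  induction m with
  | zero => intro q hq; omega
  | succ m ih =>
    intro q hq
    rw [Function.iterate_succ_apply', poly_integral_parts,
      rodrigues_eval_eq_zero om! num!, rodrigues_eval_eq_zero om! num!]
    rcases Nat.eq_zero_or_pos q.natDegree with h | h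
    · rw [natDegree_eq_zero] at h; obtain ⟨c, rfl⟩ := h; simp
    · rw [ih om! (𝒟 q) (by have := natDegree_derivative_le q; omega)]; simp

lemma legendre_orth (q : ℝ[X]) (hq : q.natDegree < n) : ∮₁ x, (legendre n).eval x * q.eval x = 0 := by
  simp only [legendre, eval_mul, eval_C, mul_assoc]; rw [ii_const_mul, rodrigues_orth le_rfl q hq, mul_zero]

lemma natDegree_legendre (n : ℕ) : (legendre n).natDegree = n := by
  have h : ((X ^ 2 - 1 : ℝ[X]) ^ n).natDegree = 2 * n := by
    have : (X ^ 2 - 1 : ℝ[X]) = X ^ 2 - C 1 := by simp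
    rw [natDegree_pow, this, natDegree_X_pow_sub_C]; ring
  apply le_antisymm
  · rw [legendre]; refine (natDegree_C_mul_le _ _).trans ((natDegree_iterate_derivative _ _).trans ?_); rw [h]; omega
  · by_contra hlt; have h1 := eval_derivative_legendre n n (r := 1) num!
    rw [iterate_derivative_eq_zero om!] at h1; simp only [eval_zero, Nat.choose_self] at h1
    have : 0 < ((n + n).factorial : ℝ) * ((1 : ℕ) : ℝ) * (2 * 1) ^ (n - n) / (2 ^ n * n.factorial) := pos!; linarith

lemma legendre_ne_zero (n : ℕ) : legendre n ≠ 0 := by intro h; have := legendre_one n; rw [h] at this; simp at this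

lemma integral_sq_pos {p : ℝ[X]} (hp : p ≠ 0) {a b : ℝ} (hab : a < b) : 0 < ∫ x in a..b, (p.eval x) ^ 2 := by
  rw [intervalIntegral.integral_pos_iff_support_of_nonneg_ae (Filter.Eventually.of_forall fun x => sq_nonneg _)
    (by apply ii; fun_prop)]
  refine ⟨hab, ?_⟩; have hfin : (p.roots.toFinset : Set ℝ).Finite := Finset.finite_toSet _
  have hsub : Ioc a b \ (p.roots.toFinset : Set ℝ) ⊆ Function.support (fun x => (p.eval x) ^ 2) ∩ Ioc a b := by
    rintro x ⟨hx, hn⟩; refine ⟨?_, hx⟩; simp only [Function.mem_support]; intro h; apply hn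
    simp only [Finset.mem_coe, Multiset.mem_toFinset, mem_roots hp]; exact pow_eq_zero_iff (two_ne_zero) |>.1 h
  refine lt_of_lt_of_le ?_ (measure_mono hsub); rw [measure_sdiff_null (hfin.measure_zero _)]; simp [hab]

/-- Squared `L²` norm of the Legendre polynomial. -/
def legSq (n : ℕ) : ℝ := ∮₁ x, (legendre n).eval x * (legendre n).eval x

lemma legSq_pos (n : ℕ) : 0 < legSq n := by
  have := integral_sq_pos (legendre_ne_zero n) (a := -1) (b := 1) num!; simpa only [legSq, sq] using this

lemma legendre_orth_legendre {m n : ℕ} (h : m ≠ n) : ∮₁ x, (legendre m).eval x * (legendre n).eval x = 0 := by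
  rcases lt_or_gt_of_ne h with h | h
  · simp_rw [mul_comm ((legendre m).eval _)]; exact legendre_orth _ (by rwa [natDegree_legendre])
  · exact legendre_orth _ (by rwa [natDegree_legendre])

lemma exists_legendre_expansion (k : ℕ) (p : ℝ[X]) (hp : p.natDegree ≤ k) :
    ∃ z : Fin (k + 1) → ℝ, p = ∑ l : Fin (k + 1), C (z l) * legendre l := by
  induction k generalizing p with
  | zero =>
    refine ⟨fun _ => p.coeff 0, ?_⟩
    have : legendre 0 = 1 := by simp [legendre]
    simp [this]; exact eq_C_of_natDegree_le_zero hp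
  | succ k ih =>
    set c := p.coeff (k + 1) / (legendre (k + 1)).coeff (k + 1) with hc
    have hl : (legendre (k + 1)).coeff (k + 1) ≠ 0 := by
      have := leadingCoeff_ne_zero.2 (legendre_ne_zero (k + 1)); rwa [leadingCoeff, natDegree_legendre] at this
    have hd : (p - C c * legendre (k + 1)).natDegree ≤ k := by
      have h1 : (p - C c * legendre (k + 1)).natDegree ≤ k + 1 := by
        refine (natDegree_sub_le _ _).trans (max_le hp ?_)
        exact (natDegree_C_mul_le _ _).trans (natDegree_legendre _).le
      rw [natDegree_le_iff_coeff_eq_zero] at h1 ⊢; intro n hn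
      rcases (Nat.lt_or_ge (k + 1) n) with h | h
      · exact h1 n h
      · have : n = k + 1 := om!; subst this; simp [hc]; field_simp; simp
    obtain ⟨z, hz⟩ := ih _ hd; refine ⟨Fin.snoc z c, ?_⟩; rw [Fin.sum_univ_castSucc]
    simp only [Fin.snoc_castSucc, Fin.snoc_last, Fin.val_castSucc, Fin.val_last]; rw [← hz]; ring

/-! ### The admissibility constant -/

lemma quad_bound {E : Type*} [NormedAddCommGroup E] [NormedSpace ℝ E] [FiniteDimensional ℝ E]
    (Q R : E → ℝ) (hQ : Continuous Q) (hR : Continuous R)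
    (hQ2 : ∀ (a : ℝ) x, Q (a • x) = a ^ 2 * Q x) (hR2 : ∀ (a : ℝ) x, R (a • x) = a ^ 2 * R x)
    (hpos : ∀ x, x ≠ 0 → 0 < Q x) : ∃ C : ℝ, 0 < C ∧ ∀ x, R x ≤ C * Q x := by
  have : ProperSpace E := FiniteDimensional.proper ℝ E
  have hc : IsCompact (Metric.sphere (0 : E) 1) := isCompact_sphere 0 1
  have hcont : ContinuousOn (fun x => R x / Q x) (Metric.sphere (0 : E) 1) := by
    apply hR.continuousOn.div hQ.continuousOn; intro x hx
    have : x ≠ 0 := by rintro rfl; simp at hx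
    exact (hpos x this).ne'
  obtain ⟨C, hC⟩ := (hc.image_of_continuousOn hcont).bddAbove; refine ⟨max C 1, pos!, fun x => ?_⟩
  have hz : Q 0 = 0 ∧ R 0 = 0 := by have h1 := hQ2 0 0; have h2 := hR2 0 0; simp at h1 h2; exact ⟨h1, h2⟩
  by_cases hx : x = 0
  · subst hx; simp [hz.1, hz.2]
  · have hn : ‖x‖ ≠ 0 := norm_ne_zero_iff.2 hx; set y := ‖x‖⁻¹ • x with hy
    have hy1 : y ∈ Metric.sphere (0 : E) 1 := by simp [hy, norm_smul, hn]
    have hx2 : x = ‖x‖ • y := by rw [hy, smul_smul, mul_inv_cancel₀ hn, one_smul]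
    have hyn : y ≠ 0 := by intro h; rw [h] at hx2; simp at hx2; exact hx hx2
    have h1 : R y / Q y ≤ C := hC ⟨y, hy1, rfl⟩; rw [div_le_iff₀ (hpos y hyn)] at h1; rw [hx2, hQ2, hR2]
    have h2 : R y ≤ max C 1 * Q y := h1.trans (mul_le_mul_of_nonneg_right (le_max_left _ _) (hpos y hyn).le)
    nlinarith [sq_nonneg ‖x‖, scale_le h2 (sq_nonneg ‖x‖)]

/-- The polynomial with Legendre coefficients `z`. -/
def legSum {n : ℕ} (z : Fin n → ℝ) : ℝ[X] := ∑ l : Fin n, C (z l) * legendre l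

lemma legSum_eval (z : Fin n → ℝ) (s : ℝ) : (legSum z).eval s = ∑ l, z l * (legendre l).eval s := by
  simp [legSum, eval_finsetSum]

lemma legSum_eval1 (z : Fin n → ℝ) (s : ℝ) : (𝒟 (legSum z)).eval s = ∑ l, z l * (𝒟 (legendre l)).eval s := by
  simp [legSum, eval_finsetSum]

lemma legSum_eval2 (z : Fin n → ℝ) (s : ℝ) : (𝒟 (𝒟 (legSum z))).eval s = ∑ l, z l * (𝒟 (𝒟 (legendre l))).eval s := by
  simp [legSum, eval_finsetSum]

lemma legSum_add (y z : Fin n → ℝ) : legSum (y + z) = legSum y + legSum z := by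
  simp [legSum, add_mul, sum_add_distrib]

lemma legSum_smul (a : ℝ) (z : Fin n → ℝ) : legSum (a • z) = C a * legSum z := by simp [legSum, mul_sum, mul_assoc]

lemma natDegree_legSum_le (z : Fin n → ℝ) : (legSum z).natDegree ≤ n - 1 := by
  refine natDegree_sum_le_of_forall_le _ _ fun l _ => ?_; refine (natDegree_C_mul_le _ _).trans ?_
  rw [natDegree_legendre]; have := l.2; omega

lemma exists_legSum (p : ℝ[X]) (hp : p.natDegree ≤ k) :
    ∃ z : Fin (k + 1) → ℝ, p = legSum z := exists_legendre_expansion k p hp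

lemma integral_legSum_mul_legendre (z : Fin n → ℝ) (m : Fin n) :
    ∮₁ s, (legSum z).eval s * (legendre m).eval s = z m * legSq m := by
  simp_rw [legSum_eval, sum_mul, mul_assoc]; rw [ii_sum (fun l _ => by apply ii; fun_prop)]
  simp_rw [ii_const_mul]; rw [sum_eq_single m]
  · rfl
  · intro l _ hl; rw [legendre_orth_legendre (fun h => hl (Fin.ext h)), mul_zero]
  · simp

lemma integral_legSum_mul (z y : Fin n → ℝ) :
    ∮₁ s, (legSum z).eval s * (legSum y).eval s = ∑ l, z l * y l * legSq l := by
  simp_rw [legSum_eval y, mul_sum]; rw [ii_sum (fun l _ => by apply ii; fun_prop)]; refine sum_congr rfl fun l _ => ?_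
  rw [show (fun s => eval s (legSum z) * (y l * eval s (legendre l))) =
    fun s => y l * (eval s (legSum z) * eval s (legendre l)) from by ext s; ring,
    ii_const_mul, integral_legSum_mul_legendre]
  ring

lemma integral_legSum_sq (z : Fin n → ℝ) : ∮₁ s, (legSum z).eval s ^ 2 = ∑ l, z l ^ 2 * legSq l := by
  simp_rw [sq]; exact integral_legSum_mul z z

lemma legSum_integral_pos (z : Fin n → ℝ) (hz : z ≠ 0) : 0 < ∮₁ s, (legSum z).eval s ^ 2 := by
  rw [integral_legSum_sq]; obtain ⟨l, hl⟩ := Function.ne_iff.1 hz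
  refine Finset.sum_pos' (fun l _ => mul_nonneg (sq_nonneg _) (legSq_pos _).le)
    ⟨l, Finset.mem_univ _, mul_pos (sq_pos_of_ne_zero (show z l ≠ 0 from hl)) (legSq_pos _)⟩

lemma poly_bdd (p : ℝ[X]) : ∃ B : ℝ, 0 ≤ B ∧ ∀ s ∈ Icc (-1 : ℝ) 1, |p.eval s| ≤ B := by
  obtain ⟨B, hB⟩ := isCompact_Icc.exists_bound_of_continuousOn (s := Icc (-1 : ℝ) 1) (f := fun s => p.eval s) fp!
  refine ⟨B, ?_, fun s hs => by simpa using hB s hs⟩; exact (abs_nonneg _).trans (by simpa using hB 0 num!)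

lemma sum_mul_bdd (z : Fin n → ℝ) (g B : ℕ → ℝ) (hz : ∀ l, |z l| ≤ M) (hg : ∀ l, |g l| ≤ B l) :
    |∑ l : Fin n, z l * g l| ≤ (∑ l : Fin n, B l) * M := by
  refine (Finset.abs_sum_le_sum_abs _ _).trans ?_; rw [sum_mul]; refine sum_le_sum fun l _ => ?_
  rw [abs_mul, mul_comm]; exact mul_le_mul (hg l) (hz l) (abs_nonneg _) ((abs_nonneg _).trans (hg l))

lemma legSum_bdd (n : ℕ) : ∃ B : ℝ, 0 < B ∧ ∀ (z : Fin n → ℝ) (M : ℝ), 0 ≤ M → (∀ l, |z l| ≤ M) →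
    ∀ s ∈ Icc (-1 : ℝ) 1, |(legSum z).eval s| ≤ B * M ∧ |(𝒟 (legSum z)).eval s| ≤ B * M ∧
      |(𝒟 (𝒟 (legSum z))).eval s| ≤ B * M := by
  choose B0 hB0 hb0 using fun l : ℕ => poly_bdd (legendre l)
  choose B1 hB1 hb1 using fun l : ℕ => poly_bdd (𝒟 (legendre l))
  choose B2 hB2 hb2 using fun l : ℕ => poly_bdd (𝒟 (𝒟 (legendre l)))
  have h0 : 0 ≤ ∑ l : Fin n, B0 l := sum_nonneg fun l _ => hB0 l
  have h1 : 0 ≤ ∑ l : Fin n, B1 l := sum_nonneg fun l _ => hB1 l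
  have h2 : 0 ≤ ∑ l : Fin n, B2 l := sum_nonneg fun l _ => hB2 l
  refine ⟨1 + (∑ l : Fin n, B0 l) + (∑ l : Fin n, B1 l) + ∑ l : Fin n, B2 l, by linarith, ?_⟩
  intro z M hM hz s hs; rw [legSum_eval, legSum_eval1, legSum_eval2]
  have e0 := sum_mul_bdd z (fun l => (legendre l).eval s) B0 hz (fun l => hb0 l s hs)
  have e1 := sum_mul_bdd z (fun l => (𝒟 (legendre l)).eval s) B1 hz (fun l => hb1 l s hs)
  have e2 := sum_mul_bdd z (fun l => (𝒟 (𝒟 (legendre l))).eval s) B2 hz (fun l => hb2 l s hs)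
  refine ⟨e0.trans ?_, e1.trans ?_, e2.trans ?_⟩ <;>
  exact mul_le_mul_of_nonneg_right (by linarith) hM

lemma poly_inverse (k : ℕ) : ∃ B : ℝ, 0 < B ∧ ∀ p : ℝ[X], p.natDegree ≤ k → ∀ s ∈ Icc (-1 : ℝ) 1,
    p.eval s ^ 2 ≤ B * ∮₁ s, p.eval s ^ 2 ∧
    (𝒟 p).eval s ^ 2 ≤ B * ∮₁ s, p.eval s ^ 2 ∧
    (𝒟 (𝒟 p)).eval s ^ 2 ≤ B * ∮₁ s, p.eval s ^ 2 := by
  obtain ⟨B, hB, hb⟩ := legSum_bdd (k + 1)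
  obtain ⟨c, hc, hcl⟩ : ∃ c : ℝ, 0 < c ∧ ∀ l : Fin (k + 1), c ≤ legSq l := by
    obtain ⟨l, -, hl⟩ := Finset.exists_min_image (Finset.univ : Finset (Fin (k + 1)))
      (fun l => legSq l) ⟨0, Finset.mem_univ _⟩
    exact ⟨legSq l, legSq_pos _, fun m => hl m (Finset.mem_univ _)⟩
  refine ⟨B ^ 2 / c, pos!, ?_⟩; intro p hp s hs; obtain ⟨z, rfl⟩ := exists_legSum p hp
  set I := ∮₁ s, (legSum z).eval s ^ 2; have hI' : I = ∑ l, z l ^ 2 * legSq l := integral_legSum_sq z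
  have hI0 : 0 ≤ I := by rw [hI']; exact sum_nonneg fun l _ => mul_nonneg (sq_nonneg _) (legSq_pos _).le
  have hz : ∀ l, |z l| ≤ √(I / c) := by
    intro l; apply Real.abs_le_sqrt; rw [le_div_iff₀ hc]
    calc z l ^ 2 * c ≤ z l ^ 2 * legSq l := by gcongr; exact hcl l
      _ ≤ I := by
        rw [hI']
        exact single_le_sum (f := fun l : Fin (k + 1) => z l ^ 2 * legSq l)
          (fun l _ => mul_nonneg (sq_nonneg _) (legSq_pos _).le) (Finset.mem_univ l)
  have h := hb z _ (Real.sqrt_nonneg _) hz s hs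
  have e : B ^ 2 / c * I = (B * √(I / c)) ^ 2 := by rw [mul_pow, Real.sq_sqrt pos!]; ring
  rw [e]
  exact ⟨sq_le_sq' (abs_le.1 h.1).1 (abs_le.1 h.1).2, sq_le_sq' (abs_le.1 h.2.1).1 (abs_le.1 h.2.1).2,
    sq_le_sq' (abs_le.1 h.2.2).1 (abs_le.1 h.2.2).2⟩

/-! ### The admissibility constant -/

lemma Gam_bound {θ β : ℝ} (hβ : Gam k θ ≤ β) (v : ℝ[X]) (hv : v.natDegree ≤ k - 1) :
    2 * (v.eval 1 - 2 * θ * (𝒟 v).eval 1) ^ 2 ≤ β * ∮₁ s, (v.eval s) ^ 2 := by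
  by_cases h0 : v = 0
  · simp [h0]
  have hpos := integral_sq_pos h0 (a := -1) (b := 1) num!; rw [← div_le_iff₀ hpos]
  refine le_trans ?_ hβ; refine le_csSup ?_ ⟨v, h0, hv, rfl⟩; obtain ⟨B, hB, hb⟩ := poly_inverse (k - 1)
  refine ⟨4 * B * (1 + 4 * θ ^ 2), ?_⟩; rintro r ⟨w, hw0, hw, rfl⟩
  have hpos := integral_sq_pos hw0 (a := -1) (b := 1) num!; rw [div_le_iff₀ hpos]
  obtain ⟨h1, h2, -⟩ := hb w hw 1 num!
  have e : (w.eval 1 - 2 * θ * (𝒟 w).eval 1) ^ 2 ≤ 2 * (w.eval 1) ^ 2 + 8 * θ ^ 2 * (𝒟 w).eval 1 ^ 2 := by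
    nlinarith [sq_nonneg (w.eval 1 + 2 * θ * (𝒟 w).eval 1)]
  nlinarith [scale_le h2 (sq_nonneg θ)]

lemma Gam_bound' {θ β : ℝ} (hβ : Gam k θ ≤ β) (v : ℝ[X]) (hv : v.natDegree ≤ k - 1) :
    2 * (v.eval (-1) + 2 * θ * (𝒟 v).eval (-1)) ^ 2 ≤ β * ∮₁ s, (v.eval s) ^ 2 := by
  have h := Gam_bound hβ (v.comp (-X)) (by simpa [natDegree_comp] using hv)
  have e : ∮₁ s, ((v.comp (-X)).eval s) ^ 2 = ∮₁ s, (v.eval s) ^ 2 := by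
    simp only [eval_comp, eval_neg, eval_X]; rw [intervalIntegral.integral_comp_neg (fun s => (v.eval s) ^ 2)]; simp
  rw [e] at h; simpa [derivative_comp] using h

lemma beta_lower (hk : 2 ≤ k) {θ β : ℝ} (hθ : θ = 1 / (2 * (k : ℝ) * ((k : ℝ) + 1)))
    (hβ : Gam k θ ≤ β) : (k ^ 2 + k + 2 : ℝ) / 4 < β := by
  obtain ⟨m, rfl⟩ : ∃ m, k = m + 1 := ⟨k - 1, by omega⟩; set v : ℝ[X] := 𝒟 (legendre (m + 1)) + 𝒟 (legendre m) with hv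
  have hd : v.natDegree ≤ m := by
    refine (natDegree_add_le _ _).trans (max_le ?_ ?_)
    · have := natDegree_derivative_le (legendre (m + 1)); rw [natDegree_legendre] at this; omega
    · have := natDegree_derivative_le (legendre m); rw [natDegree_legendre] at this; omega
  have hdv : (𝒟 v).natDegree < m := by have h1 := natDegree_derivative_le v; have : 1 ≤ m := om!; omega
  have hint : ∮₁ s, (v.eval s) ^ 2 = 2 * v.eval 1 := by
    have h1 : ∀ s, (v.eval s) ^ 2 = (𝒟 (legendre (m + 1) + legendre m)).eval s * v.eval s := by
      intro s; rw [derivative_add, ← hv, sq]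
    simp_rw [h1]; rw [poly_integral_parts]
    have h2 : ∮₁ x, (legendre (m + 1) + legendre m).eval x * (𝒟 v).eval x = 0 := by
      simp only [eval_add, add_mul]
      rw [ii_add (by apply ii; fun_prop) (by apply ii; fun_prop), legendre_orth _ om!, legendre_orth _ hdv, add_zero]
    rw [h2]; simp only [eval_add, legendre_one, legendre_neg_one]; rw [pow_succ]; ring
  have hv1 : v.eval 1 = ((m : ℝ) + 1) ^ 2 := by
    simp only [hv, eval_add, legendre_deriv_end _ (one_pow 2)]; push_cast; ring
  have hv2 : (𝒟 v).eval 1 = (m : ℝ) * (m + 1) ^ 2 * (m + 2) / 4 := by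
    simp only [hv, derivative_add, eval_add, legendre_deriv2_end _ (one_pow 2)]; push_cast; ring
  have h := Gam_bound hβ v hd; rw [hint, hv1, hv2, hθ] at h
  have hm : (1 : ℝ) ≤ m := by exact_mod_cast (by omega : 1 ≤ m)
  have e : ((m : ℝ) + 1) ^ 2 - 2 * (1 / (2 * ((m + 1 : ℕ) : ℝ) * (((m + 1 : ℕ) : ℝ) + 1))) *
      ((m : ℝ) * (m + 1) ^ 2 * (m + 2) / 4) = (m + 1) * (3 * m + 4) / 4 := by
    push_cast; field_simp; ring
  rw [e] at h
  have h3 : (3 * (m : ℝ) + 4) ^ 2 / 16 ≤ β := by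
    have : 0 < ((m : ℝ) + 1) ^ 2 := pos!; by_contra hc
    push Not at hc
    nlinarith [mul_lt_mul_of_pos_left hc this]
  push_cast; nlinarith

lemma eq_zero_of_forall_mul_le {A B : ℝ} (h : ∀ t : ℝ, A * t ≤ B * t ^ 2) : A = 0 := by
  by_contra hA; have hB : 0 < |B| + 1 := pos!; have := h (A / (|B| + 1))
  have h2 : A * (A / (|B| + 1)) = A ^ 2 / (|B| + 1) := by ring
  have h3 : B * (A / (|B| + 1)) ^ 2 = (B / (|B| + 1)) * (A ^ 2 / (|B| + 1)) := by field_simp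
  rw [h2, h3] at this; have h4 : 0 < A ^ 2 / (|B| + 1) := pos!
  have h5 : B / (|B| + 1) < 1 := by rw [div_lt_one hB]; linarith [le_abs_self B]
  nlinarith

/-- The assumptions on the parameters of the scheme. -/
class Params (k : outParam ℕ) (β θ : outParam ℝ) : Prop where
  hk : 2 ≤ k
  hθ : θ = 1 / (2 * (k : ℝ) * ((k : ℝ) + 1))
  hβ' : Gam k θ ≤ β

lemma Params.hβ [H : Params k β θ] : (k ^ 2 + k + 2 : ℝ) / 4 < β := beta_lower H.hk H.hθ H.hβ'

variable [H : Params k β θ]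

lemma ref_form_pos (z : Fin (k - 1 + 1) → ℝ) (c d : ℝ) (hx : (z, c, d) ≠ 0) :
    0 < (∑ l, z l ^ 2 * legSq l) + d * ((legSum z).eval 1 - 2 * θ * (𝒟 (legSum z)).eval 1)
        + c * ((legSum z).eval (-1) + 2 * θ * (𝒟 (legSum z)).eval (-1))
        + β / 4 * (c ^ 2 + d ^ 2) := by
  have hβ' : 0 < β := lt_trans pos! H.hβ; set v := legSum z; set I := ∑ l, z l ^ 2 * legSq l
  have hI' : ∮₁ s, v.eval s ^ 2 = I := integral_legSum_sq z; have hd : v.natDegree ≤ k - 1 := natDegree_legSum_le z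
  have key : ∀ L : ℝ[X] →ₗ[ℝ] ℝ, (∀ w, w.natDegree ≤ k - 1 → 2 * L w ^ 2 ≤ β * ∮₁ s, w.eval s ^ 2) →
      2 * L v ^ 2 = β * I → ∀ q, q.natDegree ≤ k - 1 →
      4 * L v * L q - 2 * β * (∮₁ s, v.eval s * q.eval s) = 0 := by
    intro L hL h0 q hq; apply eq_zero_of_forall_mul_le (B := β * (∮₁ s, q.eval s ^ 2) - 2 * L q ^ 2); intro t
    have e : ∮₁ s, (v + t • q).eval s ^ 2 = I + 2 * t * (∮₁ s, v.eval s * q.eval s) + t ^ 2 * ∮₁ s, q.eval s ^ 2 := by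
      rw [← hI', ← ii_const_mul, ← ii_const_mul, ← ii_add, ← ii_add]
      · congr 1; ext s; simp; ring
      all_goals apply ii; fun_prop
    have := hL (v + t • q) ((natDegree_add_le _ _).trans (max_le hd ((natDegree_smul_le _ _).trans hq)))
    rw [e, map_add, map_smul, smul_eq_mul] at this; linarith only [this, h0]
  set P : ℝ[X] →ₗ[ℝ] ℝ := leval 1 - (2 * θ) • leval 1 ∘ₗ derivative with hP
  set Q : ℝ[X] →ₗ[ℝ] ℝ := leval (-1) + (2 * θ) • leval (-1) ∘ₗ derivative with hQ
  have eP : ∀ w, P w = w.eval 1 - 2 * θ * (𝒟 w).eval 1 := fun w => by simp [hP]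
  have eQ : ∀ w, Q w = w.eval (-1) + 2 * θ * (𝒟 w).eval (-1) := fun w => by simp [hQ]
  have gP : ∀ w, w.natDegree ≤ k - 1 → 2 * P w ^ 2 ≤ _ := fun w hw => eP w ▸ Gam_bound H.hβ' w hw
  have gQ : ∀ w, w.natDegree ≤ k - 1 → 2 * Q w ^ 2 ≤ _ := fun w hw => eQ w ▸ Gam_bound' H.hβ' w hw
  rw [← eP, ← eQ]; have hp := gP v hd; have hm := gQ v hd; rw [hI'] at hp hm; by_contra hneg
  have e2 := mul_nonpos_of_nonneg_of_nonpos hβ'.le (not_lt.1 hneg); have S1 := sq_nonneg (β * d + 2 * P v)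
  have S2 := sq_nonneg (β * c + 2 * Q v)
  have hp0 : 2 * P v ^ 2 = β * I := by linarith only [e2, S1, S2, hp, hm]
  have hm0 : 2 * Q v ^ 2 = β * I := by linarith only [e2, S1, S2, hp, hm]
  have hd0 : (β * d + 2 * P v) ^ 2 = 0 := by linarith only [e2, S1, S2, hp, hm]
  have hc0 : (β * c + 2 * Q v) ^ 2 = 0 := by linarith only [e2, S1, S2, hp, hm]
  have hk := H.hk; have p1 := key P gP hp0 1 (by simp); have p2 := key P gP hp0 X (by rw [natDegree_X]; omega)
  have q1 := key Q gQ hm0 1 (by simp); have q2 := key Q gQ hm0 X (by rw [natDegree_X]; omega)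
  simp [eP 1, eQ 1, eP X, eQ X] at p1 p2 q1 q2
  have hb1 : 2 * θ < 1 := by
    have hk' : (2 : ℝ) ≤ k := by exact_mod_cast hk
    rw [H.hθ, mul_one_div, div_lt_one pos!]; nlinarith
  have hlp0 : P v = 0 := by
    have : P v * (1 - 2 * θ) = 0 := by
      have h : Q v = P v := by linarith
      rw [h] at q2; linarith
    exact (mul_eq_zero.1 this).resolve_right (by linarith)
  have hlm0 : Q v = 0 := by linarith
  rw [hlp0] at hd0 hp0; rw [hlm0] at hc0; simp [hβ'.ne'] at hd0 hc0 hp0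
  have hz : z = 0 := by by_contra hz; exact (legSum_integral_pos z hz).ne' (hI'.trans hp0)
  exact hx (by rw [hz, hc0, hd0]; rfl)

/-- Strict positivity on the reference cell of the local part of the diffusion form. -/
lemma ref_coercive :
    ∃ γ : ℝ, 0 < γ ∧ ∀ (v : ℝ[X]) (c d : ℝ), v.natDegree ≤ k - 1 → γ * ((∮₁ s, (v.eval s) ^ 2) + c ^ 2 + d ^ 2) ≤
      (∮₁ s, (v.eval s) ^ 2) + d * (v.eval 1 - 2 * θ * (𝒟 v).eval 1)
        + c * (v.eval (-1) + 2 * θ * (𝒟 v).eval (-1)) + β / 4 * (c ^ 2 + d ^ 2) := by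
  set Q : (Fin (k - 1 + 1) → ℝ) × ℝ × ℝ → ℝ := fun x =>
    (∑ l, x.1 l ^ 2 * legSq l) + x.2.2 * ((legSum x.1).eval 1 - 2 * θ * (𝒟 (legSum x.1)).eval 1)
        + x.2.1 * ((legSum x.1).eval (-1) + 2 * θ * (𝒟 (legSum x.1)).eval (-1))
        + β / 4 * (x.2.1 ^ 2 + x.2.2 ^ 2) with hQ
  set R : (Fin (k - 1 + 1) → ℝ) × ℝ × ℝ → ℝ := fun x => (∑ l, x.1 l ^ 2 * legSq l) + x.2.1 ^ 2 + x.2.2 ^ 2 with hR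
  have hpos : ∀ x, x ≠ 0 → 0 < Q x := by rintro ⟨z, c, d⟩ hx; exact ref_form_pos z c d hx
  obtain ⟨C, hC, hCb⟩ := quad_bound Q R
    (by simp only [hQ, legSum_eval, legSum_eval1]; fun_prop) (by simp only [hR]; fun_prop)
    (by
      rintro a ⟨z, c, d⟩
      simp only [hQ, Prod.smul_mk, Pi.smul_apply, smul_eq_mul, legSum_smul, eval_mul, eval_C,
        derivative_C_mul, mul_pow, mul_assoc, ← mul_sum]
      ring)
    (by
      rintro a ⟨z, c, d⟩; simp only [hR, Prod.smul_mk, Pi.smul_apply, smul_eq_mul, mul_pow, mul_assoc, ← mul_sum]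
      ring) hpos
  refine ⟨C⁻¹, pos!, ?_⟩; intro v c d hv; obtain ⟨z, rfl⟩ := exists_legSum v hv; have := hCb (z, c, d)
  simp only [hQ, hR] at this; rw [integral_legSum_sq, inv_mul_le_iff₀ hC]; exact this

/-! ### One-dimensional periodic meshes -/

lemma step_pos (N : ℕ) [NeZero N] : 0 < step N := by
  have : (0 : ℝ) < N := by exact_mod_cast Nat.pos_of_ne_zero (NeZero.ne N)
  unfold step; positivity

lemma step_mul (N : ℕ) [NeZero N] : step N * N = 2 * π := by
  have : (N : ℝ) ≠ 0 := by exact_mod_cast NeZero.ne N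
  unfold step; field_simp

lemma step_le (N : ℕ) [NeZero N] : step N ≤ 2 * π := by
  rw [← step_mul N]
  have : (1 : ℝ) ≤ N := by exact_mod_cast Nat.pos_of_ne_zero (NeZero.ne N)
  nlinarith [step_pos N]

lemma right_sub_left (N : ℕ) (i : Fin N) : right N i - left N i = step N := by unfold right left; ring

lemma left_lt_right (N : ℕ) [NeZero N] (i : Fin N) : left N i < right N i := by
  linarith [right_sub_left N i, step_pos N]

lemma pt_one (N : ℕ) (i : Fin N) : pt N i 1 = right N i := by unfold pt right left; ring

lemma pt_neg_one (N : ℕ) (i : Fin N) : pt N i (-1) = left N i := by unfold pt right left; ring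

lemma pt_mem (i : Fin N) {s : ℝ} (hs : s ∈ Icc (-1 : ℝ) 1) : pt N i s ∈ cell N i := by
  have h := step_pos N; rw [← pt_one, ← pt_neg_one]; unfold pt; constructor <;> nlinarith [hs.1, hs.2]

lemma exists_pt (i : Fin N) {x : ℝ} (hx : x ∈ cell N i) : ∃ s ∈ Icc (-1 : ℝ) 1, x = pt N i s := by
  have h := step_pos N; have hr := right_sub_left N i
  refine ⟨(x - (left N i + right N i) / 2) / (step N / 2), ⟨?_, ?_⟩, ?_⟩
  · rw [le_div_iff₀ pos!]; linarith [hx.1]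
  · rw [div_le_iff₀ pos!]; linarith [hx.2]
  · unfold pt; field_simp; ring

lemma continuous_pt (N : ℕ) (i : Fin N) : Continuous (pt N i) := by unfold pt; fun_prop

lemma integral_cell (i : Fin N) (f : Fn) : ∮ x N i, f x = step N / 2 * ∮₁ s, f (pt N i s) := by
  have h := step_pos N
  have e : ∀ s, pt N i s = step N / 2 * s + (left N i + right N i) / 2 := fun s => by unfold pt; ring
  simp_rw [e]
  rw [intervalIntegral.integral_comp_mul_add f pos!, smul_eq_mul, ← mul_assoc, mul_inv_cancel₀ pos!, one_mul]
  rw [← e, ← e, pt_one, pt_neg_one]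

lemma periodic_left_succ {g : Fn} (hg : ∀ x, g (x + 2 * π) = g x)
    (i : Fin N) : g (left N (i + 1)) = g (right N i) := by
  unfold left right
  by_cases h : (i : ℕ) + 1 < N
  · have : ((i + 1 : Fin N) : ℕ) = i + 1 := Fin.val_add_one_of_lt' h; rw [this]; push_cast; rfl
  · have h1 : (i : ℕ) + 1 = N := by have := i.2; omega
    have h2 : ((i + 1 : Fin N) : ℕ) = 0 := by
      rw [Fin.val_add_eq_ite, Fin.val_one']
      rcases Nat.lt_or_ge 1 N with h3 | h3
      · rw [Nat.mod_eq_of_lt h3]; split_ifs <;> omega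
      · have : N = 1 := by have := i.2; omega
        subst this; simp
    have h3 : ((i : ℕ) : ℝ) + 1 = N := by exact_mod_cast h1
    rw [h2, h3, step_mul, Nat.cast_zero, mul_zero, ← hg 0, zero_add]

lemma sum_succ (F : Fin N → ℝ) : ∑ i, F (i + 1) = ∑ i, F i := Equiv.sum_comp (Equiv.addRight (1 : Fin N)) F

lemma sum_pred (F : Fin N → ℝ) : ∑ i, F (i - 1) = ∑ i, F i := Equiv.sum_comp (Equiv.subRight (1 : Fin N)) F

/-- Pull back of a polynomial to the reference cell. -/
def toRef (N : ℕ) (i : Fin N) (p : ℝ[X]) : ℝ[X] := p.comp (C ((left N i + right N i) / 2) + C (step N / 2) * X)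

lemma toRef_eval (N : ℕ) (i : Fin N) (p : ℝ[X]) (s : ℝ) : (toRef N i p).eval s = p.eval (pt N i s) := by
  simp [toRef, eval_comp, pt]

lemma derivative_toRef (N : ℕ) (i : Fin N) (p : ℝ[X]) : 𝒟 (toRef N i p) = C (step N / 2) * toRef N i (𝒟 p) := by
  simp [toRef, derivative_comp]

lemma natDegree_toRef_le (N : ℕ) (i : Fin N) (p : ℝ[X]) : (toRef N i p).natDegree ≤ p.natDegree := by
  unfold toRef; refine natDegree_comp_le.trans ?_
  have : (C ((left N i + right N i) / 2) + C (step N / 2) * X : ℝ[X]).natDegree ≤ 1 := by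
    refine (natDegree_add_le _ _).trans (max_le (by simp) ?_); exact (natDegree_C_mul_le _ _).trans natDegree_X_le
  nlinarith

/-- Polynomial on the cell `i` with the pull back `q`. -/
def fromRef (N : ℕ) (i : Fin N) (q : ℝ[X]) : ℝ[X] := q.comp (C (2 / step N) * (X - C ((left N i + right N i) / 2)))

lemma fromRef_eval (i : Fin N) (q : ℝ[X]) (s : ℝ) : (fromRef N i q).eval (pt N i s) = q.eval s := by
  have := step_pos N; simp only [fromRef, eval_comp, eval_mul, eval_C, eval_sub, eval_X]; congr 1
  unfold pt; field_simp; ring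

lemma toRef_fromRef (i : Fin N) (q : ℝ[X]) : toRef N i (fromRef N i q) = q := by
  apply Polynomial.funext; intro s; rw [toRef_eval, fromRef_eval]

lemma toRef_injective (i : Fin N) {p q : ℝ[X]} (h : toRef N i p = toRef N i q) : p = q := by
  have hs := step_pos N; apply Polynomial.funext; intro x
  have : x = pt N i ((x - (left N i + right N i) / 2) / (step N / 2)) := by unfold pt; field_simp; ring
  rw [this, ← toRef_eval, ← toRef_eval, h]

lemma natDegree_fromRef_le (N : ℕ) (i : Fin N) (q : ℝ[X]) : (fromRef N i q).natDegree ≤ q.natDegree := by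
  unfold fromRef; refine natDegree_comp_le.trans ?_
  have : (C (2 / step N) * (X - C ((left N i + right N i) / 2)) : ℝ[X]).natDegree ≤ 1 := by
    refine (natDegree_C_mul_le _ _).trans ?_; exact (natDegree_sub_le _ _).trans (max_le natDegree_X_le (by simp))
  nlinarith

/-! ### The one-dimensional diffusion form -/

lemma deriv_pfun {N : ℕ} (p : Pw N) : (fun m => deriv (pfun p m)) = pfun fun m => 𝒟 (p m) := by
  funext m x; exact (p m).deriv

lemma diffFlux_pfun (β θ : ℝ) (p : Pw N) (i : Fin N) :
    diffFlux β θ (pfun p) i = β * (step N)⁻¹ * jump (pfun p) i + avg (pfun fun m => 𝒟 (p m)) i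
      + θ * step N * jump (pfun fun m => 𝒟 (𝒟 (p m))) i := by
  have h1 := deriv_pfun p; have h2 := deriv_pfun fun m => 𝒟 (p m)
  have h3 : (fun m => deriv (deriv (pfun p m))) = pfun fun m => 𝒟 (𝒟 (p m)) := by rw [← h2]; funext m; rw [← h1]
  rw [diffFlux, h1, h3]

/-- The diffusion form. -/
def A1 (β θ : ℝ) (p v : Pw N) : ℝ := (∑ i, ∮ x N i, (𝒟 (p i)).eval x * (𝒟 (v i)).eval x)
    + ∑ i, diffFlux β θ (pfun p) i * jump (pfun v) i
    + ∑ i, jump (pfun p) i * avg (pfun fun m => 𝒟 (v m)) i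

/-- The discrete energy seminorm. -/
def D1 (v : Pw N) : ℝ := (∑ i, ∮ x N i, (𝒟 (v i)).eval x ^ 2) + ∑ i, jump (pfun v) i ^ 2 / step N

lemma A1_coercive :
    ∃ γ : ℝ, 0 < γ ∧ ∀ (N : ℕ) [NeZero N] (v : Pw N), (∀ i, (v i).natDegree ≤ k) → γ * D1 v ≤ A1 β θ v v := by
  obtain ⟨γ, hγ, hc⟩ := ref_coercive; refine ⟨γ, hγ, ?_⟩; intro N _ v hv; have hs := step_pos N
  set q : Pw N := fun i => 𝒟 (toRef N i (v i)) with hq; set J : Fin N → ℝ := fun i => jump (pfun v) i with hJ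
  set I : Fin N → ℝ := fun i => ∮₁ s, (q i).eval s ^ 2 with hI
  have hqd : ∀ i, (q i).natDegree ≤ k - 1 := fun i => by
    refine (natDegree_derivative_le _).trans ?_; have := (natDegree_toRef_le N i (v i)).trans (hv i); omega
  have hq1 : ∀ i s, (𝒟 (v i)).eval (pt N i s) = 2 / step N * (q i).eval s := by
    intro i s; simp only [hq, derivative_toRef, eval_mul, eval_C, toRef_eval]; field_simp
  have hq2 : ∀ i s, (𝒟 (𝒟 (v i))).eval (pt N i s) = 4 / step N ^ 2 * (𝒟 (q i)).eval s := by
    intro i s; simp only [hq, derivative_toRef, derivative_C_mul, eval_mul, eval_C, toRef_eval]; field_simp; norm_num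
  have hint : ∀ i, ∮ x N i, (𝒟 (v i)).eval x ^ 2 = 2 / step N * I i := by
    intro i; rw [integral_cell]; simp_rw [hq1, mul_pow]; rw [ii_const_mul, hI]; field_simp
  set lp : Fin N → ℝ := fun i => (q i).eval 1 - 2 * θ * (𝒟 (q i)).eval 1 with hlp
  set lm : Fin N → ℝ := fun i => (q i).eval (-1) + 2 * θ * (𝒟 (q i)).eval (-1) with hlm
  have hflux : ∀ i, diffFlux β θ (pfun v) i * J i + J i * avg (pfun fun m => 𝒟 (v m)) i
      = 2 / step N * (β / 2 * J i ^ 2 + J i * lp i + J i * lm (i + 1)) := by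
    intro i; rw [diffFlux_pfun]; simp only [avg, jump, traceL, traceR, pfun, hlp, hlm]
    rw [← pt_one, ← pt_neg_one, hq1, hq1, hq2, hq2]; have : jump (pfun v) i = J i := rfl
    simp only [jump, traceL, traceR, pfun] at this; rw [← pt_one, ← pt_neg_one] at this; rw [this]; field_simp; ring
  have hA : A1 β θ v v = 2 / step N * ∑ i, (I i + J i * lp i + J (i - 1) * lm i
      + β / 4 * (J (i - 1) ^ 2 + J i ^ 2)) := by
    have e1 : ∑ i, J (i - 1) * lm i = ∑ i, J i * lm (i + 1) := by rw [← sum_pred (fun i => J i * lm (i + 1))]; simp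
    have e2 : ∑ i, J (i - 1) ^ 2 = ∑ i, J i ^ 2 := sum_pred (fun i => J i ^ 2)
    have e3 : ∑ i, diffFlux β θ (pfun v) i * jump (pfun v) i + ∑ i, jump (pfun v) i * avg (pfun fun m => 𝒟 (v m)) i =
        2 / step N * (β / 2 * ∑ i, J i ^ 2 + ∑ i, J i * lp i + ∑ i, J i * lm (i + 1)) := by
      rw [← sum_add_distrib, mul_sum, ← sum_add_distrib, ← sum_add_distrib, mul_sum]
      exact sum_congr rfl fun i _ => hflux i
    rw [A1, add_assoc, e3]; simp_rw [← sq, hint, sum_add_distrib, ← mul_sum, sum_add_distrib]; rw [e1, e2]; ring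
  have hD : D1 v = 2 / step N * (∑ i, I i + 1 / 2 * ∑ i, J i ^ 2) := by
    rw [D1]; simp_rw [hint, ← mul_sum, ← Finset.sum_div]; simp only [hJ]; field_simp
  rw [hA, hD]
  have hle : γ * (∑ i, I i + 1 / 2 * ∑ i, J i ^ 2) ≤ ∑ i, (I i + J i * lp i + J (i - 1) * lm i
      + β / 4 * (J (i - 1) ^ 2 + J i ^ 2)) := by
    have : ∑ i, γ * (I i + J (i - 1) ^ 2 + J i ^ 2) ≤ ∑ i, (I i + J i * lp i + J (i - 1) * lm i
      + β / 4 * (J (i - 1) ^ 2 + J i ^ 2)) :=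
      sum_le_sum fun i _ => hc (q i) (J (i - 1)) (J i) (hqd i)
    refine le_trans ?_ this; rw [← mul_sum]; refine scale_le ?_ hγ.le
    rw [sum_add_distrib, sum_add_distrib, sum_pred (fun i => J i ^ 2)]
    have : 0 ≤ ∑ i, J i ^ 2 := sum_nonneg fun i _ => sq_nonneg _; linarith
  have h2 : 0 < 2 / step N := pos!; nlinarith [scale_le hle h2.le]

lemma sum_node_parts (p v : Fin N → Fn) : ∑ i, (p i (right N i) * v i (right N i) - p i (left N i) * v i (left N i)) =
      - ∑ i, (avg p i * jump v i + jump p i * avg v i) := by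
  rw [sum_sub_distrib, ← sum_succ (fun i => p i (left N i) * v i (left N i)),
    ← sum_sub_distrib, ← Finset.sum_neg_distrib]
  refine sum_congr rfl fun i _ => ?_; simp only [avg, jump, traceL, traceR]; ring

lemma A1_parts (β θ : ℝ) (p v : Pw N) : A1 β θ p v = - (∑ i, ∮ x N i, (p i).eval x * (𝒟 (𝒟 (v i))).eval x)
      + ∑ i, diffFlux β θ (pfun p) i * jump (pfun v) i
      - ∑ i, avg (pfun p) i * jump (pfun fun m => 𝒟 (v m)) i := by
  rw [A1, sum_congr rfl fun i _ => poly_integral_parts (p i) (𝒟 (v i)) (left N i) (right N i), sum_sub_distrib]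
  have := sum_node_parts (pfun p) (pfun fun m => 𝒟 (v m)); simp only [pfun] at this; rw [this, sum_add_distrib]; ring

lemma integral_parts_smooth {g g' : Fn} (hg : ∀ x, HasDerivAt g (g' x) x) (hg' : Continuous g') (v : ℝ[X]) (a b : ℝ) :
    ∫ x in a..b, g' x * v.eval x = g b * v.eval b - g a * v.eval a - ∫ x in a..b, g x * (𝒟 v).eval x := by
  have hgc : Continuous g := continuous_iff_continuousAt.2 fun x => (hg x).continuousAt
  rw [eq_sub_iff_add_eq, ← ii_add]
  · exact intervalIntegral.integral_deriv_mul_eq_sub (u := g)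
      (v := fun x => v.eval x) (u' := g') (v' := fun x => (𝒟 v).eval x)
      (fun x _ => hg x) (fun x _ => v.hasDerivAt x)
      (hg'.intervalIntegrable _ _)
      (by apply ii; fun_prop)
  · apply ii; fun_prop
  · apply ii; fun_prop

lemma sum_integral_parts_periodic {g g' : Fn} (hg : ∀ x, HasDerivAt g (g' x) x) (hg' : Continuous g')
    (hper : ∀ x, g (x + 2 * π) = g x) (v : Pw N) :
    ∑ i, ∮ x N i, g' x * (v i).eval x = - (∑ i, g (right N i) * jump (pfun v) i)
      - ∑ i, ∮ x N i, g x * (𝒟 (v i)).eval x := by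
  rw [sum_congr rfl fun i _ => integral_parts_smooth hg hg' (v i) (left N i) (right N i), sum_sub_distrib]
  have := sum_node_parts (fun _ : Fin N => g) (pfun v); simp only [pfun] at this; rw [this]; congr 2
  refine sum_congr rfl fun i _ => ?_; simp only [avg, jump, traceL, traceR, pfun, periodic_left_succ hper]; ring

lemma A1_proj {g g' g'' : Fn} {p : Pw N}
    (hg : ∀ x, HasDerivAt g (g' x) x) (hg' : ∀ x, HasDerivAt g' (g'' x) x) (hc : Continuous g'')
    (hper : ∀ x, g (x + 2 * π) = g x) (hp : IsProj k β θ g p)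
    (v : Pw N) (hv : ∀ i, (v i).natDegree ≤ k) :
    A1 β θ p v = - ∑ i, ∮ x N i, g'' x * (v i).eval x := by
  have hgc : Continuous g := continuous_iff_continuousAt.2 fun x => (hg x).continuousAt
  have hgc' : Continuous g' := continuous_iff_continuousAt.2 fun x => (hg' x).continuousAt
  have hper' : ∀ x, g' (x + 2 * π) = g' x := by
    intro x; have h1 := (hg (x + 2 * π)).comp_add_const x (2 * π); rw [funext hper] at h1; exact h1.unique (hg x)
  rw [sum_integral_parts_periodic hg' hc hper', sum_integral_parts_periodic hg hgc' hper (fun i => 𝒟 (v i)), A1_parts]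
  have h1 : ∀ i, ∮ x N i, (p i).eval x * (𝒟 (𝒟 (v i))).eval x = ∮ x N i, g x * (𝒟 (𝒟 (v i))).eval x := by
    intro i; have := hp.orth i (v i) (hv i); simp_rw [sub_mul] at this
    rw [ii_sub (by apply ii; fun_prop) (by apply ii; fun_prop)] at this; linarith
  have h2 : ∀ i, deriv g (right N i) = g' (right N i) := fun i => (hg _).deriv
  simp_rw [h1, hp.flux, hp.average, h2]; ring

lemma cell_inverse (k : ℕ) : ∃ B : ℝ, 0 < B ∧ ∀ (N : ℕ) [NeZero N] (i : Fin N) (p : ℝ[X]),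
    p.natDegree ≤ k → ∀ x ∈ cell N i, step N * p.eval x ^ 2 ≤ B * ∮ x N i, p.eval x ^ 2 := by
  obtain ⟨B, hB, hb⟩ := poly_inverse k; refine ⟨2 * B, pos!, ?_⟩; intro N _ i p hp x hx
  obtain ⟨s, hs, rfl⟩ := exists_pt i hx
  have := (hb (toRef N i p) ((natDegree_toRef_le N i p).trans hp) s hs).1; simp only [toRef_eval] at this
  rw [integral_cell]; nlinarith [scale_le this (step_pos N).le]

/-! ### The solution operator of the one-dimensional global problems -/

/-- Cellwise polynomial with given Legendre coefficients. -/
def cellPoly {N n : ℕ} (z : Fin N → Fin n → ℝ) : Pw N := fun i => fromRef N i (legSum (z i))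

lemma derivative_fromRef (i : Fin N) (q : ℝ[X]) : 𝒟 (fromRef N i q) = C (2 / step N) * fromRef N i (𝒟 q) := by
  simp [fromRef, derivative_comp]

lemma cellPoly_eval {N n : ℕ} [NeZero N] (z : Fin N → Fin n → ℝ) (i : Fin N) (s : ℝ) :
    (cellPoly z i).eval (pt N i s) = (legSum (z i)).eval s := fromRef_eval i _ s

lemma cellPoly_eval1 {N n : ℕ} [NeZero N] (z : Fin N → Fin n → ℝ) (i : Fin N) (s : ℝ) :
    (𝒟 (cellPoly z i)).eval (pt N i s) = 2 / step N * (𝒟 (legSum (z i))).eval s := by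
  rw [cellPoly, derivative_fromRef, eval_mul, eval_C, fromRef_eval]

lemma cellPoly_eval2 {N n : ℕ} [NeZero N] (z : Fin N → Fin n → ℝ) (i : Fin N) (s : ℝ) :
    (𝒟 (𝒟 (cellPoly z i))).eval (pt N i s) = 4 / step N ^ 2 * (𝒟 (𝒟 (legSum (z i)))).eval s := by
  have := step_pos N
  rw [cellPoly, derivative_fromRef, derivative_C_mul, derivative_fromRef, eval_mul, eval_C, eval_mul,
    eval_C, fromRef_eval]
  field_simp; ring

/-- `h` times the diffusion flux in terms of Legendre coefficients. -/
def fluxOp {n : ℕ} (β θ : ℝ) (z : Fin N → Fin n → ℝ) (i : Fin N) : ℝ :=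
  β * ((legSum (z (i + 1))).eval (-1) - (legSum (z i)).eval 1)
    + ((𝒟 (legSum (z i))).eval 1 + (𝒟 (legSum (z (i + 1)))).eval (-1))
    + 4 * θ * ((𝒟 (𝒟 (legSum (z (i + 1))))).eval (-1) - (𝒟 (𝒟 (legSum (z i)))).eval 1)

/-- The average in terms of Legendre coefficients. -/
def avgOp {n : ℕ} (z : Fin N → Fin n → ℝ) (i : Fin N) : ℝ :=
  ((legSum (z i)).eval 1 + (legSum (z (i + 1))).eval (-1)) / 2

lemma avg_cellPoly (z : Fin N → Fin n → ℝ) (i : Fin N) : avg (pfun (cellPoly z)) i = avgOp z i := by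
  simp only [avg, traceL, traceR, pfun, avgOp]; rw [← pt_one, ← pt_neg_one, cellPoly_eval, cellPoly_eval]

lemma flux_cellPoly (β θ : ℝ) (z : Fin N → Fin n → ℝ) (i : Fin N) :
    step N * diffFlux β θ (pfun (cellPoly z)) i = fluxOp β θ z i := by
  have hs := step_pos N; rw [diffFlux_pfun]; simp only [avg, jump, traceL, traceR, pfun, fluxOp]
  rw [← pt_one, ← pt_neg_one]; simp only [cellPoly_eval, cellPoly_eval1, cellPoly_eval2]; field_simp

/-- The operator that maps the Legendre coefficients of a cellwise polynomial to its low order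
coefficients, fluxes and averages. -/
def dataOp [H : Params k β θ] (N : ℕ) [NeZero N] : Module.End ℝ (Fin N → Fin (k + 1) → ℝ) where
  toFun z i l := if (l : ℕ) + 1 < k then z i l else if (l : ℕ) + 1 = k then fluxOp β θ z i else avgOp z i
  map_add' y z := by
    funext i l; simp only [fluxOp, avgOp, Pi.add_apply, legSum_add, eval_add, derivative_add]; split_ifs <;> ring
  map_smul' a z := by
    funext i l
    simp only [fluxOp, avgOp, Pi.smul_apply, legSum_smul, eval_mul, eval_C, derivative_C_mul,
      RingHom.id_apply, smul_eq_mul]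
    split_ifs <;> ring

/-- The solution operator. -/
def solveOp (N : ℕ) [NeZero N] : Module.End ℝ (Fin N → Fin (k + 1) → ℝ) := Ring.inverse (dataOp N)

lemma two_term_bound {σ p R : ℝ} (hσ : |σ| = 1) (hp : 0 < p)
    (a b r s : Fin N → ℝ) (h1 : ∀ i, a i + b i + σ * (a (i + 1) - b (i + 1)) = r i)
    (h2 : ∀ i, 2 * p * a i + (2 * p + 1) * b i + σ * b (i + 1) = s i)
    (hr : ∀ i, p * |r i| ≤ R) (hs : ∀ i, |s i| ≤ R) (i : Fin N) :
    p * |b i| ≤ R ∧ 2 * p ^ 2 * |a i| ≤ (3 * p + 2) * R := by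
  have hσ' : ∀ x, |σ * x| = |x| := fun x => by rw [abs_mul, hσ, one_mul]
  have tri : ∀ x y z : ℝ, |x - y - z| ≤ |x| + |y| + |z| := fun x y z => by grind
  have hb : ∀ i, p * |b i| ≤ R := by
    obtain ⟨j, -, hj⟩ := Finset.exists_max_image (Finset.univ : Finset (Fin N)) (fun i => |b i|) ⟨0, Finset.mem_univ _⟩
    have key : (4 * p + 2) * b j = σ * ((s (j - 1) + σ * s j - 2 * (p * r (j - 1))) - b (j - 1) - b (j + 1)) := by
      have e1 := h1 (j - 1); have e2 := h2 (j - 1); rw [sub_add_cancel] at e1 e2; rw [← e1, ← e2, ← h2 j]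
      linear_combination (-(4 * p + 2) * b j - σ * b (j + 1)) * ((sq_abs σ).symm.trans (by rw [hσ, one_pow]))
    have h := congrArg abs key; rw [hσ', abs_mul, abs_of_pos (by linarith)] at h
    have t := tri (s (j - 1) + σ * s j - 2 * (p * r (j - 1))) (b (j - 1)) (b (j + 1))
    have t' : |s (j - 1) + σ * s j - 2 * (p * r (j - 1))| ≤ |s (j - 1)| + |σ * s j| + 2 * |p * r (j - 1)| := by grind
    rw [hσ', abs_mul, abs_of_pos hp] at t'
    have h3 : p * |b j| ≤ R := by
      linarith [hs (j - 1), hs j, hr (j - 1), hj (j - 1) (Finset.mem_univ _), hj (j + 1) (Finset.mem_univ _)]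
    exact fun i => (scale_le (hj i (Finset.mem_univ _)) hp.le).trans h3
  refine ⟨hb i, ?_⟩; have h := tri (s i) ((2 * p + 1) * b i) (σ * b (i + 1))
  rw [hσ', show s i - (2 * p + 1) * b i - σ * b (i + 1) = 2 * p * a i by linarith [h2 i], abs_mul,
    abs_mul (2 * p + 1), abs_of_pos (pos! : 0 < 2 * p), abs_of_pos (pos! : 0 < 2 * p + 1)] at h
  nlinarith [hb i, hb (i + 1), hs i]

/-- The part of degree at most `m` of a Legendre expansion. -/
def lowPart {m : ℕ} (z : Fin (m + 3) → ℝ) : Fin (m + 3) → ℝ := fun l => if (l : ℕ) < m + 1 then z l else 0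

lemma legSum_split (z : Fin (m + 3) → ℝ) : legSum z = legSum (lowPart z) + C (z ⟨m + 1, by omega⟩) * legendre (m + 1)
      + C (z (Fin.last _)) * legendre (m + 2) := by
  have h : ∀ l : Fin (m + 1), (l : ℕ) < m + 1 := fun l => l.2
  simp only [legSum, Fin.sum_univ_castSucc (n := m + 2), Fin.sum_univ_castSucc (n := m + 1), lowPart,
    Fin.val_castSucc, Fin.val_last, h, if_true]
  have e : (Fin.last (m + 1)).castSucc = (⟨m + 1, by omega⟩ : Fin (m + 3)) := rfl; simp [e]

lemma dataOp_bound : ∃ B : ℝ, 0 < B ∧ ∀ (N : ℕ) [NeZero N] (z : Fin N → Fin (k + 1) → ℝ) (M : ℝ), 0 ≤ M →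
      (∀ i l, |dataOp N z i l| ≤ M) → ∀ i l, |z i l| ≤ B * M := by
  obtain ⟨m, rfl⟩ : ∃ m, k = m + 2 := ⟨k - 2, by have := H.hk; omega⟩; obtain ⟨B, hB, hb⟩ := legSum_bdd (m + 3)
  set p : ℝ := β - (((m + 2 : ℕ) : ℝ) ^ 2 + ((m + 2 : ℕ) : ℝ) + 2) / 4 with hp
  have hp0 : 0 < p := by linarith [H.hβ]
  have hβ0 : 0 < β := lt_trans pos! H.hβ
  have hθ0 : 0 < θ := by rw [H.hθ]; positivity
  set σ : ℝ := (-1) ^ (m + 2) with hσ; set S : ℝ := p * (2 + 2 * B) + (1 + β * (2 * B) + 2 * B + 4 * θ * (2 * B))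
  refine ⟨1 + S / p + (3 * p + 2) * S / (2 * p ^ 2), pos!, ?_⟩; intro N _ z M hM hz
  have hlow : ∀ i l, |lowPart (z i) l| ≤ M := by
    intro i l; unfold lowPart; split_ifs with h
    · simpa [dataOp, Nat.lt_succ_iff.1 h] using hz i l
    · simpa using hM
  have hl := fun i => hb (lowPart (z i)) M hM (hlow i) 1 num!
  have hl' := fun i => hb (lowPart (z i)) M hM (hlow i) (-1) num!
  set a : Fin N → ℝ := fun i => z i (Fin.last _); set b : Fin N → ℝ := fun i => z i ⟨m + 1, by omega⟩
  have hflux : ∀ i, |fluxOp β θ z i| ≤ M := fun i => by simpa [dataOp] using hz i ⟨m + 1, by omega⟩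
  have havg : ∀ i, |avgOp z i| ≤ M := fun i => by simpa [dataOp] using hz i (Fin.last _)
  set q : Pw N := fun i => legSum (lowPart (z i))
  have hzq : ∀ i, legSum (z i) = q i + C (b i) * legendre (m + 1) + C (a i) * legendre (m + 2) :=
    fun i => legSum_split (z i)
  set r : Fin N → ℝ := fun i => 2 * avgOp z i - ((q i).eval 1 + (q (i + 1)).eval (-1)) with hr
  set f : Fin N → ℝ := fun i => fluxOp β θ z i - (β * ((q (i + 1)).eval (-1) - (q i).eval 1)
    + ((𝒟 (q i)).eval 1 + (𝒟 (q (i + 1))).eval (-1))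
    + 4 * θ * ((𝒟 (𝒟 (q (i + 1)))).eval (-1) - (𝒟 (𝒟 (q i))).eval 1)) with hf
  have h1' : ((1 : ℝ)) ^ 2 = 1 := by norm_num
  have h2' : ((-1 : ℝ)) ^ 2 = 1 := by norm_num
  have hσ1 : (-1 : ℝ) ^ (m + 1) = -σ := by rw [hσ, pow_succ (-1 : ℝ) (m + 1)]; ring
  have hσ3 : (-1 : ℝ) ^ (m + 2 + 1) = -σ := by rw [hσ, pow_succ (-1 : ℝ) (m + 2)]; ring
  have hσ4 : (-1 : ℝ) ^ (m + 1 + 1) = σ := rfl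
  have E1 : ∀ i, a i + b i + σ * (a (i + 1) - b (i + 1)) = r i := by
    intro i; simp only [hr, avgOp, hzq, eval_add, eval_mul, eval_C, legendre_one, legendre_neg_one, hσ1, ← hσ]; ring
  have E3 : ∀ i, -p * a i - (p + 1) * b i + σ * (p * a (i + 1) - (p + 1) * b (i + 1)) = f i := by
    intro i
    simp only [hf, fluxOp, hzq, eval_add, eval_mul, eval_C, legendre_one, legendre_neg_one,
      derivative_add, derivative_C_mul, legendre_deriv_end _ h1', legendre_deriv_end _ h2',
      legendre_deriv2_end _ h1', legendre_deriv2_end _ h2', hσ1, hσ3, hσ4, one_pow, hp, H.hθ]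
    push_cast; field_simp; ring
  have hrb : ∀ i, p * |r i| ≤ p * (2 + 2 * B) * M := by
    intro i; have h := abs_le.1 (hl i).1; have h' := abs_le.1 (hl' (i + 1)).1; have h3 := abs_le.1 (havg i)
    rw [mul_assoc]; exact scale_le (abs_le.2 ⟨by linarith [h.2, h'.2], by linarith [h.1, h'.1]⟩) hp0.le
  have hfb : ∀ i, |f i| ≤ (1 + β * (2 * B) + 2 * B + 4 * θ * (2 * B)) * M := by
    intro i; obtain ⟨u1, u2, u3⟩ := hl i; obtain ⟨w1, w2, w3⟩ := hl' (i + 1)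
    have g1 := scale_le ((abs_sub _ _).trans (add_le_add w1 u1)) hβ0.le
    have g2 := scale_le ((abs_sub _ _).trans (add_le_add w3 u3)) (by positivity : 0 ≤ 4 * θ)
    rw [← abs_of_pos hβ0, ← abs_mul, abs_of_pos hβ0] at g1; have h4 : 0 < 4 * θ := pos!
    rw [← abs_of_pos h4, ← abs_mul, abs_of_pos h4] at g2; have := hflux i
    rw [abs_le] at *
    simp only [hf]; constructor <;> linarith [u2.1, u2.2, w2.1, w2.2, this.1, this.2, g1.1, g1.2, g2.1, g2.2]
  have hf0 : 0 ≤ (1 + β * (2 * B) + 2 * B + 4 * θ * (2 * B)) * M := pos!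
  have fin := two_term_bound (R := S * M) (by rw [hσ, abs_pow]; simp) hp0 a b r (fun i => p * r i - f i) E1
    (fun i => by rw [← E1, ← E3]; ring) (fun i => by linarith [hrb i]) fun i => by
      have := abs_sub (p * r i) (f i); rw [abs_mul, abs_of_pos hp0] at this; linarith [hrb i, hfb i]
  intro i l; obtain ⟨f1, f2⟩ := fin i; rw [mul_comm, ← le_div_iff₀ hp0] at f1
  rw [mul_comm, ← le_div_iff₀ pos!] at f2; have hA : 0 ≤ S / p * M := pos!
  have hA' : 0 ≤ (3 * p + 2) * S / (2 * p ^ 2) * M := pos!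
  have e1 : S * M / p = S / p * M := by ring
  have e2 : (3 * p + 2) * (S * M) / (2 * p ^ 2) = (3 * p + 2) * S / (2 * p ^ 2) * M := by ring
  rw [add_mul, add_mul, one_mul]
  rcases lt_trichotomy (l : ℕ) (m + 1) with h | h | h
  · have := hlow i l; simp only [lowPart, if_pos h] at this; linarith
  · rw [show l = ⟨m + 1, by omega⟩ from Fin.ext h]; linarith
  · rw [show l = Fin.last _ from Fin.ext (by have := l.2; simp; omega)]; linarith

lemma isUnit_dataOp (N : ℕ) [NeZero N] : IsUnit (dataOp N) := by
  rw [Module.End.isUnit_iff]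
  have hinj : Function.Injective (dataOp N) := by
    obtain ⟨B, hB, hb⟩ := dataOp_bound; rw [injective_iff_map_eq_zero]; intro z hz; funext i l
    have := hb N z 0 le_rfl (by intro i l; rw [hz]; simp) i l; rw [mul_zero] at this; exact abs_nonpos_iff.1 this
  exact ⟨hinj, LinearMap.injective_iff_surjective.1 hinj⟩

/-- Twofold antiderivative on the cell `i`, vanishing with its derivative at the left end point, of
the polynomial with the pull back `q`. -/
def dblPrim (N : ℕ) (i : Fin N) (q : ℝ[X]) : ℝ[X] := fromRef N i (C (step N ^ 2 / 4) * primitive (primitive q))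

lemma derivative_primitive (p : ℝ[X]) : 𝒟 (primitive p) = p := by
  unfold primitive
  simp only [derivative_sub, derivative_C, sub_zero, Polynomial.sum_def, derivative_sum,
    derivative_C_mul, derivative_X_pow]
  conv_rhs => rw [p.as_sum_support_C_mul_X_pow]
  refine sum_congr rfl fun n _ => ?_; rw [Nat.add_sub_cancel, ← mul_assoc, ← C_mul]; congr 2
  have : ((n : ℝ) + 1) ≠ 0 := pos!; push_cast; field_simp

lemma primitive_neg_one (p : ℝ[X]) : (primitive p).eval (-1) = 0 := by simp [primitive]

lemma natDegree_primitive_le (p : ℝ[X]) : (primitive p).natDegree ≤ p.natDegree + 1 := by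
  unfold primitive; refine (natDegree_sub_le _ _).trans (max_le ?_ (by simp)); rw [Polynomial.sum_def]
  refine natDegree_sum_le_of_forall_le _ _ fun n hn => ?_; refine (natDegree_C_mul_le _ _).trans ?_
  rw [natDegree_X_pow]; have := le_natDegree_of_mem_supp n hn; omega

lemma eq_of_derivative_eq {p q : ℝ[X]} (h : 𝒟 p = 𝒟 q) {a : ℝ} (ha : p.eval a = q.eval a) : p = q := by
  have h1 : 𝒟 (p - q) = 0 := by rw [derivative_sub, h, sub_self]
  have h2 := derivative_eq_zero.1 h1; rw [natDegree_eq_zero] at h2; obtain ⟨c, hc⟩ := h2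
  have : c = 0 := by have := congrArg (eval a) hc; simpa [ha] using this
  rw [this, C_0] at hc; exact (sub_eq_zero.1 hc.symm)

lemma primitive_add (p q : ℝ[X]) : primitive (p + q) = primitive p + primitive q := by
  apply eq_of_derivative_eq (a := -1)
  · simp [derivative_primitive]
  · simp [primitive_neg_one]

lemma primitive_C_mul (c : ℝ) (p : ℝ[X]) : primitive (C c * p) = C c * primitive p := by
  apply eq_of_derivative_eq (a := -1)
  · simp [derivative_primitive]
  · simp [primitive_neg_one]

lemma fromRef_add {N : ℕ} (i : Fin N) (p q : ℝ[X]) :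
    fromRef N i (p + q) = fromRef N i p + fromRef N i q := by simp [fromRef]

lemma fromRef_C_mul {N : ℕ} (i : Fin N) (c : ℝ) (p : ℝ[X]) :
    fromRef N i (C c * p) = C c * fromRef N i p := by simp [fromRef]

/-- `dblPrim` as a linear map. -/
def dblPrimL (N : ℕ) (i : Fin N) : ℝ[X] →ₗ[ℝ] ℝ[X] where
  toFun := dblPrim N i
  map_add' p q := by simp only [dblPrim, primitive_add, mul_add, fromRef_add]
  map_smul' c p := by simp only [dblPrim, smul_eq_C_mul, primitive_C_mul, RingHom.id_apply, fromRef_C_mul]; ring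

lemma derivative_dblPrim (i : Fin N) (q : ℝ[X]) : 𝒟 (dblPrim N i q) = C (step N / 2) * fromRef N i (primitive q) := by
  have := step_pos N
  rw [dblPrim, derivative_fromRef, derivative_C_mul, derivative_primitive, fromRef_C_mul, ← mul_assoc, ← C_mul]
  congr 2; field_simp; norm_num

lemma derivative2_dblPrim (i : Fin N) (q : ℝ[X]) : 𝒟 (𝒟 (dblPrim N i q)) = fromRef N i q := by
  have := step_pos N
  rw [derivative_dblPrim, derivative_C_mul, derivative_fromRef, derivative_primitive, ← mul_assoc, ← C_mul]
  rw [div_mul_div_cancel₀' pos!]; simp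

lemma dblPrim_left (i : Fin N) (q : ℝ[X]) :
    (dblPrim N i q).eval (left N i) = 0 ∧ (𝒟 (dblPrim N i q)).eval (left N i) = 0 := by
  rw [derivative_dblPrim, ← pt_neg_one]; simp [dblPrim, fromRef_eval, primitive_neg_one]

lemma natDegree_dblPrim_le {N : ℕ} (i : Fin N) (q : ℝ[X]) : (dblPrim N i q).natDegree ≤ q.natDegree + 2 := by
  refine (natDegree_fromRef_le _ _ _).trans ((natDegree_C_mul_le _ _).trans ?_)
  have h1 := natDegree_primitive_le q; have h2 := natDegree_primitive_le (primitive q); omega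

lemma eq_dblPrim (i : Fin N) (v : ℝ[X]) (h0 : v.eval (left N i) = 0) (h1 : (𝒟 v).eval (left N i) = 0) :
    v = dblPrim N i (toRef N i (𝒟 (𝒟 v))) := by
  obtain ⟨d0, d1⟩ := dblPrim_left i (toRef N i (𝒟 (𝒟 v)))
  apply eq_of_derivative_eq (a := left N i) _ (h0.trans d0.symm)
  apply eq_of_derivative_eq (a := left N i) _ (h1.trans d1.symm); rw [derivative2_dblPrim]
  exact toRef_injective i (by rw [toRef_fromRef])

/-- Data for the solution operator: moments, fluxes and averages. -/
def mkData (k : ℕ) (B : Fin N → ℝ[X] → ℝ) (q a : Fin N → ℝ) : Fin N → Fin (k + 1) → ℝ :=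
  fun i l => if (l : ℕ) + 1 < k then 2 / step N / legSq l * B i (dblPrim N i (legendre l)) else
    if (l : ℕ) + 1 = k then step N * q i else a i

/-- The solution of the one-dimensional global problem. -/
def sol (d : Fin N → Fin (k + 1) → ℝ) : Pw N := cellPoly (solveOp N d)

/-- The conditions of the one-dimensional global problem. -/
structure IsSol (k : ℕ) (β θ : ℝ) (B : Fin N → ℝ[X] → ℝ)
    (q a : Fin N → ℝ) (p : Pw N) : Prop where
  degree : ∀ i, (p i).natDegree ≤ k
  form : ∀ i, ∀ v : ℝ[X], v.natDegree ≤ k → v.eval (left N i) = 0 →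
    (𝒟 v).eval (left N i) = 0 → ∮ x N i, (p i).eval x * (𝒟 (𝒟 v)).eval x = B i v
  flux : ∀ i, diffFlux β θ (pfun p) i = q i
  average : ∀ i, avg (pfun p) i = a i

lemma cellPoly_moment (z : Fin N → Fin (k + 1) → ℝ) (i : Fin N) (l : Fin (k + 1)) :
    ∮ x N i, (cellPoly z i).eval x * (𝒟 (𝒟 (dblPrim N i (legendre l)))).eval x = step N / 2 * (z i l * legSq l) := by
  rw [integral_cell, derivative2_dblPrim]; simp_rw [cellPoly_eval, fromRef_eval]; rw [integral_legSum_mul_legendre]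

lemma isSol_sol (B : Fin N → ℝ[X] → ℝ) (q a : Fin N → ℝ)
    (hB : ∀ i (z : Fin (k - 2 + 1) → ℝ), B i (dblPrim N i (legSum z)) = ∑ l, z l * B i (dblPrim N i (legendre l))) :
    IsSol k β θ B q a (sol (mkData k B q a)) := by
  have hs := step_pos N; have hk := H.hk; set z := solveOp N (mkData k B q a) with hz
  have hT : dataOp N z = mkData k B q a := by
    have := Ring.mul_inverse_cancel _ (isUnit_dataOp N)
    exact congrArg (fun T : Module.End ℝ (Fin N → Fin (k + 1) → ℝ) => T (mkData k B q a)) this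
  refine ⟨fun i => (natDegree_fromRef_le _ _ _).trans (natDegree_legSum_le _), ?_, ?_, ?_⟩
  · intro i v hv h0 h1
    obtain ⟨y, hy⟩ := exists_legSum (k := k - 2) (toRef N i (𝒟 (𝒟 v))) (by
      have e1 := natDegree_toRef_le N i (𝒟 (𝒟 v)); have e2 := natDegree_derivative_le (𝒟 v)
      have e3 := natDegree_derivative_le v
      omega)
    have hv' := eq_dblPrim i v h0 h1; rw [hy] at hv'; rw [hv', hB]
    have hlin : dblPrim N i (legSum y) = ∑ l, C (y l) * dblPrim N i (legendre l) := by
      have : dblPrim N i (legSum y) = dblPrimL N i (legSum y) := rfl; rw [this, legSum, map_sum]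
      refine sum_congr rfl fun l _ => ?_; rw [← smul_eq_C_mul, map_smul, smul_eq_C_mul]; rfl
    rw [hlin]; simp only [derivative_sum, derivative_C_mul, eval_finsetSum, eval_mul, eval_C, mul_sum]
    rw [ii_sum (fun l _ => by apply ii; fun_prop)]; refine sum_congr rfl fun l _ => ?_; have hl := l.2
    have hm := cellPoly_moment z i ⟨l, by omega⟩; have hd := congrFun (congrFun hT i) ⟨l, by omega⟩
    simp only [dataOp, LinearMap.coe_mk, AddHom.coe_mk, mkData] at hd; rw [if_pos om!, if_pos om!] at hd
    simp only at hm; rw [hd] at hm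
    have : ∀ x, (sol (mkData k B q a) i).eval x * (y l * (𝒟 (𝒟 (dblPrim N i (legendre l)))).eval x) =
        y l * ((cellPoly z i).eval x * (𝒟 (𝒟 (dblPrim N i (legendre l)))).eval x) := by
      intro x; simp only [sol, ← hz]; ring
    simp_rw [this]; rw [ii_const_mul, hm]; have := (legSq_pos l).ne'; field_simp
  · intro i; have hd := congrFun (congrFun hT i) ⟨k - 1, by omega⟩
    simp only [dataOp, LinearMap.coe_mk, AddHom.coe_mk, mkData] at hd
    rw [if_neg om!, if_pos om!, if_neg om!, if_pos om!] at hd; have := flux_cellPoly β θ z i; rw [hd] at this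
    exact mul_left_cancel₀ hs.ne' this
  · intro i; have hd := congrFun (congrFun hT i) (Fin.last k)
    simp only [dataOp, LinearMap.coe_mk, AddHom.coe_mk, mkData, Fin.val_last] at hd
    rw [if_neg om!, if_neg om!, if_neg om!, if_neg om!] at hd; rw [← hd]; exact avg_cellPoly z i

lemma IsSol.eq_sol {B : Fin N → ℝ[X] → ℝ} {q a : Fin N → ℝ} {p : Pw N}
    (hp : IsSol k β θ B q a p) : p = sol (mkData k B q a) := by
  have hs := step_pos N; have hk := H.hk
  choose z hz using fun i => exists_legSum (k := k) (toRef N i (p i)) ((natDegree_toRef_le _ _ _).trans (hp.degree i))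
  have hpz : p = cellPoly z := by funext i; apply toRef_injective i; rw [hz, cellPoly, toRef_fromRef]
  have hT : dataOp N z = mkData k B q a := by
    funext i l; simp only [dataOp, LinearMap.coe_mk, AddHom.coe_mk, mkData]; have hl := l.2; split_ifs with h1 h2
    · have hm := cellPoly_moment z i l; rw [← hpz] at hm; have hd := dblPrim_left (N := N) i (legendre l)
      rw [hp.form i _ ((natDegree_dblPrim_le _ _).trans (by rw [natDegree_legendre]; omega)) hd.1 hd.2] at hm
      rw [hm]; have := (legSq_pos l).ne'; field_simp
    · rw [← flux_cellPoly, ← hpz, hp.flux]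
    · rw [← avg_cellPoly, ← hpz, hp.average]
  rw [sol, ← hT, solveOp, hpz]; have := Ring.inverse_mul_cancel _ (isUnit_dataOp N)
  rw [← Module.End.mul_apply, this, Module.End.one_apply]

lemma sol_bound : ∃ B : ℝ, 0 < B ∧ ∀ (N : ℕ) [NeZero N] (d : Fin N → Fin (k + 1) → ℝ) (M : ℝ),
    0 ≤ M → (∀ i l, |d i l| ≤ M) → ∀ i, ∀ x ∈ cell N i,
      |(sol d i).eval x| ≤ B * M ∧
      |(𝒟 (sol d i)).eval x| ≤ B * M / step N := by
  obtain ⟨B, hB, hb⟩ := dataOp_bound; obtain ⟨B', hB', hb'⟩ := legSum_bdd (k + 1)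
  refine ⟨2 * (B' * B), pos!, ?_⟩; intro N _ d M hM hd i x hx; have hs := step_pos N
  obtain ⟨s, hs', rfl⟩ := exists_pt i hx
  have hT : dataOp N (solveOp N d) = d := by
    have := Ring.mul_inverse_cancel _ (isUnit_dataOp N)
    exact congrArg (fun T : Module.End ℝ (Fin N → Fin (k + 1) → ℝ) => T d) this
  have hz := hb N (solveOp N d) M hM (by rw [hT]; exact hd)
  obtain ⟨h0, h1, -⟩ := hb' (solveOp N d i) (B * M) pos! (hz i) s hs'; rw [sol, cellPoly_eval, cellPoly_eval1]
  have hp : 0 ≤ B' * (B * M) := pos!; refine ⟨h0.trans (by linarith), ?_⟩; rw [abs_mul, abs_of_pos pos!]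
  have := scale_le h1 (pos! : (0:ℝ) ≤ 2 / step N); refine this.trans (le_of_eq (by ring))

lemma sol_add (d e : Fin N → Fin (k + 1) → ℝ) (i : Fin N) : sol (d + e) i = sol d i + sol e i := by
  simp only [sol, map_add, cellPoly, Pi.add_apply, legSum_add, fromRef_add]

lemma sol_smul (c : ℝ) (d : Fin N → Fin (k + 1) → ℝ) (i : Fin N) : sol (c • d) i = C c * sol d i := by
  simp only [sol, map_smul, cellPoly, Pi.smul_apply, legSum_smul, fromRef_C_mul]

/-! ### The one-dimensional projection and its approximation properties -/

/-- Data of the projection of `v` with derivative `v'`. -/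
def projData (k : ℕ) (v v' : Fn) : Fin N → Fin (k + 1) → ℝ :=
  mkData k (fun i w => ∮ x N i, v x * (𝒟 (𝒟 w)).eval x) (fun i => v' (right N i)) (fun i => v (right N i))

/-- The projection of `v`, with derivative `v'`. -/
def pr (N : ℕ) [NeZero N] (v v' : Fn) : Pw N := sol (projData k v v')

lemma form_dblPrim {N n : ℕ} (i : Fin N) (B : ℝ[X] → ℝ) (hadd : ∀ p q, B (p + q) = B p + B q)
    (hsmul : ∀ (c : ℝ) p, B (C c * p) = c * B p) (z : Fin n → ℝ) :
    B (dblPrim N i (legSum z)) = ∑ l, z l * B (dblPrim N i (legendre l)) := by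
  let L : ℝ[X] →ₗ[ℝ] ℝ := { toFun := B, map_add' := hadd, map_smul' := fun c p => by rw [smul_eq_C_mul, hsmul]; rfl }
  have : B (dblPrim N i (legSum z)) = (L.comp (dblPrimL N i)) (legSum z) := rfl; rw [this, legSum, map_sum]
  refine sum_congr rfl fun l _ => ?_; rw [← smul_eq_C_mul, map_smul]; rfl

/-- A smooth periodic function with its derivatives, bounded up to order `m`. -/
structure Smooth1 (m : ℕ) (M : ℝ) (V : ℕ → Fn) : Prop where
  der : ∀ n x, HasDerivAt (V n) (V (n + 1) x) x
  per : ∀ n x, V n (x + 2 * π) = V n x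
  bd : ∀ n ≤ m, ∀ x, |V n x| ≤ M

lemma Smooth1.continuous {V : ℕ → Fn} (hV : Smooth1 m M V) (n : ℕ) :
    Continuous (V n) := continuous_iff_continuousAt.2 fun x => (hV.der n x).continuousAt

lemma Smooth1.nonneg {V : ℕ → Fn} (hV : Smooth1 m M V) : 0 ≤ M := (abs_nonneg _).trans (hV.bd 0 (Nat.zero_le _) 0)

lemma isProj_pr {v v' : Fn} (hv : Continuous v) (hv' : ∀ i : Fin N, deriv v (right N i) = v' (right N i)) :
    IsProj k β θ v (pr N v v') := by
  have h := isSol_sol (N := N) (fun i w => ∮ x N i, v x * (𝒟 (𝒟 w)).eval x)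
    (fun i => v' (right N i)) (fun i => v (right N i)) (fun i z => form_dblPrim i
      (fun w => ∮ x N i, v x * (𝒟 (𝒟 w)).eval x)
      (fun p q => by
        simp only [derivative_add, eval_add, mul_add]
        rw [ii_add] <;> (apply ii; fun_prop))
      (fun c p => by
        simp only [derivative_C_mul, eval_mul, eval_C]; rw [← ii_const_mul]
        congr 1; ext x; ring) z)
  refine ⟨h.degree, ?_, fun i => (h.flux i).trans (hv' i).symm, h.average⟩; intro i w hw
  obtain ⟨d0, d1⟩ := dblPrim_left i (toRef N i (𝒟 (𝒟 w)))
  have e : 𝒟 (𝒟 (dblPrim N i (toRef N i (𝒟 (𝒟 w))))) = 𝒟 (𝒟 w) := by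
    rw [derivative2_dblPrim]; exact toRef_injective i (by rw [toRef_fromRef])
  have := h.form i (dblPrim N i (toRef N i (𝒟 (𝒟 w)))) (by
    have e0 := natDegree_dblPrim_le i (toRef N i (𝒟 (𝒟 w))); have e1 := natDegree_toRef_le N i (𝒟 (𝒟 w))
    have e2 := natDegree_derivative_le (𝒟 w); have e3 := natDegree_derivative_le w
    have := H.hk; omega) d0 d1
  simp only [e] at this; simp_rw [sub_mul]; rw [ii_sub (by apply ii; fun_prop) (by apply ii; fun_prop)]
  rw [sub_eq_zero]; exact this

lemma IsProj.eq_pr {v v' : Fn} (hv : Continuous v)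
    (hv' : ∀ i : Fin N, deriv v (right N i) = v' (right N i)) {p : Pw N}
    (hp : IsProj k β θ v p) : p = pr N v v' := by
  apply IsSol.eq_sol; refine ⟨hp.degree, ?_, fun i => (hp.flux i).trans (hv' i), hp.average⟩; intro i w hw _ _
  have := hp.orth i w hw; simp_rw [sub_mul] at this
  rw [ii_sub (by apply ii; fun_prop) (by apply ii; fun_prop), sub_eq_zero] at this; exact this

lemma proj_eq_pr {v v' : Fn} (hv : Continuous v) (hv' : ∀ i : Fin N, deriv v (right N i) = v' (right N i)) :
    proj N k β θ v = pr N v v' :=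
  IsProj.eq_pr hv hv' (Classical.epsilon_spec (p := IsProj k β θ v) ⟨_, isProj_pr hv hv'⟩)

/-- Bound for a cellwise polynomial in terms of its moments, fluxes and averages. -/
lemma poly_bound_of_data : ∃ B : ℝ, 0 < B ∧ ∀ (N : ℕ) [NeZero N] (p : Pw N) (M : ℝ),
    0 ≤ M → (∀ i, (p i).natDegree ≤ k) →
    (∀ i, ∀ l : ℕ, l + 1 < k → |∮₁ s, (p i).eval (pt N i s) * (legendre l).eval s| ≤ M) →
    (∀ i, step N * |diffFlux β θ (pfun p) i| ≤ M) → (∀ i, |avg (pfun p) i| ≤ M) →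
    ∀ i, ∀ x ∈ cell N i, |(p i).eval x| ≤ B * M ∧
      |(𝒟 (p i)).eval x| ≤ B * M / step N := by
  obtain ⟨B, hB, hb⟩ := sol_bound
  obtain ⟨c, hc, hcl⟩ : ∃ c : ℝ, 0 < c ∧ ∀ l : Fin (k + 1), c ≤ legSq l := by
    obtain ⟨l, -, hl⟩ := Finset.exists_min_image (Finset.univ : Finset (Fin (k + 1)))
      (fun l => legSq l) ⟨0, Finset.mem_univ _⟩
    exact ⟨legSq l, legSq_pos _, fun m => hl m (Finset.mem_univ _)⟩
  refine ⟨B * (1 + 1 / c), pos!, ?_⟩; intro N _ p M hM hdeg hmom hflux havg; have hs := step_pos N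
  have hp : IsSol k β θ (fun i w => ∮ x N i, (p i).eval x * (𝒟 (𝒟 w)).eval x)
    (diffFlux β θ (pfun p)) (avg (pfun p)) p :=
    ⟨hdeg, fun i w _ _ _ => rfl, fun _ => rfl, fun _ => rfl⟩
  have he := IsSol.eq_sol hp; have hc1 : 0 ≤ 1 / c := pos!
  have := hb N (mkData k (fun i w => ∮ x N i, (p i).eval x * (𝒟 (𝒟 w)).eval x) (diffFlux β θ (pfun p)) (avg (pfun p)))
    ((1 + 1 / c) * M) pos! (by
      intro i l; simp only [mkData]; split_ifs with h1 h2
      · rw [integral_cell, derivative2_dblPrim]; simp_rw [fromRef_eval]; have h3 := hmom i l h1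
        have h4 := legSq_pos l
        have e : ∀ I : ℝ, 2 / step N / legSq l * (step N / 2 * I) = I / legSq l := by intro I; field_simp
        rw [e, abs_div, abs_of_pos h4]
        have : M / legSq l ≤ 1 / c * M := by rw [div_eq_mul_one_div, mul_comm]; gcongr; exact hcl l
        refine (div_le_div_of_nonneg_right h3 h4.le).trans (this.trans ?_); nlinarith
      · rw [abs_mul, abs_of_pos hs]; refine (hflux i).trans ?_; nlinarith [mul_nonneg hc1 hM]
      · refine (havg i).trans ?_
        nlinarith [mul_nonneg hc1 hM])
  rw [← he] at this; intro i x hx; have := this i x hx; rwa [← mul_assoc] at this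

/-! ### Taylor approximation on a cell -/

/-- The Taylor polynomial of degree `n` at `c`. -/
def taylorPoly (V : ℕ → Fn) (n : ℕ) (c : ℝ) : ℝ[X] :=
  ∑ j ∈ Finset.range (n + 1), C (V j c / j.factorial) * (X - C c) ^ j

lemma natDegree_taylorPoly_le (V : ℕ → Fn) (n : ℕ) (c : ℝ) : (taylorPoly V n c).natDegree ≤ n := by
  refine natDegree_sum_le_of_forall_le _ _ fun j hj => ?_; refine (natDegree_C_mul_le _ _).trans ?_
  rw [natDegree_pow, natDegree_X_sub_C]; have := Finset.mem_range.1 hj; omega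

lemma taylor_taylorPoly (V : ℕ → Fn) (n : ℕ) (c : ℝ) :
    taylor c (taylorPoly V n c) = ∑ j ∈ Finset.range (n + 1), C (V j c / j.factorial) * X ^ j := by
  simp only [taylorPoly, map_sum, taylor_apply, mul_comp, C_comp, pow_comp, sub_comp, X_comp]
  refine sum_congr rfl fun j _ => ?_; congr 2; ring

lemma taylorPoly_eval (V : ℕ → Fn) (n : ℕ) (c : ℝ) {j : ℕ} (hj : j ≤ n) :
    (𝒟^[j] (taylorPoly V n c)).eval c = V j c := by
  rw [eval_iterate_derivative_eq_taylor, taylor_taylorPoly, finsetSum_coeff]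
  simp only [coeff_C_mul, coeff_X_pow]; rw [sum_eq_single j]
  · have : (j.factorial : ℝ) ≠ 0 := pos!; simp; field_simp
  · intro b _ hb; simp [hb.symm]
  · intro h; exact absurd (Finset.mem_range.2 om!) h

lemma taylor_remainder {V : ℕ → Fn} (hV : Smooth1 m M V) (hn : n < m)
    (c r : ℝ) (hr : 0 ≤ r) (j : ℕ) (hj : j ≤ n + 1) :
    ∀ x, |x - c| ≤ r → |V j x - (𝒟^[j] (taylorPoly V n c)).eval x| ≤ M * r ^ (n + 1 - j) := by
  have hM := hV.nonneg; obtain ⟨d, rfl⟩ : ∃ d, j = n + 1 - d := ⟨n + 1 - j, by omega⟩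
  have : d ≤ n + 1 ∨ n + 1 < d := le_or_gt _ _; clear hj
  induction d with
  | zero =>
    intro x _; rw [Nat.sub_zero, iterate_derivative_eq_zero (by have := natDegree_taylorPoly_le V n c; omega)]
    simpa using hV.bd (n + 1) om! x
  | succ d ih =>
    by_cases hd : d ≤ n
    · specialize ih (Or.inl om!)
      have e : n + 1 - d = (n + 1 - (d + 1)) + 1 := om!; rw [e] at ih; set j := n + 1 - (d + 1) with hj
      intro x hx; have hconv := convex_closedBall c r
      have hder : ∀ y ∈ Metric.closedBall c r, HasDerivWithinAt (fun y => V j y - (𝒟^[j] (taylorPoly V n c)).eval y)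
          (V (j + 1) y - (𝒟^[j + 1] (taylorPoly V n c)).eval y) (Metric.closedBall c r) y := by
        intro y _; rw [Function.iterate_succ_apply']
        exact ((hV.der j y).sub (Polynomial.hasDerivAt _ y)).hasDerivWithinAt
      have := hconv.norm_image_sub_le_of_norm_hasDerivWithin_le hder (C := M * r ^ (n + 1 - (j + 1))) (fun y hy => by
          rw [norm_eq_abs]
          exact ih y (by simpa [Real.dist_eq] using hy))
        (x := c) (y := x) (Metric.mem_closedBall_self hr) (by simpa [Real.dist_eq] using hx)
      rw [taylorPoly_eval V n c (by omega : j ≤ n), sub_self, sub_zero, norm_eq_abs, norm_eq_abs] at this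
      refine this.trans ?_; have e2 : n + 1 - j = (n + 1 - (j + 1)) + 1 := om!; rw [e2, pow_succ, ← mul_assoc]
      exact scale_le hx pos!
    · have e : n + 1 - (d + 1) = n + 1 - d := om!; rw [e]; exact ih om!

/-! ### Superconvergence of the one-dimensional projection -/

lemma integral_legendre (hk : 1 ≤ k) : ∮₁ s, (legendre k).eval s = 0 := by
  have := legendre_orth (n := k) 1 (by rw [natDegree_one]; omega); simpa using this

lemma primitive_legendre_one (hk : 1 ≤ k) : (primitive (legendre k)).eval 1 = 0 := by
  have h1 := poly_integral_parts (primitive (legendre k)) 1 (-1) 1; rw [derivative_primitive, primitive_neg_one] at h1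
  simp only [eval_one, mul_one, sub_zero, derivative_one, eval_zero, mul_zero, intervalIntegral.integral_zero] at h1
  rw [← h1, integral_legendre hk]

lemma primitive_legendre_orth {q : ℝ[X]} (hq : q.natDegree + 1 < k) :
    ∮₁ s, (primitive (legendre k)).eval s * q.eval s = 0 := by
  have h1 := poly_integral_parts (primitive q) (primitive (legendre k)) (-1) 1
  rw [derivative_primitive, derivative_primitive, primitive_neg_one, primitive_legendre_one om!] at h1
  simp_rw [mul_comm ((primitive (legendre k)).eval _)]; rw [h1]; simp_rw [mul_comm ((primitive q).eval _)]
  rw [legendre_orth _ (by have := natDegree_primitive_le q; omega)]; simp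

lemma natDegree_primitive_legendre (k : ℕ) : (primitive (legendre k)).natDegree = k + 1 := by
  apply le_antisymm
  · have := natDegree_primitive_le (legendre k); rwa [natDegree_legendre] at this
  · have := natDegree_derivative_lt (p := primitive (legendre k)) (by
      intro h; have h2 := derivative_eq_zero.2 h; rw [derivative_primitive] at h2
      exact legendre_ne_zero k h2)
    rw [derivative_primitive, natDegree_legendre] at this; omega

lemma toRef_taylorPoly_coeff (N : ℕ) (i : Fin N) (V : ℕ → Fn) (n : ℕ) :
    (toRef N i (taylorPoly V n ((left N i + right N i) / 2))).coeff n =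
      V n ((left N i + right N i) / 2) / n.factorial * (step N / 2) ^ n := by
  have h : toRef N i (taylorPoly V n ((left N i + right N i) / 2)) =
      (taylor ((left N i + right N i) / 2) (taylorPoly V n ((left N i + right N i) / 2))).comp
        (C (step N / 2) * X) := by
    rw [taylor_apply, comp_assoc, toRef]; congr 1; simp [add_comm]
  rw [h, comp_C_mul_X_coeff, taylor_taylorPoly, finsetSum_coeff, sum_eq_single n]
  · simp
  · intro b _ hb; simp [coeff_X_pow, hb.symm]
  · simp

lemma diffFlux_sub (β θ : ℝ) (p q : Pw N) (i : Fin N) :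
    diffFlux β θ (pfun fun i => p i - q i) i = diffFlux β θ (pfun p) i - diffFlux β θ (pfun q) i := by
  simp only [diffFlux_pfun, jump, avg, traceL, traceR, pfun, derivative_sub, eval_sub]; ring

lemma avg_sub (p q : Pw N) (i : Fin N) : avg (pfun fun i => p i - q i) i = avg (pfun p) i - avg (pfun q) i := by
  simp only [avg, traceL, traceR, pfun, eval_sub]; ring

lemma abs_integral_ref_le (h : ∀ s ∈ Icc (-1 : ℝ) 1, |f s| ≤ M) :
    |∮₁ s, f s| ≤ 2 * M := by
  have := intervalIntegral.norm_integral_le_of_norm_le_const (a := -1) (b := 1) (f := f) (C := M) (by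
    intro s hs; rw [uIoc_of_le num!] at hs
    exact h s ⟨hs.1.le, hs.2⟩)
  rw [norm_eq_abs] at this; refine this.trans (le_of_eq ?_); norm_num; ring

lemma abs_pt_sub_le (i : Fin N) {s : ℝ} (hs : s ∈ Icc (-1 : ℝ) 1) :
    |pt N i s - (left N i + right N i) / 2| ≤ step N := by
  have := step_pos N; unfold pt; rw [add_sub_cancel_left, abs_le]; constructor <;> nlinarith [hs.1, hs.2]

lemma abs_flux_le {X a b a' b' a'' b'' : ℝ} (hβ : 0 ≤ β) (hθ : 0 ≤ θ) (ha : |a| ≤ X) (hb : |b| ≤ X) (ha1 : |a'| ≤ X)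
    (hb1 : |b'| ≤ X) (ha2 : |a''| ≤ X) (hb2 : |b''| ≤ X) :
    |β * (b - a) + (a' + b') / 2 + θ * (b'' - a'')| ≤ (2 * β + 1 + 2 * θ) * X := by
  have h := scale_le ((abs_sub b a).trans (add_le_add hb ha)) hβ
  have h' := scale_le ((abs_sub b'' a'').trans (add_le_add hb2 ha2)) hθ
  rw [← abs_of_nonneg hβ, ← abs_mul, abs_of_nonneg hβ] at h
  rw [← abs_of_nonneg hθ, ← abs_mul, abs_of_nonneg hθ] at h'
  rw [abs_le] at *
  constructor <;> linarith [h.1, h.2, h'.1, h'.2, ha1.1, ha1.2, hb1.1, hb1.2]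

set_option maxHeartbeats 1000000 in
lemma pr_expansion : ∃ B : ℝ, 0 < B ∧ ∀ (N : ℕ) [NeZero N] (V : ℕ → Fn) (M : ℝ),
    Smooth1 (k + 2) M V → ∀ i, ∃ c : ℝ, |c| ≤ B * M ∧ ∀ s ∈ Icc (-1 : ℝ) 1,
      |V 0 (pt N i s) - (pr N (V 0) (V 1) i).eval (pt N i s)
        - c * step N ^ (k + 1) * (primitive (legendre k)).eval s| ≤ B * M * step N ^ (k + 2) ∧
      |V 1 (pt N i s) - (𝒟 (pr N (V 0) (V 1) i)).eval (pt N i s)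
        - 2 * c * step N ^ k * (legendre k).eval s| ≤ B * M * step N ^ (k + 1) := by
  obtain ⟨B, hB, hb⟩ := poly_bound_of_data
  choose B0 hB0 hb0 using fun l : ℕ => poly_bdd (legendre l)
  set BL := ∑ l ∈ Finset.range k, B0 l; have hBL0 : 0 ≤ BL := sum_nonneg fun l _ => hB0 l
  set Φ := primitive (legendre k) with hΦ; have hβ0 : 0 < β := lt_trans pos! H.hβ; have hk := H.hk
  have hk0 : (0 : ℝ) < k := by exact_mod_cast (by omega : 0 < k)
  have hθ0 : 0 < θ := by rw [H.hθ]; positivity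
  set lam := Φ.coeff (k + 1) with hlam
  have hlam0 : lam ≠ 0 := by
    have h1 : Φ ≠ 0 := by intro h; have := natDegree_primitive_legendre k; rw [← hΦ, h] at this; simp at this
    have := leadingCoeff_ne_zero.2 h1; rwa [leadingCoeff, natDegree_primitive_legendre] at this
  set D : ℝ := 2 * BL + (2 * β + 1 + 2 * θ) + 1 with hD; have hD0 : 0 < D := pos!
  refine ⟨1 + B * D + 1 / |lam|, pos!, ?_⟩; intro N _ V M hV; have hM := hV.nonneg; have hs := step_pos N
  set h := step N with hh; set mid : Fin N → ℝ := fun i => (left N i + right N i) / 2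
  set T : Pw N := fun i => taylorPoly V (k + 1) (mid i)
  set c : Fin N → ℝ := fun i => (toRef N i (T i)).coeff (k + 1) / lam / h ^ (k + 1) with hc
  have hcb : ∀ i, |c i| ≤ 1 / |lam| * M := by
    intro i; simp only [hc]; rw [toRef_taylorPoly_coeff]
    have e : V (k + 1) (mid i) / ((k + 1).factorial : ℝ) * (step N / 2) ^ (k + 1) / lam / h ^ (k + 1) =
      (1 / 2 ^ (k + 1) / ((k + 1).factorial : ℝ)) * (1 / lam * V (k + 1) (mid i)) := by
      rw [← hh, div_pow]; field_simp
    rw [e, abs_mul, abs_mul, abs_div 1 lam, abs_one]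
    have h1 : |1 / 2 ^ (k + 1) / ((k + 1).factorial : ℝ)| ≤ 1 := by
      rw [abs_of_pos pos!, div_div, div_le_one pos!]; have a1 : (1 : ℝ) ≤ 2 ^ (k + 1) := one_le_pow₀ num!
      have a2 : (1 : ℝ) ≤ ((k + 1).factorial : ℝ) := by exact_mod_cast Nat.one_le_iff_ne_zero.2 (Nat.factorial_ne_zero _)
      nlinarith
    have h2 := hV.bd (k + 1) om! (mid i)
    calc _ ≤ 1 * (1 / |lam| * M) := by gcongr
      _ = _ := one_mul _
  set R : Pw N := fun i => fromRef N i (toRef N i (T i) - C (c i * h ^ (k + 1)) * Φ) with hR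
  have hRd : ∀ i, (R i).natDegree ≤ k := by
    intro i; refine (natDegree_fromRef_le _ _ _).trans ?_
    have h1 : (toRef N i (T i) - C (c i * h ^ (k + 1)) * Φ).natDegree ≤ k + 1 := by
      refine (natDegree_sub_le _ _).trans (max_le ?_ ?_)
      · exact (natDegree_toRef_le _ _ _).trans (natDegree_taylorPoly_le _ _ _)
      · exact (natDegree_C_mul_le _ _).trans (natDegree_primitive_legendre k).le
    rw [natDegree_le_iff_coeff_eq_zero] at h1 ⊢; intro n hn
    rcases (Nat.lt_or_ge (k + 1) n) with h2 | h2
    · exact h1 n h2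
    · have : n = k + 1 := om!; subst this; rw [coeff_sub, coeff_C_mul, ← hlam]; simp only [hc]; field_simp; ring
  have hRT : ∀ i s, (R i).eval (pt N i s) = (T i).eval (pt N i s) - c i * h ^ (k + 1) * Φ.eval s ∧
      (𝒟 (R i)).eval (pt N i s) = (𝒟 (T i)).eval (pt N i s) - 2 * c i * h ^ k * (legendre k).eval s ∧
      (𝒟 (𝒟 (R i))).eval (pt N i s) =
        (𝒟 (𝒟 (T i))).eval (pt N i s) - 4 * (c i * h ^ k) / h * (𝒟 (legendre k)).eval s := by
    intro i s
    simp only [hR, derivative_fromRef, fromRef_eval, eval_mul, eval_C, derivative_sub, eval_sub,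
      derivative_toRef, toRef_eval, derivative_C_mul, hΦ, derivative_primitive, ← hh, true_and]
    constructor <;> (field_simp; ring)
  have hT : ∀ n ≤ 2, ∀ i, ∀ s ∈ Icc (-1 : ℝ) 1,
      |h ^ n * (V n (pt N i s) - (𝒟^[n] (T i)).eval (pt N i s))| ≤ M * h ^ (k + 2) := by
    intro n hn i s hs'
    rw [abs_mul, abs_of_pos pos!, show k + 2 = n + (k + 1 + 1 - n) by omega, pow_add, mul_left_comm]
    exact scale_le (taylor_remainder hV om! (mid i) h hs.le n om! _ (abs_pt_sub_le i hs')) pos!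
  have u := fun i n hn => hT n hn i 1 num!
  have w := fun i n hn => hT n hn (i + 1) (-1) num!; have hr := fun i => hRT i 1; have hl := fun i => hRT i (-1)
  simp only [pt_one, pt_neg_one, periodic_left_succ (hV.per _), hΦ, primitive_legendre_one (show 1 ≤ k by omega),
    primitive_neg_one, legendre_one, legendre_neg_one, legendre_deriv_end k (one_pow (M := ℝ) 2),
    legendre_deriv_end k (neg_one_sq (R := ℝ)), one_pow] at u w hr hl
  set p := pr N (V 0) (V 1)
  have hP : IsProj k β θ (V 0) p := isProj_pr (hV.continuous 0) (fun i => (hV.der 0 _).deriv)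
  set e : Pw N := fun i => p i - R i with he; have hV0 := hV.continuous 0
  have hpt := fun i => continuous_pt N i; have hMh : 0 ≤ M * h ^ (k + 2) := pos!
  have hebound := hb N e (D * (M * h ^ (k + 2))) pos!
    (fun i => (natDegree_sub_le _ _).trans (max_le (hP.degree i) (hRd i)))
    (by
      intro i l hl
      have horth : ∮₁ s, ((p i).eval (pt N i s) - V 0 (pt N i s)) * (legendre l).eval s = 0 := by
        have := hP.orth i (dblPrim N i (legendre l))
          ((natDegree_dblPrim_le _ _).trans (by rw [natDegree_legendre]; omega))
        rw [derivative2_dblPrim, integral_cell] at this; simp_rw [fromRef_eval] at this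
        exact (mul_eq_zero.1 this).resolve_left pos!
      have e1 : ∀ s, (e i).eval (pt N i s) * (legendre l).eval s =
          ((p i).eval (pt N i s) - V 0 (pt N i s)) * (legendre l).eval s +
          (V 0 (pt N i s) - (T i).eval (pt N i s)) * (legendre l).eval s +
          c i * h ^ (k + 1) * (Φ.eval s * (legendre l).eval s) := by
        intro s; simp only [he, eval_sub, (hRT i s).1]; ring
      simp_rw [e1]; have hpi := hpt i
      rw [ii_add (by apply ii; fun_prop) (by apply ii; fun_prop),
        ii_add (by apply ii; fun_prop) (by apply ii; fun_prop), horth,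
        ii_const_mul, primitive_legendre_orth (by rwa [natDegree_legendre])]
      rw [zero_add, mul_zero, add_zero]; refine (abs_integral_ref_le (M := M * h ^ (k + 2) * BL) ?_).trans ?_
      · intro s hs'; rw [abs_mul]
        have : B0 l ≤ BL := single_le_sum (f := B0) (fun l _ => hB0 l) (Finset.mem_range.2 om!)
        exact mul_le_mul (by simpa using hT 0 om! i s hs') ((hb0 l s hs').trans this) (abs_nonneg _) hMh
      · have : 0 ≤ 2 * β + 1 + 2 * θ + 1 := pos!; rw [hD]
        nlinarith [mul_nonneg this hMh])
    (by
      intro i; rw [diffFlux_sub, hP.flux, (hV.der 0 _).deriv]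
      have hfl : step N * |V 1 (right N i) - diffFlux β θ (pfun R) i| =
          |β * (h ^ 0 * (V 0 (right N i) - (𝒟^[0] (T (i + 1))).eval (left N (i + 1)))
              - h ^ 0 * (V 0 (right N i) - (𝒟^[0] (T i)).eval (right N i)))
            + (h ^ 1 * (V 1 (right N i) - (𝒟^[1] (T i)).eval (right N i))
              + h ^ 1 * (V 1 (right N i) - (𝒟^[1] (T (i + 1))).eval (left N (i + 1)))) / 2
            + θ * (h ^ 2 * (V 2 (right N i) - (𝒟^[2] (T (i + 1))).eval (left N (i + 1)))
              - h ^ 2 * (V 2 (right N i) - (𝒟^[2] (T i)).eval (right N i)))| := by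
        rw [← hh, ← abs_of_pos hs, ← abs_mul, abs_of_pos hs, diffFlux_pfun]
        simp only [jump, avg, traceL, traceR, pfun, hr, hl, ← hh, H.hθ, Function.iterate_succ, Function.iterate_zero,
          Function.comp, id]
        congr 1; field_simp; ring
      have := abs_flux_le hβ0.le hθ0.le (u i 0 om!) (w i 0 om!) (u i 1 om!) (w i 1 om!) (u i 2 om!) (w i 2 om!)
      rw [← hfl] at this
      nlinarith)
    (by
      intro i; rw [avg_sub, hP.average]; have u0 := abs_le.1 (u i 0 om!); have w0 := abs_le.1 (w i 0 om!)
      simp only [avg, traceL, traceR, pfun, (hr i).1, (hl (i + 1)).1, mul_zero, sub_zero]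
      simp only [pow_zero, one_mul, Function.iterate_zero, id] at u0 w0
      refine (abs_le.2 ⟨?_, ?_⟩ : _ ≤ M * h ^ (k + 2)).trans (by nlinarith) <;> linarith [u0.1, u0.2, w0.1, w0.2])
  intro i; refine ⟨c i, (hcb i).trans ?_, ?_⟩
  · refine mul_le_mul_of_nonneg_right ?_ hM; have : 0 ≤ B * D := pos!; linarith
  intro s hs'; obtain ⟨e0, e1⟩ := hebound i _ (pt_mem i hs')
  have t0 : |V 0 (pt N i s) - (T i).eval (pt N i s)| ≤ M * h ^ (k + 2) := by simpa using hT 0 om! i s hs'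
  have t1 : |V 1 (pt N i s) - (𝒟 (T i)).eval (pt N i s)| ≤ M * h ^ (k + 1) := by
    have := hT 1 om! i s hs'
    rw [pow_one, abs_mul, abs_of_pos hs, show M * h ^ (k + 2) = h * (M * h ^ (k + 1)) by ring] at this
    exact le_of_mul_le_mul_left this hs
  have i1 : 0 ≤ 1 / |lam| := pos!; constructor
  · have eq : V 0 (pt N i s) - (p i).eval (pt N i s) - c i * h ^ (k + 1) * Φ.eval s =
      (V 0 (pt N i s) - (T i).eval (pt N i s)) - (e i).eval (pt N i s) := by
      simp only [he, eval_sub, (hRT i s).1]; ring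
    rw [eq]; refine (abs_sub _ _).trans ?_; nlinarith [mul_nonneg i1 hMh]
  · have eq : V 1 (pt N i s) - (𝒟 (p i)).eval (pt N i s) - 2 * c i * h ^ k * (legendre k).eval s =
      (V 1 (pt N i s) - (𝒟 (T i)).eval (pt N i s)) - (𝒟 (e i)).eval (pt N i s) := by
      simp only [he, derivative_sub, eval_sub, (hRT i s).2.1]; ring
    rw [eq]; refine (abs_sub _ _).trans ?_
    have e2 : B * (D * (M * h ^ (k + 2))) / step N = B * D * (M * h ^ (k + 1)) := by rw [← hh]; field_simp; ring
    rw [e2] at e1; have : 0 ≤ M * h ^ (k + 1) := pos!; nlinarith [mul_nonneg i1 this]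

lemma pr_error : ∃ B : ℝ, 0 < B ∧ ∀ (N : ℕ) [NeZero N] (V : ℕ → Fn) (M : ℝ), Smooth1 (k + 2) M V →
    (∀ i, ∀ x ∈ cell N i,
      |V 0 x - (pr N (V 0) (V 1) i).eval x| ≤ B * M * step N ^ (k + 1) ∧
      |V 1 x - (𝒟 (pr N (V 0) (V 1) i)).eval x| ≤ B * M * step N ^ k) ∧
    (∀ i, |jump (pfun (pr N (V 0) (V 1))) i| ≤ B * M * step N ^ (k + 2)) ∧
    (∀ i, ∀ s ∈ Icc (-1 : ℝ) 1, (primitive (legendre k)).eval s = 0 →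
      |V 0 (pt N i s) - (pr N (V 0) (V 1) i).eval (pt N i s)| ≤ B * M * step N ^ (k + 2)) ∧
    (∀ i, ∀ s ∈ Icc (-1 : ℝ) 1, (legendre k).eval s = 0 →
      |V 1 (pt N i s) - (𝒟 (pr N (V 0) (V 1) i)).eval (pt N i s)| ≤ B * M * step N ^ (k + 1)) := by
  obtain ⟨B, hB, hb⟩ := pr_expansion; obtain ⟨B1, hB1, hb1⟩ := poly_bdd (primitive (legendre k))
  obtain ⟨B2, hB2, hb2⟩ := poly_bdd (legendre k); refine ⟨B * (2 * π) + B * B1 + 2 * B * B2 + 2 * B, pos!, ?_⟩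
  intro N _ V M hV; have hM := hV.nonneg; have hs := step_pos N; have hs2 := step_le N; set h := step N
  have hpi := pi_pos
  have mono : ∀ K n, K ≤ B * (2 * π) + B * B1 + 2 * B * B2 + 2 * B →
      K * M * h ^ n ≤ (B * (2 * π) + B * B1 + 2 * B * B2 + 2 * B) * M * h ^ n := by
    intro K n hK; gcongr
  have n1 : 0 ≤ B * (2 * π) := pos!; have n2 : 0 ≤ B * B1 := pos!; have n3 : 0 ≤ 2 * B * B2 := pos!
  have hz : ∀ i, ∀ s ∈ Icc (-1 : ℝ) 1, (primitive (legendre k)).eval s = 0 →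
      |V 0 (pt N i s) - (pr N (V 0) (V 1) i).eval (pt N i s)| ≤ B * M * h ^ (k + 2) := by
    intro i s hs' h0; obtain ⟨c, hc, hcs⟩ := hb N V M hV i; have := (hcs s hs').1
    rwa [h0, mul_zero, sub_zero] at this
  refine ⟨?_, ?_, fun i s hs' h0 => (hz i s hs' h0).trans (mono _ _ (by linarith)), ?_⟩
  · intro i x hx; obtain ⟨s, hs', rfl⟩ := exists_pt i hx; obtain ⟨c, hc, hcs⟩ := hb N V M hV i
    obtain ⟨e0, e1⟩ := hcs s hs'; have b1 := hb1 s hs'; have b2 := hb2 s hs'; constructor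
    · have t : |c * h ^ (k + 1) * (primitive (legendre k)).eval s| ≤ B * M * h ^ (k + 1) * B1 := by
        rw [abs_mul, abs_mul, abs_of_pos (pos! : 0 < h ^ (k + 1))]; gcongr
      have t2 : B * M * h ^ (k + 2) ≤ B * M * h ^ (k + 1) * (2 * π) := by rw [pow_succ h (k + 1), ← mul_assoc]; gcongr
      refine le_trans ?_ (mono (B * (2 * π) + B * B1) (k + 1) (by linarith))
      have := abs_sub_abs_le_abs_sub (V 0 (pt N i s) - (pr N (V 0) (V 1) i).eval (pt N i s))
        (c * h ^ (k + 1) * (primitive (legendre k)).eval s)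
      linarith
    · have t : |2 * c * h ^ k * (legendre k).eval s| ≤ 2 * (B * M) * h ^ k * B2 := by
        rw [abs_mul, abs_mul, abs_mul, abs_two, abs_of_pos (pos! : 0 < h ^ k)]; gcongr
      have t2 : B * M * h ^ (k + 1) ≤ B * M * h ^ k * (2 * π) := by rw [pow_succ h k, ← mul_assoc]; gcongr
      refine le_trans ?_ (mono (B * (2 * π) + 2 * B * B2) k (by linarith))
      have := abs_sub_abs_le_abs_sub (V 1 (pt N i s) -
        (𝒟 (pr N (V 0) (V 1) i)).eval (pt N i s)) (2 * c * h ^ k * (legendre k).eval s)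
      linarith
  · intro i; have h1 := hz i 1 num! (primitive_legendre_one (by have := H.hk; omega))
    have h2 := hz (i + 1) (-1) num! (primitive_neg_one _); rw [pt_one] at h1
    rw [pt_neg_one, periodic_left_succ (hV.per 0)] at h2
    refine le_trans ?_ (mono (2 * B) (k + 2) (by linarith)); simp only [jump, traceL, traceR, pfun]
    rw [abs_le] at *
    constructor <;> linarith [h1.1, h1.2, h2.1, h2.2]
  · intro i s hs' h0; obtain ⟨c, hc, hcs⟩ := hb N V M hV i; have := (hcs s hs').2
    rw [h0, mul_zero, sub_zero] at this; exact this.trans (mono _ _ (by linarith))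

lemma pr_integral_err {v v' : Fn} (hv : ∀ x, HasDerivAt v (v' x) x)
    (i : Fin N) : ∮ x N i, (v x - (pr N v v' i).eval x) = 0 := by
  have hc : Continuous v := continuous_iff_continuousAt.2 fun x => (hv x).continuousAt
  have := (isProj_pr (N := N) hc (fun i => (hv _).deriv)).orth i (C (1 / 2) * X ^ 2)
    ((natDegree_C_mul_X_pow_le _ _).trans H.hk)
  have e : ∀ x, ((pr N v v' i).eval x - v x) * (𝒟 (𝒟 (C (1 / 2) * X ^ 2 : ℝ[X]))).eval x =
      - (v x - (pr N v v' i).eval x) := by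
    intro x; simp [derivative_pow]
  simp_rw [e] at this; rwa [ii_neg, neg_eq_zero] at this

/-! ### Linearity and parameter dependence -/

/-- Evaluation of the solution as a linear functional of the data. -/
def solEval (N : ℕ) [NeZero N] (L : ℝ[X] →ₗ[ℝ] ℝ) (i : Fin N) : (Fin N → Fin (k + 1) → ℝ) →ₗ[ℝ] ℝ where
  toFun d := L (sol d i)
  map_add' d e := by rw [sol_add, map_add]
  map_smul' c d := by rw [sol_smul, ← smul_eq_C_mul, map_smul]; rfl

lemma hasDerivAt_linear {E : Type*} [NormedAddCommGroup E] [NormedSpace ℝ E] [FiniteDimensional ℝ E]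
    (L : E →ₗ[ℝ] ℝ) {f : ℝ → E} {f' : E} {t : ℝ} (hf : HasDerivAt f f' t) :
    HasDerivAt (fun t => L (f t)) (L f') t := by
  have := (LinearMap.toContinuousLinearMap L).hasFDerivAt.comp_hasDerivAt t hf; exact this

lemma hasDerivAt_integral_of_bounded {F F' : Fn₂} {M τ a b : ℝ} (hab : a ≤ b) {s : Set ℝ}
    (hs : s ∈ nhds τ) (hF : ∀ t ∈ s, ∀ x, HasDerivAt (fun t => F t x) (F' t x) t)
    (hc : ∀ t ∈ s, Continuous (F t)) (hc' : ∀ t ∈ s, Continuous (F' t))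
    (hM : ∀ t ∈ s, ∀ x ∈ Icc a b, |F' t x| ≤ M) :
    HasDerivAt (fun t => ∫ x in a..b, F t x) (∫ x in a..b, F' τ x) τ := by
  have hτ := mem_of_mem_nhds hs
  refine (intervalIntegral.hasDerivAt_integral_of_dominated_loc_of_deriv_le
      (F := F) (F' := F') (bound := fun _ => M) (s := s) hs ?_ ?_ ?_ ?_ ?_ ?_).2
  · filter_upwards [hs] with t ht using (hc t ht).aestronglyMeasurable
  · exact (hc τ hτ).intervalIntegrable _ _
  · exact (hc' τ hτ).aestronglyMeasurable
  · refine Filter.Eventually.of_forall fun x hx t ht => ?_; rw [uIoc_of_le hab] at hx; exact hM t ht x ⟨hx.1.le, hx.2⟩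
  · exact intervalIntegrable_const
  · exact Filter.Eventually.of_forall fun x _ t ht => hF t ht x

lemma hasDerivAt_projData {G G1 G' G1' : Fn₂} {M τ : ℝ} {s : Set ℝ}
    (hs : s ∈ nhds τ) (hG : ∀ τ ∈ s, ∀ y, HasDerivAt (fun τ => G τ y) (G' τ y) τ)
    (hG1 : ∀ τ ∈ s, ∀ y, HasDerivAt (fun τ => G1 τ y) (G1' τ y) τ)
    (hc : ∀ τ ∈ s, Continuous (G τ)) (hc' : ∀ τ ∈ s, Continuous (G' τ))
    (hM : ∀ τ ∈ s, ∀ y, |G' τ y| ≤ M) :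
    HasDerivAt (fun τ => projData (N := N) k (G τ) (G1 τ)) (projData k (G' τ) (G1' τ)) τ := by
  have hτ := mem_of_mem_nhds hs; rw [hasDerivAt_pi]; intro i; rw [hasDerivAt_pi]; intro l
  simp only [projData, mkData]; split_ifs with h1 h2
  · apply HasDerivAt.const_mul; set w := 𝒟 (𝒟 (dblPrim N i (legendre l)))
    obtain ⟨B, hB⟩ := isCompact_Icc.exists_bound_of_continuousOn (s := cell N i) (f := fun s => w.eval s) fp!
    have hcw : Continuous fun x => w.eval x := fp!
    refine hasDerivAt_integral_of_bounded (M := M * B) (F' := fun τ x => G' τ x * w.eval x)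
      (left_lt_right N i).le hs (fun t ht x => (hG t ht x).mul_const _)
      (fun t ht => (hc t ht).mul hcw) (fun t ht => (hc' t ht).mul hcw) fun t ht x hx => ?_
    rw [abs_mul]; exact mul_le_mul (hM t ht x) (hB x hx) (abs_nonneg _) ((abs_nonneg _).trans (hM t ht x))
  · exact (hG1 τ hτ _).const_mul _
  · exact hG τ hτ _

lemma projData_sub {v v' w w' : Fn} (hv : Continuous v)
    (hw : Continuous w) : projData (N := N) k (fun x => v x - w x) (fun x => v' x - w' x) =
      projData k v v' - projData k w w' := by
  funext i l; simp only [projData, mkData, Pi.sub_apply]; split_ifs with h1 h2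
  · simp_rw [sub_mul]; rw [ii_sub (by apply ii; fun_prop) (by apply ii; fun_prop)]; ring
  · ring
  · ring

lemma sol_sub (d e : Fin N → Fin (k + 1) → ℝ) (i : Fin N) : sol (d - e) i = sol d i - sol e i := by
  have := sol_add (β := β) (θ := θ) (d - e) e i; rw [sub_add_cancel] at this; rw [this]; ring

lemma pr_sub {v v' w w' : Fn} (hv : Continuous v)
    (hw : Continuous w) (i : Fin N) : pr N (fun x => v x - w x) (fun x => v' x - w' x) i =
      pr N v v' i - pr N w w' i := by
  rw [pr, projData_sub hv hw, sol_sub]; rfl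

lemma integral_swap_of_continuous {f : Fn₂} (a b c d : ℝ) (hf : C₂ f) :
    ∫ x in a..b, ∫ y in c..d, f x y = ∫ y in c..d, ∫ x in a..b, f x y := by
  have key : Integrable (uncurry f) ((volume.restrict (uIoc a b)).prod (volume.restrict (uIoc c d))) := by
    rw [Measure.prod_restrict]
    refine (hf.continuousOn.integrableOn_compact (isCompact_uIcc.prod isCompact_uIcc)).mono_set
      (prod_mono uIoc_subset_uIcc uIoc_subset_uIcc)
  simp only [intervalIntegral.intervalIntegral_eq_integral_uIoc, smul_eq_mul]; simp only [integral_const_mul]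
  rw [integral_integral_swap key]; ring

lemma projData_comm {u ux uy uxy : Fn₂} (hu : C₂ u) (i : Fin Nx) (j : Fin Ny) (l m : Fin (k + 1)) :
    projData k (fun x => projData k (u x) (uy x) j m) (fun x => projData k (ux x) (uxy x) j m) i l =
      projData k (fun y => projData k (fun x => u x y) (fun x => ux x y) i l)
        (fun y => projData k (fun x => uy x y) (fun x => uxy x y) i l) j m := by
  simp only [projData, mkData]; split_ifs with h1 h2 h3 h4 h5
  · set w := 𝒟 (𝒟 (dblPrim Nx i (legendre l))); set v := 𝒟 (𝒟 (dblPrim Ny j (legendre m)))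
    have e1 : ∀ x, 2 / step Ny / legSq m * (∮ y Ny j, u x y * v.eval y) * w.eval x =
        2 / step Ny / legSq m * ∮ y Ny j, u x y * v.eval y * w.eval x := by
      intro x; rw [ii_mul_const]; ring
    have e2 : ∀ y, 2 / step Nx / legSq l * (∮ x Nx i, u x y * w.eval x) * v.eval y =
        2 / step Nx / legSq l * ∮ x Nx i, u x y * v.eval y * w.eval x := by
      intro y
      have : (fun x => u x y * v.eval y * w.eval x) = fun x => u x y * w.eval x * v.eval y := by funext x; ring
      rw [this, ii_mul_const]; ring
    simp_rw [e1, e2]; rw [ii_const_mul, ii_const_mul, integral_swap_of_continuous _ _ _ _ fp!]; ring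
  all_goals first
    | rfl
    | ring1
    | (simp only [← ii_const_mul]; congr 1; ext; ring)

lemma linear_expand {N n : ℕ} (L : (Fin N → Fin n → ℝ) →ₗ[ℝ] ℝ) (d : Fin N → Fin n → ℝ) :
    L d = ∑ i, ∑ l, d i l * L (Pi.single i (Pi.single l 1)) := by
  have h : d = ∑ i, ∑ l, d i l • (Pi.single i (Pi.single l 1) : Fin N → Fin n → ℝ) := by
    funext i l; simp only [Finset.sum_apply, Pi.smul_apply, smul_eq_mul]; rw [sum_eq_single i, sum_eq_single l]
    · simp
    · intro b _ hb; simp [hb.symm]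
    · simp
    · intro b _ hb; simp [hb.symm]
    · simp
  conv_lhs => rw [h]; simp only [map_sum, map_smul, smul_eq_mul]

/-! ### The corrections of the comparison function -/

/-- The solution of `⟨p, v''⟩ = -⟨Z, v'⟩` with vanishing fluxes and averages. -/
def corr (N : ℕ) [NeZero N] (Z : Fin N → Fn) : Pw N := sol (mkData k (fun i v => -∮ x N i, Z i x * (𝒟 v).eval x) 0 0)

lemma natDegree_sol_le (d : Fin N → Fin (k + 1) → ℝ) (i : Fin N) : (sol d i).natDegree ≤ k :=
  (natDegree_fromRef_le _ _ _).trans (natDegree_legSum_le _)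

lemma corr_sub {Z W : Fin N → Fn} (hZ : ∀ i, Continuous (Z i)) (hW : ∀ i, Continuous (W i)) (i : Fin N) :
    corr N Z i - corr N W i = corr N (fun i x => Z i x - W i x) i := by
  rw [corr, corr, ← sol_sub, corr]; congr 1; funext i l; simp only [mkData, Pi.sub_apply, Pi.zero_apply]
  have hZ' := hZ i; have hW' := hW i; split_ifs
  · simp_rw [sub_mul]; rw [ii_sub (by apply ii; fun_prop) (by apply ii; fun_prop)]; ring
  · ring
  · ring

lemma abs_integral_cell_le (i : Fin N) (h : ∀ x ∈ cell N i, |f x| ≤ M) :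
    |∮ x N i, f x| ≤ M * step N := by
  have := intervalIntegral.norm_integral_le_of_norm_le_const (a := left N i) (b := right N i)
    (f := f) (C := M) (fun x hx => h x (by rw [uIoc_of_le (left_lt_right N i).le] at hx; exact ⟨hx.1.le, hx.2⟩))
  rwa [right_sub_left, abs_of_pos (step_pos N)] at this

lemma sol_form_bound : ∃ B : ℝ, 0 < B ∧ ∀ (N : ℕ) [NeZero N] (A Z : Fin N → Fn) (q : Fin N → ℝ) (M : ℝ),
    (∀ i, ∀ x ∈ cell N i, |A i x| ≤ M ∧ |Z i x| ≤ M) → (∀ i, |q i| ≤ M) →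
    ∀ i, ∀ x ∈ cell N i, ∀ p, p = sol (mkData k (fun i v =>
        ∮ x N i, (A i x * v.eval x - Z i x * (𝒟 v).eval x)) q 0) i →
      |p.eval x| ≤ B * M * step N ∧ |(𝒟 p).eval x| ≤ B * M := by
  obtain ⟨B, hB, hb⟩ := sol_bound
  choose P hP hP' using fun l : ℕ => poly_bdd (primitive (legendre l))
  choose R hR hR' using fun l : ℕ => poly_bdd (primitive (primitive (legendre l)))
  have hπ := pi_pos; set F : ℕ → ℝ := fun l => (R l * π + P l) / legSq l with hF
  have hF0 : ∀ l, 0 ≤ F l := fun l => div_nonneg (add_nonneg (mul_nonneg (hR l) hπ.le) (hP l)) (legSq_pos l).le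
  set Q := ∑ l : Fin (k + 1), F l
  have hQl : ∀ l : Fin (k + 1), F l ≤ Q := fun l =>
    single_le_sum (f := fun l : Fin (k + 1) => F l) (fun i _ => hF0 i) (Finset.mem_univ l)
  have hQ0 : 0 ≤ Q := sum_nonneg fun i _ => hF0 i; refine ⟨B * (Q + 1), pos!, ?_⟩
  rintro N _ A Z q M hZ hq i x hx _ rfl; have hs := step_pos N; have hM : 0 ≤ M := (abs_nonneg _).trans (hq i)
  have key := hb N (mkData k (fun i v => ∮ x N i,
    (A i x * v.eval x - Z i x * (𝒟 v).eval x)) q 0) ((Q + 1) * M * step N) pos! ?_ i x hx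
  · refine ⟨key.1.trans (le_of_eq (by ring)), key.2.trans (le_of_eq (by field_simp))⟩
  · intro i l; simp only [mkData, Pi.zero_apply]; have h0 : 0 ≤ (Q + 1) * M * step N := pos!; split_ifs
    · have hl := legSq_pos l; have hRl := hR l
      have h1 : |∮ x N i, (A i x * (dblPrim N i (legendre l)).eval x - Z i x *
          (𝒟 (dblPrim N i (legendre l))).eval x)| ≤
            (M * (step N / 2 * (R l * π)) + M * (step N / 2 * P l)) * step N := by
        refine abs_integral_cell_le i fun x hx => (abs_sub _ _).trans (add_le_add ?_ ?_)
        all_goals rw [abs_mul]; obtain ⟨s, hs', rfl⟩ := exists_pt i hx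
        · refine mul_le_mul (hZ i _ hx).1 ?_ (abs_nonneg _) hM
          simp only [dblPrim, fromRef_eval, eval_mul, eval_C]; rw [abs_mul, abs_of_pos pos!]
          calc step N ^ 2 / 4 * _ ≤ step N ^ 2 / 4 * R l := by gcongr; exact hR' l s hs'
            _ ≤ step N / 2 * (R l * π) := by
              have := mul_nonneg (mul_nonneg hs.le hRl) (sub_nonneg.2 (step_le N)); linarith
        · refine mul_le_mul (hZ i _ hx).2 ?_ (abs_nonneg _) hM; rw [derivative_dblPrim]
          simp only [eval_mul, eval_C, fromRef_eval]; rw [abs_mul, abs_of_pos pos!]; exact scale_le (hP' l s hs') pos!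
      rw [abs_mul, abs_of_pos (pos! : 0 < 2 / step N / legSq l)]
      calc 2 / step N / legSq l * _ ≤ 2 / step N / legSq l * _ := scale_le h1 pos!
        _ = F l * M * step N := by simp only [hF]; field_simp
        _ ≤ (Q + 1) * M * step N := by have := hQl l; gcongr; linarith
    · rw [abs_mul, abs_of_pos hs, mul_comm]; gcongr; nlinarith [hq i]
    · simpa using h0

lemma corr_bound : ∃ B : ℝ, 0 < B ∧ ∀ (N : ℕ) [NeZero N] (Z : Fin N → Fn) (M : ℝ),
    (∀ i, ∀ x ∈ cell N i, |Z i x| ≤ M) →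
    ∀ i, ∀ x ∈ cell N i,
      |(corr N Z i).eval x| ≤ B * M * step N ∧
      |(𝒟 (corr N Z i)).eval x| ≤ B * M := by
  obtain ⟨B, hB, hb⟩ := sol_form_bound; refine ⟨B, hB, fun N _ Z M hZ i x hx => ?_⟩
  have hM : 0 ≤ M := (abs_nonneg _).trans (hZ i x hx)
  exact hb N 0 Z 0 M (fun i x hx => ⟨by simpa using hM, hZ i x hx⟩) (by simpa using hM) i x hx _ (by
    simp only [corr, Pi.zero_apply, zero_mul, zero_sub, ii_neg])

lemma corr_A1 {Z : Fin N → Fn} (hZ : ∀ i, Continuous (Z i)) (h0 : ∀ i, ∮ x N i, Z i x = 0) (v : Pw N)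
    (hv : ∀ i, (v i).natDegree ≤ k) :
    A1 β θ (corr N Z) v = ∑ i, ∮ x N i, Z i x * (𝒟 (v i)).eval x := by
  have h := isSol_sol (N := N) (fun i v => -∮ x N i, Z i x * (𝒟 v).eval x) 0 0
    (fun i z => form_dblPrim i (fun v => -∮ x N i, Z i x * (𝒟 v).eval x) (fun p q => by
        have := hZ i; simp only [derivative_add, eval_add, mul_add]
        rw [ii_add, neg_add] <;> (apply ii; fun_prop))
      (fun c p => by
        simp only [derivative_C_mul, eval_mul, eval_C, mul_neg]; rw [← ii_const_mul]
        congr 2; ext x; ring) z)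
  rw [A1_parts]; have e1 : ∀ i, diffFlux β θ (pfun (corr N Z)) i = 0 := h.flux
  have e2 : ∀ i, avg (pfun (corr N Z)) i = 0 := h.average
  simp only [e1, e2, zero_mul, Finset.sum_const_zero, add_zero, sub_zero]; rw [← Finset.sum_neg_distrib]
  refine sum_congr rfl fun i _ => ?_; have hZ' := hZ i; set a := (v i).eval (left N i)
  set b := (𝒟 (v i)).eval (left N i); set q : ℝ[X] := v i - C a - C b * (X - C (left N i)) with hq
  have hd : 𝒟 q = 𝒟 (v i) - C b := by simp [hq]
  have hd2 : 𝒟 (𝒟 q) = 𝒟 (𝒟 (v i)) := by simp [hd]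
  have hf := h.form i q (by
      refine (natDegree_sub_le _ _).trans (max_le (natDegree_sub_C.le.trans (hv i)) ?_)
      exact (natDegree_C_mul_le _ _).trans (by have := H.hk; rw [natDegree_X_sub_C]; omega))
    (by simp [hq, a]) (by simp [hd, b])
  rw [hd2, hd] at hf
  change ∮ x N i, (corr N Z i).eval x * _ = _ at hf
  rw [hf, neg_neg]; simp only [eval_sub, eval_C, mul_sub]
  rw [ii_sub (by apply ii; fun_prop) (by apply ii; fun_prop), ii_mul_const, h0]; ring

/-! ### Nonlinear fluxes on bounded sets -/

lemma smooth_flux_bounds (hf : C∞ f) (R : ℝ) : ∃ L : ℝ, 0 < L ∧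
    (∀ a, |a| ≤ R → |f a| ≤ L ∧ |deriv f a| ≤ L ∧ |deriv (deriv f) a| ≤ L ∧
      |deriv (deriv (deriv f)) a| ≤ L) ∧
    (∀ a b, |a| ≤ R → |b| ≤ R → |f a - f b| ≤ L * |a - b| ∧
      |deriv f a - deriv f b| ≤ L * |a - b| ∧
      |f a - f b - deriv f b * (a - b)| ≤ L * (a - b) ^ 2) := by
  have h1 := hf.drv; have h2 := h1.drv; have h3 := h2.drv
  have bd : ∀ F : Fn, Continuous F → ∃ L : ℝ, ∀ a ∈ Icc (-R) R, |F a| ≤ L := fun F hF =>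
    isCompact_Icc.exists_bound_of_continuousOn hF.continuousOn
  obtain ⟨L0, hL0⟩ := bd f hf.continuous; obtain ⟨L1, hL1⟩ := bd _ h1.continuous
  obtain ⟨L2, hL2⟩ := bd _ h2.continuous; obtain ⟨L3, hL3⟩ := bd _ h3.continuous
  have m : ∀ a : ℝ, |a| ≤ R → a ∈ Icc (-R) R := fun a h => abs_le.1 h; have d0 := hf.hd; have d1 := h1.hd
  set L := |L0| + |L1| + |L2| + |L3| + 1; have n0 := abs_nonneg L0; have n1 := abs_nonneg L1
  have n2 := abs_nonneg L2; have n3 := abs_nonneg L3; have g0 := le_abs_self L0; have g1 := le_abs_self L1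
  have g2 := le_abs_self L2; have g3 := le_abs_self L3
  have lip : ∀ (F F' : Fn), (∀ x, HasDerivAt F (F' x) x) → ∀ (s : Set ℝ) (K : ℝ), Convex ℝ s →
      (∀ x ∈ s, |F' x| ≤ K) → ∀ a ∈ s, ∀ b ∈ s, |F a - F b| ≤ K * |a - b| := by
    intro F F' hF s K hs hK a ha b hb
    exact hs.norm_image_sub_le_of_norm_hasDerivWithin_le (fun x _ => (hF x).hasDerivWithinAt) hK hb ha
  refine ⟨L, pos!, ?_, ?_⟩
  · intro a ha; have h := m a ha
    exact ⟨by linarith [hL0 a h], by linarith [hL1 a h], by linarith [hL2 a h], by linarith [hL3 a h]⟩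
  · intro a b ha hb
    refine ⟨lip f _ d0 _ _ (convex_Icc _ _) (fun x hx => (hL1 x hx).trans (by linarith)) a (m a ha) b (m b hb),
      lip _ _ d1 _ _ (convex_Icc _ _) (fun x hx => (hL2 x hx).trans (by linarith)) a (m a ha) b (m b hb), ?_⟩
    have := lip (fun x => f x - deriv f b * x) (fun x => deriv f x - deriv f b)
      (fun x => ((d0 x).sub ((hasDerivAt_id x).const_mul (deriv f b))).congr_deriv (by ring))
      (uIcc a b) (L * |a - b|) (convex_uIcc _ _) (by
        intro x hx; have hx' := (convex_Icc (-R) R).ordConnected.uIcc_subset (m a ha) (m b hb) hx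
        have := lip _ _ d1 _ L (convex_Icc (-R) R) (fun x hx => (hL2 x hx).trans (by linarith)) x hx' b (m b hb)
        refine this.trans ?_
        have h5 : |x - b| ≤ |a - b| := by rw [uIcc_comm] at hx; exact abs_sub_left_of_mem_uIcc hx
        have : 0 ≤ L := pos!
        gcongr) a left_mem_uIcc b right_mem_uIcc
    rw [show L * (a - b) ^ 2 = L * |a - b| * |a - b| by rw [← sq_abs]; ring]
    refine le_trans (le_of_eq ?_) this; congr 1; ring

lemma locallyLipschitz_bound (hg : LocallyLipschitz (uncurry g)) (R : ℝ) :
    ∃ L : ℝ, 0 ≤ L ∧ ∀ a b c d, |a| ≤ R → |b| ≤ R → |c| ≤ R → |d| ≤ R →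
      |g a b - g c d| ≤ L * (|a - c| + |b - d|) := by
  obtain ⟨K, hK⟩ := (hg.locallyLipschitzOn (s := Icc (-R) R ×ˢ Icc (-R) R)).exists_lipschitzOnWith_of_compact
    (isCompact_Icc.prod isCompact_Icc)
  refine ⟨K, K.2, fun a b c d ha hb hc hd => ?_⟩
  have := hK.dist_le_mul (a, b) ⟨abs_le.1 ha, abs_le.1 hb⟩ (c, d) ⟨abs_le.1 hc, abs_le.1 hd⟩
  refine this.trans (scale_le ?_ K.2); rw [Prod.dist_eq, Real.dist_eq, Real.dist_eq]
  exact max_le (by linarith [abs_nonneg (b - d)]) (by linarith [abs_nonneg (a - c)])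

lemma eFlux_diag (hg : IsEFlux f g) (hc : C₂ g) (a : ℝ) : g a a = f a := by
  have hca := hc.comp (Continuous.prodMk_right a)
  have ht : ∀ s : Set ℝ, Filter.Tendsto (fun b => g a b) (nhdsWithin a s) (nhds (g a a)) := fun s =>
    hca.continuousAt.tendsto.mono_left nhdsWithin_le_nhds
  apply le_antisymm
  · refine le_of_tendsto (ht (Ioi a)) ?_; filter_upwards [self_mem_nhdsWithin] with b hb
    have := hg a b a left_mem_uIcc; rw [Real.sign_of_pos (sub_pos.2 hb)] at this; linarith
  · refine ge_of_tendsto (ht (Iio a)) ?_; filter_upwards [self_mem_nhdsWithin] with b hb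
    have := hg a b a left_mem_uIcc; rw [Real.sign_of_neg (sub_neg.2 hb)] at this; linarith

/-! ### The scheme on a line -/

/-- Sum over the cells of the integrals of a cellwise defined function. -/
def cellSum {N : ℕ} (F : Fin N → Fn) : ℝ := ∑ i, ∮ x N i, F i x

lemma cellSum_add {N : ℕ} {F G : Fin N → Fn} (hF : ∀ i, Continuous (F i)) (hG : ∀ i, Continuous (G i)) :
    cellSum (fun i x => F i x + G i x) = cellSum F + cellSum G := by
  rw [cellSum, cellSum, cellSum, ← sum_add_distrib]
  exact sum_congr rfl fun i _ => ii_add ((hF i).intervalIntegrable _ _) ((hG i).intervalIntegrable _ _)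

lemma cellSum_sub {N : ℕ} {F G : Fin N → Fn} (hF : ∀ i, Continuous (F i)) (hG : ∀ i, Continuous (G i)) :
    cellSum (fun i x => F i x - G i x) = cellSum F - cellSum G := by
  rw [cellSum, cellSum, cellSum, ← sum_sub_distrib]
  exact sum_congr rfl fun i _ => ii_sub ((hF i).intervalIntegrable _ _) ((hG i).intervalIntegrable _ _)

lemma cellSum_const_mul {N : ℕ} (c : ℝ) (F : Fin N → Fn) : cellSum (fun i x => c * F i x) = c * cellSum F := by
  rw [cellSum, cellSum, mul_sum]; exact sum_congr rfl fun i _ => ii_const_mul _ _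

lemma cellSum_const (c : ℝ) : cellSum (fun (_ : Fin N) _ => c) = 2 * π * c := by
  simp only [cellSum, ii_const, right_sub_left, Finset.sum_const,
    Finset.card_univ, Fintype.card_fin, smul_eq_mul, nsmul_eq_mul]
  rw [← step_mul N]; ring

lemma cellSum_le {F G : Fin N → Fn} (hF : ∀ i, Continuous (F i))
    (hG : ∀ i, Continuous (G i)) (h : ∀ i, ∀ x ∈ cell N i, F i x ≤ G i x) :
    cellSum F ≤ cellSum G :=
  sum_le_sum fun i _ => ii_mono (left_lt_right N i).le
    ((hF i).intervalIntegrable _ _) ((hG i).intervalIntegrable _ _) (h i)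

/-- The form of the scheme on a line. -/
def B1 (β θ : ℝ) (f : Fn) (g : Fn₂) (p v : Pw N) : ℝ :=
  cellSum (fun i x => (f ((p i).eval x) - (𝒟 (p i)).eval x) * (𝒟 (v i)).eval x)
    + ∑ i, totalFlux β θ g (pfun p) i * jump (pfun v) i
    - ∑ i, jump (pfun p) i * avg (pfun fun m => 𝒟 (v m)) i

lemma B1_eq (hf : Continuous f)
    (p v : Pw N) : B1 β θ f g p v = - A1 β θ p v + cellSum (fun i x => f ((p i).eval x) * (𝒟 (v i)).eval x)
      + ∑ i, g (traceL (pfun p) i) (traceR (pfun p) i) * jump (pfun v) i := by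
  have h1 : A1 β θ p v = cellSum (fun i x => (𝒟 (p i)).eval x * (𝒟 (v i)).eval x)
      + ∑ i, diffFlux β θ (pfun p) i * jump (pfun v) i
      + ∑ i, jump (pfun p) i * avg (pfun fun m => 𝒟 (v m)) i := rfl
  rw [B1, h1]; simp only [sub_mul, totalFlux, sum_sub_distrib]
  rw [cellSum_sub (fun i => by fun_prop) (fun i => by fun_prop)]; ring

lemma A1_sub (β θ : ℝ) (p q v : Pw N) : A1 β θ (fun i => p i - q i) v = A1 β θ p v - A1 β θ q v := by
  have h1 : ∀ p : Pw N, A1 β θ p v = cellSum (fun i x => (𝒟 (p i)).eval x * (𝒟 (v i)).eval x)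
      + ∑ i, diffFlux β θ (pfun p) i * jump (pfun v) i
      + ∑ i, jump (pfun p) i * avg (pfun fun m => 𝒟 (v m)) i := fun _ => rfl
  have h2 : ∀ i, jump (pfun fun i => p i - q i) i = jump (pfun p) i - jump (pfun q) i := by
    intro i; simp only [jump, traceL, traceR, pfun, eval_sub]; ring
  rw [h1, h1, h1]; simp only [diffFlux_sub, h2, sub_mul, sum_sub_distrib, derivative_sub, eval_sub]
  rw [cellSum_sub (fun i => by fun_prop) (fun i => by fun_prop)]; ring

lemma A1_add (β θ : ℝ) (p q v : Pw N) : A1 β θ (fun i => p i + q i) v = A1 β θ p v + A1 β θ q v := by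
  have := A1_sub β θ (fun i => p i + q i) q v; simp only [add_sub_cancel_right] at this; linarith

lemma line_identity (hf : C∞ f) (g : Fn₂) {U e : ℕ → Fn} {M M' : ℝ} (hU : Smooth1 m M U) (he : Smooth1 m M' e)
    {Z : Fin N → Fn} (hZ : ∀ i, Continuous (Z i)) {p ξ Om : Pw N} {κ : Fin N → ℝ}
    (hξ : ∀ i, (ξ i).natDegree ≤ k)
    (hOm : A1 β θ Om ξ = cellSum fun i x => Z i x * (𝒟 (ξ i)).eval x)
    (hp : ∀ i, p i = ξ i + pr N (fun x => U 0 x - e 0 x) (fun x => U 1 x - e 1 x) i - Om i - C (κ i)) :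
    B1 β θ f g p ξ - cellSum (fun i x => (U 2 x - deriv f (U 0 x) * U 1 x) * (ξ i).eval x) =
      - A1 β θ ξ ξ + A1 β θ (fun i => C (κ i)) ξ
      + cellSum (fun i x => (f ((p i).eval x) - f (U 0 x) + deriv f (U 0 x) * e 0 x + Z i x) * (𝒟 (ξ i)).eval x)
      + (∑ i, (g (traceL (pfun p) i) (traceR (pfun p) i) - f (U 0 (right N i))
          + deriv f (U 0 (right N i)) * e 0 (right N i)) * jump (pfun ξ) i)
      + cellSum (fun i x => (deriv (deriv f) (U 0 x) * U 1 x * e 0 x + deriv f (U 0 x) * e 1 x - e 2 x)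
          * (ξ i).eval x) := by
  have h1 := hf.drv; have h2 := h1.drv; have d0 := hf.hd; have d1 := h1.hd
  have cf := hf.continuous; have cf1 := h1.continuous; have cf2 := h2.continuous
  have cU0 := hU.continuous 0; have cU1 := hU.continuous 1; have cU2 := hU.continuous 2
  have ce0 := he.continuous 0; have ce1 := he.continuous 1; have ce2 := he.continuous 2
  set Pg := pr N (fun x => U 0 x - e 0 x) (fun x => U 1 x - e 1 x)
  have hA : A1 β θ p ξ = A1 β θ ξ ξ + A1 β θ Pg ξ - A1 β θ Om ξ - A1 β θ (fun i => C (κ i)) ξ := by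
    rw [← A1_add, ← A1_sub, ← A1_sub]; congr 1; funext i; exact hp i
  have hP : A1 β θ Pg ξ = - cellSum (fun i x => (U 2 x - e 2 x) * (ξ i).eval x) :=
    A1_proj (g := fun x => U 0 x - e 0 x) (g' := fun x => U 1 x - e 1 x) (g'' := fun x => U 2 x - e 2 x)
      (fun x => (hU.der 0 x).sub (he.der 0 x)) (fun x => (hU.der 1 x).sub (he.der 1 x))
      fp! (fun x => by simp only [hU.per, he.per])
      (isProj_pr fp! fun i => ((hU.der 0 _).sub (he.der 0 _)).deriv) ξ hξ
  have i1 : cellSum (fun i x => (deriv f (U 0 x) * U 1 x) * (ξ i).eval x) =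
      - (∑ i, f (U 0 (right N i)) * jump (pfun ξ) i)
      - cellSum fun i x => f (U 0 x) * (𝒟 (ξ i)).eval x :=
    sum_integral_parts_periodic (g := fun x => f (U 0 x)) (g' := fun x => deriv f (U 0 x) * U 1 x)
      (fun x => (d0 _).comp x (hU.der 0 x)) fp! (fun x => by simp only [hU.per]) ξ
  have i2 : cellSum (fun i x => (deriv (deriv f) (U 0 x) * U 1 x * e 0 x + deriv f (U 0 x) * e 1 x) * (ξ i).eval x) =
      - (∑ i, deriv f (U 0 (right N i)) * e 0 (right N i) * jump (pfun ξ) i)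
      - cellSum fun i x => deriv f (U 0 x) * e 0 x * (𝒟 (ξ i)).eval x :=
    sum_integral_parts_periodic (g := fun x => deriv f (U 0 x) * e 0 x)
      (fun x => ((d1 _).comp x (hU.der 0 x)).mul (he.der 0 x)) fp!
      (fun x => by simp only [hU.per, he.per]) ξ
  rw [B1_eq cf, hA, hP, hOm]; simp only [sub_mul, add_mul] at i1 i2 ⊢; simp only [sum_add_distrib, sum_sub_distrib]
  rw [cellSum_sub (F := fun i x => U 2 x * (ξ i).eval x)
      (G := fun i x => e 2 x * (ξ i).eval x) (fun i => by fun_prop) (fun i => by fun_prop),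
    cellSum_sub (F := fun i x => U 2 x * (ξ i).eval x)
      (G := fun i x => deriv f (U 0 x) * U 1 x * (ξ i).eval x) (fun i => by fun_prop) (fun i => by fun_prop),
    cellSum_add (F := fun i x => f ((p i).eval x) * (𝒟 (ξ i)).eval x
          - f (U 0 x) * (𝒟 (ξ i)).eval x + deriv f (U 0 x) * e 0 x * (𝒟 (ξ i)).eval x)
      (fun i => by fun_prop) (fun i => by have := hZ i; fun_prop),
    cellSum_add (F := fun i x => f ((p i).eval x) * (𝒟 (ξ i)).eval x - f (U 0 x) * (𝒟 (ξ i)).eval x)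
      (fun i => by fun_prop) (fun i => by fun_prop),
    cellSum_sub (F := fun i x => f ((p i).eval x) * (𝒟 (ξ i)).eval x) (fun i => by fun_prop) (fun i => by fun_prop),
    cellSum_sub (G := fun i x => e 2 x * (ξ i).eval x) (fun i => by fun_prop) (fun i => by fun_prop),
    i1, i2]
  ring

/-- The setting of the error estimate on a line. -/
structure LineData (N : ℕ) [NeZero N] (k : ℕ) (β θ M : ℝ) (f : Fn) (U e : ℕ → Fn)
    (Z : Fin N → Fn) (p ξ Om : Pw N) (κ : Fin N → ℝ) : Prop where
  smooth : Smooth1 (k + 2) M U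
  smooth_err : Smooth1 (k + 2) (M * step N ^ (k + 1)) e
  cont : ∀ i, Continuous (Z i)
  degree : ∀ i, (ξ i).natDegree ≤ k
  le_one : ∀ i, ∀ x ∈ cell N i, |(ξ i).eval x| ≤ 1
  form : A1 β θ Om ξ = cellSum fun i x => Z i x * (𝒟 (ξ i)).eval x
  om_le : ∀ i, ∀ x ∈ cell N i, |(Om i).eval x| ≤ M * step N ^ (k + 2)
  z_le : ∀ i, ∀ x ∈ cell N i,
    |deriv f (U 0 x) * (U 0 x - (pr N (U 0) (U 1) i).eval x) - Z i x| ≤ M * step N ^ (k + 2)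
  kappa_le : ∀ i, |κ i| ≤ M * step N ^ (k + 2)
  kappa_jump : ∀ i, |κ (i + 1) - κ i| ≤ M * step N ^ (k + 3)
  eq : ∀ i, p i = ξ i + pr N (fun x => U 0 x - e 0 x) (fun x => U 1 x - e 1 x) i - Om i - C (κ i)

lemma add_sq_le_two (a b : ℝ) : (a + b) ^ 2 ≤ 2 * a ^ 2 + 2 * b ^ 2 := by nlinarith [sq_nonneg (a - b)]

lemma abs_sub3 (a b c d : ℝ) : |a - b - c - d| ≤ |a| + |b| + |c| + |d| := by
  linarith [abs_sub (a - b - c) d, abs_sub (a - b) c, abs_sub a b]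

lemma left_mem (i : Fin N) : left N i ∈ cell N i := ⟨le_rfl, (left_lt_right N i).le⟩

lemma right_mem (i : Fin N) : right N i ∈ cell N i := ⟨(left_lt_right N i).le, le_rfl⟩

lemma step_pow_le {n k : ℕ} (hn : n ≤ k) : step N ^ n ≤ (2 * π + 1) ^ k := by
  have hs := step_pos N
  calc step N ^ n ≤ (2 * π + 1) ^ n := by
        gcongr; linarith [step_le N]
    _ ≤ (2 * π + 1) ^ k := pow_le_pow_right₀ (by linarith [pi_pos]) hn

lemma Smooth1.sub {M M' : ℝ} {U e : ℕ → Fn} (hU : Smooth1 m M U) (he : Smooth1 m M' e) :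
    Smooth1 m (M + M') (fun n x => U n x - e n x) where
  der n x := (hU.der n x).sub (he.der n x)
  per n x := by simp only [hU.per, he.per]
  bd n hn x := (abs_sub _ _).trans (add_le_add (hU.bd n hn x) (he.bd n hn x))

lemma line_cell_bound (hf : C∞ f) (M : ℝ) : ∃ L : ℝ, 0 < L ∧
    ∀ (N : ℕ) [NeZero N] (U e : ℕ → Fn) (Z : Fin N → Fn) (p ξ Om : Pw N)
      (κ : Fin N → ℝ), LineData N k β θ M f U e Z p ξ Om κ →
      ∀ i, ∀ x ∈ cell N i,
        |f ((p i).eval x) - f (U 0 x) + deriv f (U 0 x) * e 0 x + Z i x| ≤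
          L * (|(ξ i).eval x| + step N ^ (k + 2)) := by
  obtain ⟨B, hB, hb⟩ := pr_error
  by_cases hM : 0 ≤ M
  swap
  · refine ⟨1, one_pos, fun N _ U e Z p ξ Om κ h => ?_⟩; exact absurd h.smooth.nonneg hM
  set Q := (2 * π + 1) ^ (k + 2)
  have hQ0 : 0 < Q := by have := pi_pos; positivity
  set c := B * M + M + B * (M * Q) + 2 * M * Q with hc; have hc0 : 0 ≤ c := pos!
  obtain ⟨L, hL, l1, l2⟩ := smooth_flux_bounds hf (M + 1 + c * Q); have hcQ : 0 ≤ c * Q := pos!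
  refine ⟨L * (2 + 2 * c ^ 2 * Q) + L * (1 + B * M * Q + 2 * M) + M, pos!, ?_⟩
  intro N _ U e Z p ξ Om κ h i x hx; have hs := step_pos N; set η := step N
  have hηp : ∀ n ≤ k + 2, η ^ n ≤ Q := fun n hn => step_pow_le hn; obtain ⟨hbU, -, -, -⟩ := hb N U M h.smooth
  obtain ⟨hbe, -, -, -⟩ := hb N e _ h.smooth_err; have b1 := (hbU i x hx).1; have b2 := (hbe i x hx).1
  have hU0 := h.smooth.bd 0 om! x; have he0 := h.smooth_err.bd 0 om! x; have hξ := h.le_one i x hx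
  have hOm := h.om_le i x hx; have hκ := h.kappa_le i; have hZ : _ ≤ M * η ^ (k + 2) := h.z_le i x hx
  have ceq : (p i).eval x = (ξ i).eval x + ((pr N (U 0) (U 1) i).eval x
      - (pr N (e 0) (e 1) i).eval x) - (Om i).eval x - κ i := by
    rw [h.eq i, pr_sub (h.smooth.continuous 0) (h.smooth_err.continuous 0)]; simp
  set EU := U 0 x - (pr N (U 0) (U 1) i).eval x; set Ee := e 0 x - (pr N (e 0) (e 1) i).eval x
  set X := (ξ i).eval x; set O := (Om i).eval x; set q := (p i).eval x - U 0 x with hq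
  have hqe : q = X - EU - e 0 x + Ee - O - κ i := by rw [hq, ceq]; ring
  have t2 : M * η ^ (k + 2) ≤ M * Q * η ^ (k + 1) := by
    have hη1 : η ≤ Q := by simpa using hηp 1 om!
    calc M * η ^ (k + 2) = M * η * η ^ (k + 1) := by ring
      _ ≤ _ := by gcongr
  have t3 : B * (M * η ^ (k + 1)) * η ^ (k + 1) ≤ B * (M * Q) * η ^ (k + 1) := by have := hηp (k + 1) om!; gcongr
  have t4 : B * (M * η ^ (k + 1)) * η ^ (k + 1) ≤ B * M * Q * η ^ (k + 2) := by
    have h1 := hηp k om!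
    calc B * (M * η ^ (k + 1)) * η ^ (k + 1) = B * M * η ^ k * η ^ (k + 2) := by ring
      _ ≤ _ := by gcongr
  have hqb : |q| ≤ |X| + c * η ^ (k + 1) := by
    rw [hqe, hc]
    linarith [abs_sub3 (X - EU) (e 0 x - Ee) O (κ i), abs_sub X EU, abs_sub (e 0 x) Ee,
      congrArg abs (show X - EU - e 0 x + Ee - O - κ i = X - EU - (e 0 x - Ee) - O - κ i by ring)]
  have hpb : |(p i).eval x| ≤ M + 1 + c * Q := by
    have h1 : c * η ^ (k + 1) ≤ c * Q := by have := hηp (k + 1) om!; gcongr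
    linarith [abs_sub_abs_le_abs_sub ((p i).eval x) (U 0 x)]
  have hUb : |U 0 x| ≤ M + 1 + c * Q := by linarith
  have key := (l2 _ _ hpb hUb).2.2; have hf' := (l1 _ hUb).2.1; rw [← hq] at key
  have hq2 : q ^ 2 ≤ 2 * |X| + 2 * c ^ 2 * Q * η ^ (k + 2) := by
    have h1 : q ^ 2 ≤ (|X| + c * η ^ (k + 1)) ^ 2 := by rw [← sq_abs]; gcongr
    have h2 : |X| ^ 2 ≤ |X| := by rw [sq]; exact mul_le_of_le_one_left (abs_nonneg X) hξ
    have h3 : (c * η ^ (k + 1)) ^ 2 ≤ c ^ 2 * Q * η ^ (k + 2) := by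
      have := hηp k om!
      calc (c * η ^ (k + 1)) ^ 2 = c ^ 2 * η ^ k * η ^ (k + 2) := by ring
        _ ≤ _ := by gcongr
    have h4 := add_sq_le_two (|X|) (c * η ^ (k + 1)); linarith
  have split : f ((p i).eval x) - f (U 0 x) + deriv f (U 0 x) * e 0 x + Z i x =
      (f ((p i).eval x) - f (U 0 x) - deriv f (U 0 x) * q)
      + deriv f (U 0 x) * (X + Ee - O - κ i) - (deriv f (U 0 x) * EU - Z i x) := by
    rw [hqe]; ring
  rw [split]
  have m1 : |deriv f (U 0 x) * (X + Ee - O - κ i)| ≤ L * (|X| + (B * M * Q + 2 * M) * η ^ (k + 2)) := by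
    rw [abs_mul]; refine mul_le_mul hf' ?_ (abs_nonneg _) hL.le; have := abs_sub3 X (-Ee) O (κ i)
    rw [abs_neg, sub_neg_eq_add] at this; linarith
  have m2 : L * q ^ 2 ≤ L * (2 * |X| + 2 * c ^ 2 * Q * η ^ (k + 2)) := by gcongr
  refine ((abs_sub _ _).trans (add_le_add ((abs_add_le _ _).trans (add_le_add (key.trans m2) m1)) hZ)).trans ?_
  rw [← sub_nonneg]; ring_nf; positivity

lemma node_error : ∃ B : ℝ, 0 < B ∧ ∀ (N : ℕ) [NeZero N] (V : ℕ → Fn) (M : ℝ), Smooth1 (k + 2) M V → ∀ i,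
      |V 0 (right N i) - (pr N (V 0) (V 1) i).eval (right N i)| ≤ B * M * step N ^ (k + 2) ∧
      |V 0 (right N i) - (pr N (V 0) (V 1) (i + 1)).eval (left N (i + 1))| ≤ B * M * step N ^ (k + 2) := by
  obtain ⟨B, hB, hb⟩ := pr_error; refine ⟨B, hB, fun N _ V M hV i => ?_⟩; obtain ⟨-, -, h, -⟩ := hb N V M hV
  have h1 := h i 1 num! (primitive_legendre_one (by have := H.hk; omega))
  have h2 := h (i + 1) (-1) num! (primitive_neg_one _); rw [pt_one] at h1
  rw [pt_neg_one, periodic_left_succ (hV.per 0)] at h2; exact ⟨h1, h2⟩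

lemma line_node_bound (hf : C∞ f) (hg : LocallyLipschitz (uncurry g)) (hd : ∀ a, g a a = f a) (M : ℝ) :
    ∃ L : ℝ, 0 < L ∧
    ∀ (N : ℕ) [NeZero N] (U e : ℕ → Fn) (Z : Fin N → Fn) (p ξ Om : Pw N)
      (κ : Fin N → ℝ), LineData N k β θ M f U e Z p ξ Om κ →
      ∀ i, |g (traceL (pfun p) i) (traceR (pfun p) i) - f (U 0 (right N i))
          + deriv f (U 0 (right N i)) * e 0 (right N i)| ≤
        L * (|traceL (pfun ξ) i| + |traceR (pfun ξ) i| + step N ^ (k + 2)) := by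
  obtain ⟨B, hB, hb⟩ := node_error
  by_cases hM : 0 ≤ M
  swap
  · refine ⟨1, one_pos, fun N _ U e Z p ξ Om κ h => ?_⟩; exact absurd h.smooth.nonneg hM
  set Q := (2 * π + 1) ^ (k + 2)
  have hQ0 : 0 < Q := by have := pi_pos; positivity
  set c := B * (M + M * Q) + 2 * M with hc; have hc0 : 0 ≤ c := pos!; set R := M + M * Q + 1 + c * Q
  have hcQ : 0 ≤ c * Q := pos!; have hMQ : 0 ≤ M * Q := pos!
  obtain ⟨L, hL, l1, l2⟩ := smooth_flux_bounds hf R; obtain ⟨L', hL', l'⟩ := locallyLipschitz_bound hg R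
  refine ⟨L' * (1 + 2 * c) + L * M ^ 2 * Q + 1, pos!, ?_⟩; intro N _ U e Z p ξ Om κ h i; have hs := step_pos N
  set η := step N; have hηp : ∀ n ≤ k + 2, η ^ n ≤ Q := fun n hn => step_pow_le hn; set x := right N i with hx
  have hU0 := h.smooth.bd 0 om! x; have he0 := h.smooth_err.bd 0 om! x
  have heQ : |e 0 x| ≤ M * Q := he0.trans (by have := hηp (k + 1) om!; gcongr)
  have hk2 : 0 < η ^ (k + 2) := pos!; obtain ⟨hE1, hE2⟩ := hb N _ _ (h.smooth.sub h.smooth_err) i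
  have hEb : B * (M + M * η ^ (k + 1)) * η ^ (k + 2) ≤ B * (M + M * Q) * η ^ (k + 2) := by
    have := hηp (k + 1) om!; gcongr
  set v := U 0 x - e 0 x with hv; have heq := h.eq; set P := pr N (fun x => U 0 x - e 0 x) (fun x => U 1 x - e 1 x)
  have t : ∀ j, ∀ y ∈ cell N j, |v - (P j).eval y| ≤ B * (M + M * η ^ (k + 1)) * η ^ (k + 2) →
      |(p j).eval y - v| ≤ |(ξ j).eval y| + c * η ^ (k + 2) := by
    intro j y hy hE
    rw [show (p j).eval y - v = (ξ j).eval y - (v - (P j).eval y) - (Om j).eval y - κ j by rw [heq j]; simp; ring, hc]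
    linarith [abs_sub3 ((ξ j).eval y) (v - (P j).eval y) ((Om j).eval y) (κ j), h.om_le j y hy, h.kappa_le j]
  simp only [traceL, traceR, pfun]; have tl := t i x (right_mem i) hE1
  have tr := t (i + 1) _ (left_mem _) hE2; have hξl := h.le_one i _ (right_mem i)
  have hξr := h.le_one (i + 1) _ (left_mem (i + 1))
  rw [← hx] at *
  set xl := (ξ i).eval x; set xr := (ξ (i + 1)).eval (left N (i + 1)); set pl := (p i).eval x
  set pr := (p (i + 1)).eval (left N (i + 1)); have hvb : |v| ≤ M + M * Q := (abs_sub _ _).trans (add_le_add hU0 heQ)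
  have hcη : c * η ^ (k + 2) ≤ c * Q := by have := hηp (k + 2) le_rfl; gcongr
  have gb := l' pl pr v v (by linarith [abs_sub_abs_le_abs_sub pl v]) (by linarith [abs_sub_abs_le_abs_sub pr v])
    (by linarith) (by linarith)
  rw [hd] at gb; have fb := (l2 v (U 0 x) (by linarith) (by linarith)).2.2
  have e2 : v - U 0 x = - e 0 x := by rw [hv]; ring
  rw [e2] at fb
  have he2 : (- e 0 x) ^ 2 ≤ M ^ 2 * Q * η ^ (k + 2) := by
    rw [neg_sq, ← sq_abs]; have := hηp k om!
    calc |e 0 x| ^ 2 ≤ (M * η ^ (k + 1)) ^ 2 := by gcongr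
      _ = M ^ 2 * η ^ k * η ^ (k + 2) := by ring
      _ ≤ _ := by gcongr
  have m2 : L * (- e 0 x) ^ 2 ≤ L * (M ^ 2 * Q * η ^ (k + 2)) := by gcongr
  have m1 : L' * (|pl - v| + |pr - v|) ≤ L' * (|xl| + |xr| + 2 * c * η ^ (k + 2)) := scale_le (by linarith) hL'
  rw [show g pl pr - f (U 0 x) + deriv f (U 0 x) * e 0 x =
    (g pl pr - f v) + (f v - f (U 0 x) - deriv f (U 0 x) * (- e 0 x)) by ring]
  refine ((abs_add_le _ _).trans (add_le_add (gb.trans m1) (fb.trans m2))).trans ?_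
  rw [← sub_nonneg]; ring_nf; positivity

lemma young {ε : ℝ} (hε : 0 < ε) (a b : ℝ) : a * b ≤ ε * b ^ 2 + a ^ 2 / (4 * ε) := by
  have h : 0 ≤ (2 * ε * b - a) ^ 2 / (4 * ε) := pos!
  have e : (2 * ε * b - a) ^ 2 / (4 * ε) = ε * b ^ 2 + a ^ 2 / (4 * ε) - a * b := by field_simp; ring
  linarith

lemma cellSum_young {ε L η : ℝ} (hε : 0 < ε) {R : Fin N → Fn} (hR : ∀ i, Continuous (R i)) (ξ : Pw N)
    (h : ∀ i, ∀ x ∈ cell N i, |R i x| ≤ L * (|(ξ i).eval x| + η)) :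
    cellSum (fun i x => R i x * (𝒟 (ξ i)).eval x) ≤ ε * cellSum (fun i x => (𝒟 (ξ i)).eval x ^ 2)
      + L ^ 2 / (2 * ε) * (cellSum (fun i x => (ξ i).eval x ^ 2) + 2 * π * η ^ 2) := by
  have e : ε * cellSum (fun i x => (𝒟 (ξ i)).eval x ^ 2)
      + L ^ 2 / (2 * ε) * (cellSum (fun i x => (ξ i).eval x ^ 2) + 2 * π * η ^ 2) =
      cellSum (fun i x => ε * (𝒟 (ξ i)).eval x ^ 2 + L ^ 2 / (2 * ε) * ((ξ i).eval x ^ 2 + η ^ 2)) := by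
    rw [cellSum_add (fun i => by fun_prop) (fun i => by fun_prop), cellSum_const_mul,
      cellSum_const_mul, cellSum_add (fun i => by fun_prop) (fun i => by fun_prop), cellSum_const]
  rw [e]; refine cellSum_le (fun i => by have := hR i; fun_prop) (fun i => by fun_prop) fun i x hx => ?_
  have h1 := young hε (R i x) ((𝒟 (ξ i)).eval x)
  have h2 : R i x ^ 2 ≤ (L * (|(ξ i).eval x| + η)) ^ 2 := by
    rw [← sq_abs]; exact pow_le_pow_left₀ (abs_nonneg _) (h i x hx) 2
  have h3 := add_sq_le_two |(ξ i).eval x| η; rw [sq_abs] at h3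
  have h4 : R i x ^ 2 / (4 * ε) ≤ L ^ 2 / (2 * ε) * ((ξ i).eval x ^ 2 + η ^ 2) := by
    calc R i x ^ 2 / (4 * ε) ≤ (L ^ 2 * (2 * (ξ i).eval x ^ 2 + 2 * η ^ 2)) / (4 * ε) := by
          gcongr; refine h2.trans ?_; rw [mul_pow]; gcongr
      _ = _ := by field_simp; ring
  linarith

lemma trace_inverse (k : ℕ) : ∃ B : ℝ, 0 < B ∧ ∀ (N : ℕ) [NeZero N] (ξ : Pw N), (∀ i, (ξ i).natDegree ≤ k) →
      ∑ i, step N * (traceL (pfun ξ) i ^ 2 + traceR (pfun ξ) i ^ 2) ≤ B * cellSum fun i x => (ξ i).eval x ^ 2 := by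
  obtain ⟨B, hB, hb⟩ := cell_inverse k; refine ⟨2 * B, pos!, fun N _ ξ hξ => ?_⟩; simp only [mul_add, sum_add_distrib]
  have h1 : ∑ i, step N * traceL (pfun ξ) i ^ 2 ≤ B * cellSum fun i x => (ξ i).eval x ^ 2 := by
    rw [cellSum, mul_sum]; exact sum_le_sum fun i _ => hb N i (ξ i) (hξ i) _ (right_mem i)
  have h2 : ∑ i, step N * traceR (pfun ξ) i ^ 2 ≤ B * cellSum fun i x => (ξ i).eval x ^ 2 := by
    rw [cellSum, mul_sum, ← sum_succ (fun i => B * ∮ x N i, (ξ i).eval x ^ 2)]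
    exact sum_le_sum fun i _ => hb N (i + 1) (ξ (i + 1)) (hξ _) _ (left_mem _)
  linarith

lemma sum_step (N : ℕ) [NeZero N] (c : ℝ) : ∑ _i : Fin N, step N * c = 2 * π * c := by
  rw [Finset.sum_const, Finset.card_univ, Fintype.card_fin, nsmul_eq_mul, ← step_mul N]; ring

lemma node_young {ε L η : ℝ} (hε : 0 < ε) (a b S J : Fin N → ℝ) (h : ∀ i, |S i| ≤ L * (|a i| + |b i| + η)) :
    ∑ i, S i * J i ≤ ε * ∑ i, J i ^ 2 / step N
      + 3 * L ^ 2 / (4 * ε) * (∑ i, step N * (a i ^ 2 + b i ^ 2) + 2 * π * η ^ 2) := by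
  have hs := step_pos N; rw [← sum_step N (η ^ 2), ← sum_add_distrib, mul_sum, mul_sum, ← sum_add_distrib]
  refine sum_le_sum fun i _ => ?_; have h1 := young (ε := ε / step N) pos! (S i) (J i)
  have h2 : S i ^ 2 ≤ (L * (|a i| + |b i| + η)) ^ 2 := by rw [← sq_abs]; exact pow_le_pow_left₀ (abs_nonneg _) (h i) 2
  have h3 : (|a i| + |b i| + η) ^ 2 ≤ 3 * (a i ^ 2 + b i ^ 2 + η ^ 2) := by
    rw [← sq_abs (a i), ← sq_abs (b i)]
    nlinarith [sq_nonneg (|a i| - |b i|), sq_nonneg (|a i| - η), sq_nonneg (|b i| - η)]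
  have h4 : S i ^ 2 / (4 * (ε / step N)) ≤ 3 * L ^ 2 / (4 * ε) * (step N * (a i ^ 2 + b i ^ 2) + step N * η ^ 2) := by
    calc S i ^ 2 / (4 * (ε / step N)) ≤
        (L ^ 2 * (3 * (a i ^ 2 + b i ^ 2 + η ^ 2))) / (4 * (ε / step N)) := by
          gcongr; refine h2.trans ?_; rw [mul_pow]; gcongr
      _ = _ := by field_simp
  have e : ε / step N * J i ^ 2 = ε * (J i ^ 2 / step N) := by ring
  linarith

lemma kappa_form (β θ : ℝ) (κ : Fin N → ℝ) (ξ : Pw N) :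
    A1 β θ (fun i => C (κ i)) ξ = (∑ i, β * ((κ (i + 1) - κ i) / step N) * jump (pfun ξ) i)
      + ∑ i, (κ (i + 1) - κ i) * avg (pfun fun m => 𝒟 (ξ m)) i := by
  rw [A1]
  have h : ∀ i, diffFlux β θ (pfun fun i => C (κ i)) i = β * ((κ (i + 1) - κ i) / step N) := by
    intro i; rw [diffFlux_pfun]; simp [jump, avg, traceL, traceR, pfun]; ring
  simp only [h, derivative_C, eval_zero, zero_mul, intervalIntegral.integral_zero, Finset.sum_const_zero, zero_add]
  congr 1; refine sum_congr rfl fun i _ => ?_; simp [jump, traceL, traceR, pfun]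

lemma kappa_bound {ε : ℝ} (hε : 0 < ε) : ∃ K : ℝ, 0 < K ∧
    ∀ (N : ℕ) [NeZero N] (κ : Fin N → ℝ) (ξ : Pw N) (η : ℝ), 0 ≤ η →
      (∀ i, |κ (i + 1) - κ i| ≤ η * step N) → (∀ i, (ξ i).natDegree ≤ k) →
      A1 β θ (fun i => C (κ i)) ξ ≤ ε * D1 ξ + K * η ^ 2 := by
  obtain ⟨B, hB, hb⟩ := trace_inverse k; have hpi := pi_pos
  refine ⟨3 * β ^ 2 / (4 * ε) * (2 * π) + 2 * π / (4 * (ε / B)), pos!, ?_⟩; intro N _ κ ξ η hη hκ hξ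
  have hs := step_pos N; rw [kappa_form]
  have h1 := node_young (N := N) (L := |β|) (η := η) hε 0 0
    (fun i => β * ((κ (i + 1) - κ i) / step N)) (jump (pfun ξ)) (by
      intro i; rw [abs_mul, abs_div, abs_of_pos hs]; simp only [Pi.zero_apply, abs_zero, zero_add]; gcongr
      rw [div_le_iff₀ hs]; exact hκ i)
  have h3 := hb N (fun m => 𝒟 (ξ m)) fun i => (natDegree_derivative_le _).trans ((Nat.sub_le _ _).trans (hξ i))
  set d := pfun fun m => 𝒟 (ξ m)
  have h4 : ∑ i, (κ (i + 1) - κ i) * avg d i ≤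
      ∑ i, (ε / B * (step N * (traceL d i ^ 2 + traceR d i ^ 2)) + step N * (η ^ 2 / (4 * (ε / B)))) := by
    refine sum_le_sum fun i _ => ?_; have y := young (ε := ε / B * step N) pos! (κ (i + 1) - κ i) (avg d i)
    have y2 : (κ (i + 1) - κ i) ^ 2 / (4 * (ε / B * step N)) ≤ step N * (η ^ 2 / (4 * (ε / B))) := by
      calc _ ≤ (η * step N) ^ 2 / (4 * (ε / B * step N)) := by
            rw [← sq_abs]; gcongr; exact hκ i
        _ = _ := by field_simp
    have y3 : avg d i ^ 2 ≤ traceL d i ^ 2 + traceR d i ^ 2 := by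
      rw [avg]; nlinarith [sq_nonneg (traceL d i - traceR d i)]
    have y4 := scale_le y3 (pos! : 0 ≤ ε / B * step N); linarith
  rw [sum_add_distrib, ← mul_sum, sum_step] at h4; have h5 := scale_le h3 (pos! : 0 ≤ ε / B)
  rw [← mul_assoc, div_mul_cancel₀ _ hB.ne'] at h5
  simp only [Pi.zero_apply, ne_eq, OfNat.ofNat_ne_zero, not_false_eq_true, zero_pow, add_zero,
    mul_zero, Finset.sum_const_zero, zero_add, sq_abs] at h1
  change _ ≤ ε * ((cellSum fun i x => (𝒟 (ξ i)).eval x ^ 2) + ∑ i, jump (pfun ξ) i ^ 2 / step N) + _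
  have e2 : 2 * π * (η ^ 2 / (4 * (ε / B))) = 2 * π / (4 * (ε / B)) * η ^ 2 := by ring
  linarith

lemma line_estimate (hf : C∞ f) (hg : LocallyLipschitz (uncurry g)) (hd : ∀ a, g a a = f a) (M : ℝ) :
    ∃ c K : ℝ, 0 < c ∧ 0 < K ∧
    ∀ (N : ℕ) [NeZero N] (U e : ℕ → Fn) (Z : Fin N → Fn) (p ξ Om : Pw N)
      (κ : Fin N → ℝ), LineData N k β θ M f U e Z p ξ Om κ →
    B1 β θ f g p ξ - cellSum (fun i x => (U 2 x - deriv f (U 0 x) * U 1 x) * (ξ i).eval x) ≤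
      - c * (cellSum fun i x => (𝒟 (ξ i)).eval x ^ 2)
      + K * ((cellSum fun i x => (ξ i).eval x ^ 2) + step N ^ (2 * k + 4))
      + cellSum (fun i x => (deriv (deriv f) (U 0 x) * U 1 x * e 0 x + deriv f (U 0 x) * e 1 x - e 2 x)
          * (ξ i).eval x) := by
  obtain ⟨γ, hγ, hc⟩ := A1_coercive; obtain ⟨L1, hL1, hR⟩ := line_cell_bound hf M
  obtain ⟨L2, hL2, hS⟩ := line_node_bound hf hg hd M; obtain ⟨B, hB, hb⟩ := trace_inverse k
  set ε := γ / 4 with hε; have hε0 : 0 < ε := pos!; obtain ⟨K, hK, hκ⟩ := kappa_bound hε0; have hpi := pi_pos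
  set K1 := L1 ^ 2 / (2 * ε) with hK1; set K2 := 3 * L2 ^ 2 / (4 * ε) with hK2; have hK10 : 0 < K1 := pos!
  have hK20 : 0 < K2 := pos!; refine ⟨γ / 4, K1 * (1 + 2 * π) + K2 * (B + 2 * π) + K * M ^ 2, pos!, pos!, ?_⟩
  intro N _ U e Z p ξ Om κ h; have hs := step_pos N
  rw [line_identity hf g h.smooth h.smooth_err h.cont h.degree h.form h.eq]; have cf := hf.continuous
  have cf1 := hf.drv.continuous; have cU := h.smooth.continuous 0; have ce := h.smooth_err.continuous 0
  have r1 := cellSum_young (η := step N ^ (k + 2)) hε0 (R := fun i x =>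
    f ((p i).eval x) - f (U 0 x) + deriv f (U 0 x) * e 0 x + Z i x)
    (fun i => by have := h.cont i; fun_prop) ξ (hR N U e Z p ξ Om κ h)
  have r2 := node_young (η := step N ^ (k + 2)) hε0 (traceL (pfun ξ)) (traceR (pfun ξ)) _
    (jump (pfun ξ)) (hS N U e Z p ξ Om κ h)
  have r3 := hκ N κ ξ (M * step N ^ (k + 2)) (mul_nonneg h.smooth.nonneg pos!)
    (fun i => (h.kappa_jump i).trans (le_of_eq (by ring))) h.degree
  have r4 := hb N ξ h.degree; have r5 := hc N ξ h.degree
  have e3 : D1 ξ = (cellSum fun i x => (𝒟 (ξ i)).eval x ^ 2) + ∑ i, jump (pfun ξ) i ^ 2 / step N := rfl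
  rw [← hK1] at r1; rw [← hK2] at r2; rw [e3] at r3 r5; have r6 := scale_le r4 hK20.le
  have ep : (step N ^ (k + 2)) ^ 2 = step N ^ (2 * k + 4) := by rw [← pow_mul]; congr 1; ring
  rw [ep] at r1 r2; rw [mul_pow, ep] at r3; set X0 := cellSum fun i x => (ξ i).eval x ^ 2
  set X1 := cellSum fun i x => (𝒟 (ξ i)).eval x ^ 2; set J := ∑ i, jump (pfun ξ) i ^ 2 / step N
  set H := step N ^ (2 * k + 4); have hJ0 : 0 ≤ J := sum_nonneg fun i _ => pos!; have hH0 : 0 < H := pos!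
  have hX0 : 0 ≤ X0 := sum_nonneg fun i _ => ii_nonneg (left_lt_right N i).le fun x _ => sq_nonneg _
  have n6 : 0 ≤ γ * J := pos!
  have n7 : 0 ≤ γ * X1 := mul_nonneg hγ.le (sum_nonneg fun i _ =>
    ii_nonneg (left_lt_right N i).le fun x _ => sq_nonneg _)
  rw [hε] at r1 r2 r3
  have key : K1 * (X0 + 2 * π * H) + (K2 * (B * X0) + K2 * (2 * π * H)) + K * (M ^ 2 * H) ≤
      (K1 * (1 + 2 * π) + K2 * (B + 2 * π) + K * M ^ 2) * (X0 + H) := by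
    rw [← sub_nonneg]; ring_nf; positivity
  linarith

/-! ### Smooth periodic functions of two variables -/

/-- A smooth doubly periodic function with its derivatives `U a b = ∂ₓᵃ ∂ᵧᵇ U`, bounded by `M` for
`a, b ≤ m`. -/
structure Smooth2 (m : ℕ) (M : ℝ) (U : Jet) : Prop where
  dx : ∀ a b x y, HasDerivAt (fun x => U a b x y) (U (a + 1) b x y) x
  dy : ∀ a b x y, HasDerivAt (fun y => U a b x y) (U a (b + 1) x y) y
  px : ∀ a b x y, U a b (x + 2 * π) y = U a b x y
  py : ∀ a b x y, U a b x (y + 2 * π) = U a b x y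
  cont : ∀ a b, C₂ (U a b)
  bdd : ∀ a b, ∃ K, ∀ x y, |U a b x y| ≤ K
  bd : ∀ a ≤ m, ∀ b ≤ m, ∀ x y, |U a b x y| ≤ M

/-- Interchange of the variables. -/
def swapU (U : Jet) : Jet := fun a b x y => U b a y x

section
variable {m : ℕ} {U : Jet} (hU : Smooth2 m M U)
include hU

lemma Smooth2.swap : Smooth2 m M (swapU U) where
  dx a b x y := hU.dy b a y x
  dy a b x y := hU.dx b a y x
  px a b x y := hU.py b a y x
  py a b x y := hU.px b a y x
  cont a b := (hU.cont b a).comp continuous_swap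
  bdd a b := (hU.bdd b a).imp fun _ h x y => h y x
  bd a ha b hb x y := hU.bd b hb a ha y x

lemma Smooth2.nonneg : 0 ≤ M := (abs_nonneg _).trans (hU.bd 0 (Nat.zero_le _) 0 (Nat.zero_le _) 0 0)

lemma Smooth2.cx (a b : ℕ) (y : ℝ) : Continuous fun x => U a b x y := (hU.cont a b).comp (Continuous.prodMk_left y)

lemma Smooth2.cy (a b : ℕ) (x : ℝ) : Continuous fun y => U a b x y := (hU.cont a b).comp (Continuous.prodMk_right x)

lemma Smooth2.smooth1 {b : ℕ} (hb : b ≤ m) (y : ℝ) : Smooth1 m M fun n x => U n b x y where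
  der n x := hU.dx n b x y
  per n x := hU.px n b x y
  bd n hn x := hU.bd n hn b hb x y

lemma Smooth2.lip_x {a b : ℕ} (ha : a < m) (hb : b ≤ m) (x x' y : ℝ) :
    |U a b x y - U a b x' y| ≤ M * |x - x'| :=
  convex_univ.norm_image_sub_le_of_norm_hasDerivWithin_le (fun z _ => (hU.dx a b z y).hasDerivWithinAt)
    (fun z _ => hU.bd (a + 1) ha b hb z y) (mem_univ _) (mem_univ _)

end

/-- The midpoint of a cell. -/
def mid (N : ℕ) (i : Fin N) : ℝ := (left N i + right N i) / 2

lemma mid_mem (i : Fin N) : mid N i ∈ cell N i := by have := left_lt_right N i; constructor <;> rw [mid] <;> linarith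

lemma abs_sub_le_step {i : Fin N} {x x' : ℝ} (hx : x ∈ cell N i) (hx' : x' ∈ cell N i) : |x - x'| ≤ step N := by
  rw [← right_sub_left N i, abs_le]; constructor <;> linarith [hx.1, hx.2, hx'.1, hx'.2]

/-! ### The projection error in the first variable -/

/-- The projection error in the first variable of the `b`-th derivative in the second variable. -/
def prErr (U : Jet) (b : ℕ) (i : Fin N) (x y : ℝ) : ℝ :=
  U 0 b x y - (pr N (fun x => U 0 b x y) (fun x => U 1 b x y) i).eval x

lemma eval_eq_sum_coeff {p : ℝ[X]} (hp : p.natDegree ≤ k) (x : ℝ) :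
    p.eval x = ∑ a : Fin (k + 1), p.coeff a * x ^ (a : ℕ) := by
  rw [eval_eq_sum_range' (Nat.lt_succ_of_le hp) x, Fin.sum_univ_eq_sum_range (fun a => p.coeff a * x ^ a)]

lemma natDegree_pr_le (v v' : Fn) (i : Fin N) : (pr N v v' i).natDegree ≤ k := natDegree_sol_le _ _

lemma hasDerivAt_pr_param {U : Jet} (hU : Smooth2 m M U) (L : ℝ[X] →ₗ[ℝ] ℝ) (b : ℕ) (i : Fin N) (y : ℝ) :
    HasDerivAt (fun y => L (pr N (fun x => U 0 b x y) (fun x => U 1 b x y) i))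
      (L (pr N (fun x => U 0 (b + 1) x y) (fun x => U 1 (b + 1) x y) i)) y := by
  obtain ⟨K, hK⟩ := hU.bdd 0 (b + 1)
  exact hasDerivAt_linear (solEval N L i)
    (hasDerivAt_projData (s := univ) Filter.univ_mem (fun y _ x => hU.dy 0 b x y)
      (fun y _ x => hU.dy 1 b x y) (fun y _ => hU.cx 0 b y) (fun y _ => hU.cx 0 (b + 1) y)
      (fun y _ x => hK x y))

section
variable {m : ℕ} {U : Jet}
  (hU : Smooth2 m M U)
include hU

lemma hasDerivAt_prErr (b : ℕ) (i : Fin N) (x y : ℝ) :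
    HasDerivAt (fun y => prErr U b i x y) (prErr U (b + 1) i x y) y :=
  (hU.dy 0 b x y).sub (hasDerivAt_pr_param hU (leval x) b i y)

lemma prErr_periodic (b : ℕ) (i : Fin N) (x y : ℝ) : prErr U b i x (y + 2 * π) = prErr U b i x y := by
  simp only [prErr, hU.py]

lemma continuous_prErr (b : ℕ) (i : Fin N) : C₂ (prErr U b i) := by
  have h : ∀ z : ℝ × ℝ, uncurry (prErr U b i) z = U 0 b z.1 z.2 -
      ∑ a : Fin (k + 1), lcoeff ℝ a (pr N (fun x => U 0 b x z.2) (fun x => U 1 b x z.2) i) * z.1 ^ (a : ℕ) := by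
    intro z; simp only [uncurry, prErr, lcoeff_apply]; rw [← eval_eq_sum_coeff (natDegree_pr_le _ _ i)]
  rw [funext h]
  have h1 : ∀ a : Fin (k + 1), Continuous fun y =>
      lcoeff ℝ (a : ℕ) (pr N (fun x => U 0 b x y) (fun x => U 1 b x y) i) := fun a =>
    continuous_iff_continuousAt.2 fun y => (hasDerivAt_pr_param hU _ b i y).continuousAt
  refine (hU.cont 0 b).sub (continuous_finsetSum _ fun a _ => ?_); exact ((h1 a).comp continuous_snd).mul fp!

lemma continuous_prErr_left (b : ℕ) (i : Fin N) (y : ℝ) : Continuous fun x => prErr U b i x y :=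
  (continuous_prErr hU b i).comp (Continuous.prodMk_left y)

end

lemma integral_prErr {U : Jet} (hU : Smooth2 m M U) (b : ℕ) (i : Fin N) (y : ℝ) : ∮ x N i, prErr U b i x y = 0 :=
  pr_integral_err (fun x => hU.dx 0 b x y) i

/-- For `x` in a fixed cell, the projection error is a smooth function of the second variable. -/
lemma smooth1_prErr : ∃ B : ℝ, 0 < B ∧ ∀ (N : ℕ) [NeZero N] (U : Jet) (M : ℝ),
    Smooth2 (k + 2) M U → ∀ i, ∀ x ∈ cell N i,
      Smooth1 (k + 2) (B * M * step N ^ (k + 1)) fun n y => prErr U n i x y := by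
  obtain ⟨B, hB, hb⟩ := pr_error
  refine ⟨B, hB, fun N _ U M hU i x hx => ⟨fun n y => hasDerivAt_prErr hU n i x y,
    fun n y => prErr_periodic hU n i x y, fun n hn y => ?_⟩⟩
  exact ((hb N _ M (hU.smooth1 hn y)).1 i x hx).1

/-- The density defining the correction in the first variable. -/
def zfun (f : Fn) (U : Jet) (i : Fin N) (x y : ℝ) : ℝ := deriv f (U 0 0 (mid N i) y) * prErr U 0 i x y

/-- The correction in the first variable at the height `y`. -/
def corX (N : ℕ) [NeZero N] (f : Fn) (U : Jet) (y : ℝ) : Pw N := corr N fun i x => zfun f U i x y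

lemma periodic_mid_succ {g : Fn} (hg : ∀ x, g (x + 2 * π) = g x)
    (i : Fin N) : g (mid N (i + 1)) = g (mid N i + step N) := by
  have h1 : ∀ i : Fin N, mid N i = left N i + step N / 2 := by intro i; rw [← right_sub_left N i, mid]; ring
  have h2 := periodic_left_succ (N := N) (g := fun x => g (x + step N / 2))
    (fun x => by rw [show x + 2 * π + step N / 2 = x + step N / 2 + 2 * π by ring, hg]) i
  rw [h1, h1, h2, show right N i = left N i + step N by rw [← right_sub_left N i]; ring]; congr 1; ring

lemma zfun_bound (hf : C∞ f) (M : ℝ) : ∃ K : ℝ, 0 < K ∧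
    ∀ (N : ℕ) [NeZero N] (U : Jet), Smooth2 (k + 2) M U → ∀ i, ∀ x ∈ cell N i, ∀ y,
        |zfun f U i x y| ≤ K * step N ^ (k + 1) ∧
        (∀ y', |zfun f U i x y - zfun f U i x y'| ≤ K * step N ^ (k + 1) * |y - y'|) ∧
        |deriv f (U 0 0 x y) * prErr U 0 i x y - zfun f U i x y| ≤ K * step N ^ (k + 2) := by
  obtain ⟨B, hB, hb⟩ := smooth1_prErr; obtain ⟨L, hL, l1, l2⟩ := smooth_flux_bounds hf M
  by_cases hM : 0 ≤ M
  swap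
  · exact ⟨1, one_pos, fun N _ U hU => absurd hU.nonneg hM⟩
  refine ⟨L * (B * M) + L * M * (B * M) + 1, pos!, ?_⟩; intro N _ U hU i x hx y; have hs := step_pos N
  have hE := hb N U M hU i x hx; set c := step N ^ (k + 1); have hc0 : 0 < c := pos!
  have bu : ∀ x y, |U 0 0 x y| ≤ M := hU.bd 0 om! 0 om!; have E0 : ∀ y, |prErr U 0 i x y| ≤ B * M * c := hE.bd 0 om!
  have E1 : ∀ y, |prErr U 1 i x y| ≤ B * M * c := hE.bd 1 om!; have d1 := hf.drv.hd
  have n1 : 0 ≤ L * (B * M) * c := pos!; have n2 : 0 ≤ L * M * (B * M) * c := pos!; refine ⟨?_, fun y' => ?_, ?_⟩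
  · rw [zfun, abs_mul]; have := mul_le_mul (l1 _ (bu (mid N i) y)).2.1 (E0 y) (abs_nonneg _) hL.le; linarith
  · have hder : ∀ y, HasDerivAt (fun y => zfun f U i x y)
        (deriv (deriv f) (U 0 0 (mid N i) y) * U 0 1 (mid N i) y * prErr U 0 i x y
          + deriv f (U 0 0 (mid N i) y) * prErr U 1 i x y) y := fun y =>
      ((d1 _).comp y (hU.dy 0 0 (mid N i) y)).mul (hasDerivAt_prErr hU 0 i x y)
    refine convex_univ.norm_image_sub_le_of_norm_hasDerivWithin_le
      (fun z _ => (hder z).hasDerivWithinAt) (fun z _ => ?_) (mem_univ _) (mem_univ _)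
    refine (norm_add_le _ _).trans ?_; rw [norm_mul, norm_mul, norm_mul]
    have a1 : |deriv (deriv f) (U 0 0 (mid N i) z)| * |U 0 1 (mid N i) z| *
        |prErr U 0 i x z| ≤ L * M * (B * M * c) := by
      have := (l1 _ (bu (mid N i) z)).2.2.1; have := hU.bd 0 om! 1 om! (mid N i) z; have := E0 z; gcongr
    have a2 := mul_le_mul (l1 _ (bu (mid N i) z)).2.1 (E1 z) (abs_nonneg _) hL.le; simp only [norm_eq_abs]; linarith
  · rw [zfun, ← sub_mul, abs_mul]; have a1 := (l2 _ _ (bu x y) (bu (mid N i) y)).2.1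
    have a2 := hU.lip_x (a := 0) (b := 0) om! om! x (mid N i) y; have a3 := abs_sub_le_step hx (mid_mem i)
    have a4 : |deriv f (U 0 0 x y) - deriv f (U 0 0 (mid N i) y)| ≤ L * (M * step N) :=
      a1.trans (by gcongr; exact a2.trans (by gcongr))
    have a5 := mul_le_mul a4 (E0 y) (abs_nonneg _) pos!
    have e : step N ^ (k + 2) = c * step N := pow_succ _ _; rw [e]
    have n3 : 0 ≤ (L * (B * M) + 1) * c * step N := pos!; linarith

lemma corX_bound (hf : C∞ f) (M : ℝ) : ∃ K : ℝ, 0 < K ∧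
    ∀ (N : ℕ) [NeZero N] (U : Jet), Smooth2 (k + 2) M U → ∀ i, ∀ x ∈ cell N i, ∀ y,
        |(corX N f U y i).eval x| ≤ K * step N ^ (k + 2) ∧
        |(𝒟 (corX N f U y i)).eval x| ≤ K * step N ^ (k + 1) ∧
        (∀ y', |(corX N f U y i).eval x - (corX N f U y' i).eval x| ≤ K * step N ^ (k + 2) * |y - y'|) := by
  obtain ⟨B, hB, hb⟩ := corr_bound; obtain ⟨K, hK, hz⟩ := zfun_bound hf M; refine ⟨B * K, pos!, ?_⟩
  intro N _ U hU i x hx y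
  have hc : ∀ y (i : Fin N), Continuous fun x => zfun f U i x y := fun y i =>
    continuous_const.mul (continuous_prErr_left hU 0 i y)
  obtain ⟨h1, h2⟩ := hb N (fun i x => zfun f U i x y) (K * step N ^ (k + 1))
    (fun i x hx => (hz N U hU i x hx y).1) i x hx
  refine ⟨h1.trans (le_of_eq (by ring)), h2.trans (le_of_eq (by ring)), fun y' => ?_⟩
  rw [← eval_sub, corX, corX, corr_sub (hc y) (hc y')]
  refine (hb N _ (K * step N ^ (k + 1) * |y - y'|)
    (fun i x hx => (hz N U hU i x hx y).2.1 y') i x hx).1.trans (le_of_eq (by ring))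

/-! ### Polynomials in two variables -/

/-- The polynomial in `x` obtained by fixing `y`. -/
def polyX (c : Coef k) (y : ℝ) : ℝ[X] := ∑ a : Fin (k + 1), C (∑ b : Fin (k + 1), c a b * y ^ (b : ℕ)) * X ^ (a : ℕ)

lemma polyX_eval (c : Coef k) (x y : ℝ) : (polyX c y).eval x = val c x y := by
  simp only [polyX, val, eval_finsetSum, eval_mul, eval_C, eval_pow, eval_X, sum_mul]
  exact sum_congr rfl fun a _ => sum_congr rfl fun b _ => by ring

lemma natDegree_polyX_le (c : Coef k) (y : ℝ) : (polyX c y).natDegree ≤ k :=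
  natDegree_sum_le_of_forall_le _ _ fun a _ => (natDegree_C_mul_X_pow_le _ _).trans (Nat.lt_succ_iff.1 a.2)

lemma polyX_sub (c d : Coef k) (y : ℝ) : polyX (c - d) y = polyX c y - polyX d y := by
  simp only [polyX, Pi.sub_apply, sub_mul, sum_sub_distrib, C_sub]

/-- Interchange of the variables of a polynomial. -/
def swapC (c : Coef k) : Coef k := fun a b => c b a

lemma val_swapC (c : Coef k) (x y : ℝ) : val (swapC c) x y = val c y x := by
  simp only [val, swapC]; rw [sum_comm]
  exact sum_congr rfl fun a _ => sum_congr rfl fun b _ => by ring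

/-- Interchange of the variables of a discrete function. -/
def swapV (w : Vh Nx Ny k) : Vh Ny Nx k := fun j i => swapC (w i j)

/-- A polynomial in `x` as a polynomial in `x` and `y`. -/
def ofX (k : ℕ) (p : ℝ[X]) : Coef k := fun a b => if b = 0 then p.coeff a else 0

lemma val_ofX {p : ℝ[X]} (hp : p.natDegree ≤ k) (x y : ℝ) : val (ofX k p) x y = p.eval x := by
  rw [eval_eq_sum_coeff hp, val]; refine sum_congr rfl fun a _ => ?_; rw [sum_eq_single 0]
  · simp [ofX]
  · intro b _ hb; simp [ofX, hb]
  · simp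

lemma polyX_ofX {p : ℝ[X]} (hp : p.natDegree ≤ k) (y : ℝ) : polyX (ofX k p) y = p :=
  Polynomial.funext fun x => by rw [polyX_eval, val_ofX hp]

lemma polyX_swapC_ofX {p : ℝ[X]} (hp : p.natDegree ≤ k) (y : ℝ) : polyX (swapC (ofX k p)) y = C (p.eval y) :=
  Polynomial.funext fun x => by rw [polyX_eval, val_swapC, val_ofX hp, eval_C]

/-! ### The tensor product projection -/

lemma projData_linear {N n m : ℕ} [NeZero N] (L : (Fin n → Fin m → ℝ) →ₗ[ℝ] ℝ)
    {D D' : ℝ → Fin n → Fin m → ℝ} (hD : ∀ r s, Continuous fun x => D x r s) (i : Fin N)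
    (l : Fin (k + 1)) : projData k (fun x => L (D x)) (fun x => L (D' x)) i l =
      L (fun r s => projData k (fun x => D x r s) (fun x => D' x r s) i l) := by
  rw [linear_expand L]; conv_lhs => simp only [linear_expand L (D _), linear_expand L (D' _)]
  simp only [projData, mkData]; split_ifs
  · simp only [sum_mul]
    rw [ii_sum (fun r _ => by
      apply Continuous.intervalIntegrable; have := fun s => hD r s
      fun_prop)]
    rw [mul_sum]; refine sum_congr rfl fun r _ => ?_
    rw [ii_sum (fun s _ => by
      apply Continuous.intervalIntegrable; have := hD r s
      fun_prop)]
    rw [mul_sum]; refine sum_congr rfl fun s _ => ?_; rw [mul_assoc, ← ii_mul_const]; congr 2; ext x; ring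
  · simp only [mul_sum]
    refine sum_congr rfl fun r _ => sum_congr rfl fun s _ => by ring
  · rfl

lemma linear_exchange {n m n' m' : ℕ} (L : (Fin n → Fin m → ℝ) →ₗ[ℝ] ℝ)
    (L' : (Fin n' → Fin m' → ℝ) →ₗ[ℝ] ℝ) (D : Fin n → Fin m → Fin n' → Fin m' → ℝ) :
    L (fun r l => L' (D r l)) = L' (fun s q => L (fun r l => D r l s q)) := by
  rw [linear_expand L, linear_expand L']
  simp only [linear_expand L' (D _ _), linear_expand L (fun r l => D r l _ _), sum_mul]
  have h : ∀ F : Fin n → Fin m → Fin n' → Fin m' → ℝ,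
      ∑ r, ∑ l, ∑ s, ∑ q, F r l s q = ∑ s, ∑ q, ∑ r, ∑ l, F r l s q := by
    intro F
    calc ∑ r, ∑ l, ∑ s, ∑ q, F r l s q = ∑ r, ∑ s, ∑ l, ∑ q, F r l s q :=
          sum_congr rfl fun r _ => sum_comm
      _ = ∑ s, ∑ r, ∑ l, ∑ q, F r l s q := sum_comm
      _ = ∑ s, ∑ r, ∑ q, ∑ l, F r l s q := sum_congr rfl fun s _ => sum_congr rfl fun r _ => sum_comm
      _ = ∑ s, ∑ q, ∑ r, ∑ l, F r l s q := sum_congr rfl fun s _ => sum_comm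
  rw [h]
  exact sum_congr rfl fun s _ => sum_congr rfl fun q _ => sum_congr rfl fun r _ => sum_congr rfl fun l _ => by ring

/-- The tensor product of the data functionals. -/
def dataXY (k : ℕ) (U : Jet) (i : Fin Nx) (l : Fin (k + 1)) (j : Fin Ny) (q : Fin (k + 1)) : ℝ :=
  projData k (fun x => projData k (U 0 0 x) (U 0 1 x) j q) (fun x => projData k (U 1 0 x) (U 1 1 x) j q) i l

/-- The tensor product projection. -/
def tens (Nx Ny : ℕ) [NeZero Nx] [NeZero Ny] (U : Jet) : Vh Nx Ny k := fun i j a b =>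
  solEval Nx (lcoeff ℝ (a : ℕ)) i fun i' l => solEval Ny (lcoeff ℝ (b : ℕ)) j fun j' q => dataXY k U i' l j' q

section
variable {U : Jet} (hU : Smooth2 m M U)

lemma solEval_leval (N : ℕ) [NeZero N] (x : ℝ) (i : Fin N) (d : Fin N → Fin (k + 1) → ℝ) : solEval N (leval x) i d =
      ∑ a : Fin (k + 1), x ^ (a : ℕ) * solEval N (lcoeff ℝ (a : ℕ)) i d := by
  change (sol d i).eval x = ∑ a : Fin (k + 1), x ^ (a : ℕ) * (sol d i).coeff a
  rw [eval_eq_sum_coeff (natDegree_sol_le d i)]; exact sum_congr rfl fun a _ => mul_comm _ _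

lemma val_tens (i : Fin Nx) (j : Fin Ny) (x y : ℝ) : val (tens Nx Ny U i j) x y =
    solEval Nx (leval x) i fun i' l => solEval Ny (leval y) j fun j' q => dataXY k U i' l j' q := by
  rw [solEval_leval, val]; refine sum_congr rfl fun a _ => ?_
  have e : (fun (i' : Fin Nx) (l : Fin (k + 1)) => solEval Ny (leval y) j fun j' q =>
      dataXY k U i' l j' q) = ∑ b : Fin (k + 1), y ^ (b : ℕ) • fun i' l =>
        solEval Ny (lcoeff ℝ (b : ℕ)) j fun j' q => dataXY k U i' l j' q := by
    funext i' l; rw [solEval_leval]; simp only [Finset.sum_apply, Pi.smul_apply, smul_eq_mul]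
  rw [e, map_sum, mul_sum]; refine sum_congr rfl fun b _ => ?_; rw [map_smul, smul_eq_mul, tens]; ring

lemma tens_swap (hU : Smooth2 m M U) : swapV (tens Nx Ny U) = tens Ny Nx (swapU U) := by
  funext j i b a; simp only [swapV, swapC, tens]; rw [linear_exchange]; congr 1; funext j' q; congr 1
  funext i' l; exact projData_comm (hU.cont 0 0) i' j' l q

lemma continuous_projData_param (hU : Smooth2 m M U) (a : ℕ) (j : Fin Ny) (q : Fin (k + 1)) :
    Continuous fun x => projData k (U a 0 x) (U a 1 x) j q := by
  simp only [projData, mkData]; have h0 := hU.cont a 0; split_ifs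
  · refine continuous_const.mul ?_; apply continuous_ii; fun_prop
  · exact continuous_const.mul (hU.cx a 1 _)
  · exact hU.cx a 0 _

include hU in
/-- On a horizontal line, the tensor product projection is the projection in `x` of the
projection in `y`. -/
lemma polyX_tens (i : Fin Nx) (j : Fin Ny) (y : ℝ) : polyX (tens Nx Ny U i j) y =
    pr Nx (fun x => (pr Ny (U 0 0 x) (U 0 1 x) j).eval y) (fun x => (pr Ny (U 1 0 x) (U 1 1 x) j).eval y) i := by
  refine Polynomial.funext fun x => ?_; rw [polyX_eval, val_tens]
  change (sol _ i).eval x = (sol _ i).eval x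
  congr 2; funext i' l
  exact (projData_linear (solEval Ny (leval y) j)
    (D := fun x => projData k (U 0 0 x) (U 0 1 x)) (D' := fun x => projData k (U 1 0 x) (U 1 1 x))
    (fun r s => continuous_projData_param hU 0 r s) i' l).symm

include hU in
lemma polyX_tens' (i : Fin Nx) (j : Fin Ny) (y : ℝ) : polyX (tens Nx Ny U i j) y =
    pr Nx (fun x => U 0 0 x y - prErr (swapU U) 0 j y x) (fun x => U 1 0 x y - prErr (swapU U) 1 j y x) i := by
  rw [polyX_tens hU]; simp only [prErr, swapU, sub_sub_cancel]

end

lemma abs_projData_le (N : ℕ) [NeZero N] (k : ℕ) : ∃ B : ℝ, 0 ≤ B ∧ ∀ (v v' : Fn) (M : ℝ),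
    (∀ x, |v x| ≤ M) → (∀ x, |v' x| ≤ M) → ∀ (i : Fin N) l, |projData k v v' i l| ≤ B * M := by
  have hb : ∀ (i : Fin N) (l : Fin (k + 1)), ∃ B : ℝ, 0 ≤ B ∧ ∀ (v v' : Fn) (M : ℝ),
      (∀ x, |v x| ≤ M) → (∀ x, |v' x| ≤ M) → |projData k v v' i l| ≤ B * M := by
    intro i l; have hs := step_pos N; simp only [projData, mkData]; split_ifs
    · set w := 𝒟 (𝒟 (dblPrim N i (legendre l)))
      obtain ⟨B, hB⟩ := isCompact_Icc.exists_bound_of_continuousOn (s := cell N i) (f := fun s => w.eval s) fp!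
      have hB0 : 0 ≤ B := (norm_nonneg _).trans (hB _ (left_mem i)); have hl := legSq_pos l
      refine ⟨2 / step N / legSq l * (B * step N), pos!, fun v v' M h _ => ?_⟩
      rw [abs_mul, abs_of_pos pos!, mul_assoc]; refine scale_le ?_ pos!
      have := abs_integral_cell_le i (f := fun x => v x * w.eval x) (M := M * B) fun x hx => by
        rw [abs_mul]; exact mul_le_mul (h x) (hB x hx) (abs_nonneg _) ((abs_nonneg _).trans (h x))
      linarith
    · refine ⟨step N, hs.le, fun v v' M _ h => ?_⟩; rw [abs_mul, abs_of_pos hs]; exact scale_le (h _) hs.le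
    · exact ⟨1, zero_le_one, fun v v' M h _ => by rw [one_mul]; exact h _⟩
  choose B hB0 hB using hb
  refine ⟨∑ i, ∑ l, B i l, sum_nonneg fun i _ => sum_nonneg fun l _ => hB0 i l, ?_⟩; intro v v' M h h' i l
  refine (hB i l v v' M h h').trans (mul_le_mul_of_nonneg_right ?_ ((abs_nonneg _).trans (h 0)))
  exact (single_le_sum (f := fun l => B i l) (fun l _ => hB0 i l) (Finset.mem_univ l)).trans
    (single_le_sum (f := fun i => ∑ l, B i l) (fun i _ => sum_nonneg fun l _ => hB0 i l) (Finset.mem_univ i))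

/-! ### Dependence on time -/

/-- A smooth function of space, differentiable in time. -/
structure TimeFamily (m : ℕ) (T M : ℝ) (U V : ℝ → Jet) : Prop where
  smooth : ∀ t ∈ Icc 0 T, Smooth2 m M (U t)
  smooth' : ∀ t ∈ Ioo 0 T, Smooth2 m M (V t)
  der : ∀ t ∈ Ioo 0 T, ∀ a b x y, HasDerivAt (fun t => U t a b x y) (V t a b x y) t

lemma TimeFamily.swap {T M : ℝ} {U V : ℝ → Jet} (h : TimeFamily m T M U V) :
    TimeFamily m T M (fun t => swapU (U t)) (fun t => swapU (V t)) :=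
  ⟨fun t ht => (h.smooth t ht).swap, fun t ht => (h.smooth' t ht).swap, fun t ht a b x y => h.der t ht b a y x⟩

section
variable {m : ℕ} {T M : ℝ} {U V : ℝ → Jet} (h : TimeFamily m T M U V)
include h

lemma hasDerivAt_tens (hm : 1 ≤ m) (Nx Ny : ℕ) [NeZero Nx] [NeZero Ny] {t : ℝ}
    (ht : t ∈ Ioo 0 T) : HasDerivAt (fun t => tens Nx Ny (U t)) (tens Nx Ny (V t)) t := by
  have hs : Ioo 0 T ∈ nhds t := Ioo_mem_nhds ht.1 ht.2
  have sm : ∀ τ ∈ Ioo 0 T, Smooth2 m M (U τ) := fun τ hτ => h.smooth τ (Ioo_subset_Icc_self hτ)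
  have inner : ∀ a ≤ 1, ∀ τ ∈ Ioo 0 T, ∀ x, HasDerivAt (fun τ => projData (N := Ny) k (U τ a 0 x) (U τ a 1 x))
      (projData k (V τ a 0 x) (V τ a 1 x)) τ := fun a ha τ hτ x =>
    hasDerivAt_projData (Ioo_mem_nhds hτ.1 hτ.2) (fun τ hτ y => h.der τ hτ a 0 x y)
      (fun τ hτ y => h.der τ hτ a 1 x y) (fun τ hτ => (sm τ hτ).cy a 0 x)
      (fun τ hτ => (h.smooth' τ hτ).cy a 0 x)
      (fun τ hτ y => (h.smooth' τ hτ).bd a (ha.trans hm) 0 (Nat.zero_le _) x y)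
  obtain ⟨B, hB0, hB⟩ := abs_projData_le Ny k
  have hdata : ∀ j q, HasDerivAt (fun t => fun (i : Fin Nx) l => dataXY (Ny := Ny) k (U t) i l j q)
      (fun i l => dataXY k (V t) i l j q) t := by
    intro j q
    refine hasDerivAt_projData (M := B * M) hs
      (fun τ hτ x => (hasDerivAt_pi.1 (hasDerivAt_pi.1 (inner 0 om! τ hτ x) j) q))
      (fun τ hτ x => (hasDerivAt_pi.1 (hasDerivAt_pi.1 (inner 1 le_rfl τ hτ x) j) q))
      (fun τ hτ => continuous_projData_param (sm τ hτ) 0 j q)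
      (fun τ hτ => continuous_projData_param (h.smooth' τ hτ) 0 j q) fun τ hτ x => ?_
    exact hB _ _ M (fun y => (h.smooth' τ hτ).bd 0 (Nat.zero_le _) 0 (Nat.zero_le _) x y)
      (fun y => (h.smooth' τ hτ).bd 0 (Nat.zero_le _) 1 hm x y) j q
  rw [hasDerivAt_pi]; intro i; rw [hasDerivAt_pi]; intro j; rw [hasDerivAt_pi]; intro a
  rw [hasDerivAt_pi]; intro b; refine hasDerivAt_linear (solEval Nx (lcoeff ℝ (a : ℕ)) i) ?_
  rw [hasDerivAt_pi]; intro i'; rw [hasDerivAt_pi]; intro l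
  refine hasDerivAt_linear (solEval Ny (lcoeff ℝ (b : ℕ)) j) ?_; rw [hasDerivAt_pi]; intro j'
  rw [hasDerivAt_pi]; intro q; exact hasDerivAt_pi.1 (hasDerivAt_pi.1 (hdata j' q) i') l

lemma hasDerivAt_prErr_time (N : ℕ) [NeZero N] {t : ℝ} (ht : t ∈ Ioo 0 T) {b : ℕ} (hb : b ≤ m) (i : Fin N) (x y : ℝ) :
    HasDerivAt (fun t => prErr (U t) b i x y) (prErr (V t) b i x y) t := by
  have hs := Ioo_mem_nhds ht.1 ht.2; refine (h.der t ht 0 b x y).sub (hasDerivAt_linear (solEval N (leval x) i) ?_)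
  exact hasDerivAt_projData hs (fun τ hτ x => h.der τ hτ 0 b x y)
      (fun τ hτ x => h.der τ hτ 1 b x y) (fun τ hτ => (h.smooth τ (Ioo_subset_Icc_self hτ)).cx 0 b y)
      (fun τ hτ => (h.smooth' τ hτ).cx 0 b y)
      (fun τ hτ x => (h.smooth' τ hτ).bd 0 (Nat.zero_le _) b hb x y)

end

/-! ### The comparison function -/

/-- The time derivative of `zfun`. -/
def zfun' (f : Fn) (U V : Jet) (i : Fin N) (x y : ℝ) : ℝ :=
  deriv (deriv f) (U 0 0 (mid N i) y) * V 0 0 (mid N i) y * prErr U 0 i x y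
    + deriv f (U 0 0 (mid N i) y) * prErr V 0 i x y

/-- The time derivative of `corX`. -/
def corX' (N : ℕ) [NeZero N] (f : Fn) (U V : Jet) (y : ℝ) : Pw N := corr N fun i x => zfun' f U V i x y

lemma natDegree_corX_le (N : ℕ) [NeZero N] (f : Fn) (U : Jet) (y : ℝ) (i : Fin N) : (corX N f U y i).natDegree ≤ k :=
  natDegree_sol_le _ _

lemma natDegree_corX'_le (N : ℕ) [NeZero N] (f : Fn)
    (U V : Jet) (y : ℝ) (i : Fin N) : (corX' N f U V y i).natDegree ≤ k :=
  natDegree_sol_le _ _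

/-- The comparison function. -/
def cmp (Nx Ny : ℕ) [NeZero Nx] [NeZero Ny] (f1 f2 : Fn) (U : Jet) : Vh Nx Ny k := fun i j =>
  tens Nx Ny U i j - ofX k (corX Nx f1 U (mid Ny j) i) - swapC (ofX k (corX Ny f2 (swapU U) (mid Nx i) j))

/-- The time derivative of the comparison function. -/
def cmp' (Nx Ny : ℕ) [NeZero Nx] [NeZero Ny] (f1 f2 : Fn) (U V : Jet) : Vh Nx Ny k := fun i j =>
  tens Nx Ny V i j - ofX k (corX' Nx f1 U V (mid Ny j) i)
    - swapC (ofX k (corX' Ny f2 (swapU U) (swapU V) (mid Nx i) j))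

lemma swapV_cmp {U : Jet} (hU : Smooth2 m M U) : swapV (cmp Nx Ny f1 f2 U) = cmp Ny Nx f2 f1 (swapU U) := by
  have := tens_swap (Nx := Nx) (Ny := Ny) (k := k) (β := β) (θ := θ) hU; funext j i b a
  have h := congrFun (congrFun (congrFun (congrFun this j) i) b) a; simp only [swapV, swapC] at h
  simp only [swapV, swapC, cmp, Pi.sub_apply, h]
  change _ = tens Ny Nx (swapU U) j i b a - _ - ofX k (corX Nx f1 U (mid Ny j) i) a b
  ring

lemma hasDerivAt_corr {Z Z' : ℝ → Fin N → Fn} {τ K : ℝ}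
    {s : Set ℝ} (hs : s ∈ nhds τ) (hZ : ∀ t ∈ s, ∀ i x, HasDerivAt (fun t => Z t i x) (Z' t i x) t)
    (hc : ∀ t ∈ s, ∀ i, Continuous (Z t i)) (hc' : ∀ t ∈ s, ∀ i, Continuous (Z' t i))
    (hK : ∀ t ∈ s, ∀ i, ∀ x ∈ cell N i, |Z' t i x| ≤ K)
    (L : ℝ[X] →ₗ[ℝ] ℝ) (i : Fin N) :
    HasDerivAt (fun t => L (corr N (Z t) i)) (L (corr N (Z' τ) i)) τ := by
  refine hasDerivAt_linear (solEval N L i) ?_; rw [hasDerivAt_pi]; intro i; rw [hasDerivAt_pi]; intro l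
  simp only [mkData]; split_ifs
  · apply HasDerivAt.const_mul; apply HasDerivAt.fun_neg; set w := 𝒟 (dblPrim N i (legendre l))
    obtain ⟨B, hB⟩ := isCompact_Icc.exists_bound_of_continuousOn (s := cell N i) (f := fun s => w.eval s) fp!
    have hcw : Continuous fun x => w.eval x := fp!
    refine hasDerivAt_integral_of_bounded (M := K * B) (F' := fun t x => Z' t i x * w.eval x)
      (left_lt_right N i).le hs (fun t ht x => (hZ t ht i x).mul_const _)
      (fun t ht => (hc t ht i).mul hcw) (fun t ht => (hc' t ht i).mul hcw) fun t ht x hx => ?_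
    rw [abs_mul]; exact mul_le_mul (hK t ht i x hx) (hB x hx) (abs_nonneg _) ((abs_nonneg _).trans (hK t ht i x hx))
  · simpa using hasDerivAt_const τ (0 : ℝ)
  · simpa using hasDerivAt_const τ (0 : ℝ)

lemma zfun'_bound (hf : C∞ f) (M : ℝ) : ∃ K : ℝ, 0 < K ∧
    ∀ (N : ℕ) [NeZero N] (U V : Jet), Smooth2 (k + 2) M U → Smooth2 (k + 2) M V → ∀ i, ∀ x ∈ cell N i, ∀ y,
        |zfun' f U V i x y| ≤ K * step N ^ (k + 1) := by
  obtain ⟨B, hB, hb⟩ := smooth1_prErr; obtain ⟨L, hL, l1, -⟩ := smooth_flux_bounds hf M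
  by_cases hM : 0 ≤ M
  swap
  · exact ⟨1, one_pos, fun N _ U V hU => absurd hU.nonneg hM⟩
  refine ⟨L * M * (B * M) + L * (B * M) + 1, pos!, ?_⟩; intro N _ U V hU hV i x hx y; have hs := step_pos N
  have h1 := (hb N U M hU i x hx).bd 0 om! y; have h2 := (hb N V M hV i x hx).bd 0 om! y
  have h3 := hV.bd 0 om! 0 om! (mid N i) y; obtain ⟨-, h4, h5, -⟩ := l1 _ (hU.bd 0 om! 0 om! (mid N i) y)
  set c := step N ^ (k + 1); have hc0 : 0 < c := pos!; refine (abs_add_le _ _).trans ?_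
  rw [abs_mul, abs_mul, abs_mul]
  have a1 : |deriv (deriv f) (U 0 0 (mid N i) y)| * |V 0 0 (mid N i) y| *
        |prErr U 0 i x y| ≤ L * M * (B * M * c) := by gcongr
  have a2 : |deriv f (U 0 0 (mid N i) y)| * |prErr V 0 i x y| ≤ L * (B * M * c) := by gcongr
  linarith

lemma corX'_bound (hf : C∞ f) (M : ℝ) : ∃ K : ℝ, 0 < K ∧
    ∀ (N : ℕ) [NeZero N] (U V : Jet), Smooth2 (k + 2) M U → Smooth2 (k + 2) M V → ∀ i, ∀ x ∈ cell N i, ∀ y,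
        |(corX' N f U V y i).eval x| ≤ K * step N ^ (k + 2) := by
  obtain ⟨B, hB, hb⟩ := corr_bound; obtain ⟨K, hK, hz⟩ := zfun'_bound hf M
  refine ⟨B * K, pos!, fun N _ U V hU hV i x hx y => ?_⟩
  exact (hb N (fun i x => zfun' f U V i x y) (K * step N ^ (k + 1))
    (fun i x hx => hz N U V hU hV i x hx y) i x hx).1.trans (le_of_eq (by ring))

lemma hasDerivAt_corX (hf : C∞ f) {T M : ℝ} {U V : ℝ → Jet}
    (h : TimeFamily (k + 2) T M U V) {t : ℝ} (ht : t ∈ Ioo 0 T) (y : ℝ)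
    (L : ℝ[X] →ₗ[ℝ] ℝ) (i : Fin N) :
    HasDerivAt (fun t => L (corX N f (U t) y i)) (L (corX' N f (U t) (V t) y i)) t := by
  obtain ⟨K, hK, hz⟩ := zfun'_bound hf M; have d1 := hf.drv.hd
  have sm : ∀ τ ∈ Ioo 0 T, Smooth2 (k + 2) M (U τ) := fun τ hτ => h.smooth τ (Ioo_subset_Icc_self hτ)
  exact hasDerivAt_corr (Ioo_mem_nhds ht.1 ht.2) (fun τ hτ i x => ((d1 _).comp τ (h.der τ hτ 0 0 (mid N i) y)).mul
      (hasDerivAt_prErr_time h N hτ (Nat.zero_le _) i x y))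
    (fun τ hτ i => continuous_const.mul (continuous_prErr_left (sm τ hτ) 0 i y))
    (fun τ hτ i => (continuous_const.mul (continuous_prErr_left (sm τ hτ) 0 i y)).add
      (continuous_const.mul (continuous_prErr_left (h.smooth' τ hτ) 0 i y)))
    (fun τ hτ i x hx => hz N _ _ (sm τ hτ) (h.smooth' τ hτ) i x hx y) L i

lemma hasDerivAt_cmp (hf1 : C∞ f1) (hf2 : C∞ f2) {T M : ℝ}
    {U V : ℝ → Jet} (h : TimeFamily (k + 2) T M U V) (Nx Ny : ℕ) [NeZero Nx] [NeZero Ny]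
    {t : ℝ} (ht : t ∈ Ioo 0 T) :
    HasDerivAt (fun t => cmp Nx Ny f1 f2 (U t)) (cmp' Nx Ny f1 f2 (U t) (V t)) t := by
  have h0 := hasDerivAt_tens h om! Nx Ny ht; rw [hasDerivAt_pi]; intro i; rw [hasDerivAt_pi]; intro j
  rw [hasDerivAt_pi]; intro a; rw [hasDerivAt_pi]; intro b
  have h1 := hasDerivAt_pi.1 (hasDerivAt_pi.1 (hasDerivAt_pi.1 (hasDerivAt_pi.1 h0 i) j) a) b
  refine (h1.sub ?_).sub ?_
  · simp only [ofX]; split_ifs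
    · exact hasDerivAt_corX hf1 h ht (mid Ny j) (lcoeff ℝ (a : ℕ)) i
    · exact hasDerivAt_const _ _
  · simp only [swapC, ofX]; split_ifs
    · exact hasDerivAt_corX hf2 h.swap ht (mid Nx i) (lcoeff ℝ (b : ℕ)) j
    · exact hasDerivAt_const _ _

lemma Smooth1.mono {M M' : ℝ} {U : ℕ → Fn} (hU : Smooth1 m M U) (h : M ≤ M') :
    Smooth1 m M' U := ⟨hU.der, hU.per, fun n hn x => (hU.bd n hn x).trans h⟩

/-- The comparison function satisfies the hypotheses of the estimate on a line. -/
lemma exists_lineData (hf1 : C∞ f1) (hf2 : C∞ f2) (M ρ : ℝ) :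
    ∃ M' : ℝ, ∀ (Nx Ny : ℕ) [NeZero Nx] [NeZero Ny], step Ny ≤ ρ * step Nx →
      ∀ (U : Jet), Smooth2 (k + 2) M U → ∀ w : Vh Nx Ny k,
      (∀ i j, ∀ x ∈ cell Nx i, ∀ y ∈ cell Ny j,
        |val (w i j - cmp Nx Ny f1 f2 U i j) x y| ≤ 1) →
      ∀ j, ∀ y ∈ cell Ny j, LineData Nx k β θ M' f1 (fun n x => U n 0 x y) (fun n x => prErr (swapU U) n j y x)
        (fun i x => zfun f1 U i x (mid Ny j)) (fun i => polyX (w i j) y)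
        (fun i => polyX (w i j - cmp Nx Ny f1 f2 U i j) y)
        (corX Nx f1 U (mid Ny j))
        (fun i => (corX Ny f2 (swapU U) (mid Nx i) j).eval y) := by
  obtain ⟨B, hB, hb⟩ := smooth1_prErr; obtain ⟨K, hK, hz⟩ := zfun_bound hf1 M
  obtain ⟨K1, hK1, hc1⟩ := corX_bound hf1 M; obtain ⟨K2, hK2, hc2⟩ := corX_bound hf2 M
  by_cases hM : 0 ≤ M
  swap
  · exact ⟨1, fun Nx Ny _ _ _ U hU => absurd hU.nonneg hM⟩
  by_cases hρ : 0 < ρ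
  swap
  · refine ⟨1, fun Nx Ny _ _ h => ?_⟩; have := step_pos Nx; have := step_pos Ny; nlinarith
  refine ⟨M + B * M * ρ ^ (k + 1) + K * (1 + ρ) + K1 + K2 * ρ ^ (k + 2), ?_⟩
  set M' := M + B * M * ρ ^ (k + 1) + K * (1 + ρ) + K1 + K2 * ρ ^ (k + 2); intro Nx Ny _ _ hr U hU w hw j y hy
  have hsx := step_pos Nx; have hsy := step_pos Ny; have p1 : 0 ≤ B * M * ρ ^ (k + 1) := pos!
  have p2 : 0 ≤ K * (1 + ρ) := pos!; have p3 : 0 ≤ K2 * ρ ^ (k + 2) := pos!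
  have mono : ∀ (A : ℝ) (n : ℕ), A ≤ M' → A * step Nx ^ n ≤ M' * step Nx ^ n := fun A n hA => by gcongr
  have ry : ∀ n, step Ny ^ n ≤ ρ ^ n * step Nx ^ n := fun n => by rw [← mul_pow]; gcongr
  have zc : ∀ i : Fin Nx, Continuous fun x => zfun f1 U i x (mid Ny j) := fun i =>
    continuous_const.mul (continuous_prErr_left hU 0 i _)
  have c2 := fun x0 => (hc2 Ny (swapU U) hU.swap j y hy x0)
  refine ⟨(hU.smooth1 (Nat.zero_le _) y).mono (by linarith), (hb Ny _ M hU.swap j y hy).mono ?_, zc,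
    fun i => natDegree_polyX_le _ _, fun i x hx => ?_, ?_, fun i x hx => ?_, fun i x hx => ?_,
    fun i => ?_, fun i => ?_, fun i => ?_⟩
  · calc B * M * step Ny ^ (k + 1) ≤ B * M * (ρ ^ (k + 1) * step Nx ^ (k + 1)) := by
          have := ry (k + 1); gcongr
      _ = B * M * ρ ^ (k + 1) * step Nx ^ (k + 1) := by ring
      _ ≤ _ := mono _ _ (by linarith)
  · rw [polyX_eval]; exact hw i j x hx y hy
  · refine corr_A1 zc (fun i => ?_) _ fun i => natDegree_polyX_le _ _; simp only [zfun]
    rw [ii_const_mul, integral_prErr hU, mul_zero]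
  · exact (hc1 Nx U hU i x hx _).1.trans (mono _ _ (by linarith))
  · have a1 := (hz Nx U hU i x hx y).2.2; have a2 := (hz Nx U hU i x hx y).2.1 (mid Ny j)
    have a3 := (abs_sub_le_step hy (mid_mem j)).trans hr
    have a4 : K * step Nx ^ (k + 1) * |y - mid Ny j| ≤ K * ρ * step Nx ^ (k + 2) := by
      calc _ ≤ K * step Nx ^ (k + 1) * (ρ * step Nx) := by gcongr
        _ = _ := by ring
    refine le_trans ?_ (mono (K * (1 + ρ)) (k + 2) (by linarith))
    have a5 := abs_sub_le (deriv f1 (U 0 0 x y) * prErr U 0 i x y) (zfun f1 U i x y) (zfun f1 U i x (mid Ny j))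
    refine a5.trans ?_; linarith
  · refine (c2 _).1.trans ?_
    calc K2 * step Ny ^ (k + 2) ≤ K2 * (ρ ^ (k + 2) * step Nx ^ (k + 2)) := by
          have := ry (k + 2); gcongr
      _ = K2 * ρ ^ (k + 2) * step Nx ^ (k + 2) := by ring
      _ ≤ _ := mono _ _ (by linarith)
  · have e := periodic_mid_succ (N := Nx) (g := fun x0 => (corX Ny f2 (swapU U) x0 j).eval y) (fun x0 => by
        have hz' : ∀ (i : Fin Ny) x, zfun f2 (swapU U) i x (x0 + 2 * π) = zfun f2 (swapU U) i x x0 := fun i x => by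
          simp only [zfun, hU.swap.py, prErr_periodic hU.swap]
        simp only [corX, hz']) i
    rw [e]; refine ((c2 _).2.2 _).trans ?_; rw [add_sub_cancel_left, abs_of_pos hsx]
    calc K2 * step Ny ^ (k + 2) * step Nx ≤ K2 * (ρ ^ (k + 2) * step Nx ^ (k + 2)) * step Nx := by
          have := ry (k + 2); gcongr
      _ = K2 * ρ ^ (k + 2) * step Nx ^ (k + 3) := by ring
      _ ≤ _ := mono _ _ (by linarith)
  · rw [polyX_sub, cmp, polyX_sub, polyX_sub, polyX_tens' hU, polyX_ofX (natDegree_corX_le ..),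
      polyX_swapC_ofX (natDegree_corX_le ..)]
    ring

/-! ### Summation of the scheme over the cells -/

lemma derivative_polyX_eval (c : Coef k) (x y : ℝ) : (𝒟 (polyX c y)).eval x =
    ∑ a : Fin (k + 1), (∑ b : Fin (k + 1), c a b * y ^ (b : ℕ)) * ((a : ℕ) * x ^ ((a : ℕ) - 1)) := by
  simp only [polyX, derivative_sum, derivative_C_mul, derivative_X_pow, eval_finsetSum, eval_mul,
    eval_C, eval_pow, eval_X]

lemma derivative2_polyX_eval (c : Coef k) (x y : ℝ) : (𝒟 (𝒟 (polyX c y))).eval x =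
    ∑ a : Fin (k + 1), (∑ b : Fin (k + 1), c a b * y ^ (b : ℕ)) *
      ((a : ℕ) * (((a : ℕ) - 1 : ℕ) * x ^ ((a : ℕ) - 1 - 1))) := by
  simp only [polyX, derivative_sum, derivative_C_mul, derivative_X_pow, eval_finsetSum, eval_mul,
    eval_C, eval_pow, eval_X]

/-- The derivative in the first variable. -/
def dval (c : Coef k) (x y : ℝ) : ℝ := (𝒟 (polyX c y)).eval x

/-- The second derivative in the first variable. -/
def ddval (c : Coef k) (x y : ℝ) : ℝ := (𝒟 (𝒟 (polyX c y))).eval x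

section
variable {α : Type*} [TopologicalSpace α] (c : Coef k) {f g : α → ℝ}

@[fun_prop]
lemma continuous_val (hf : Continuous f) (hg : Continuous g) : Continuous fun z => val c (f z) (g z) := by
  simp only [val]; fun_prop

@[fun_prop]
lemma continuous_dval (hf : Continuous f) (hg : Continuous g) : Continuous fun z => dval c (f z) (g z) := by
  simp only [dval, derivative_polyX_eval]; fun_prop

@[fun_prop]
lemma continuous_ddval (hf : Continuous f) (hg : Continuous g) : Continuous fun z => ddval c (f z) (g z) := by
  simp only [ddval, derivative2_polyX_eval]; fun_prop

end

lemma deriv_val_left (c : Coef k) (x y : ℝ) : deriv (fun x' => val c x' y) x = dval c x y := by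
  simp_rw [← polyX_eval]; exact (polyX c y).deriv

lemma deriv_val_right (c : Coef k) (x y : ℝ) : deriv (fun y' => val c x y') y = dval (swapC c) y x := by
  simp_rw [← val_swapC c, deriv_val_left]

lemma lineX_eq (w : Vh Nx Ny k) (j : Fin Ny) (y : ℝ) : lineX w j y = pfun fun i => polyX (w i j) y := by
  funext i x; simp only [lineX, pfun, polyX_eval]

lemma lineY_eq (w : Vh Nx Ny k) (i : Fin Nx) (x : ℝ) : lineY w i x = lineX (swapV w) i x := by
  funext j y; simp only [lineY, lineX, swapV, val_swapC]

/-- The contribution of the fluxes in the first variable to the scheme on a cell. -/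
def rowPart (β θ : ℝ) (f : Fn) (g : Fn₂) (w v : Vh Nx Ny k) (i : Fin Nx) (j : Fin Ny) : ℝ :=
  (∮ y Ny j, ∮ x Nx i, (f (val (w i j) x y) - dval (w i j) x y) * dval (v i j) x y)
  - (∮ y Ny j, (val (v i j) (right Nx i) y * totalFlux β θ g (lineX w j y) i
        - val (v i j) (left Nx i) y * totalFlux β θ g (lineX w j y) (i - 1)))
  - (1 / 2) * ∮ y Ny j,
      (jump (lineX w j y) i * dval (v i j) (right Nx i) y + jump (lineX w j y) (i - 1) * dval (v i j) (left Nx i) y)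

lemma schemeRHS_eq (hf1 : Continuous f1) (hf2 : Continuous f2) (g1 g2 : Fn₂) (w v : Vh Nx Ny k) (i : Fin Nx)
    (j : Fin Ny) : schemeRHS β θ f1 f2 g1 g2 w i j (v i j) =
      rowPart β θ f1 g1 w v i j + rowPart β θ f2 g2 (swapV w) (swapV v) j i := by
  have h1 : (∮ x Nx i, ∮ y Ny j, ((f1 (val (w i j) x y) - dval (w i j) x y) * dval (v i j) x y
        + (f2 (val (w i j) x y) - dval (swapC (w i j)) y x) * dval (swapC (v i j)) y x)) =
      (∮ y Ny j, ∮ x Nx i, (f1 (val (w i j) x y) - dval (w i j) x y) * dval (v i j) x y)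
      + ∮ x Nx i, ∮ y Ny j, (f2 (val (w i j) x y) - dval (swapC (w i j)) y x) * dval (swapC (v i j)) y x := by
    rw [integral_swap_of_continuous (f := fun y x => (f1 (val (w i j) x y) - dval (w i j) x y) * dval (v i j) x y)
          _ _ _ _ (cont₂ fp!),
      ← ii_add]
    · refine ii_congr fun x _ => ?_; rw [← ii_add] <;> (apply ii; fun_prop)
    · apply Continuous.intervalIntegrable; apply continuous_ii; unfold uncurry; fun_prop
    · apply Continuous.intervalIntegrable; apply continuous_ii; unfold uncurry; fun_prop
  simp only [schemeRHS, rowPart, deriv_val_left, deriv_val_right, lineY_eq, swapV, val_swapC]; rw [h1]; ring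

/-- The form of the scheme in the first variable. -/
def rowForm (β θ : ℝ) (f : Fn) (g : Fn₂) (w v : Vh Nx Ny k) : ℝ :=
  ∑ j, ∮ y Ny j, B1 β θ f g (fun i => polyX (w i j) y) (fun i => polyX (v i j) y)

lemma sum_line (β θ : ℝ) (f : Fn) (g : Fn₂) (p v : Pw N) :
    ∑ i, ((∮ x N i, (f ((p i).eval x) - (𝒟 (p i)).eval x) * (𝒟 (v i)).eval x)
      - ((v i).eval (right N i) * totalFlux β θ g (pfun p) i
        - (v i).eval (left N i) * totalFlux β θ g (pfun p) (i - 1))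
      - 1 / 2 * (jump (pfun p) i * (𝒟 (v i)).eval (right N i)
        + jump (pfun p) (i - 1) * (𝒟 (v i)).eval (left N i))) = B1 β θ f g p v := by
  rw [B1, cellSum]; simp only [sum_sub_distrib, ← mul_sum, sum_add_distrib]
  rw [← sum_succ (fun i => (v i).eval (left N i) * totalFlux β θ g (pfun p) (i - 1)),
    ← sum_succ (fun i => jump (pfun p) (i - 1) * (𝒟 (v i)).eval (left N i))]
  simp only [add_sub_cancel_right]
  have h1 : ∑ i, totalFlux β θ g (pfun p) i * jump (pfun v) i =
      (∑ i, (v (i + 1)).eval (left N (i + 1)) * totalFlux β θ g (pfun p) i)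
      - ∑ i, (v i).eval (right N i) * totalFlux β θ g (pfun p) i := by
    rw [← sum_sub_distrib]; refine sum_congr rfl fun i _ => ?_; rw [jump, traceL, traceR, pfun, pfun]; ring
  have h2 : ∑ i, jump (pfun p) i * avg (pfun fun m => 𝒟 (v m)) i =
      1 / 2 * ((∑ i, jump (pfun p) i * (𝒟 (v i)).eval (right N i))
      + ∑ i, jump (pfun p) i * (𝒟 (v (i + 1))).eval (left N (i + 1))) := by
    rw [← sum_add_distrib, mul_sum]; refine sum_congr rfl fun i _ => ?_; simp only [avg, traceL, traceR, pfun]; ring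
  rw [h1, h2]; ring

section
variable (hg : C₂ g) (w : Vh Nx Ny k) (j : Fin Ny) (i : Fin Nx)

lemma continuous_jump_lineX : Continuous fun y => jump (lineX w j y) i := by
  simp only [jump, traceL, traceR, lineX]; fun_prop

include hg in
lemma continuous_totalFlux_lineX : Continuous fun y => totalFlux β θ g (lineX w j y) i := by
  have h : Continuous fun y => g (traceL (lineX w j y) i) (traceR (lineX w j y) i) := by
    simp only [traceL, traceR, lineX]; have a1 : Continuous fun y => val (w i j) (right Nx i) y := fp!
    have a2 : Continuous fun y => val (w (i + 1) j) (left Nx (i + 1)) y := fp!; exact hg.comp (a1.prodMk a2)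
  have h2 : Continuous fun y => diffFlux β θ (lineX w j y) i := by
    simp only [lineX_eq, diffFlux_pfun, jump, avg, traceL, traceR, pfun]
    change Continuous fun y => β * (step Nx)⁻¹ * ((polyX (w (i + 1) j) y).eval (left Nx (i + 1))
        - (polyX (w i j) y).eval (right Nx i))
      + (dval (w i j) (right Nx i) y + dval (w (i + 1) j) (left Nx (i + 1)) y) / 2
      + θ * step Nx * (ddval (w (i + 1) j) (left Nx (i + 1)) y - ddval (w i j) (right Nx i) y)
    simp only [polyX_eval]; fun_prop
  exact h.sub h2

end

lemma sum_rowPart (hf : Continuous f) (hg : C₂ g) (w v : Vh Nx Ny k) :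
    ∑ i, ∑ j, rowPart β θ f g w v i j = rowForm β θ f g w v := by
  rw [sum_comm, rowForm]; refine sum_congr rfl fun j _ => ?_
  simp_rw [← sum_line, ← lineX_eq, polyX_eval, ← dval.eq_def]
  have c1 := fun i => continuous_totalFlux_lineX (β := β) (θ := θ) hg w j i
  have c2 := fun i => continuous_jump_lineX w j i
  have c3 : ∀ i : Fin Nx, Continuous fun y => ∮ x Nx i,
      (f (val (w i j) x y) - dval (w i j) x y) * dval (v i j) x y := by
    intro i; apply continuous_ii; unfold uncurry; fun_prop
  rw [ii_sum]
  · refine sum_congr rfl fun i _ => ?_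
    have c4 := c1 i; have c5 := c1 (i - 1); have c6 := c2 i; have c7 := c2 (i - 1); have c8 := c3 i
    rw [rowPart]; symm; rw [ii_sub, ii_sub, ii_const_mul] <;> (apply ii; fun_prop)
  · intro i _; have c4 := c1 i; have c5 := c1 (i - 1); have c6 := c2 i; have c7 := c2 (i - 1); have c8 := c3 i
    apply ii; fun_prop

lemma sum_scheme (hf1 : Continuous f1) (hf2 : Continuous f2) {g1 g2 : Fn₂} (hg1 : C₂ g1) (hg2 : C₂ g2)
    (w v : Vh Nx Ny k) : ∑ i, ∑ j, schemeRHS β θ f1 f2 g1 g2 w i j (v i j) =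
      rowForm β θ f1 g1 w v + rowForm β θ f2 g2 (swapV w) (swapV v) := by
  simp_rw [schemeRHS_eq hf1 hf2, sum_add_distrib]
  rw [sum_rowPart hf1 hg1, sum_comm (f := fun i j => rowPart β θ f2 g2 (swapV w) (swapV v) j i), sum_rowPart hf2 hg2]

/-! ### Integrals over the mesh -/

/-- Sum over the cells of the integrals of a cellwise defined function of two variables. -/
def rsum (F : Fin Nx → Fin Ny → Fn₂) : ℝ := ∑ j, ∮ y Ny j, cellSum fun i x => F i j x y

section
variable {F G : Fin Nx → Fin Ny → Fn₂}
  (hF : ∀ i j, C₂ (F i j))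
  (hG : ∀ i j, C₂ (G i j))

include hF in
lemma continuous_cellSum (j : Fin Ny) : Continuous fun y => cellSum fun i x => F i j x y := by
  refine continuous_finsetSum _ fun i _ => ?_; apply continuous_ii; exact (hF i j).comp continuous_swap

include hF in
lemma continuous_slice (i : Fin Nx) (j : Fin Ny) (y : ℝ) : Continuous fun x => F i j x y :=
  (hF i j).comp (Continuous.prodMk_left y)

include hF hG

lemma rsum_add : rsum (fun i j x y => F i j x y + G i j x y) = rsum F + rsum G := by
  rw [rsum, rsum, rsum, ← sum_add_distrib]; refine sum_congr rfl fun j _ => ?_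
  rw [← ii_add ((continuous_cellSum hF j).intervalIntegrable _ _) ((continuous_cellSum hG j).intervalIntegrable _ _)]
  refine ii_congr fun y _ => ?_
  exact cellSum_add (fun i => continuous_slice hF i j y) fun i => continuous_slice hG i j y

lemma rsum_sub : rsum (fun i j x y => F i j x y - G i j x y) = rsum F - rsum G := by
  rw [rsum, rsum, rsum, ← sum_sub_distrib]; refine sum_congr rfl fun j _ => ?_
  rw [← ii_sub ((continuous_cellSum hF j).intervalIntegrable _ _) ((continuous_cellSum hG j).intervalIntegrable _ _)]
  refine ii_congr fun y _ => ?_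
  exact cellSum_sub (fun i => continuous_slice hF i j y) fun i => continuous_slice hG i j y

lemma rsum_le (h : ∀ i j, ∀ x ∈ cell Nx i, ∀ y ∈ cell Ny j, F i j x y ≤ G i j x y) : rsum F ≤ rsum G :=
  sum_le_sum fun j _ => ii_mono (left_lt_right Ny j).le ((continuous_cellSum hF j).intervalIntegrable _ _)
    ((continuous_cellSum hG j).intervalIntegrable _ _) fun y hy =>
      cellSum_le (fun i => continuous_slice hF i j y) (fun i => continuous_slice hG i j y)
        fun i x hx => h i j x hx y hy

omit hG

lemma rsum_eq : rsum F = ∑ i, ∑ j, ∮ x Nx i, ∮ y Ny j, F i j x y := by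
  rw [rsum, sum_comm]; refine sum_congr rfl fun j _ => ?_; simp only [cellSum]; rw [ii_sum]
  · refine sum_congr rfl fun i _ => ?_; exact (integral_swap_of_continuous _ _ _ _ (hF i j)).symm
  · intro i _; apply Continuous.intervalIntegrable; apply continuous_ii; exact (hF i j).comp continuous_swap

lemma rsum_swap : rsum (fun j i y x => F i j x y) = rsum F := by
  rw [rsum_eq hF, rsum]; refine sum_congr rfl fun i _ => ?_; simp only [cellSum]; rw [ii_sum]; intro j _
  apply Continuous.intervalIntegrable; apply continuous_ii; exact hF i j

end

lemma rsum_const_mul (c : ℝ) (F : Fin Nx → Fin Ny → Fn₂) : rsum (fun i j x y => c * F i j x y) = c * rsum F := by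
  simp only [rsum, cellSum_const_mul, ii_const_mul, mul_sum]

lemma rsum_const (c : ℝ) : rsum (fun (_ : Fin Nx) (_ : Fin Ny) _ _ => c) = (2 * π) ^ 2 * c := by
  simp only [rsum, cellSum_const, ii_const, right_sub_left, smul_eq_mul]; rw [sum_step]; ring

lemma rsum_nonneg {F : Fin Nx → Fin Ny → Fn₂} (h : ∀ i j x y, 0 ≤ F i j x y) : 0 ≤ rsum F :=
  sum_nonneg fun j _ => ii_nonneg (left_lt_right Ny j).le fun y _ =>
    sum_nonneg fun i _ => ii_nonneg (left_lt_right Nx i).le fun x _ => h i j x y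

/-! ### Integrals against functions of vanishing mean -/

lemma orth_cell (i : Fin N) {E F F' : Fn} {A : ℝ} (hE : Continuous E) (h0 : ∮ x N i, E x = 0)
    (hA : ∀ x ∈ cell N i, |E x| ≤ A) (hF : ∀ x, HasDerivAt F (F' x) x)
    (hF' : Continuous F') :
    |∮ x N i, E x * F x| ≤ A * step N * ∮ x N i, |F' x| := by
  have hFc : Continuous F := continuous_iff_continuousAt.2 fun x => (hF x).continuousAt
  have e : ∮ x N i, E x * F x = ∮ x N i, E x * (F x - F (left N i)) := by
    simp only [mul_sub]; rw [ii_sub (ii fp!) (ii fp!), ii_mul_const, h0]; ring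
  rw [e]; have hA0 : 0 ≤ A := (abs_nonneg _).trans (hA _ (left_mem i))
  refine (abs_integral_cell_le i (M := A * ∮ x N i, |F' x|) fun x hx => ?_).trans (le_of_eq (by ring))
  rw [abs_mul]; refine mul_le_mul (hA x hx) ?_ (abs_nonneg _) hA0
  rw [← intervalIntegral.integral_eq_sub_of_hasDerivAt (fun z _ => hF z) (hF'.intervalIntegrable _ _)]
  refine (intervalIntegral.abs_integral_le_integral_abs hx.1).trans ?_
  exact intervalIntegral.integral_mono_interval le_rfl hx.1 hx.2
    (Filter.Eventually.of_forall fun z => abs_nonneg _) (hF'.abs.intervalIntegrable _ _)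

lemma line_orth (k : ℕ) {ε : ℝ} (hε : 0 < ε) (M : ℝ) : ∃ K : ℝ, 0 < K ∧ ∀ (N : ℕ) [NeZero N]
    (E : Fin N → Fn) (c c' : Fn) (p : Pw N), (∀ i, Continuous (E i)) →
    (∀ i, ∮ x N i, E i x = 0) →
    (∀ i, ∀ x ∈ cell N i, |E i x| ≤ M * step N ^ (k + 1)) →
    (∀ x, HasDerivAt c (c' x) x) → Continuous c' → (∀ x, |c x| ≤ M) → (∀ x, |c' x| ≤ M) →
    cellSum (fun i x => E i x * c x * (p i).eval x) ≤ ε * cellSum (fun i x => (𝒟 (p i)).eval x ^ 2)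
      + K * (cellSum (fun i x => (p i).eval x ^ 2) + step N ^ (2 * k + 4)) := by
  set Q := M ^ 4 / (4 * ε) + M ^ 4 / 4 with hQ; have hQ0 : 0 ≤ Q := pos!; have hpi := pi_pos
  refine ⟨1 + 2 * π * Q, pos!, ?_⟩; intro N _ E c c' p hE h0 hEb hc hc' hcb hcb'; have hs := step_pos N
  have hcc : Continuous c := continuous_iff_continuousAt.2 fun x => (hc x).continuousAt
  set H := step N ^ (2 * k + 4) with hH; have hH0 : 0 < H := pos!; have hM0 : 0 ≤ M := (abs_nonneg _).trans (hcb 0)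
  have key : ∀ i, ∮ x N i, E i x * c x * (p i).eval x ≤
      ∮ x N i, (ε * (𝒟 (p i)).eval x ^ 2 + ((p i).eval x ^ 2 + Q * H)) := by
    intro i
    have h1 := orth_cell i (F := fun x => c x * (p i).eval x)
      (F' := fun x => c' x * (p i).eval x + c x * (𝒟 (p i)).eval x) (hE i) (h0 i) (hEb i)
      (fun x => (hc x).mul ((p i).hasDerivAt x)) fp!
    simp only [mul_assoc] at h1 ⊢; refine (le_abs_self _).trans (h1.trans ?_)
    rw [← mul_assoc, ← mul_assoc, ← ii_const_mul]
    refine ii_mono (left_lt_right N i).le (ii fp!) (ii fp!) fun x hx => ?_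
    set P := (p i).eval x; set P' := (𝒟 (p i)).eval x
    have a1 : |c' x * P + c x * P'| ≤ M * |P| + M * |P'| := by
      refine (abs_add_le _ _).trans ?_; rw [abs_mul, abs_mul]; have := hcb x; have := hcb' x; gcongr
    have a2 : M * step N ^ (k + 1) * step N * |c' x * P + c x * P'| ≤
        M ^ 2 * step N ^ (k + 2) * |P| + M ^ 2 * step N ^ (k + 2) * |P'| := by
      calc _ ≤ M * step N ^ (k + 1) * step N * (M * |P| + M * |P'|) := by gcongr
        _ = _ := by ring
    have y1 := young hε (M ^ 2 * step N ^ (k + 2)) |P'|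
    have y2 := young one_pos (M ^ 2 * step N ^ (k + 2)) |P|
    rw [sq_abs] at y1 y2
    have e1 : (M ^ 2 * step N ^ (k + 2)) ^ 2 = M ^ 4 * H := by rw [hH]; ring
    rw [e1] at y1 y2
    have e2 : Q * H = M ^ 4 * H / (4 * ε) + M ^ 4 * H / (4 * 1) := by rw [hQ]; ring
    rw [e2]; linarith
  have h2 : cellSum (fun i x => E i x * c x * (p i).eval x) ≤ cellSum (fun i x =>
      (ε * (𝒟 (p i)).eval x ^ 2 + ((p i).eval x ^ 2 + Q * H))) :=
    sum_le_sum fun i _ => key i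
  rw [cellSum_add (fun i => by fun_prop) (fun i => by fun_prop), cellSum_const_mul,
    cellSum_add (fun i => by fun_prop) (fun i => by fun_prop), cellSum_const] at h2
  have hX : 0 ≤ cellSum (fun i x => (p i).eval x ^ 2) := sum_nonneg fun i _ =>
    ii_nonneg (left_lt_right N i).le fun x _ => sq_nonneg _
  set X := cellSum (fun i x => (p i).eval x ^ 2); have n1 : 0 ≤ 2 * π * Q * X := pos!; linarith

/-- The `L²` norm squared of a discrete function. -/
def sqNorm (ξ : Vh Nx Ny k) : ℝ := rsum fun i j x y => val (ξ i j) x y ^ 2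

/-- The `L²` norm squared of the derivative in the first variable. -/
def sqNormX (ξ : Vh Nx Ny k) : ℝ := rsum fun i j x y => dval (ξ i j) x y ^ 2

lemma sqNorm_swapV (ξ : Vh Nx Ny k) : sqNorm (swapV ξ) = sqNorm ξ := by
  rw [sqNorm, sqNorm, ← rsum_swap fun i j => by unfold uncurry; fun_prop]; simp only [swapV, val_swapC]

lemma swapV_swapV (ξ : Vh Nx Ny k) : swapV (swapV ξ) = ξ := rfl

lemma rsum_orth (k : ℕ) {ε : ℝ} (hε : 0 < ε) (M : ℝ) : ∃ K : ℝ, 0 < K ∧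
    ∀ (Nx Ny : ℕ) [NeZero Nx] [NeZero Ny] (E : Fin Nx → Fn₂) (c c' : Fn₂) (ξ : Vh Nx Ny k), (∀ i, C₂ (E i)) →
    (∀ i y, ∮ x Nx i, E i x y = 0) →
    (∀ i, ∀ x ∈ cell Nx i, ∀ y, |E i x y| ≤ M * step Nx ^ (k + 1)) →
    C₂ c → (∀ x y, HasDerivAt (fun x => c x y) (c' x y) x) →
    Continuous (uncurry c') → (∀ x y, |c x y| ≤ M) → (∀ x y, |c' x y| ≤ M) →
    rsum (fun i j x y => E i x y * c x y * val (ξ i j) x y) ≤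
      ε * sqNormX ξ + K * (sqNorm ξ + step Nx ^ (2 * k + 4)) := by
  obtain ⟨K, hK, h⟩ := line_orth k hε M; have hpi := pi_pos; refine ⟨K * (1 + 2 * π), pos!, ?_⟩
  intro Nx Ny _ _ E c c' ξ hE h0 hEb hc hcd hc' hcb hcb'; have hs := step_pos Nx
  set H := step Nx ^ (2 * k + 4); have hH0 : 0 < H := pos!
  have c0 : ∀ (i : Fin Nx) (j : Fin Ny), C₂ fun x y => E i x y * c x y * val (ξ i j) x y := fun i j => by
    have := hE i; unfold uncurry at this hc ⊢; fun_prop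
  have c1 : ∀ (i : Fin Nx) (j : Fin Ny), C₂ fun x y => dval (ξ i j) x y ^ 2 := fun i j => cont₂ fp!
  have c2 : ∀ (i : Fin Nx) (j : Fin Ny), C₂ fun x y => val (ξ i j) x y ^ 2 := fun i j => cont₂ fp!
  have key : rsum (fun i j x y => E i x y * c x y * val (ξ i j) x y) ≤ ∑ j : Fin Ny, ∮ y Ny j,
        (ε * cellSum (fun i x => dval (ξ i j) x y ^ 2) + K * (cellSum (fun i x => val (ξ i j) x y ^ 2) + H)) := by
    refine sum_le_sum fun j _ => ii_mono (left_lt_right Ny j).le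
      ((continuous_cellSum c0 j).intervalIntegrable _ _) ?_ fun y hy => ?_
    · apply Continuous.intervalIntegrable; have := continuous_cellSum c1 j; have := continuous_cellSum c2 j; fun_prop
    · have := h Nx (fun i x => E i x y) (fun x => c x y) (fun x => c' x y)
        (fun i => polyX (ξ i j) y) (fun i => (hE i).comp (Continuous.prodMk_left y))
        (fun i => h0 i y) (fun i x hx => hEb i x hx y) (fun x => hcd x y)
        (hc'.comp (Continuous.prodMk_left y)) (fun x => hcb x y) (fun x => hcb' x y)
      simp only [polyX_eval] at this; exact this
  have e : ∑ j : Fin Ny, ∮ y Ny j,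
        (ε * cellSum (fun i x => dval (ξ i j) x y ^ 2) + K * (cellSum (fun i x => val (ξ i j) x y ^ 2) + H)) =
      ε * sqNormX ξ + K * (sqNorm ξ + 2 * π * H) := by
    rw [sqNormX, sqNorm, rsum, rsum, ← sum_step Ny H, ← sum_add_distrib, mul_sum, mul_sum, ← sum_add_distrib]
    refine sum_congr rfl fun j _ => ?_; have a1 := continuous_cellSum c1 j; have a2 := continuous_cellSum c2 j
    rw [ii_add (ii fp!) (ii fp!), ii_const_mul, ii_const_mul, ii_add (ii fp!) (ii fp!), ii_const,
      right_sub_left, smul_eq_mul]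
  rw [e] at key; have hX : 0 ≤ sqNorm ξ := rsum_nonneg fun i j x y => sq_nonneg _
  have n1 : 0 ≤ K * (2 * π) * sqNorm ξ := pos!; have n2 : 0 ≤ K * H := pos!; linarith

/-- The terms coming from the projection error in the second variable. -/
lemma cross_estimate (hf : C∞ f) (M : ℝ) {ε : ℝ} (hε : 0 < ε) :
    ∃ K : ℝ, 0 < K ∧ ∀ (Nx Ny : ℕ) [NeZero Nx] [NeZero Ny] (U : Jet), Smooth2 (k + 2) M U → ∀ ξ : Vh Nx Ny k,
      rsum (fun i j x y => (deriv (deriv f) (U 0 0 x y) * U 1 0 x y * prErr (swapU U) 0 j y x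
        + deriv f (U 0 0 x y) * prErr (swapU U) 1 j y x
        - prErr (swapU U) 2 j y x) * val (ξ i j) x y) ≤
      ε * sqNormX (swapV ξ) + K * (sqNorm ξ + step Ny ^ (2 * k + 4)) := by
  obtain ⟨B, hB, hb⟩ := smooth1_prErr; obtain ⟨L, hL, l1, -⟩ := smooth_flux_bounds hf M
  by_cases hM : 0 ≤ M
  swap
  · exact ⟨1, one_pos, fun Nx Ny _ _ U hU => absurd hU.nonneg hM⟩
  set Q := B * M + L * M + L + L * M * M + L * M + 1; have p1 : 0 ≤ B * M := pos!; have p2 : 0 ≤ L * M := pos!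
  have p3 : 0 ≤ L * M * M := pos!; obtain ⟨K, hK, hr⟩ := rsum_orth k (pos! : 0 < ε / 3) Q
  refine ⟨3 * K, pos!, ?_⟩; intro Nx Ny _ _ U hU ξ; have hs := step_pos Ny; have h1 := hf.drv
  have h2 := h1.drv; have h3 := h2.drv; have d1 := h1.hd; have d2 := h2.hd
  have cf1 := h1.continuous; have cf2 := h2.continuous; have cf3 := h3.continuous
  have cU00 := hU.swap.cont 0 0; have cU10 := hU.swap.cont 0 1; have cU01 := hU.swap.cont 1 0
  have cU11 := hU.swap.cont 1 1
  have bd : ∀ a ≤ 1, ∀ b ≤ 1, ∀ x y, |swapU U a b x y| ≤ M := fun a ha b hb' x y => hU.swap.bd a om! b om! x y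
  have eb : ∀ n ≤ 2, ∀ j : Fin Ny, ∀ y ∈ cell Ny j, ∀ x,
      |prErr (swapU U) n j y x| ≤ Q * step Ny ^ (k + 1) := fun n hn j y hy x =>
    ((hb Ny _ M hU.swap j y hy).bd n om! x).trans (by gcongr; linarith)
  have e0 := fun n (j : Fin Ny) => continuous_prErr (k := k) (β := β) (θ := θ) hU.swap n j
  have ez := fun n (j : Fin Ny) x => integral_prErr hU.swap n j x; unfold uncurry at cU00 cU10 cU01 cU11
  have r0 := hr Ny Nx (fun j y x => prErr (swapU U) 0 j y x)
    (fun y x => deriv (deriv f) (swapU U 0 0 y x) * swapU U 0 1 y x)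
    (fun y x => deriv (deriv (deriv f)) (swapU U 0 0 y x) * swapU U 1 0 y x * swapU U 0 1 y x
      + deriv (deriv f) (swapU U 0 0 y x) * swapU U 1 1 y x) (swapV ξ) (e0 0) (ez 0) (eb 0 om!)
    (cont₂ fp!)
    (fun y x => ((d2 _).comp y (hU.swap.dx 0 0 y x)).mul (hU.swap.dx 0 1 y x))
    (cont₂ fp!)
    (fun y x => by
      rw [abs_mul]; have := mul_le_mul (l1 _ (bd 0 om! 0 om! y x)).2.2.1 (bd 0 om! 1 om! y x) (abs_nonneg _) hL.le
      linarith)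
    (fun y x => by
      refine (abs_add_le _ _).trans ?_; rw [abs_mul, abs_mul, abs_mul]
      have a1 := (l1 _ (bd 0 om! 0 om! y x)).2.2.2; have a2 := (l1 _ (bd 0 om! 0 om! y x)).2.2.1
      have a3 := bd 1 om! 0 om! y x; have a4 := bd 0 om! 1 om! y x; have a5 := bd 1 om! 1 om! y x
      calc _ ≤ L * M * M + L * M := by gcongr
        _ ≤ Q := by linarith)
  have r1 := hr Ny Nx (fun j y x => prErr (swapU U) 1 j y x) (fun y x => deriv f (swapU U 0 0 y x))
    (fun y x => deriv (deriv f) (swapU U 0 0 y x) * swapU U 1 0 y x) (swapV ξ) (e0 1) (ez 1)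
    (eb 1 om!)
    (cont₂ fp!) (fun y x => (d1 _).comp y (hU.swap.dx 0 0 y x))
    (cont₂ fp!)
    (fun y x => (l1 _ (bd 0 om! 0 om! y x)).2.1.trans (by linarith))
    (fun y x => by
      rw [abs_mul]; have := mul_le_mul (l1 _ (bd 0 om! 0 om! y x)).2.2.1 (bd 1 om! 0 om! y x) (abs_nonneg _) hL.le
      linarith)
  have r2 := hr Ny Nx (fun j y x => prErr (swapU U) 2 j y x)
    (fun y x => -1) (fun y x => 0) (swapV ξ) (e0 2) (ez 2) (eb 2 le_rfl)
    (cont₂ fp!) (fun y x => hasDerivAt_const _ _)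
    (cont₂ fp!) (fun y x => by simp; linarith) (fun y x => by simp; linarith)
  rw [sqNorm_swapV] at r0 r1 r2; have c0 := fun j : Fin Ny => e0 0 j; have c1 := fun j : Fin Ny => e0 1 j
  have c2 := fun j : Fin Ny => e0 2 j
  have k0 : ∀ (j : Fin Ny) (i : Fin Nx), C₂ fun y x =>
      prErr (swapU U) 0 j y x * (deriv (deriv f) (swapU U 0 0 y x) * swapU U 0 1 y x)
        * val (swapV ξ j i) y x := fun j i => by
    have := c0 j; unfold uncurry at this ⊢; fun_prop
  have k1 : ∀ (j : Fin Ny) (i : Fin Nx), C₂ fun y x =>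
      prErr (swapU U) 1 j y x * deriv f (swapU U 0 0 y x) * val (swapV ξ j i) y x := fun j i => by
    have := c1 j; unfold uncurry at this ⊢; fun_prop
  have k2 : ∀ (j : Fin Ny) (i : Fin Nx), C₂ fun y x =>
      prErr (swapU U) 2 j y x * (-1) * val (swapV ξ j i) y x := fun j i => by
    have := c2 j; unfold uncurry at this ⊢; fun_prop
  have k01 : ∀ (j : Fin Ny) (i : Fin Nx), C₂ fun y x =>
      prErr (swapU U) 0 j y x * (deriv (deriv f) (swapU U 0 0 y x) * swapU U 0 1 y x)
        * val (swapV ξ j i) y x + prErr (swapU U) 1 j y x * deriv f (swapU U 0 0 y x)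
        * val (swapV ξ j i) y x := fun j i => (k0 j i).add (k1 j i)
  have k012 := fun (j : Fin Ny) (i : Fin Nx) => (k01 j i).add (k2 j i); have tot := rsum_add k01 k2
  rw [rsum_add k0 k1] at tot
  have sw := rsum_swap (F := fun j i y x =>
      prErr (swapU U) 0 j y x * (deriv (deriv f) (swapU U 0 0 y x) * swapU U 0 1 y x)
        * val (swapV ξ j i) y x + prErr (swapU U) 1 j y x * deriv f (swapU U 0 0 y x)
        * val (swapV ξ j i) y x + prErr (swapU U) 2 j y x * (-1)
        * val (swapV ξ j i) y x) k012
  have e : (fun (i : Fin Nx) (j : Fin Ny) x y => (deriv (deriv f) (U 0 0 x y) * U 1 0 x y * prErr (swapU U) 0 j y x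
        + deriv f (U 0 0 x y) * prErr (swapU U) 1 j y x
        - prErr (swapU U) 2 j y x) * val (ξ i j) x y) = fun i j x y =>
      prErr (swapU U) 0 j y x * (deriv (deriv f) (swapU U 0 0 y x) * swapU U 0 1 y x)
        * val (swapV ξ j i) y x + prErr (swapU U) 1 j y x * deriv f (swapU U 0 0 y x)
        * val (swapV ξ j i) y x + prErr (swapU U) 2 j y x * (-1)
        * val (swapV ξ j i) y x := by
    funext i j x y; rw [swapV, val_swapC]; simp only [swapU]; ring
  rw [e, sw, tot]; linarith

lemma row_estimate (hf1 : C∞ f1) (hf2 : C∞ f2) (hg : LocallyLipschitz (uncurry g)) (hd : ∀ a, g a a = f1 a) (M ρ : ℝ) :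
    ∃ c : ℝ, 0 < c ∧ ∀ ε : ℝ, 0 < ε → ∃ K : ℝ, 0 < K ∧
    ∀ (Nx Ny : ℕ) [NeZero Nx] [NeZero Ny], step Ny ≤ ρ * step Nx →
      ∀ (U : Jet), Smooth2 (k + 2) M U → ∀ w ξ : Vh Nx Ny k,
      ξ = w - cmp Nx Ny f1 f2 U →
      (∀ i j, ∀ x ∈ cell Nx i, ∀ y ∈ cell Ny j,
        |val (ξ i j) x y| ≤ 1) →
      rowForm β θ f1 g w ξ - rsum (fun i j x y => (U 2 0 x y - deriv f1 (U 0 0 x y) * U 1 0 x y) * val (ξ i j) x y) ≤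
      - c * sqNormX ξ + ε * sqNormX (swapV ξ) + K * (sqNorm ξ + (step Nx ^ (2 * k + 4) + step Ny ^ (2 * k + 4))) := by
  obtain ⟨M', hM'⟩ := exists_lineData hf1 hf2 M ρ; obtain ⟨c, K, hc, hK, hl⟩ := line_estimate hf1 hg hd M'
  refine ⟨c, hc, fun ε hε => ?_⟩; obtain ⟨K', hK', hx⟩ := cross_estimate hf1 M hε; have hpi := pi_pos
  refine ⟨K * (1 + 2 * π) + K', pos!, ?_⟩; intro Nx Ny _ _ hr U hU w ξ hξ hξ1; have hsx := step_pos Nx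
  have hsy := step_pos Ny; set H := step Nx ^ (2 * k + 4); have hH0 : 0 < H := pos!
  have hHy : 0 < step Ny ^ (2 * k + 4) := pos!; have h1 := hf1.drv; have h2 := h1.drv
  have cf0 := hf1.continuous; have cf1 := h1.continuous; have cf2 := h2.continuous
  have u00 := hU.cont 0 0; have u10 := hU.cont 1 0; have u20 := hU.cont 2 0; unfold uncurry at u00 u10 u20
  have e0 : ∀ n (j : Fin Ny), Continuous fun z : ℝ × ℝ => prErr (swapU U) n j z.2 z.1 :=
    fun n j => (continuous_prErr hU.swap n j).comp continuous_swap
  have cA : ∀ (i : Fin Nx) (j : Fin Ny), C₂ fun x y =>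
      (U 2 0 x y - deriv f1 (U 0 0 x y) * U 1 0 x y) * val (ξ i j) x y := fun i j => by
    unfold uncurry; fun_prop
  have cX : ∀ (i : Fin Nx) (j : Fin Ny), C₂ fun x y => dval (ξ i j) x y ^ 2 := fun i j => cont₂ fp!
  have c0 : ∀ (i : Fin Nx) (j : Fin Ny), C₂ fun x y => val (ξ i j) x y ^ 2 := fun i j => cont₂ fp!
  have cE : ∀ (i : Fin Nx) (j : Fin Ny), C₂ fun x y =>
      (deriv (deriv f1) (U 0 0 x y) * U 1 0 x y * prErr (swapU U) 0 j y x
        + deriv f1 (U 0 0 x y) * prErr (swapU U) 1 j y x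
        - prErr (swapU U) 2 j y x) * val (ξ i j) x y := fun i j => by
    have := e0 0 j; have := e0 1 j; have := e0 2 j; unfold uncurry; fun_prop
  have cB : ∀ j : Fin Ny, Continuous fun y => B1 β θ f1 g (fun i => polyX (w i j) y) (fun i => polyX (ξ i j) y) := by
    intro j; simp only [B1, ← lineX_eq, polyX_eval]
    have t1 : Continuous fun y => cellSum fun (i : Fin Nx) x =>
        (f1 (val (w i j) x y) - dval (w i j) x y) * dval (ξ i j) x y :=
      continuous_cellSum (F := fun i j x y => (f1 (val (w i j) x y) - dval (w i j) x y) * dval (ξ i j) x y)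
        (fun i j => cont₂ fp!) j
    have t2 := fun i => continuous_totalFlux_lineX (β := β) (θ := θ) hg.continuous w j i
    have t3 := fun i => continuous_jump_lineX ξ j i; have t4 := fun i => continuous_jump_lineX w j i
    have t5 : ∀ i : Fin Nx, Continuous fun y => avg (pfun fun m => 𝒟 (polyX (ξ m j) y)) i := by
      intro i
      change Continuous fun y => (dval (ξ i j) (right Nx i) y + dval (ξ (i + 1) j) (left Nx (i + 1)) y) / 2
      fun_prop
    exact (t1.add (continuous_finsetSum _ fun i _ => (t2 i).mul (t3 i))).sub
      (continuous_finsetSum _ fun i _ => (t4 i).mul (t5 i))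
  have key : rowForm β θ f1 g w ξ
      - rsum (fun i j x y => (U 2 0 x y - deriv f1 (U 0 0 x y) * U 1 0 x y) * val (ξ i j) x y) ≤
      ∑ j : Fin Ny, ∮ y Ny j,
        (- c * cellSum (fun i x => dval (ξ i j) x y ^ 2) + K * (cellSum (fun i x => val (ξ i j) x y ^ 2) + H)
          + cellSum (fun i x => (deriv (deriv f1) (U 0 0 x y) * U 1 0 x y * prErr (swapU U) 0 j y x
            + deriv f1 (U 0 0 x y) * prErr (swapU U) 1 j y x
            - prErr (swapU U) 2 j y x) * val (ξ i j) x y)) := by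
    rw [rowForm, rsum, ← sum_sub_distrib]; refine sum_le_sum fun j _ => ?_; have a1 := cB j
    have a2 := continuous_cellSum cA j; have a3 := continuous_cellSum cX j; have a4 := continuous_cellSum c0 j
    have a5 := continuous_cellSum cE j; rw [← ii_sub (a1.intervalIntegrable _ _) (a2.intervalIntegrable _ _)]
    refine ii_mono (left_lt_right Ny j).le ((a1.sub a2).intervalIntegrable _ _) (ii fp!) fun y hy => ?_
    have hd := hM' Nx Ny hr U hU w (fun i j x hx y hy => by
      have := hξ1 i j x hx y hy
      rwa [hξ] at this) j y hy
    have := hl Nx _ _ _ _ _ _ _ hd; rw [hξ]; simp only [polyX_eval] at this; exact this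
  have e : ∑ j : Fin Ny, ∮ y Ny j,
        (- c * cellSum (fun i x => dval (ξ i j) x y ^ 2) + K * (cellSum (fun i x => val (ξ i j) x y ^ 2) + H)
          + cellSum (fun i x => (deriv (deriv f1) (U 0 0 x y) * U 1 0 x y * prErr (swapU U) 0 j y x
            + deriv f1 (U 0 0 x y) * prErr (swapU U) 1 j y x
            - prErr (swapU U) 2 j y x) * val (ξ i j) x y)) =
      - c * sqNormX ξ + K * (sqNorm ξ + 2 * π * H) + rsum (fun i j x y =>
            (deriv (deriv f1) (U 0 0 x y) * U 1 0 x y * prErr (swapU U) 0 j y x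
            + deriv f1 (U 0 0 x y) * prErr (swapU U) 1 j y x
            - prErr (swapU U) 2 j y x) * val (ξ i j) x y) := by
    rw [sqNormX, sqNorm, rsum, rsum, rsum, ← sum_step Ny H, ← sum_add_distrib, mul_sum,
      mul_sum, ← sum_add_distrib, ← sum_add_distrib]
    refine sum_congr rfl fun j _ => ?_; have a3 := continuous_cellSum cX j; have a4 := continuous_cellSum c0 j
    have a5 := continuous_cellSum cE j
    rw [ii_add (ii fp!) (a5.intervalIntegrable _ _), ii_add (ii fp!) (ii fp!), ii_const_mul, ii_const_mul, ii_add
      (ii fp!)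
      (ii fp!), ii_const,
      right_sub_left, smul_eq_mul]
  rw [e] at key; have hx' := hx Nx Ny U hU ξ; have hX : 0 ≤ sqNorm ξ := rsum_nonneg fun i j x y => sq_nonneg _
  have n1 : 0 ≤ K * (2 * π) * sqNorm ξ := pos!; have n2 : 0 ≤ K * H := pos!
  have n3 : 0 ≤ (K * (1 + 2 * π)) * step Ny ^ (2 * k + 4) := pos!; have n4 : 0 ≤ K' * H := pos!; linarith

/-- The error of the tensor product projection is the sum of the errors in the two variables, up to
terms of higher order. -/
lemma tens_error (M ρ : ℝ) : ∃ K : ℝ, 0 < K ∧ ∀ (Nx Ny : ℕ) [NeZero Nx] [NeZero Ny],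
    step Ny ≤ ρ * step Nx → ∀ U : Jet, Smooth2 (k + 2) M U →
    ∀ i j, ∀ x ∈ cell Nx i, ∀ y ∈ cell Ny j,
      |U 0 0 x y - val (tens Nx Ny U i j) x y - prErr U 0 i x y - prErr (swapU U) 0 j y x| ≤ K * step Nx ^ (k + 2) ∧
      |U 1 0 x y - dval (tens Nx Ny U i j) x y
        - (U 1 0 x y - (𝒟 (pr Nx (fun x => U 0 0 x y) (fun x => U 1 0 x y) i)).eval x)
        - prErr (swapU U) 1 j y x| ≤ K * step Nx ^ (k + 1) := by
  obtain ⟨B, hB, hb⟩ := smooth1_prErr; obtain ⟨B', hB', hb'⟩ := pr_error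
  by_cases hM : 0 ≤ M
  swap
  · exact ⟨1, one_pos, fun Nx Ny _ _ _ U hU => absurd hU.nonneg hM⟩
  by_cases hρ : 0 < ρ
  swap
  · refine ⟨1, one_pos, fun Nx Ny _ _ h => ?_⟩; have := step_pos Nx; have := step_pos Ny; nlinarith
  set Q := (2 * π + 1) ^ (k + 2)
  have hQ0 : 0 < Q := by have := pi_pos; positivity
  refine ⟨B' * (B * M * ρ ^ (k + 1)) * Q + 1, pos!, ?_⟩; intro Nx Ny _ _ hr U hU i j x hx y hy
  have hsx := step_pos Nx; have hsy := step_pos Ny; have he := hb Ny _ M hU.swap j y hy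
  obtain ⟨h0, h1⟩ := (hb' Nx _ _ he).1 i x hx
  have hP : polyX (tens Nx Ny U i j) y = pr Nx (fun x => U 0 0 x y) (fun x => U 1 0 x y) i -
      pr Nx (prErr (swapU U) 0 j y) (prErr (swapU U) 1 j y) i := by
    rw [polyX_tens' hU, pr_sub (hU.cx 0 0 y) (he.continuous 0)]
  have ry : step Ny ^ (k + 1) ≤ ρ ^ (k + 1) * step Nx ^ (k + 1) := by rw [← mul_pow]; gcongr
  have q1 : step Nx ^ k ≤ Q := step_pow_le om!; constructor
  · rw [← polyX_eval, hP, eval_sub, prErr]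
    have e : ∀ a b c d : ℝ, a - (b - c) - (a - b) - d = -(d - c) := fun a b c d => by ring
    rw [e, abs_neg]; refine h0.trans ?_
    calc B' * (B * M * step Ny ^ (k + 1)) * step Nx ^ (k + 1)
        ≤ B' * (B * M * (ρ ^ (k + 1) * step Nx ^ (k + 1))) * step Nx ^ (k + 1) := by gcongr
      _ = B' * (B * M * ρ ^ (k + 1)) * step Nx ^ k * step Nx ^ (k + 2) := by ring
      _ ≤ B' * (B * M * ρ ^ (k + 1)) * Q * step Nx ^ (k + 2) := by gcongr
      _ ≤ _ := by gcongr; linarith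
  · rw [dval, hP, derivative_sub, eval_sub]
    have e : ∀ a b c d : ℝ, a - (b - c) - (a - b) - d = -(d - c) := fun a b c d => by ring
    rw [e, abs_neg]; refine h1.trans ?_
    calc B' * (B * M * step Ny ^ (k + 1)) * step Nx ^ k
        ≤ B' * (B * M * (ρ ^ (k + 1) * step Nx ^ (k + 1))) * step Nx ^ k := by gcongr
      _ = B' * (B * M * ρ ^ (k + 1)) * step Nx ^ k * step Nx ^ (k + 1) := by ring
      _ ≤ B' * (B * M * ρ ^ (k + 1)) * Q * step Nx ^ (k + 1) := by gcongr
      _ ≤ _ := by gcongr; linarith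

lemma time_estimate (hf1 : C∞ f1) (hf2 : C∞ f2) (M ρ : ℝ) {ε : ℝ}
    (hε : 0 < ε) : ∃ K : ℝ, 0 < K ∧ ∀ (Nx Ny : ℕ) [NeZero Nx] [NeZero Ny],
    step Ny ≤ ρ * step Nx → ∀ U V : Jet, Smooth2 (k + 2) M U → Smooth2 (k + 2) M V →
    ∀ ξ : Vh Nx Ny k, rsum (fun i j x y => (V 0 0 x y - val (cmp' Nx Ny f1 f2 U V i j) x y)
        * val (ξ i j) x y) ≤ ε * sqNormX ξ + ε * sqNormX (swapV ξ)
        + K * (sqNorm ξ + (step Nx ^ (2 * k + 4) + step Ny ^ (2 * k + 4))) := by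
  obtain ⟨B, hB, hb⟩ := smooth1_prErr; obtain ⟨K1, hK1, ht⟩ := tens_error M ρ
  obtain ⟨K2, hK2, hc2⟩ := corX'_bound hf1 M; obtain ⟨K3, hK3, hc3⟩ := corX'_bound hf2 M
  by_cases hM : 0 ≤ M
  swap
  · exact ⟨1, one_pos, fun Nx Ny _ _ _ U V hU => absurd hU.nonneg hM⟩
  obtain ⟨K4, hK4, ho⟩ := rsum_orth k hε (B * M + 1); set Q := K1 + K2 + K3
  refine ⟨2 * K4 + (2 * π) ^ 2 * Q ^ 2 + 1, pos!, ?_⟩; intro Nx Ny _ _ hr U V hU hV ξ; have hsx := step_pos Nx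
  have hsy := step_pos Ny; have p0 : 0 ≤ B * M := pos!
  have ex := fun i : Fin Nx => continuous_prErr (k := k) (β := β) (θ := θ) hV 0 i
  have ey := fun j : Fin Ny => continuous_prErr (k := k) (β := β) (θ := θ) hV.swap 0 j
  have bx : ∀ i : Fin Nx, ∀ x ∈ cell Nx i, ∀ y,
      |prErr V 0 i x y| ≤ (B * M + 1) * step Nx ^ (k + 1) := fun i x hx y =>
    ((hb Nx V M hV i x hx).bd 0 om! y).trans (by gcongr; linarith)
  have by' : ∀ i : Fin Ny, ∀ x ∈ cell Ny i, ∀ y,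
      |prErr (swapU V) 0 i x y| ≤ (B * M + 1) * step Ny ^ (k + 1) := fun i x hx y =>
    ((hb Ny _ M hV.swap i x hx).bd 0 om! y).trans (by gcongr; linarith)
  have one : |(1 : ℝ)| ≤ B * M + 1 := by rw [abs_one]; linarith
  have zero : |(0 : ℝ)| ≤ B * M + 1 := by rw [abs_zero]; linarith
  have r1 := ho Nx Ny (fun i x y => prErr V 0 i x y) (fun _ _ => 1) (fun _ _ => 0) ξ
    ex (fun i y => integral_prErr hV 0 i y) bx continuous_const
    (fun x y => hasDerivAt_const _ _) continuous_const (fun _ _ => one) (fun _ _ => zero)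
  have r2 := ho Ny Nx (fun i x y => prErr (swapU V) 0 i x y) (fun _ _ => 1) (fun _ _ => 0)
    (swapV ξ) ey (fun i y => integral_prErr hV.swap 0 i y) by' continuous_const
    (fun x y => hasDerivAt_const _ _) continuous_const (fun _ _ => one) (fun _ _ => zero)
  simp only [mul_one] at r1 r2; rw [sqNorm_swapV] at r2; have v00 := hV.cont 0 0; unfold uncurry at v00
  have cy : ∀ (i : Fin Nx) (j : Fin Ny), C₂ fun x y => prErr (swapU V) 0 j y x * val (ξ i j) x y := fun i j => by
    have := (ey j).comp continuous_swap; unfold uncurry at this ⊢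
    simp only [Function.comp_def, Prod.fst_swap, Prod.snd_swap] at this; fun_prop
  have cx : ∀ (i : Fin Nx) (j : Fin Ny), C₂ fun x y => prErr V 0 i x y * val (ξ i j) x y := fun i j => by
    have := ex i; unfold uncurry at this ⊢; fun_prop
  have sw : rsum (fun j i x y => prErr (swapU V) 0 j x y * val (swapV ξ j i) x y) =
      rsum (fun i j x y => prErr (swapU V) 0 j y x * val (ξ i j) x y) := by
    rw [← rsum_swap cy]; simp only [swapV, val_swapC]
  rw [sw] at r2
  set R : Fin Nx → Fin Ny → Fn₂ := fun i j x y => V 0 0 x y - val (cmp' Nx Ny f1 f2 U V i j) x y - prErr V 0 i x y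
    - prErr (swapU V) 0 j y x with hR
  have cR : ∀ i j, C₂ (R i j) := fun i j => by
    have a1 := (ey j).comp continuous_swap; have a2 := ex i; unfold uncurry at a1 a2 ⊢
    simp only [Function.comp_def, Prod.fst_swap, Prod.snd_swap] at a1; simp only [hR]; fun_prop
  have hRb : ∀ i j, ∀ x ∈ cell Nx i, ∀ y ∈ cell Ny j,
      |R i j x y| ≤ Q * (step Nx ^ (k + 2) + step Ny ^ (k + 2)) := by
    intro i j x hx y hy; have t := (ht Nx Ny hr V hV i j x hx y hy).1
    have c2 := hc2 Nx U V hU hV i x hx (mid Ny j); have c3 := hc3 Ny _ _ hU.swap hV.swap j y hy (mid Nx i)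
    have e : R i j x y = (V 0 0 x y - val (tens Nx Ny V i j) x y - prErr V 0 i x y
        - prErr (swapU V) 0 j y x) + (corX' Nx f1 U V (mid Ny j) i).eval x
        + (corX' Ny f2 (swapU U) (swapU V) (mid Nx i) j).eval y := by
      have : val (cmp' Nx Ny f1 f2 U V i j) x y = val (tens Nx Ny V i j) x y - (corX' Nx f1 U V (mid Ny j) i).eval x
          - (corX' Ny f2 (swapU U) (swapU V) (mid Nx i) j).eval y := by
        rw [← polyX_eval, cmp', polyX_sub, polyX_sub, polyX_ofX (natDegree_corX'_le ..),
          polyX_swapC_ofX (natDegree_corX'_le ..), eval_sub, eval_sub, polyX_eval, eval_C]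
      simp only [hR, this]; ring
    rw [e]; refine (abs_add_le _ _).trans ((add_le_add (abs_add_le _ _) le_rfl).trans ?_)
    have n1 : 0 ≤ K3 * step Nx ^ (k + 2) := pos!; have n2 : 0 ≤ (K1 + K2) * step Ny ^ (k + 2) := pos!; linarith
  set H := step Nx ^ (2 * k + 4) + step Ny ^ (2 * k + 4); have hH0 : 0 < H := pos!
  have r3 : rsum (fun i j x y => R i j x y * val (ξ i j) x y) ≤ sqNorm ξ + (2 * π) ^ 2 * (Q ^ 2 * H) := by
    rw [sqNorm, ← rsum_const (Nx := Nx) (Ny := Ny) (Q ^ 2 * H), ← rsum_add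
      (fun i j => cont₂ fp!) (fun i j => continuous_const)]
    refine rsum_le (fun i j => ?_) (fun i j => cont₂ fp!) fun i j x hx y hy => ?_
    · have := cR i j; unfold uncurry at this ⊢; fun_prop
    have y1 := young one_pos (R i j x y) (val (ξ i j) x y)
    have y2 : R i j x y ^ 2 ≤ (Q * (step Nx ^ (k + 2) + step Ny ^ (k + 2))) ^ 2 := by
      rw [← sq_abs]; exact pow_le_pow_left₀ (abs_nonneg _) (hRb i j x hx y hy) 2
    have y3 := add_sq_le_two (step Nx ^ (k + 2)) (step Ny ^ (k + 2))
    have e1 : ∀ s : ℝ, (s ^ (k + 2)) ^ 2 = s ^ (2 * k + 4) := fun s => by rw [← pow_mul]; congr 1; ring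
    rw [e1, e1] at y3; rw [mul_pow] at y2
    have y4 : Q ^ 2 * (step Nx ^ (k + 2) + step Ny ^ (k + 2)) ^ 2 ≤ Q ^ 2 * (2 * H) := by gcongr; linarith
    have y5 := mul_nonneg (sq_nonneg Q) hH0.le; linarith
  have tot : rsum (fun i j x y => (V 0 0 x y - val (cmp' Nx Ny f1 f2 U V i j) x y)
        * val (ξ i j) x y) = rsum (fun i j x y => R i j x y * val (ξ i j) x y)
      + rsum (fun i j x y => prErr V 0 i x y * val (ξ i j) x y)
      + rsum (fun i j x y => prErr (swapU V) 0 j y x * val (ξ i j) x y) := by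
    have cRv : ∀ i j, C₂ fun x y => R i j x y * val (ξ i j) x y := fun i j => by
        have := cR i j; unfold uncurry at this ⊢; fun_prop
    rw [← rsum_add cRv cx, ← rsum_add (fun i j => by
      have a1 := cRv i j; have a2 := cx i j; unfold uncurry at a1 a2 ⊢
      exact a1.add a2) cy]
    congr 1; funext i j x y; simp only [hR]; ring
  rw [tot]; have hX : 0 ≤ sqNorm ξ := rsum_nonneg fun i j x y => sq_nonneg _
  have n1 : 0 ≤ ((2 * π) ^ 2 * Q ^ 2) * sqNorm ξ := pos!; have n2 : 0 ≤ K4 * step Nx ^ (2 * k + 4) := pos!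
  have n3 : 0 ≤ K4 * step Ny ^ (2 * k + 4) := pos!; linarith

/-- The energy estimate for the difference of the discrete solution and the comparison function. -/
lemma energy_estimate (hf1 : C∞ f1) (hf2 : C∞ f2)
    {g1 g2 : Fn₂} (hg1 : LocallyLipschitz (uncurry g1)) (hd1 : ∀ a, g1 a a = f1 a)
    (hg2 : LocallyLipschitz (uncurry g2)) (hd2 : ∀ a, g2 a a = f2 a) (M ρ : ℝ) :
    ∃ K : ℝ, 0 < K ∧ ∀ (Nx Ny : ℕ) [NeZero Nx] [NeZero Ny], step Nx ≤ ρ * step Ny → step Ny ≤ ρ * step Nx →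
      ∀ (U V : Jet), Smooth2 (k + 2) M U → Smooth2 (k + 2) M V →
      (∀ x y, V 0 0 x y = U 2 0 x y + U 0 2 x y - deriv f1 (U 0 0 x y) * U 1 0 x y
        - deriv f2 (U 0 0 x y) * U 0 1 x y) →
      ∀ w d ξ : Vh Nx Ny k, ξ = w - cmp Nx Ny f1 f2 U →
      (∀ i j, ∀ x ∈ cell Nx i, ∀ y ∈ cell Ny j,
        |val (ξ i j) x y| ≤ 1) →
      (∀ (i : Fin Nx) (j : Fin Ny) (c : Coef k),
        ∮ x Nx i, ∮ y Ny j, val (d i j) x y * val c x y = schemeRHS β θ f1 f2 g1 g2 w i j c) →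
      rsum (fun i j x y => (val (d i j) x y - val (cmp' Nx Ny f1 f2 U V i j) x y) * val (ξ i j) x y) ≤
        K * (sqNorm ξ + (step Nx ^ (2 * k + 4) + step Ny ^ (2 * k + 4))) := by
  obtain ⟨c1, hc1, h1⟩ := row_estimate hf1 hf2 hg1 hd1 M ρ
  obtain ⟨c2, hc2, h2⟩ := row_estimate hf2 hf1 hg2 hd2 M ρ; set ε := min c1 c2 / 2 with hε; have hε0 : 0 < ε := pos!
  have he1 : 2 * ε ≤ c1 := by rw [hε]; linarith [min_le_left c1 c2]
  have he2 : 2 * ε ≤ c2 := by rw [hε]; linarith [min_le_right c1 c2]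
  obtain ⟨K1, hK1, h1⟩ := h1 ε hε0; obtain ⟨K2, hK2, h2⟩ := h2 ε hε0
  obtain ⟨K3, hK3, h3⟩ := time_estimate hf1 hf2 M ρ hε0; refine ⟨K1 + K2 + K3, pos!, ?_⟩
  intro Nx Ny _ _ hr1 hr2 U V hU hV hpde w d ξ hξ hξ1 hd; have e1 := h1 Nx Ny hr2 U hU w ξ hξ hξ1
  have e2 := h2 Ny Nx hr1 (swapU U) hU.swap (swapV w) (swapV ξ) (by rw [← swapV_cmp hU, hξ]; rfl)
    (fun j i y hy x hx => by rw [swapV, val_swapC]; exact hξ1 i j x hx y hy)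
  rw [sqNorm_swapV, swapV_swapV] at e2; have e3 := h3 Nx Ny hr2 U V hU hV ξ
  have u00 := hU.cont 0 0; have u10 := hU.cont 1 0; have u20 := hU.cont 2 0
  have u01 := hU.cont 0 1; have u02 := hU.cont 0 2; have v00 := hV.cont 0 0
  unfold uncurry at u00 u10 u20 u01 u02 v00; have cf1 := hf1.drv.continuous; have cf2 := hf2.drv.continuous
  have c1' : ∀ (i : Fin Nx) (j : Fin Ny), C₂ fun x y =>
      (U 2 0 x y - deriv f1 (U 0 0 x y) * U 1 0 x y) * val (ξ i j) x y := fun i j => by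
    unfold uncurry; fun_prop
  have c2' : ∀ (i : Fin Nx) (j : Fin Ny), C₂ fun x y =>
      (U 0 2 x y - deriv f2 (U 0 0 x y) * U 0 1 x y) * val (ξ i j) x y := fun i j => by
    unfold uncurry; fun_prop
  have c3' : ∀ (i : Fin Nx) (j : Fin Ny), C₂ fun x y =>
      (V 0 0 x y - val (cmp' Nx Ny f1 f2 U V i j) x y) * val (ξ i j) x y := fun i j => by
    unfold uncurry; fun_prop
  have cd : ∀ (i : Fin Nx) (j : Fin Ny), C₂ fun x y => val (d i j) x y * val (ξ i j) x y := fun i j => cont₂ fp!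
  have sw : rsum (fun j i x y => (swapU U 2 0 x y - deriv f2 (swapU U 0 0 x y) * swapU U 1 0 x y)
      * val (swapV ξ j i) x y) =
      rsum (fun i j x y => (U 0 2 x y - deriv f2 (U 0 0 x y) * U 0 1 x y) * val (ξ i j) x y) := by
    rw [← rsum_swap c2']; simp only [swapV, val_swapC, swapU]
  rw [sw] at e2
  have hs := sum_scheme (β := β) (θ := θ) hf1.continuous hf2.continuous hg1.continuous hg2.continuous w ξ
  have hs2 : rsum (fun i j x y => val (d i j) x y * val (ξ i j) x y) =
      rowForm β θ f1 g1 w ξ + rowForm β θ f2 g2 (swapV w) (swapV ξ) := by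
    rw [rsum_eq cd, ← hs]; exact sum_congr rfl fun i _ => sum_congr rfl fun j _ => hd i j (ξ i j)
  have tot : rsum (fun i j x y => (val (d i j) x y - val (cmp' Nx Ny f1 f2 U V i j) x y)
        * val (ξ i j) x y) = rsum (fun i j x y => val (d i j) x y * val (ξ i j) x y)
      - rsum (fun i j x y => (U 2 0 x y - deriv f1 (U 0 0 x y) * U 1 0 x y) * val (ξ i j) x y)
      - rsum (fun i j x y => (U 0 2 x y - deriv f2 (U 0 0 x y) * U 0 1 x y) * val (ξ i j) x y)
      + rsum (fun i j x y => (V 0 0 x y - val (cmp' Nx Ny f1 f2 U V i j) x y) * val (ξ i j) x y) := by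
    rw [← rsum_sub cd c1', ← rsum_sub (fun i j => cont₂ fp!) c2', ← rsum_add (fun i j => cont₂ fp!) c3']
    congr 1; funext i j x y; rw [hpde]; ring
  rw [tot, hs2]; have hX1 : 0 ≤ sqNormX ξ := rsum_nonneg fun i j x y => sq_nonneg _
  have hX2 : 0 ≤ sqNormX (swapV ξ) := rsum_nonneg fun i j x y => sq_nonneg _
  have m1 := mul_le_mul_of_nonneg_right he1 hX1; have m2 := mul_le_mul_of_nonneg_right he2 hX2; linarith

/-! ### Location of the Gauss and Lobatto points -/

lemma legendre_pos_outside (n : ℕ) {r s : ℝ} (hr : r ^ 2 = 1) (hs : 0 ≤ s) :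
    0 < r ^ n * (legendre n).eval (r * s + r) := by
  have h : ∀ j ∈ Finset.range (n + 1), r ^ n * ((taylor r (legendre n)).coeff j * (r * s) ^ j) =
      (n + j).factorial * (n.choose j) * 2 ^ (n - j) / (2 ^ n * n.factorial) / j.factorial * s ^ j := by
    intro j hj; have e := eval_derivative_legendre n j hr; rw [eval_iterate_derivative_eq_taylor] at e
    have hj0 : (j.factorial : ℝ) ≠ 0 := pos!
    have e2 : (taylor r (legendre n)).coeff j = (n + j).factorial * (n.choose j) * (2 * r) ^ (n - j)
        / (2 ^ n * n.factorial) / j.factorial := by rw [← e]; field_simp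
    have hp : r ^ n * r ^ (n - j) * r ^ j = 1 := by
      rw [mul_assoc, ← pow_add, Nat.sub_add_cancel (Nat.lt_succ_iff.1 (Finset.mem_range.1 hj)), ← pow_add,
        ← two_mul, pow_mul, hr, one_pow]
    rw [e2, mul_pow, mul_pow]
    calc _ = (n + j).factorial * (n.choose j) * 2 ^ (n - j) / (2 ^ n * n.factorial) / j.factorial * s ^ j
        * (r ^ n * r ^ (n - j) * r ^ j) := by ring
      _ = _ := by rw [hp, mul_one]
  rw [← taylor_eval, eval_eq_sum_range, natDegree_taylor, natDegree_legendre, mul_sum, sum_congr rfl h]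
  refine Finset.sum_pos' (fun j _ => pos!) ⟨0, by simp, ?_⟩
  simp only [pow_zero, add_zero, Nat.choose_zero_right]; positivity

lemma legendre_ne_zero_outside (n : ℕ) {x : ℝ} (hx : 1 ≤ |x|) : (legendre n).eval x ≠ 0 := by
  rcases le_abs.1 hx with h | h
  · have := legendre_pos_outside n (r := 1) (s := x - 1) num! (by linarith); intro h0; simp [h0] at this
  · have := legendre_pos_outside n (r := -1) (s := -x - 1) num! (by linarith); intro h0
    rw [show -1 * (-x - 1) + -1 = x by ring, h0, mul_zero] at this; exact this.false

lemma mem_of_mem_gaussPts {s : ℝ} (hs : s ∈ gaussPts k) : s ∈ Icc (-1 : ℝ) 1 ∧ (legendre k).eval s = 0 := by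
  rw [gaussPts, Multiset.mem_toFinset, mem_roots (legendre_ne_zero k)] at hs; refine ⟨abs_le.1 ?_, hs⟩
  by_contra h; exact legendre_ne_zero_outside k (not_le.1 h).le hs

lemma mem_of_mem_lobattoPts (hk : 1 ≤ k) {s : ℝ} (hs : s ∈ lobattoPts k) :
    s ∈ Icc (-1 : ℝ) 1 ∧ (primitive (legendre k)).eval s = 0 := by
  have h0 : primitive (legendre k) ≠ 0 := fun h => legendre_ne_zero k (by
    rw [← derivative_primitive (legendre k), h, derivative_zero])
  rw [lobattoPts, Multiset.mem_toFinset, mem_roots h0] at hs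
  have hd : ∀ x, HasDerivAt (fun x => (primitive (legendre k)).eval x) ((legendre k).eval x) x := fun x => by
      have := (primitive (legendre k)).hasDerivAt x; rwa [derivative_primitive] at this
  have hc : Continuous fun x => (primitive (legendre k)).eval x := fp!; refine ⟨abs_le.1 ?_, hs⟩; by_contra h
  rcases lt_abs.1 (not_le.1 h) with h | h
  · obtain ⟨c, hc1, hc2⟩ := exists_hasDerivAt_eq_zero h hc.continuousOn ((primitive_legendre_one hk).trans hs.symm) fun x _ => hd x
    exact legendre_ne_zero_outside k (le_abs.2 (Or.inl hc1.1.le)) hc2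
  · obtain ⟨c, hc1, hc2⟩ := exists_hasDerivAt_eq_zero (show s < -1 by linarith) hc.continuousOn
      (Eq.trans hs (primitive_neg_one _).symm) fun x _ => hd x
    exact legendre_ne_zero_outside k (le_abs.2 (Or.inr (by linarith [hc1.2]))) hc2

/-! ### Inverse inequalities on the cells of the mesh -/

lemma cell_derivative_bound (k : ℕ) : ∃ B : ℝ, 0 < B ∧ ∀ (N : ℕ) [NeZero N] (i : Fin N) (p : ℝ[X]) (A : ℝ),
    p.natDegree ≤ k → (∀ x ∈ cell N i, p.eval x ^ 2 ≤ A) →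
    ∀ x ∈ cell N i, step N ^ 2 * (𝒟 p).eval x ^ 2 ≤ B * A := by
  obtain ⟨B, hB, hb⟩ := poly_inverse k; refine ⟨8 * B, pos!, fun N _ i p A hp hA x hx => ?_⟩
  obtain ⟨s, hs, rfl⟩ := exists_pt i hx; have h1 := (hb (toRef N i p) ((natDegree_toRef_le N i p).trans hp) s hs).2.1
  have h2 : ∮₁ s, (toRef N i p).eval s ^ 2 ≤ ∮₁ s, A :=
    ii_mono num! (ii fp!) (by simp) fun s hs => by rw [toRef_eval]; exact hA _ (pt_mem i hs)
  rw [ii_const, smul_eq_mul] at h2; rw [derivative_toRef, eval_mul, eval_C, toRef_eval, mul_pow] at h1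
  have h3 := scale_le h2 hB.le; linarith

lemma val_inverse (k : ℕ) : ∃ B : ℝ, 0 < B ∧ ∀ (Nx Ny : ℕ) [NeZero Nx] [NeZero Ny] (i : Fin Nx)
    (j : Fin Ny) (c : Coef k), ∀ x ∈ cell Nx i, ∀ y ∈ cell Ny j,
      step Nx * step Ny * val c x y ^ 2 ≤ B * ∮ y Ny j, ∮ x Nx i, val c x y ^ 2 := by
  obtain ⟨B, hB, hb⟩ := cell_inverse k; refine ⟨B * B, pos!, fun Nx Ny _ _ i j c x hx y hy => ?_⟩
  have h1 := hb Ny j (polyX (swapC c) x) (natDegree_polyX_le _ _) y hy; simp only [polyX_eval, val_swapC] at h1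
  have h2 : ∮ y Ny j, step Nx * val c x y ^ 2 ≤ ∮ y Ny j, B * ∮ x Nx i, val c x y ^ 2 := by
    refine ii_mono (left_lt_right Ny j).le (ii fp!) ?_ fun y _ => ?_
    · apply Continuous.intervalIntegrable; refine continuous_const.mul ?_; apply continuous_ii; fun_prop
    · have := hb Nx i (polyX c y) (natDegree_polyX_le _ _) x hx; simpa only [polyX_eval] using this
  rw [ii_const_mul, ii_const_mul] at h2; have h3 := scale_le h1 (step_pos Nx).le; have h4 := scale_le h2 hB.le
  linarith

lemma sum_cells (ξ : Vh Nx Ny k) : sqNorm ξ = ∑ i, ∑ j, ∮ y Ny j, ∮ x Nx i, val (ξ i j) x y ^ 2 := by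
  rw [sqNorm, rsum, sum_comm]; refine sum_congr rfl fun j _ => ?_; simp only [cellSum]; rw [ii_sum]; intro i _
  apply Continuous.intervalIntegrable; apply continuous_ii; fun_prop

lemma val_inverse_sqNorm (k : ℕ) : ∃ B : ℝ, 0 < B ∧ ∀ (Nx Ny : ℕ) [NeZero Nx] [NeZero Ny]
    (ξ : Vh Nx Ny k), ∀ i j, ∀ x ∈ cell Nx i, ∀ y ∈ cell Ny j,
      step Nx * step Ny * val (ξ i j) x y ^ 2 ≤ B * sqNorm ξ := by
  obtain ⟨B, hB, hb⟩ := val_inverse k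
  refine ⟨B, hB, fun Nx Ny _ _ ξ i j x hx y hy => (hb Nx Ny i j _ x hx y hy).trans ?_⟩
  have n : ∀ i j, 0 ≤ ∮ y Ny j, ∮ x Nx i, val (ξ i j) x y ^ 2 :=
    fun i j => ii_nonneg (left_lt_right Ny j).le fun y _ => ii_nonneg (left_lt_right Nx i).le fun x _ => sq_nonneg _
  rw [sum_cells]; gcongr
  exact (single_le_sum (f := fun j => ∮ y Ny j,
    ∮ x Nx i, val (ξ i j) x y ^ 2) (fun j _ => n i j) (Finset.mem_univ j)).trans
    (single_le_sum (f := fun i => ∑ j, ∮ y Ny j,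
      ∮ x Nx i, val (ξ i j) x y ^ 2) (fun i _ => sum_nonneg fun j _ => n i j)
      (Finset.mem_univ i))

lemma dval_inverse (k : ℕ) : ∃ B : ℝ, 0 < B ∧ ∀ (Nx Ny : ℕ) [NeZero Nx] [NeZero Ny] (i : Fin Nx)
    (j : Fin Ny) (c : Coef k), ∀ x ∈ cell Nx i, ∀ y ∈ cell Ny j,
      step Nx * step Ny * dval c x y ^ 2 ≤ (step Nx ^ 2)⁻¹ * (B * ∮ y Ny j, ∮ x Nx i, val c x y ^ 2) ∧
      step Nx * step Ny * dval (swapC c) y x ^ 2 ≤ (step Ny ^ 2)⁻¹ * (B * ∮ y Ny j, ∮ x Nx i, val c x y ^ 2) := by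
  obtain ⟨B, hB, hb⟩ := val_inverse k; obtain ⟨C, hC, hc⟩ := cell_derivative_bound k
  refine ⟨C * B, pos!, fun Nx Ny _ _ i j c x hx y hy => ?_⟩; have hsx := step_pos Nx; have hsy := step_pos Ny
  have hp : 0 < step Nx * step Ny := pos!; set I := ∮ y Ny j, ∮ x Nx i, val c x y ^ 2
  have h0 : ∀ x ∈ cell Nx i, ∀ y ∈ cell Ny j, val c x y ^ 2 ≤ B * I / (step Nx * step Ny) := fun x hx y hy => by
    rw [le_div_iff₀ hp, mul_comm]; exact hb Nx Ny i j c x hx y hy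
  have h1 := hc Nx i (polyX c y) _ (natDegree_polyX_le _ _) (fun x hx => by rw [polyX_eval]; exact h0 x hx y hy) x hx
  have h2 := hc Ny j (polyX (swapC c) x) _ (natDegree_polyX_le _ _)
    (fun y hy => by rw [polyX_eval, val_swapC]; exact h0 x hx y hy) y hy
  have e : C * (B * I / (step Nx * step Ny)) = C * B * I / (step Nx * step Ny) := by ring
  rw [e, le_div_iff₀ hp] at h1 h2; constructor
  · rw [le_inv_mul_iff₀ pos!]; exact (le_of_eq (by rw [dval]; ring)).trans h1
  · rw [le_inv_mul_iff₀ pos!]; exact (le_of_eq (by rw [dval]; ring)).trans h2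

/-! ### The evolution of the energy -/

/-- The `L²` inner product as a bilinear form. -/
def inner2 (Nx Ny k : ℕ) [NeZero Nx] [NeZero Ny] : Vh Nx Ny k →ₗ[ℝ] Vh Nx Ny k →ₗ[ℝ] ℝ :=
  have hv : ∀ (c d : Coef k) (x y : ℝ), val (c + d) x y = val c x y + val d x y := fun c d x y => by
    simp only [val, Pi.add_apply, add_mul, sum_add_distrib]
  have hs : ∀ (r : ℝ) (c : Coef k) (x y : ℝ), val (r • c) x y = r * val c x y := fun r c x y => by
    simp only [val, Pi.smul_apply, smul_eq_mul, mul_sum, mul_assoc]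
  have hc : ∀ ξ η : Vh Nx Ny k, ∀ i j, C₂ fun x y => val (ξ i j) x y * val (η i j) x y := fun ξ η i j => cont₂ fp!
  LinearMap.mk₂ ℝ (fun ξ η => rsum fun i j x y => val (ξ i j) x y * val (η i j) x y)
    (fun a b c => by rw [← rsum_add (hc a c) (hc b c)]; simp only [Pi.add_apply, hv, add_mul])
    (fun r a c => by rw [smul_eq_mul, ← rsum_const_mul]; simp only [Pi.smul_apply, hs, mul_assoc])
    (fun a b c => by rw [← rsum_add (hc a b) (hc a c)]; simp only [Pi.add_apply, hv, mul_add])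
    (fun r a c => by rw [smul_eq_mul, ← rsum_const_mul]; simp only [Pi.smul_apply, hs, mul_left_comm])

lemma sqNorm_eq_inner2 (ξ : Vh Nx Ny k) : sqNorm ξ = inner2 Nx Ny k ξ ξ := by rw [sqNorm]; simp only [sq]; rfl

lemma hasDerivWithinAt_sqNorm {ξ : ℝ → Vh Nx Ny k} {d : Vh Nx Ny k} {s : Set ℝ} {t : ℝ}
    (h : HasDerivWithinAt ξ d s t) : HasDerivWithinAt (fun t => sqNorm (ξ t))
      (2 * rsum fun i j x y => val (d i j) x y * val (ξ t i j) x y) s t := by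
  set L := (LinearMap.toContinuousLinearMap (𝕜 := ℝ) (E := Vh Nx Ny k) (F' := ℝ)).toLinearMap ∘ₗ inner2 Nx Ny k
  have h1 := (LinearMap.toContinuousLinearMap L).hasFDerivAt.comp_hasDerivWithinAt t h
  have h2 := HasDerivWithinAt.clm_apply h1 h
  have e : ∀ ξ η, LinearMap.toContinuousLinearMap L ξ η = inner2 Nx Ny k ξ η := fun _ _ => rfl
  simp only [Function.comp_def, e] at h2; simp only [sqNorm_eq_inner2]
  have c2 : inner2 Nx Ny k (ξ t) d = inner2 Nx Ny k d (ξ t) := by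
    change rsum (fun i j x y => val (ξ t i j) x y * val (d i j) x y) =
      rsum fun i j x y => val (d i j) x y * val (ξ t i j) x y
    simp only [mul_comm]
  rw [c2, ← two_mul] at h2; exact h2

lemma continuousOn_sqNorm {ξ : ℝ → Vh Nx Ny k} {s : Set ℝ} (h : ContinuousOn ξ s) :
    ContinuousOn (fun t => sqNorm (ξ t)) s := by
  have hc : Continuous fun ξ : Vh Nx Ny k => sqNorm ξ := by
    simp only [sqNorm_eq_inner2]
    set L := (LinearMap.toContinuousLinearMap (𝕜 := ℝ) (E := Vh Nx Ny k) (F' := ℝ)).toLinearMap ∘ₗ inner2 Nx Ny k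
    exact (LinearMap.continuous_of_finiteDimensional L).clm_apply continuous_id
  exact hc.comp_continuousOn h

/-! ### Stability in `L²` -/

lemma eFlux_integral (hf : Continuous f) (hg : IsEFlux f g) (a b : ℝ) : g a b * (b - a) ≤ ∫ w in a..b, f w := by
  rcases lt_trichotomy a b with h | rfl | h
  · have := ii_mono (μ := volume) h.le (intervalIntegrable_const (c := g a b))
      (hf.intervalIntegrable a b) fun w hw => by
        have := hg a b w (by rwa [uIcc_of_le h.le]); rw [Real.sign_of_pos (sub_pos.2 h), one_mul] at this; linarith
    rw [ii_const, smul_eq_mul] at this; linarith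
  · simp
  · have := ii_mono (μ := volume) h.le (hf.intervalIntegrable b a)
      (intervalIntegrable_const (c := g a b)) fun w hw => by
        have := hg a b w (by rwa [uIcc_of_ge h.le]); rw [Real.sign_of_neg (sub_neg.2 h)] at this; linarith
    rw [ii_const, smul_eq_mul] at this; rw [intervalIntegral.integral_symm]; linarith

lemma B1_self_nonpos (hf : Continuous f) (hg : IsEFlux f g)
    (p : Pw N) (hp : ∀ i, (p i).natDegree ≤ k) : B1 β θ f g p p ≤ 0 := by
  obtain ⟨γ, hγ, hc⟩ := A1_coercive
  have hA : 0 ≤ A1 β θ p p := by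
    refine le_trans (mul_nonneg hγ.le (add_nonneg (sum_nonneg fun i _ => ?_) (sum_nonneg fun i _ => ?_))) (hc N p hp)
    · exact ii_nonneg (left_lt_right N i).le fun x _ => sq_nonneg _
    · exact div_nonneg (sq_nonneg _) (step_pos N).le
  have hd : ∀ x, HasDerivAt (fun x => ∫ w in (0 : ℝ)..x, f w) (f x) x := fun x =>
    (hf.integral_hasStrictDerivAt 0 x).hasDerivAt
  have h1 : cellSum (fun i x => f ((p i).eval x) * (𝒟 (p i)).eval x) =
      ∑ i, ((∫ w in (0 : ℝ)..traceL (pfun p) i, f w) - ∫ w in (0 : ℝ)..traceR (pfun p) i, f w) := by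
    rw [sum_sub_distrib]; simp only [traceR]
    rw [sum_succ (fun i => ∫ w in (0 : ℝ)..pfun p i (left N i), f w), ← sum_sub_distrib, cellSum]
    refine sum_congr rfl fun i _ => ?_
    exact intervalIntegral.integral_eq_sub_of_hasDerivAt (fun x _ => (hd _).comp x ((p i).hasDerivAt x)) (ii fp!)
  rw [B1_eq hf, h1, add_assoc, ← sum_add_distrib]
  have h2 : ∀ i ∈ Finset.univ, (∫ w in (0 : ℝ)..traceL (pfun p) i, f w) - (∫ w in (0 : ℝ)..traceR (pfun p) i, f w)
      + g (traceL (pfun p) i) (traceR (pfun p) i) * jump (pfun p) i ≤ 0 := by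
    intro i _; have e := eFlux_integral hf hg (traceL (pfun p) i) (traceR (pfun p) i)
    have := intervalIntegral.integral_add_adjacent_intervals (hf.intervalIntegrable 0 (traceL (pfun p) i))
      (hf.intervalIntegrable (traceL (pfun p) i) (traceR (pfun p) i)) (μ := volume)
    rw [jump]; linarith
  linarith [Finset.sum_nonpos h2]

lemma rowForm_self_nonpos (hf : Continuous f) (hg : IsEFlux f g) (w : Vh Nx Ny k) : rowForm β θ f g w w ≤ 0 :=
  Finset.sum_nonpos fun j _ => by
    rw [← neg_nonneg, ← ii_neg]
    exact ii_nonneg (left_lt_right Ny j).le fun y _ => neg_nonneg.2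
      (B1_self_nonpos hf hg _ fun i => natDegree_polyX_le _ _)

section
variable {T : ℝ} {f1 f2 : Fn} (hf1 : C∞ f1) (hf2 : C∞ f2) {g1 g2 : Fn₂}
  (hg1 : IsEFlux f1 g1) (hg2 : IsEFlux f2 g2) (hg1' : LocallyLipschitz (uncurry g1))
  (hg2' : LocallyLipschitz (uncurry g2))
include hf1 hf2 hg1 hg2 hg1' hg2'

lemma stability {uh : ℝ → Vh Nx Ny k} (h : IsDDGSolution T β θ f1 f2 g1 g2 uh) {t : ℝ} (ht : t ∈ Icc 0 T) :
    sqNorm (uh t) ≤ sqNorm (uh 0) := by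
  have hd : ∀ t ∈ Ioo 0 T, ∃ e ≤ 0, HasDerivAt (fun t => sqNorm (uh t)) e t := by
    intro t ht; obtain ⟨d, hd, hs⟩ := h.2 t ⟨ht.1, ht.2.le⟩
    refine ⟨_, ?_, ((hasDerivWithinAt_sqNorm hd).hasDerivAt (Icc_mem_nhds ht.1 ht.2))⟩
    rw [rsum_eq fun i j => by unfold uncurry; fun_prop]; simp_rw [hs]
    rw [sum_scheme hf1.continuous hf2.continuous hg1'.continuous hg2'.continuous]
    have := rowForm_self_nonpos hf1.continuous hg1 (uh t)
    have := rowForm_self_nonpos hf2.continuous hg2 (swapV (uh t)); linarith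
  have := antitoneOn_of_deriv_nonpos (convex_Icc 0 T) (continuousOn_sqNorm h.1)
    (by rw [interior_Icc]; exact fun t ht => by
          obtain ⟨e, -, he⟩ := hd t ht
          exact he.differentiableAt.differentiableWithinAt)
    (by rw [interior_Icc]; exact fun t ht => by
          obtain ⟨e, h0, he⟩ := hd t ht
          rwa [he.deriv])
  exact this ⟨le_rfl, ht.1.trans ht.2⟩ ht ht.1

/-- On fine meshes the discrete solution stays close to the comparison function. -/
lemma energy_bound (M ρ : ℝ) {A : ℝ} (hA : 0 ≤ A) : ∃ C h₀ : ℝ, 0 < C ∧ 0 < h₀ ∧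
    ∀ (Nx Ny : ℕ) [NeZero Nx] [NeZero Ny], step Nx ≤ ρ * step Ny → step Ny ≤ ρ * step Nx →
      step Nx ≤ h₀ → step Ny ≤ h₀ → ∀ U V : ℝ → Jet, TimeFamily (k + 2) (T + 2) M U V →
      (∀ t ∈ Ioo 0 T, ∀ x y, V (t + 1) 0 0 x y = U (t + 1) 2 0 x y + U (t + 1) 0 2 x y
        - deriv f1 (U (t + 1) 0 0 x y) * U (t + 1) 1 0 x y
        - deriv f2 (U (t + 1) 0 0 x y) * U (t + 1) 0 1 x y) →
      ∀ uh : ℝ → Vh Nx Ny k, IsDDGSolution T β θ f1 f2 g1 g2 uh →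
      sqNorm (uh 0 - cmp Nx Ny f1 f2 (U 1)) ≤ A * (step Nx ^ (2 * k + 4) + step Ny ^ (2 * k + 4)) →
      ∀ t ∈ Ioc 0 T, sqNorm (uh t - cmp Nx Ny f1 f2 (U (t + 1))) ≤
        C * (step Nx ^ (2 * k + 4) + step Ny ^ (2 * k + 4)) := by
  obtain ⟨K, hK, hE⟩ := energy_estimate hf1 hf2 hg1' (eFlux_diag hg1 hg1'.continuous) hg2'
    (eFlux_diag hg2 hg2'.continuous) M ρ
  obtain ⟨B, hB, hb⟩ := val_inverse_sqNorm k; set lam := 4 * K + 1 with hlam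
  set C := (A + 1) * exp (lam * T) with hC; have hC0 : 0 < C := pos!; set R := max ρ 1
  have hR1 : 1 ≤ R := le_max_right _ _; refine ⟨C, min 1 (1 / (2 * R * (B * C))), hC0, pos!, ?_⟩
  intro Nx Ny _ _ hr1 hr2 hx hy U V hUV hpde uh huh h0 t ht; have hsx := step_pos Nx; have hsy := step_pos Ny
  set H := step Nx ^ (2 * k + 4) + step Ny ^ (2 * k + 4) with hH; have hH0 : 0 < H := pos!
  have hHs : B * (C * H) ≤ step Nx * step Ny := by
    have key : ∀ a b : ℝ, 0 < a → 0 < b → a ≤ ρ * b → a ≤ min 1 (1 / (2 * R * (B * C))) →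
        B * C * a ^ (2 * k + 4) ≤ a * b / 2 := by
      intro a b ha hb h1 h2
      have p1 : a ^ (2 * k + 4) ≤ a ^ 3 := pow_le_pow_of_le_one ha.le (h2.trans (min_le_left _ _)) om!
      have p2 := h2.trans (min_le_right _ _); rw [le_div_iff₀ pos!] at p2
      have p3 : a ≤ R * b := h1.trans (by gcongr; exact le_max_left _ _)
      calc B * C * a ^ (2 * k + 4) ≤ B * C * (a * a * a) := by
            gcongr; exact p1.trans (le_of_eq (by ring))
        _ ≤ B * C * (a * a * (R * b)) := by gcongr
        _ = (a * (2 * R * (B * C))) * (a * b / 2) := by ring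
        _ ≤ 1 * (a * b / 2) := by gcongr
        _ = _ := one_mul _
    have k1 := key _ _ hsx hsy hr1 hx; have k2 := key _ _ hsy hsx hr2 hy; rw [hH]; linarith
  set ξ : ℝ → Vh Nx Ny k := fun s => uh s - cmp Nx Ny f1 f2 (U (s + 1)) with hξ
  have hcd : ∀ s ∈ Icc 0 T, HasDerivAt (fun s => cmp Nx Ny f1 f2 (U (s + 1)))
      (cmp' Nx Ny f1 f2 (U (s + 1)) (V (s + 1))) s := fun s hs =>
    (hasDerivAt_cmp hf1 hf2 hUV Nx Ny (t := s + 1) ⟨by linarith [hs.1], by linarith [hs.2]⟩).comp_add_const s 1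
  have hξc := continuousOn_sqNorm (huh.1.sub fun s hs => (hcd s hs).continuousAt.continuousWithinAt)
  set b : Fn := fun s => (A + 1) * H * exp (lam * s) with hbdef
  have hbC : ∀ s, s ≤ T → b s ≤ C * H := fun s hs => by
    have : exp (lam * s) ≤ exp (lam * T) := Real.exp_le_exp.2 (by gcongr); simp only [hbdef, hC]
    calc (A + 1) * H * exp (lam * s) ≤ (A + 1) * H * exp (lam * T) := by gcongr
      _ = _ := by ring
  have hbH : ∀ s, 0 ≤ s → (A + 1) * H ≤ b s := fun s hs => by
    have : 1 ≤ exp (lam * s) := Real.one_le_exp pos!; exact le_mul_of_one_le_right pos! this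
  obtain ⟨ε, hε, hε1⟩ : ∃ ε ∈ Ioo 0 t, sqNorm (ξ ε) ≤ b ε := by
    have hlt : sqNorm (ξ 0) < (A + 1) * H := by
      have : sqNorm (ξ 0) ≤ A * H := by simpa only [hξ, zero_add] using h0
      linarith
    have hw : ContinuousWithinAt (fun s => sqNorm (ξ s)) (Ioo 0 t) 0 :=
      (hξc 0 ⟨le_rfl, ht.1.le.trans ht.2⟩).mono fun s hs => ⟨hs.1.le, hs.2.le.trans ht.2⟩
    have : (nhdsWithin 0 (Ioo 0 t)).NeBot := left_nhdsWithin_Ioo_neBot ht.1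
    obtain ⟨ε, h1, h2⟩ := ((hw.eventually_lt_const hlt).and self_mem_nhdsWithin).exists
    exact ⟨ε, h2, h1.le.trans (hbH ε h2.1.le)⟩
  have hD : ∀ s, ∃ d : Vh Nx Ny k, s ∈ Ioo 0 T → HasDerivAt uh d s ∧ ∀ (i : Fin Nx) (j : Fin Ny) (c : Coef k),
      ∮ x Nx i, ∮ y Ny j, val (d i j) x y * val c x y = schemeRHS β θ f1 f2 g1 g2 (uh s) i j c := by
    intro s
    by_cases hs : s ∈ Ioo 0 T
    · obtain ⟨d, h1, h2⟩ := huh.2 s ⟨hs.1, hs.2.le⟩; exact ⟨d, fun _ => ⟨h1.hasDerivAt (Icc_mem_nhds hs.1 hs.2), h2⟩⟩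
    · exact ⟨0, fun h => absurd h hs⟩
  choose d hd using hD
  have hsub : ∀ s ∈ Ico ε t, s ∈ Ioo 0 T := fun s hs => ⟨hε.1.trans_le hs.1, hs.2.trans_le ht.2⟩
  refine le_trans ?_ (hbC t ht.2)
  refine image_le_of_deriv_right_lt_deriv_boundary' (a := ε) (b := t) (f := fun s => sqNorm (ξ s))
    (f' := fun s => 2 * rsum fun i j x y => val ((d s - cmp' Nx Ny f1 f2 (U (s + 1)) (V (s + 1))) i j) x y
      * val (ξ s i j) x y)
    (B := b) (B' := fun s => (A + 1) * H * (exp (lam * s) * lam))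
    (hξc.mono (Icc_subset_Icc hε.1.le ht.2)) ?_ hε1 (by simp only [hbdef]; fun_prop) ?_ ?_ ⟨hε.2.le, le_rfl⟩
  · intro s hs
    exact hasDerivWithinAt_sqNorm
      ((hd s (hsub s hs)).1.sub (hcd s (Ioo_subset_Icc_self (hsub s hs)))).hasDerivWithinAt
  · intro s hs
    have h1 : HasDerivAt (fun s : ℝ => lam * s) lam s := by simpa using (hasDerivAt_id s).const_mul lam
    exact (h1.exp.const_mul _).hasDerivWithinAt
  · intro s hs heq; have hsT := hsub s hs
    have hs1 : s + 1 ∈ Ioo 0 (T + 2) := ⟨by linarith [hsT.1], by linarith [hsT.2]⟩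
    have hval : ∀ i j, ∀ x ∈ cell Nx i, ∀ y ∈ cell Ny j,
        |val (ξ s i j) x y| ≤ 1 := by
      intro i j x hx y hy; have := hb Nx Ny (ξ s) i j x hx y hy; rw [← sq_le_one_iff_abs_le_one]
      have h2 : B * sqNorm (ξ s) ≤ B * (C * H) := by gcongr; exact (le_of_eq heq).trans (hbC s hsT.2.le)
      have h3 : step Nx * step Ny * val (ξ s i j) x y ^ 2 ≤ step Nx * step Ny * 1 := by linarith
      exact le_of_mul_le_mul_left h3 pos!
    have e := hE Nx Ny hr1 hr2 (U (s + 1)) (V (s + 1)) (hUV.smooth _ (Ioo_subset_Icc_self hs1))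
      (hUV.smooth' _ hs1) (hpde s hsT) (uh s) (d s) (ξ s) rfl hval (hd s hsT).2
    have ev : ∀ i j x y, val ((d s - cmp' Nx Ny f1 f2 (U (s + 1)) (V (s + 1))) i j) x y =
        val (d s i j) x y - val (cmp' Nx Ny f1 f2 (U (s + 1)) (V (s + 1)) i j) x y :=
      fun i j x y => by simp only [val, Pi.sub_apply, sub_mul, sum_sub_distrib]
    simp only [ev]; have hbs : H ≤ b s := (le_mul_of_one_le_left hH0.le (by linarith)).trans (hbH s hsT.1.le)
    have heq' := heq; rw [heq'] at e
    have hfin : (A + 1) * H * (exp (lam * s) * lam) = lam * b s := by simp only [hbdef]; ring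
    rw [hfin, hlam]; have := scale_le hbs hK.le; linarith

end

/-! ### Errors at the Gauss and Lobatto points -/

lemma mean_square_le (P : Finset ℝ) {q a E : ℝ} (hq : 0 < q) (hE : 0 ≤ E)
    {F : Fin Nx → Fin Ny → Fn₂} {D : Fin Nx → Fin Ny → ℝ}
    (hF : ∀ i j, ∀ r ∈ P, ∀ s ∈ P, step Nx * step Ny * F i j r s ≤ step Nx * step Ny * a + D i j)
    (hD : ∑ i, ∑ j, D i j ≤ E) :
    1 / ((Nx : ℝ) * Ny * q) * ∑ i, ∑ j, ∑ r ∈ P, ∑ s ∈ P, F i j r s ≤ (P.card : ℝ) ^ 2 / q * (a + E) := by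
  have hNx : (0 : ℝ) < Nx := Nat.cast_pos.2 (NeZero.pos Nx)
  have hNy : (0 : ℝ) < Ny := Nat.cast_pos.2 (NeZero.pos Ny); have hπ := Real.pi_gt_three
  have h1 : step Nx * step Ny * ∑ i, ∑ j, ∑ r ∈ P, ∑ s ∈ P, F i j r s ≤ (P.card : ℝ) ^ 2 * ((2 * π) ^ 2 * a + E) := by
    calc step Nx * step Ny * ∑ i, ∑ j, ∑ r ∈ P, ∑ s ∈ P, F i j r s
        = ∑ i : Fin Nx, ∑ j : Fin Ny, ∑ r ∈ P, ∑ s ∈ P, step Nx * step Ny * F i j r s := by simp only [mul_sum]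
      _ ≤ ∑ i, ∑ j, ∑ r ∈ P, ∑ s ∈ P, (step Nx * step Ny * a + D i j) :=
          sum_le_sum fun i _ => sum_le_sum fun j _ => sum_le_sum fun r hr => sum_le_sum fun s hs => hF i j r hr s hs
      _ = (P.card : ℝ) ^ 2 * ((2 * π) ^ 2 * a + ∑ i, ∑ j, D i j) := by
          simp only [Finset.sum_const, nsmul_eq_mul, mul_add, sum_add_distrib, Finset.card_univ,
            Fintype.card_fin, ← mul_sum, step]
          field_simp
      _ ≤ _ := by gcongr
  have e : step Nx * step Ny = (2 * π) ^ 2 / (Nx * Ny) := by rw [step, step]; field_simp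
  set S := ∑ i, ∑ j, ∑ r ∈ P, ∑ s ∈ P, F i j r s
  have h2 : 1 / ((Nx : ℝ) * Ny) * S ≤ (P.card : ℝ) ^ 2 * (a + E) := by
    have h3 : (2 * π) ^ 2 * (1 / ((Nx : ℝ) * Ny) * S) ≤ (2 * π) ^ 2 * ((P.card : ℝ) ^ 2 * (a + E)) := by
      calc (2 * π) ^ 2 * (1 / ((Nx : ℝ) * Ny) * S) = step Nx * step Ny * S := by rw [e]; ring
        _ ≤ _ := h1
        _ ≤ (P.card : ℝ) ^ 2 * ((2 * π) ^ 2 * a + (2 * π) ^ 2 * E) := by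
          gcongr; exact le_mul_of_one_le_left hE (one_le_pow₀ (by linarith))
        _ = _ := by ring
    exact le_of_mul_le_mul_left h3 pos!
  calc 1 / ((Nx : ℝ) * Ny * q) * S = 1 / ((Nx : ℝ) * Ny) * S / q := by field_simp
    _ ≤ (P.card : ℝ) ^ 2 * (a + E) / q := by gcongr
    _ = _ := by ring

lemma hasDerivAt_val (c : Coef k) (x y : ℝ) : HasDerivAt (fun x => val c x y) (dval c x y) x := by
  simp_rw [← polyX_eval]; exact (polyX c y).hasDerivAt x

lemma val_sub (c d : Coef k) (x y : ℝ) : val (c - d) x y = val c x y - val d x y := by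
  rw [← polyX_eval, polyX_sub, eval_sub, polyX_eval, polyX_eval]

lemma dval_sub (c d : Coef k) (x y : ℝ) : dval (c - d) x y = dval c x y - dval d x y := by
  rw [dval, polyX_sub, derivative_sub, eval_sub, dval, dval]

lemma sqNorm_nonneg (ξ : Vh Nx Ny k) : 0 ≤ sqNorm ξ := rsum_nonneg fun _ _ _ _ => sq_nonneg _

/-- The discrete errors in terms of the distance to a comparison function `c`. -/
lemma point_errors (hk : 2 ≤ k) : ∃ C : ℝ, 0 < C ∧ ∀ (Nx Ny : ℕ) [NeZero Nx] [NeZero Ny]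
    (v vx vy : Fn₂) (w c : Vh Nx Ny k) (δ δ' : ℝ),
    (∀ x y, HasDerivAt (fun x => v x y) (vx x y) x) → (∀ x y, HasDerivAt (fun y => v x y) (vy x y) y) →
    (∀ i j, ∀ r ∈ lobattoPts k, ∀ s ∈ lobattoPts k,
      |v (pt Nx i r) (pt Ny j s) - val (c i j) (pt Nx i r) (pt Ny j s)| ≤ δ) →
    (∀ i j, ∀ r ∈ gaussPts k, ∀ s ∈ gaussPts k,
      |vx (pt Nx i r) (pt Ny j s) - dval (c i j) (pt Nx i r) (pt Ny j s)| ≤ δ' ∧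
      |vy (pt Nx i r) (pt Ny j s) - dval (swapC (c i j)) (pt Ny j s) (pt Nx i r)| ≤ δ') →
    errLobatto v w ^ 2 ≤ C * (δ ^ 2 + sqNorm (w - c)) ∧
    errGauss v w ^ 2 ≤ C * (δ' ^ 2 + ((step Nx ^ 2)⁻¹ + (step Ny ^ 2)⁻¹) * sqNorm (w - c)) := by
  obtain ⟨B, hB, hb⟩ := val_inverse k; obtain ⟨B', hB', hb'⟩ := dval_inverse k
  have hk0 : (0 : ℝ) < k := by exact_mod_cast (by omega : 0 < k)
  set m1 : ℝ := ((lobattoPts k).card : ℝ) ^ 2 / ((k : ℝ) + 1) ^ 2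
  set m2 : ℝ := ((gaussPts k).card : ℝ) ^ 2 / (k : ℝ) ^ 2; have n1 : 0 ≤ m1 := pos!; have n2 : 0 ≤ m2 := pos!
  refine ⟨m1 * (2 + 2 * B) + m2 * (4 + 2 * B') + 1, pos!, ?_⟩; intro Nx Ny _ _ v vx vy w c δ δ' hx hy hl hg
  have hsx := step_pos Nx; have hsy := step_pos Ny; have hS := sqNorm_nonneg (w - c)
  set I : Fin Nx → Fin Ny → ℝ := fun i j => ∮ y Ny j, ∮ x Nx i, val ((w - c) i j) x y ^ 2 with hI
  have hIs : ∑ i, ∑ j, I i j = sqNorm (w - c) := (sum_cells _).symm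
  have sq2 : ∀ a b d : ℝ, |a| ≤ d → (a - b) ^ 2 ≤ 2 * d ^ 2 + 2 * b ^ 2 := fun a b d h => by
    have := sq_le_sq' (neg_le_of_abs_le h) (le_of_abs_le h); linarith [sq_nonneg (a + b), add_sq a b, sub_sq a b]
  constructor
  · rw [errLobatto, Real.sq_sqrt (mul_nonneg pos! (sum_nonneg fun i _ =>
      sum_nonneg fun j _ => sum_nonneg fun r _ => sum_nonneg fun s _ => sq_nonneg _))]
    refine (mean_square_le (lobattoPts k) (a := 2 * δ ^ 2) (E := 2 * B * sqNorm (w - c))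
      (D := fun i j => 2 * (B * I i j)) pos! pos! (fun i j r hr s hs => ?_) ?_).trans ?_
    · have p := hb Nx Ny i j ((w - c) i j) (pt Nx i r) (pt_mem i (mem_of_mem_lobattoPts om! hr).1)
        (pt Ny j s) (pt_mem j (mem_of_mem_lobattoPts om! hs).1)
      have q := sq2 _ (val ((w - c) i j) (pt Nx i r) (pt Ny j s)) _ (hl i j r hr s hs)
      have e : val ((w - c) i j) (pt Nx i r) (pt Ny j s) =
        val (w i j) (pt Nx i r) (pt Ny j s) - val (c i j) (pt Nx i r) (pt Ny j s) := val_sub _ _ _ _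
      rw [e, sub_sub_sub_cancel_right] at q; rw [e] at p; have := scale_le q (mul_pos hsx hsy).le
      simp only [hI]; linarith
    · simp_rw [← mul_sum]; rw [hIs]; linarith
    · have d0 := sq_nonneg δ; have t1 : 0 ≤ m2 * (4 + 2 * B') * (δ ^ 2 + sqNorm (w - c)) := pos!
      have t2 : 0 ≤ m1 * (2 * B * δ ^ 2 + 2 * sqNorm (w - c)) := pos!; linarith
  · rw [errGauss, Real.sq_sqrt (mul_nonneg pos! (sum_nonneg fun i _ =>
      sum_nonneg fun j _ => sum_nonneg fun r _ => sum_nonneg fun s _ => add_nonneg (sq_nonneg _) (sq_nonneg _)))]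
    set J := (step Nx ^ 2)⁻¹ + (step Ny ^ 2)⁻¹ with hJ; have hJ0 : 0 < J := pos!
    refine (mean_square_le (gaussPts k) (a := 4 * δ' ^ 2) (E := 2 * J * B' * sqNorm (w - c))
      (D := fun i j => 2 * J * B' * I i j) pos! pos! (fun i j r hr s hs => ?_) ?_).trans ?_
    · have dx : deriv (fun x => v x (pt Ny j s) - val (w i j) x (pt Ny j s)) (pt Nx i r) = _ :=
        ((hx _ _).sub (hasDerivAt_val _ _ _)).deriv
      have dy : deriv (fun y => v (pt Nx i r) y - val (w i j) (pt Nx i r) y) (pt Ny j s) =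
          vy (pt Nx i r) (pt Ny j s) - dval (swapC (w i j)) (pt Ny j s) (pt Nx i r) := by
        simp_rw [← val_swapC (w i j)]; exact ((hy _ _).sub (hasDerivAt_val _ _ _)).deriv
      rw [dx, dy]
      obtain ⟨p1, p2⟩ := hb' Nx Ny i j ((w - c) i j) (pt Nx i r) (pt_mem i (mem_of_mem_gaussPts hr).1)
        (pt Ny j s) (pt_mem j (mem_of_mem_gaussPts hs).1)
      have q1 := sq2 _ (dval ((w - c) i j) (pt Nx i r) (pt Ny j s)) _ (hg i j r hr s hs).1
      have q2 := sq2 _ (dval (swapC ((w - c) i j)) (pt Ny j s) (pt Nx i r)) _ (hg i j r hr s hs).2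
      have e1 : dval ((w - c) i j) (pt Nx i r) (pt Ny j s) =
        dval (w i j) (pt Nx i r) (pt Ny j s) - dval (c i j) (pt Nx i r) (pt Ny j s) := dval_sub _ _ _ _
      have e2 : dval (swapC ((w - c) i j)) (pt Ny j s) (pt Nx i r) = dval (swapC (w i j)) (pt Ny j s) (pt Nx i r)
        - dval (swapC (c i j)) (pt Ny j s) (pt Nx i r) := dval_sub (swapC (w i j)) (swapC (c i j)) _ _
      rw [e1, sub_sub_sub_cancel_right] at q1; rw [e2, sub_sub_sub_cancel_right] at q2; rw [e1] at p1
      rw [e2] at p2; have := scale_le (add_le_add q1 q2) (mul_pos hsx hsy).le; simp only [hI, hJ]; linarith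
    · simp_rw [← mul_sum]; rw [hIs]
    · have d0 := sq_nonneg δ'; have t1 : 0 ≤ m1 * (2 + 2 * B) * (δ' ^ 2 + J * sqNorm (w - c)) := pos!
      have t2 : 0 ≤ m2 * (2 * B' * δ' ^ 2 + 4 * (J * sqNorm (w - c))) := pos!
      have t3 : 0 ≤ J * sqNorm (w - c) := pos!; linarith

/-- The error of the comparison function at the Gauss and Lobatto points. -/
lemma cmp_error (hf1 : C∞ f1) (hf2 : C∞ f2) (M ρ : ℝ) :
    ∃ K : ℝ, 0 < K ∧ ∀ (Nx Ny : ℕ) [NeZero Nx] [NeZero Ny], step Ny ≤ ρ * step Nx →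
    ∀ U : Jet, Smooth2 (k + 2) M U → ∀ (i : Fin Nx) (j : Fin Ny),
      (∀ r ∈ lobattoPts k, ∀ s ∈ lobattoPts k, |U 0 0 (pt Nx i r) (pt Ny j s)
        - val (cmp Nx Ny f1 f2 U i j) (pt Nx i r) (pt Ny j s)| ≤ K * (step Nx ^ (k + 2) + step Ny ^ (k + 2))) ∧
      (∀ r ∈ gaussPts k, ∀ s ∈ gaussPts k, |U 1 0 (pt Nx i r) (pt Ny j s)
        - dval (cmp Nx Ny f1 f2 U i j) (pt Nx i r) (pt Ny j s)| ≤ K * (step Nx ^ (k + 1) + step Ny ^ (k + 1))) := by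
  obtain ⟨K1, hK1, ht⟩ := tens_error M ρ; obtain ⟨B, hB, hb⟩ := pr_error
  obtain ⟨K2, hK2, h2⟩ := corX_bound hf1 M; obtain ⟨K3, hK3, h3⟩ := corX_bound hf2 M
  by_cases hM : 0 ≤ M
  swap
  · exact ⟨1, one_pos, fun Nx Ny _ _ _ U hU => absurd hU.nonneg hM⟩
  refine ⟨K1 + K2 + K3 + B * M, pos!, ?_⟩; intro Nx Ny _ _ hr U hU i j; have hsx := step_pos Nx
  have hsy := step_pos Ny
  have pc : ∀ y, polyX (cmp Nx Ny f1 f2 U i j) y = polyX (tens Nx Ny U i j) y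
      - corX Nx f1 U (mid Ny j) i - C ((corX Ny f2 (swapU U) (mid Nx i) j).eval y) := fun y => by
    rw [cmp, polyX_sub, polyX_sub, polyX_ofX (natDegree_corX_le ..), polyX_swapC_ofX (natDegree_corX_le ..)]
  constructor
  · intro r hr1 s hs1; obtain ⟨r1, r2⟩ := mem_of_mem_lobattoPts (by have := H.hk; omega) hr1
    obtain ⟨s1, s2⟩ := mem_of_mem_lobattoPts (by have := H.hk; omega) hs1; set x := pt Nx i r
    set y := pt Ny j s; have a1 := (ht Nx Ny hr U hU i j x (pt_mem i r1) y (pt_mem j s1)).1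
    have a2 : |prErr U 0 i x y| ≤ B * M * step Nx ^ (k + 2) :=
      (hb Nx _ M (hU.smooth1 (Nat.zero_le _) y)).2.2.1 i r r1 r2
    have a3 : |prErr (swapU U) 0 j y x| ≤ B * M * step Ny ^ (k + 2) :=
      (hb Ny _ M (hU.swap.smooth1 (Nat.zero_le _) x)).2.2.1 j s s1 s2
    have a4 := (h2 Nx U hU i x (pt_mem i r1) (mid Ny j)).1
    have a5 := (h3 Ny _ hU.swap j y (pt_mem j s1) (mid Nx i)).1
    rw [← polyX_eval, pc, eval_sub, eval_sub, eval_C, polyX_eval]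
    rw [abs_le] at *
    have n1 : 0 ≤ K3 * step Nx ^ (k + 2) := pos!; have n2 : 0 ≤ (K1 + K2) * step Ny ^ (k + 2) := pos!
    constructor <;> linarith [a1.1, a1.2, a2.1, a2.2, a3.1, a3.2, a4.1, a4.2, a5.1, a5.2]
  · intro r hr1 s hs1; obtain ⟨r1, r2⟩ := mem_of_mem_gaussPts hr1; obtain ⟨s1, s2⟩ := mem_of_mem_gaussPts hs1
    set x := pt Nx i r; set y := pt Ny j s; have a1 := (ht Nx Ny hr U hU i j x (pt_mem i r1) y (pt_mem j s1)).2
    have a2 : |U 1 0 x y - (𝒟 (pr Nx (fun x => U 0 0 x y) (fun x => U 1 0 x y) i)).eval x|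
        ≤ B * M * step Nx ^ (k + 1) := (hb Nx _ M (hU.smooth1 (Nat.zero_le _) y)).2.2.2 i r r1 r2
    have a3 : |prErr (swapU U) 1 j y x| ≤ B * M * step Ny ^ (k + 1) :=
      ((hb Ny _ M (hU.swap.smooth1 om! x)).1 j y (pt_mem j s1)).1
    have a4 := (h2 Nx U hU i x (pt_mem i r1) (mid Ny j)).2.1
    rw [dval, pc, derivative_sub, derivative_sub, derivative_C, sub_zero, eval_sub, ← dval]
    rw [abs_le] at *
    have n1 : 0 ≤ K3 * step Nx ^ (k + 1) := pos!; have n2 : 0 ≤ (K1 + K2 + K3) * step Ny ^ (k + 1) := pos!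
    constructor <;> linarith [a1.1, a1.2, a2.1, a2.2, a3.1, a3.2, a4.1, a4.2]

/-! ### Fourier coefficients on the square -/

/-- The exponential `e^{inx}`. -/
def e1 (n : ℤ) (x : ℝ) : ℂ := Complex.exp (I * n * x)

lemma norm_e1 (n : ℤ) (x : ℝ) : ‖e1 n x‖ = 1 := by
  rw [e1, show I * n * x = ((n * x : ℝ) : ℂ) * I by push_cast; ring]
  exact Complex.norm_exp_ofReal_mul_I _

lemma hasDerivAt_e1 (n : ℤ) (x : ℝ) : HasDerivAt (e1 n) (I * n * e1 n x) x := by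
  have h : HasDerivAt (fun x : ℝ => I * n * (x : ℂ)) (I * n * 1) x :=
    (HasDerivAt.ofReal_comp (hasDerivAt_id x)).const_mul _
  have := h.cexp; rw [mul_one, mul_comm (Complex.exp _)] at this; exact this

@[fun_prop]
lemma continuous_e1 (n : ℤ) : Continuous (e1 n) :=
  continuous_iff_continuousAt.2 fun x => (hasDerivAt_e1 n x).continuousAt

lemma e1_periodic (n : ℤ) (x : ℝ) : e1 n (x + 2 * π) = e1 n x := by
  rw [e1, e1, Complex.exp_eq_exp_iff_exists_int]; exact ⟨n, by push_cast; ring⟩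

lemma e1_add (n m : ℤ) (x : ℝ) : e1 (n + m) x = e1 n x * e1 m x := by
  rw [e1, e1, e1, ← Complex.exp_add]; congr 1; push_cast; ring

/-- The Fourier coefficients. -/
def coef (g : Fn₂) (n : ℤ × ℤ) : ℂ :=
  (((2 * π) ^ 2 : ℝ) : ℂ)⁻¹ * ∫ p in square, (g p.1 p.2 : ℂ) * (e1 (-n.1) p.1 * e1 (-n.2) p.2)

lemma volume_square : volume.real square = (2 * π) ^ 2 := by
  have := pi_pos; rw [square, Measure.volume_eq_prod, measureReal_prod_prod, Real.volume_real_Icc_of_le pos!]; ring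

lemma isCompact_square : IsCompact square := isCompact_Icc.prod isCompact_Icc

lemma integrableOn_square {f : ℝ × ℝ → ℂ} (hf : Continuous f) : IntegrableOn f square volume :=
  hf.continuousOn.integrableOn_compact isCompact_square

lemma coef_integrable (hg : C₂ g) (n : ℤ × ℤ) :
    IntegrableOn (fun p : ℝ × ℝ => (g p.1 p.2 : ℂ) * (e1 (-n.1) p.1 * e1 (-n.2) p.2)) square volume := by
  apply integrableOn_square; unfold uncurry at hg; fun_prop

lemma coef_swap (g : Fn₂) (n : ℤ × ℤ) : coef (fun x y => g y x) n = coef g n.swap := by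
  rw [coef, coef, square, Measure.volume_eq_prod, ← setIntegral_prod_swap]
  simp only [Prod.fst_swap, Prod.snd_swap, mul_comm (e1 (-n.1) _)]

lemma norm_coef_le {B : ℝ} (hB : ∀ x y, |g x y| ≤ B) (n : ℤ × ℤ) : ‖coef g n‖ ≤ B := by
  have hπ := pi_pos
  have h := norm_setIntegral_le_of_norm_le_const (μ := volume) (s := square) (C := B)
    (f := fun p : ℝ × ℝ => (g p.1 p.2 : ℂ) * (e1 (-n.1) p.1 * e1 (-n.2) p.2))
    isCompact_square.measure_lt_top fun p _ => by
      rw [norm_mul, norm_mul, norm_e1, norm_e1, mul_one, mul_one, norm_real]; exact hB _ _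
  rw [coef, norm_mul, norm_inv, norm_real, norm_of_nonneg pos!, inv_mul_le_iff₀ pos!, mul_comm, ← volume_square]
  exact h

lemma coef_add {g h : Fn₂} (hg : C₂ g) (hh : C₂ h)
    (n : ℤ × ℤ) : coef (fun x y => g x y + h x y) n = coef g n + coef h n := by
  rw [coef, coef, coef, ← mul_add, ← integral_add (coef_integrable hg n) (coef_integrable hh n)]
  simp only [Complex.ofReal_add, add_mul]

lemma coef_sub {g h : Fn₂} (hg : C₂ g) (hh : C₂ h)
    (n : ℤ × ℤ) : coef (fun x y => g x y - h x y) n = coef g n - coef h n := by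
  rw [coef, coef, coef, ← mul_sub, ← integral_sub (coef_integrable hg n) (coef_integrable hh n)]
  simp only [Complex.ofReal_sub, sub_mul]

lemma coef_eq_iterated (hg : C₂ g) (n : ℤ × ℤ) : coef g n =
    (((2 * π) ^ 2 : ℝ) : ℂ)⁻¹ * ∫ x in (0 : ℝ)..2 * π, ∫ y in (0 : ℝ)..2 * π,
      (g x y : ℂ) * (e1 (-n.1) x * e1 (-n.2) y) := by
  have hπ := pi_pos
  rw [coef, square, Measure.volume_eq_prod, setIntegral_prod _ (coef_integrable hg n),
    intervalIntegral.integral_of_le pos!, integral_Icc_eq_integral_Ioc]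
  simp only [integral_Icc_eq_integral_Ioc, intervalIntegral.integral_of_le (pos! : (0 : ℝ) ≤ 2 * π)]

lemma coef_dy {g g' : Fn₂} (hg : C₂ g) (hg' : Continuous (uncurry g'))
    (hd : ∀ x y, HasDerivAt (fun y => g x y) (g' x y) y) (hp : Periodic2 g) (n : ℤ × ℤ) :
    coef g' n = I * n.2 * coef g n := by
  rw [coef_eq_iterated hg', coef_eq_iterated hg, mul_left_comm (I * n.2), ← ii_const_mul (I * n.2)]
  congr 2; funext x; have hgx := hg.comp (Continuous.prodMk_right x)
  have hgx' := hg'.comp (Continuous.prodMk_right x)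
  have h := intervalIntegral.integral_mul_deriv_eq_deriv_mul (a := 0) (b := 2 * π)
    (u := fun y => e1 (-n.1) x * e1 (-n.2) y) (v := fun y => (g x y : ℂ))
    (fun y _ => (hasDerivAt_e1 (-n.2) y).const_mul (e1 (-n.1) x)) (fun y _ => (hd x y).ofReal_comp)
    (ii fp!) (ii fp!)
  have e0 := e1_periodic (-n.2) 0; have g0 := (hp x 0).2; rw [zero_add] at e0 g0
  rw [e0, g0, sub_self, zero_sub, ← ii_neg] at h; rw [← ii_const_mul]; refine Eq.trans ?_ (h.trans ?_)
  · congr 1; funext y; ring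
  · congr 1; funext y; push_cast; ring

lemma coef_dx {g g' : Fn₂} (hg : C₂ g) (hg' : Continuous (uncurry g'))
    (hd : ∀ x y, HasDerivAt (fun x => g x y) (g' x y) x) (hp : Periodic2 g) (n : ℤ × ℤ) :
    coef g' n = I * n.1 * coef g n := by
  have := coef_dy (g := fun x y => g y x) (g' := fun x y => g' y x) (hg.comp continuous_swap)
    (hg'.comp continuous_swap) (fun x y => hd y x) (fun x y => ⟨(hp y x).2, (hp y x).1⟩) n.swap
  have e : ∀ g : Fn₂, coef (fun x y => g y x) n.swap = coef g n := fun g => by rw [coef_swap, Prod.swap_swap]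
  rwa [e, e g] at this

/-! ### Inversion -/

lemma hasSum_fourier {f : ℝ → ℂ} (hf : Continuous f) (hp : ∀ x, f (x + 2 * π) = f x)
    (hs : Summable fun n : ℤ => ((2 * π : ℝ) : ℂ)⁻¹ * ∫ x in (0 : ℝ)..2 * π, f x * e1 (-n) x) (x : ℝ) :
    HasSum (fun n : ℤ => ((2 * π : ℝ) : ℂ)⁻¹ * (∫ x in (0 : ℝ)..2 * π, f x * e1 (-n) x) * e1 n x) (f x) := by
  have : Fact (0 < 2 * π) := ⟨pos!⟩; have hp' : Function.Periodic f (2 * π) := hp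
  let F : C(AddCircle (2 * π), ℂ) := ⟨hp'.lift, continuous_quot_lift _ hf⟩
  have hF : ∀ x : ℝ, F x = f x := fun x => rfl
  have h1 : ∀ (n : ℤ) (x : ℝ), fourier n (x : AddCircle (2 * π)) = e1 n x := fun n x => by
    rw [fourier_coe_apply, e1]; congr 1
    have : (π : ℂ) ≠ 0 := by exact_mod_cast Real.pi_ne_zero
    push_cast; field_simp
  have h2 : ∀ n : ℤ, fourierCoeff F n = ((2 * π : ℝ) : ℂ)⁻¹ * ∫ x in (0 : ℝ)..2 * π, f x * e1 (-n) x := fun n => by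
    rw [fourierCoeff_eq_intervalIntegral F n 0, zero_add, one_div, Complex.real_smul, Complex.ofReal_inv]
    simp only [h1, hF, smul_eq_mul, mul_comm]
  have := has_pointwise_sum_fourier_series_of_summable (f := F) ((summable_congr h2).2 hs) x
  simpa only [h1, h2, hF, smul_eq_mul] using this

lemma hasSum_coef (hg : C₂ g) (hp : Periodic2 g) (hs : Summable fun n => ‖coef g n‖) (x y : ℝ) :
    HasSum (fun n : ℤ × ℤ => coef g n * (e1 n.1 x * e1 n.2 y)) (g x y : ℂ) := by
  have hπ := pi_pos; have hgu := hg
  set c : ℤ → ℝ → ℂ := fun n y => ((2 * π : ℝ) : ℂ)⁻¹ * ∫ x in (0 : ℝ)..2 * π, (g x y : ℂ) * e1 (-n) x with hc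
  have hcc : ∀ n, Continuous (c n) := fun n => continuous_const.mul (by
    apply continuous_ii; unfold uncurry
    fun_prop)
  have hcoef : ∀ n m : ℤ, ((2 * π : ℝ) : ℂ)⁻¹ * ∫ y in (0 : ℝ)..2 * π, c n y * e1 (-m) y =
      coef g (n, m) := fun n m => by
    have e : coef g (n, m) = _ := coef_swap (fun x y => g y x) (n, m)
    rw [e, coef_eq_iterated (g := fun x y => g y x) (hg.comp continuous_swap), ← ii_const_mul, ← ii_const_mul]
    congr 1; funext y; simp only [hc, Prod.fst_swap, Prod.snd_swap]
    rw [mul_assoc, ← ii_mul_const, ← mul_assoc, ← ii_const_mul, ← ii_const_mul]; congr 1; funext x; push_cast; ring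
  have hs' : Summable fun n : ℤ × ℤ => coef g n * (e1 n.1 x * e1 n.2 y) := by
    refine Summable.of_norm ?_; simpa only [norm_mul, norm_e1, mul_one] using hs
  have h1 : ∀ n, HasSum (fun m : ℤ => coef g (n, m) * e1 m y) (c n y) := fun n => by
    have := hasSum_fourier (hcc n) (fun y => by simp only [hc, (hp _ y).2]) (by
      simp only [hcoef]
      exact (hs.of_norm).prod_factor n) y
    simpa only [hcoef] using this
  have h2 : ∀ n, HasSum (fun m : ℤ => coef g (n, m) * (e1 n x * e1 m y)) (c n y * e1 n x) := fun n => by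
    simpa only [mul_assoc, mul_comm (e1 n x)] using (h1 n).mul_right (e1 n x)
  have h3 := hs'.hasSum.prod_fiberwise h2
  have h4 : Summable fun n => c n y := by
    refine Summable.of_norm ?_; have := h3.summable.norm; simpa only [norm_mul, norm_e1, mul_one] using this
  have h5 := hasSum_fourier (f := fun x => (g x y : ℂ)) fp! (fun x => by rw [(hp x y).1]) h4 x
  rw [← h3.unique h5]; exact hs'.hasSum

/-! ### Decay of Fourier coefficients -/

/-- The weight `1 + |n₁| + |n₂|`. -/
def rho (n : ℤ × ℤ) : ℝ := 1 + |(n.1 : ℝ)| + |(n.2 : ℝ)|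

lemma one_le_rho (n : ℤ × ℤ) : 1 ≤ rho n := by rw [rho]; linarith [abs_nonneg (n.1 : ℝ), abs_nonneg (n.2 : ℝ)]

lemma rho_pos (n : ℤ × ℤ) : 0 < rho n := one_pos.trans_le (one_le_rho n)

lemma rho_le_add (n m : ℤ × ℤ) : rho n + 1 ≤ rho m + rho (n - m) := by
  have h1 := abs_add_le (m.1 : ℝ) (n.1 - m.1); have h2 := abs_add_le (m.2 : ℝ) (n.2 - m.2)
  rw [add_sub_cancel] at h1 h2; simp only [rho, Prod.fst_sub, Prod.snd_sub, Int.cast_sub]; linarith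

lemma summable_rho : Summable fun n : ℤ × ℤ => (rho n ^ 3)⁻¹ := by
  have h := EisensteinSeries.summable_one_div_norm_rpow (k := 3) num!
  rw [← (finTwoArrowEquiv ℤ).symm.summable_iff] at h; refine h.of_norm_bounded_eventually ?_
  refine (Filter.eventually_cofinite_ne ((0, 0) : ℤ × ℤ)).mono fun n hn => ?_
  have h0 : (finTwoArrowEquiv ℤ).symm n ≠ 0 := fun h => hn (by
    have := congrArg (finTwoArrowEquiv ℤ) h; rw [Equiv.apply_symm_apply] at this
    exact this)
  have h1 : ‖(finTwoArrowEquiv ℤ).symm n‖ ≤ rho n := by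
    rw [pi_norm_le_iff_of_nonneg (rho_pos n).le, Fin.forall_fin_two]; have a1 := abs_nonneg (n.1 : ℝ)
    have a2 := abs_nonneg (n.2 : ℝ); constructor
    · change ‖n.1‖ ≤ _
      rw [Int.norm_eq_abs, rho]; linarith
    · change ‖n.2‖ ≤ _
      rw [Int.norm_eq_abs, rho]; linarith
  have h2 := norm_pos_iff.2 h0; have h3 := rho_pos n
  rw [norm_of_nonneg pos!, Function.comp, Real.rpow_neg h2.le, show (3 : ℝ) = (3 : ℕ) by norm_num, Real.rpow_natCast]
  gcongr

/-- The sum of `(1 + |n₁| + |n₂|)⁻³`. -/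
def zsum : ℝ := ∑' n : ℤ × ℤ, (rho n ^ 3)⁻¹

/-- Decay of order `s` with constant `C`. -/
def Dec (s : ℕ) (C : ℝ) (c : ℤ × ℤ → ℂ) : Prop := ∀ n, rho n ^ s * ‖c n‖ ≤ C

lemma Dec.mono {s s' : ℕ} (h : s' ≤ s) {C : ℝ} {c : ℤ × ℤ → ℂ} (hc : Dec s C c) : Dec s' C c := fun n =>
  (mul_le_mul_of_nonneg_right (pow_le_pow_right₀ (one_le_rho n) h) (norm_nonneg _)).trans (hc n)

lemma Dec.nonneg {s : ℕ} {C : ℝ} {c : ℤ × ℤ → ℂ} (hc : Dec s C c) : 0 ≤ C :=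
  (mul_nonneg (pow_nonneg (rho_pos 0).le _) (norm_nonneg _)).trans (hc 0)

lemma Dec.le {s : ℕ} {C : ℝ} {c : ℤ × ℤ → ℂ} (hc : Dec (s + 3) C c) (n : ℤ × ℤ) :
    rho n ^ s * ‖c n‖ ≤ C * (rho n ^ 3)⁻¹ := by
  have h := rho_pos n; rw [← div_eq_mul_inv, le_div_iff₀ pos!]; have := hc n; rw [pow_add] at this; linarith

lemma coef_mul {g h : Fn₂} (hg : C₂ g) (hh : C₂ h)
    (hp : Periodic2 h) (hs : Summable fun n => ‖coef h n‖) (n : ℤ × ℤ) :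
    HasSum (fun m => coef h m * coef g (n - m)) (coef (fun x y => g x y * h x y) n) := by
  have hgu := hg
  set F : ℤ × ℤ → ℝ × ℝ → ℂ := fun m p =>
    coef h m * ((g p.1 p.2 : ℂ) * (e1 (-(n - m).1) p.1 * e1 (-(n - m).2) p.2)) with hF
  have hn : ∀ m p, ‖F m p‖ = ‖coef h m‖ * |g p.1 p.2| := fun m p => by
    simp only [hF, norm_mul, norm_e1, mul_one, norm_real, norm_eq_abs]
  have h1 := hasSum_integral_of_summable_integral_norm (μ := volume.restrict square) (F := F)
    (fun m => (coef_integrable hg (n - m)).const_mul _) (by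
      simp only [hn, integral_const_mul]
      exact hs.mul_right _)
  have h2 : ∀ p : ℝ × ℝ, ∑' m, F m p = ((g p.1 p.2 * h p.1 p.2 : ℝ) : ℂ) * (e1 (-n.1) p.1 * e1 (-n.2) p.2) := by
    intro p; have := (hasSum_coef hh hp hs p.1 p.2).mul_left ((g p.1 p.2 : ℂ) * (e1 (-n.1) p.1 * e1 (-n.2) p.2))
    rw [Complex.ofReal_mul, show ((g p.1 p.2 : ℂ) * (h p.1 p.2 : ℂ)) * (e1 (-n.1) p.1 * e1 (-n.2) p.2) =
      (g p.1 p.2 : ℂ) * (e1 (-n.1) p.1 * e1 (-n.2) p.2) * (h p.1 p.2 : ℂ) by ring, ← this.tsum_eq]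
    congr 1; funext m; simp only [hF, Prod.fst_sub, Prod.snd_sub]
    rw [show -(n.1 - m.1) = -n.1 + m.1 by ring, show -(n.2 - m.2) = -n.2 + m.2 by ring, e1_add, e1_add]; ring
  simp only [h2] at h1; have h3 := h1.mul_left (((2 * π) ^ 2 : ℝ) : ℂ)⁻¹
  have e : ∀ m, (((2 * π) ^ 2 : ℝ) : ℂ)⁻¹ * ∫ p in square, F m p = coef h m * coef g (n - m) := fun m => by
    simp only [hF, integral_const_mul]; rw [coef.eq_1 g]; ring
  simp only [e] at h3; exact h3

lemma Dec.summable {s : ℕ} {C : ℝ} {c : ℤ × ℤ → ℂ} (hc : Dec (s + 3) C c) : Summable fun n => rho n ^ s * ‖c n‖ :=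
  Summable.of_nonneg_of_le (fun n => mul_nonneg (pow_nonneg (rho_pos n).le _) (norm_nonneg _)) hc.le
    (summable_rho.mul_left C)

section
variable {g h : Fn₂} (hg : C₂ g) (hh : C₂ h)
    (hp : Periodic2 h)
include hg hh hp

lemma norm_coef_mul_le {s : ℕ} {A C : ℝ} (hs : Dec 3 C (coef h)) (n : ℤ × ℤ)
    (hA : ∀ m, rho n ^ s * (‖coef h m‖ * ‖coef g (n - m)‖) ≤ A * ((rho m ^ 3)⁻¹ + (rho (n - m) ^ 3)⁻¹)) :
    rho n ^ s * ‖coef (fun x y => g x y * h x y) n‖ ≤ A * (2 * zsum) := by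
  have h1 := coef_mul hg hh hp (by simpa using Dec.summable (s := 0) hs) n
  have h2 : HasSum (fun m => A * ((rho m ^ 3)⁻¹ + (rho (n - m) ^ 3)⁻¹)) (A * (zsum + zsum)) := by
    refine (summable_rho.hasSum.add ?_).mul_left A
    exact (Equiv.subLeft n).hasSum_iff (f := fun m => (rho m ^ 3)⁻¹) |>.2 summable_rho.hasSum
  have h3 := h1.mul_left ((rho n ^ s : ℝ) : ℂ); rw [two_mul, ← h2.tsum_eq]
  have h4 : ‖((rho n ^ s : ℝ) : ℂ) * coef (fun x y => g x y * h x y) n‖ =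
      rho n ^ s * ‖coef (fun x y => g x y * h x y) n‖ := by
    rw [norm_mul, norm_real, norm_of_nonneg (pow_nonneg (rho_pos n).le _)]
  rw [← h4, ← h3.tsum_eq]; refine tsum_of_norm_bounded h2.summable.hasSum fun m => ?_
  rw [norm_mul, norm_mul, norm_real, norm_of_nonneg (pow_nonneg (rho_pos n).le _)]; exact hA m

lemma Dec.mul_of_le {s : ℕ} {C C' : ℝ} (h1 : Dec s C (coef g)) (h2 : Dec (s + 3) C' (coef h)) :
    Dec s (C * C' * (2 * zsum)) (coef fun x y => g x y * h x y) := fun n => by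
  refine norm_coef_mul_le hg hh hp (h2.mono om!) n fun m => ?_; have p := rho_pos (n - m); have q := rho_pos m
  have hr : rho n ≤ rho m * rho (n - m) := by
    linarith [rho_le_add n m, mul_nonneg (sub_nonneg.2 (one_le_rho m)) (sub_nonneg.2 (one_le_rho (n - m)))]
  have n1 := norm_nonneg (coef h m); have n2 := norm_nonneg (coef g (n - m)); have c1 := h1.nonneg
  have c2 := h2.nonneg
  calc rho n ^ s * (‖coef h m‖ * ‖coef g (n - m)‖)
      ≤ (rho m * rho (n - m)) ^ s * (‖coef h m‖ * ‖coef g (n - m)‖) := by gcongr; exact (rho_pos n).le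
    _ = (rho m ^ s * ‖coef h m‖) * (rho (n - m) ^ s * ‖coef g (n - m)‖) := by ring
    _ ≤ (C' * (rho m ^ 3)⁻¹) * C := mul_le_mul (h2.le m) (h1 _) pos! pos!
    _ = C * C' * (rho m ^ 3)⁻¹ := by ring
    _ ≤ _ := by gcongr; exact le_add_of_nonneg_right pos!

lemma Dec.mul {s : ℕ} {C C' : ℝ} (h1 : Dec (s + 3) C (coef g)) (h2 : Dec (s + 3) C' (coef h)) :
    Dec (s + 3) (2 ^ (s + 3) * C * C' * (2 * zsum)) (coef fun x y => g x y * h x y) := fun n => by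
  refine norm_coef_mul_le hg hh hp (h2.mono om!) n fun m => ?_; have p := rho_pos (n - m); have q := rho_pos m
  have n1 := norm_nonneg (coef h m); have n2 := norm_nonneg (coef g (n - m)); have c1 := h1.nonneg
  have c2 := h2.nonneg
  have hr : rho n ^ (s + 3) ≤ 2 ^ (s + 3) * (rho m ^ (s + 3) + rho (n - m) ^ (s + 3)) := by
    have : rho n ≤ 2 * max (rho m) (rho (n - m)) := (by
      linarith [rho_le_add n m, le_max_left (rho m) (rho (n - m)), le_max_right (rho m) (rho (n - m))])
    refine (pow_le_pow_left₀ (rho_pos n).le this _).trans ?_; rw [mul_pow]; gcongr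
    rcases max_choice (rho m) (rho (n - m)) with h | h <;> rw [h]
    · exact le_add_of_nonneg_right pos!
    · exact le_add_of_nonneg_left pos!
  have a1 : ‖coef g (n - m)‖ ≤ C * (rho (n - m) ^ 3)⁻¹ := by simpa using Dec.le (s := 0) (h1.mono om!) (n - m)
  have a2 : ‖coef h m‖ ≤ C' * (rho m ^ 3)⁻¹ := by simpa using Dec.le (s := 0) (h2.mono om!) m
  calc rho n ^ (s + 3) * (‖coef h m‖ * ‖coef g (n - m)‖)
      ≤ 2 ^ (s + 3) * (rho m ^ (s + 3) + rho (n - m) ^ (s + 3)) * (‖coef h m‖ * ‖coef g (n - m)‖) := by gcongr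
    _ = 2 ^ (s + 3) * ((rho m ^ (s + 3) * ‖coef h m‖) * ‖coef g (n - m)‖
        + (rho (n - m) ^ (s + 3) * ‖coef g (n - m)‖) * ‖coef h m‖) := by ring
    _ ≤ 2 ^ (s + 3) * (C' * (C * (rho (n - m) ^ 3)⁻¹) + C * (C' * (rho m ^ 3)⁻¹)) := by
        gcongr
        exacts [h2 m, h1 _]
    _ = _ := by ring

end

lemma Dec.of_gradient {g gx gy : Fn₂} (hg : C₂ g) (hgx : C₂ gx) (hgy : C₂ gy)
    (hx : ∀ x y, HasDerivAt (fun x => g x y) (gx x y) x) (hy : ∀ x y, HasDerivAt (fun y => g x y) (gy x y) y)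
    (hp : Periodic2 g) {s : ℕ} {C : ℝ} (h0 : Dec s C (coef g)) (h1 : Dec s C (coef gx)) (h2 : Dec s C (coef gy)) :
    Dec (s + 1) (3 * C) (coef g) := fun n => by
  have a1 := h1 n; have a2 := h2 n
  rw [coef_dx hg hgx hx hp, norm_mul, norm_mul, Complex.norm_I, one_mul, Complex.norm_intCast] at a1
  rw [coef_dy hg hgy hy hp, norm_mul, norm_mul, Complex.norm_I, one_mul, Complex.norm_intCast] at a2
  have a0 := h0 n; rw [pow_succ]
  have e : rho n ^ s * rho n * ‖coef g n‖ = rho n ^ s * ‖coef g n‖ + rho n ^ s * (|(n.1 : ℝ)| * ‖coef g n‖)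
      + rho n ^ s * (|(n.2 : ℝ)| * ‖coef g n‖) := by
    nth_rw 2 [rho]; ring
  linarith

/-! ### Fourier series -/

/-- The term of index `n` of the derivative of order `(a, b)` of a Fourier series. -/
def serTerm (c : ℤ × ℤ → ℂ) (a b : ℕ) (x y : ℝ) (n : ℤ × ℤ) : ℂ :=
  c n * (I * n.1) ^ a * (I * n.2) ^ b * (e1 n.1 x * e1 n.2 y)

/-- The derivative of order `(a, b)` of the real part of a Fourier series. -/
def ser (c : ℤ × ℤ → ℂ) (a b : ℕ) (x y : ℝ) : ℝ := (∑' n, serTerm c a b x y n).re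

section
variable {c : ℤ × ℤ → ℂ} {a b : ℕ} {C : ℝ}

lemma norm_serTerm_le (c : ℤ × ℤ → ℂ) (a b : ℕ) (x y : ℝ) (n : ℤ × ℤ) :
    ‖serTerm c a b x y n‖ ≤ rho n ^ (a + b) * ‖c n‖ := by
  have h1 : |(n.1 : ℝ)| ≤ rho n := by rw [rho]; linarith [abs_nonneg (n.2 : ℝ)]
  have h2 : |(n.2 : ℝ)| ≤ rho n := by rw [rho]; linarith [abs_nonneg (n.1 : ℝ)]
  simp only [serTerm, norm_mul, norm_pow, norm_e1, Complex.norm_I, one_mul, mul_one, Complex.norm_intCast]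
  calc ‖c n‖ * |(n.1 : ℝ)| ^ a * |(n.2 : ℝ)| ^ b ≤ ‖c n‖ * rho n ^ a * rho n ^ b := by
        have := (rho_pos n).le; gcongr
    _ = _ := by ring

lemma serTerm_summable (hc : Dec (a + b + 3) C c) (x y : ℝ) : Summable (serTerm c a b x y) :=
  Summable.of_norm_bounded hc.summable fun n => norm_serTerm_le c a b x y n

lemma abs_ser_le (hc : Dec (a + b + 3) C c) (x y : ℝ) : |ser c a b x y| ≤ C * zsum :=
  (Complex.abs_re_le_norm _).trans (tsum_of_norm_bounded (summable_rho.hasSum.mul_left C) fun n =>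
    (norm_serTerm_le c a b x y n).trans (hc.le n))

lemma ser_swap (c : ℤ × ℤ → ℂ) (a b : ℕ) (x y : ℝ) : ser c a b x y = ser (fun n => c n.swap) b a y x := by
  rw [ser, ser, ← (Equiv.prodComm ℤ ℤ).tsum_eq]; congr 2; funext n
  simp only [serTerm, Equiv.prodComm_apply, Prod.fst_swap, Prod.snd_swap]; ring

lemma Dec.swap {s : ℕ} (hc : Dec s C c) : Dec s C fun n => c n.swap := fun n => by
  have := hc n.swap; rwa [show rho n.swap = rho n by simp only [rho, Prod.fst_swap, Prod.snd_swap]; ring] at this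

lemma ser_dx (hc : Dec (a + b + 4) C c) (x y : ℝ) : HasDerivAt (fun x => ser c a b x y) (ser c (a + 1) b x y) x := by
  have h : HasDerivAt (fun x => ∑' n, serTerm c a b x y n) (∑' n, serTerm c (a + 1) b x y n) x := by
    refine hasDerivAt_tsum (u := fun n => rho n ^ (a + 1 + b) * ‖c n‖) (g := fun n x => serTerm c a b x y n)
      (g' := fun n x => serTerm c (a + 1) b x y n) (y₀ := 0)
      (Dec.summable (s := a + 1 + b) (hc.mono om!)) (fun n x => ?_)
      (fun n x => norm_serTerm_le c (a + 1) b x y n) (serTerm_summable (hc.mono om!) 0 y) x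
    have := ((hasDerivAt_e1 n.1 x).mul_const (e1 n.2 y)).const_mul
      (c n * (I * n.1) ^ a * (I * n.2) ^ b)
    exact this.congr_deriv (by simp only [serTerm]; ring)
  exact Complex.reCLM.hasFDerivAt.comp_hasDerivAt x h

lemma ser_dy (hc : Dec (a + b + 4) C c) (x y : ℝ) : HasDerivAt (fun y => ser c a b x y) (ser c a (b + 1) x y) y := by
  simp_rw [ser_swap c]; exact ser_dx (hc.swap.mono om!) y x

lemma continuous_ser (hc : Dec (a + b + 3) C c) : C₂ (ser c a b) := by
  refine Complex.continuous_re.comp (continuous_tsum (f := fun n (p : ℝ × ℝ) => serTerm c a b p.1 p.2 n)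
    (fun n => ?_) hc.summable fun n p => norm_serTerm_le c a b p.1 p.2 n)
  simp only [serTerm]; fun_prop

lemma ser_periodic (c : ℤ × ℤ → ℂ) (a b : ℕ) : Periodic2 (ser c a b) := fun x y => by
  simp only [ser, serTerm, e1_periodic, and_self]

lemma smooth2_ser (h : ∀ s, ∃ C, Dec s C c) (hc : Dec (2 * m + 3) C c) : Smooth2 m (C * zsum) (ser c) where
  dx a b x y := (h (a + b + 4)).elim fun _ h => ser_dx h x y
  dy a b x y := (h (a + b + 4)).elim fun _ h => ser_dy h x y
  px a b x y := (ser_periodic c a b x y).1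
  py a b x y := (ser_periodic c a b x y).2
  cont a b := (h (a + b + 3)).elim fun _ h => continuous_ser h
  bdd a b := (h (a + b + 3)).imp' (fun C => C * zsum) fun _ h x y => abs_ser_le h x y
  bd a ha b hb x y := abs_ser_le (hc.mono om!) x y

end

lemma ser_coef (hg : C₂ g) (hp : Periodic2 g) {C : ℝ} (h : Dec 3 C (coef g)) : ser (coef g) 0 0 = g := by
  funext x y; have := hasSum_coef hg hp (by simpa using Dec.summable (s := 0) h) x y
  simp only [ser, serTerm, pow_zero, mul_one]; rw [this.tsum_eq, Complex.ofReal_re]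

/-! ### Fourier coefficients and weak derivatives -/

lemma integral_unfold {G : Fn₂} {p q : Fn} (hG : IntegrableOn (uncurry G) square volume)
    (hGp : Periodic2 G) (hp : Continuous p) (hq : Continuous q)
    (hp0 : ∀ x ∉ Ioc 0 (4 * π), p x = 0) (hq0 : ∀ x ∉ Ioc 0 (4 * π), q x = 0) :
    ∫ z : ℝ × ℝ, G z.1 z.2 * (p z.1 * q z.2) = ∫ z in square,
      G z.1 z.2 * ((p z.1 + p (z.1 + 2 * π)) * (q z.2 + q (z.2 + 2 * π))) := by
  have hπ := pi_pos; set J : Set ℝ := Ioc 0 (2 * π) with hJ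
  set R : Fin 2 → Fin 2 → ℝ × ℝ → ℝ := fun a b z =>
    G z.1 z.2 * (p (z.1 + 2 * π * (a : ℕ)) * q (z.2 + 2 * π * (b : ℕ))) with hR
  have hQ : J ×ˢ J =ᵐ[volume] square := Measure.set_prod_ae_eq Ioc_ae_eq_Icc Ioc_ae_eq_Icc
  have hRi : ∀ a b, IntegrableOn (R a b) square volume := fun a b =>
    IntegrableOn.mul_continuousOn hG fp! isCompact_square
  have hm : MeasurableSet (J ×ˢ J) := measurableSet_Ioc.prod measurableSet_Ioc
  set v : Fin 2 → Fin 2 → ℝ × ℝ := fun a b => (2 * π * (a : ℕ), 2 * π * (b : ℕ)) with hv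
  have hone : ∀ (r : Fn), (∀ x ∉ Ioc 0 (4 * π), r x = 0) → ∀ x,
      r x = ∑ a : Fin 2, J.indicator 1 (x - 2 * π * (a : ℕ)) * r x := by
    intro r hr x; rw [Fin.sum_univ_two]
    by_cases hx : x ∈ Ioc 0 (4 * π)
    · by_cases h2 : x ≤ 2 * π
      · rw [indicator_of_mem (by simpa [hJ] using ⟨hx.1, h2⟩), indicator_of_notMem (by simp [hJ]; intro; linarith)]
        simp
      · rw [indicator_of_notMem (by simp [hJ]; intro; linarith), indicator_of_mem (by
          simp [hJ]; constructor <;> linarith [hx.2])]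
        simp
    · rw [hr x hx]; simp
  have hF : ∀ z : ℝ × ℝ, G z.1 z.2 * (p z.1 * q z.2) = ∑ a, ∑ b, (J ×ˢ J).indicator (R a b) (z - v a b) := by
    intro z
    have e : ∀ a b, (J ×ˢ J).indicator (R a b) (z - v a b) = G z.1 z.2 *
        ((J.indicator 1 (z.1 - 2 * π * (a : ℕ)) * p z.1) * (J.indicator 1 (z.2 - 2 * π * (b : ℕ)) * q z.2)) := by
      intro a b
      have hg : G (z.1 - 2 * π * (a : ℕ)) (z.2 - 2 * π * (b : ℕ)) = G z.1 z.2 := by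
        have h1 := fun x y => (hGp (x - 2 * π) y).1; have h2 := fun x y => (hGp x (y - 2 * π)).2
        simp only [sub_add_cancel] at h1 h2
        fin_cases a <;> fin_cases b <;> simp [← h1, ← h2]
      by_cases h1 : z.1 - 2 * π * (a : ℕ) ∈ J
      · by_cases h2 : z.2 - 2 * π * (b : ℕ) ∈ J
        · rw [indicator_of_mem (show z - v a b ∈ J ×ˢ J from ⟨h1, h2⟩), indicator_of_mem h1, indicator_of_mem h2]
          simp only [hR, hv, Prod.fst_sub, Prod.snd_sub, hg, sub_add_cancel, Pi.one_apply, one_mul]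
        · rw [indicator_of_notMem (fun h => h2 h.2), indicator_of_notMem h2]; simp
      · rw [indicator_of_notMem (fun h => h1 h.1), indicator_of_notMem h1]; simp
    simp only [e, ← mul_sum, ← sum_mul, ← hone p hp0, ← hone q hq0]
  simp_rw [hF]
  have hi : ∀ a b, Integrable (fun z => (J ×ˢ J).indicator (R a b) (z - v a b)) volume := fun a b =>
    ((integrable_indicator_iff hm).2 ((hRi a b).congr_set_ae hQ)).comp_sub_right _
  rw [integral_finsetSum _ fun a _ => integrable_finsetSum _ fun b _ => hi a b]
  have h3 : ∀ a b, ∫ z, (J ×ˢ J).indicator (R a b) (z - v a b) = ∫ z in square, R a b z := fun a b => by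
    rw [integral_sub_right_eq_self, integral_indicator hm, setIntegral_congr_set hQ]
  simp_rw [integral_finsetSum _ fun b _ => hi _ b, h3, ← integral_finsetSum _ fun b _ => hRi _ b]
  rw [← integral_finsetSum _ fun a _ => integrable_finsetSum _ fun b _ => hRi a b]; congr 1; funext z
  simp only [hR, Fin.sum_univ_two]; simp; ring

/-- A smooth cutoff function whose translates by multiples of `2π` add up to one. -/
def cutoff (x : ℝ) : ℝ := smoothTransition (x / (2 * π)) - smoothTransition (x / (2 * π) - 1)

lemma contDiff_cutoff : C∞ cutoff := (smoothTransition.contDiff.comp fp!).sub (smoothTransition.contDiff.comp fp!)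

lemma iteratedDeriv_eqOn_closure {f g : Fn} (hf : C∞ f) (hg : C∞ g) {O : Set ℝ}
    (hO : IsOpen O) (h : EqOn f g O) (a : ℕ) : EqOn (iteratedDeriv a f) (iteratedDeriv a g) (closure O) :=
  EqOn.closure (fun _ hx => (h.eventuallyEq_of_mem (hO.mem_nhds hx)).iteratedDeriv_eq a)
    (hf.continuous_iteratedDeriv a (by exact_mod_cast le_top))
    (hg.continuous_iteratedDeriv a (by exact_mod_cast le_top))

section
variable {P : Fn} (hP : C∞ P)
include hP

lemma iteratedDeriv_cutoff_eq_zero (a : ℕ) : ∀ x ∉ Ioc 0 (4 * π),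
    iteratedDeriv a (fun x => cutoff x * P x) x = 0 := by
  have hπ := pi_pos
  have h0 : ∀ x, iteratedDeriv a (fun _ : ℝ => (0 : ℝ)) x = 0 := fun x => by rw [iteratedDeriv_const]; simp
  have hs := contDiff_cutoff.mul hP; intro x hx; rw [← h0 x]
  by_cases h : x ≤ 0
  · refine iteratedDeriv_eqOn_closure hs contDiff_const isOpen_Iio (fun x hx => ?_) a (by rw [closure_Iio]; exact h)
    have : x / (2 * π) ≤ 0 := div_nonpos_of_nonpos_of_nonneg (le_of_lt hx) pos!
    simp [cutoff, smoothTransition.zero_of_nonpos this,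
      smoothTransition.zero_of_nonpos (show x / (2 * π) - 1 ≤ 0 by linarith)]
  · refine iteratedDeriv_eqOn_closure hs contDiff_const (isOpen_Ioi (a := 4 * π)) (fun x hx => ?_) a
      (by rw [closure_Ioi]; exact not_lt.1 fun h' => hx ⟨not_le.1 h, h'.le⟩)
    have : 2 ≤ x / (2 * π) := by rw [le_div_iff₀ pos!]; linarith [mem_Ioi.1 hx]
    simp [cutoff, smoothTransition.one_of_one_le (show 1 ≤ x / (2 * π) by linarith),
      smoothTransition.one_of_one_le (show 1 ≤ x / (2 * π) - 1 by linarith)]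

lemma iteratedDeriv_cutoff_add (hp : ∀ x, P (x + 2 * π) = P x) (a : ℕ) {x : ℝ}
    (hx : x ∈ Icc 0 (2 * π)) : iteratedDeriv a (fun x => cutoff x * P x) x
      + iteratedDeriv a (fun x => cutoff x * P x) (x + 2 * π) = iteratedDeriv a P x := by
  have hπ := pi_pos; have hs := contDiff_cutoff.mul hP
  have hs' : C∞ fun x => cutoff (x + 2 * π) * P (x + 2 * π) := hs.comp (by fun_prop : C∞ fun x : ℝ => x + 2 * π)
  have e := iteratedDeriv_eqOn_closure (hs.add hs') hP (isOpen_Ioo (a := 0) (b := 2 * π))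
    (fun x hx => ?_) a (by rw [closure_Ioo pos!]; exact hx)
  · have hle : ((a : ℕ) : WithTop ℕ∞) ≤ ∞ := by exact_mod_cast le_top
    rw [← e, iteratedDeriv_fun_add (hs.of_le hle).contDiffAt (hs'.of_le hle).contDiffAt,
      iteratedDeriv_comp_add_const a (fun x => cutoff x * P x)]
  · have h1 : x / (2 * π) ≤ 1 := by rw [div_le_one pos!]; exact hx.2.le
    have h2 : 0 ≤ x / (2 * π) := div_nonneg hx.1.le pos!
    have h3 : (x + 2 * π) / (2 * π) = x / (2 * π) + 1 := by field_simp
    simp only [cutoff, hp, h3, add_sub_cancel_right,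
      smoothTransition.zero_of_nonpos (show x / (2 * π) - 1 ≤ 0 by linarith),
      smoothTransition.one_of_one_le (show 1 ≤ x / (2 * π) + 1 by linarith)]
    ring

end

lemma isFiniteMeasure_square : IsFiniteMeasure (volume.restrict square) :=
  isFiniteMeasure_restrict.2 isCompact_square.measure_lt_top.ne

lemma IsWeakDeriv.integrableOn {a b : ℕ} {g d : Fn₂} (h : IsWeakDeriv a b g d) :
    IntegrableOn (uncurry d) square volume :=
  have := isFiniteMeasure_square
  h.memLp.integrable num!

lemma IsWeakDeriv.integral_mul {a b : ℕ} {g d : Fn₂} (h : IsWeakDeriv a b g d)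
    (hg : C₂ g) (hgp : Periodic2 g) {P Q : Fn} (hP : C∞ P)
    (hQ : C∞ Q) (hPp : ∀ x, P (x + 2 * π) = P x) (hQp : ∀ x, Q (x + 2 * π) = Q x) :
    ∫ z in square, g z.1 z.2 * (iteratedDeriv a P z.1 * iteratedDeriv b Q z.2) =
      (-1) ^ (a + b) * ∫ z in square, d z.1 z.2 * (P z.1 * Q z.2) := by
  have hπ := pi_pos; have hs : ∀ {P}, C∞ P → C∞ fun x => cutoff x * P x := fun hP => contDiff_cutoff.mul hP
  have hc : ∀ {P}, C∞ P → ∀ a, Continuous (iteratedDeriv a fun x => cutoff x * P x) := fun hP a =>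
    (hs hP).continuous_iteratedDeriv a (by exact_mod_cast le_top)
  have key := h.integral_eq (fun x y => (cutoff x * P x) * (cutoff y * Q y))
    (((hs hP).comp contDiff_fst).mul ((hs hQ).comp contDiff_snd))
    (HasCompactSupport.intro (K := Icc 0 (4 * π) ×ˢ Icc 0 (4 * π)) (isCompact_Icc.prod isCompact_Icc) fun z hz => by
        by_cases h1 : z.1 ∈ Ioc 0 (4 * π)
        · have h2 : z.2 ∉ Ioc 0 (4 * π) := fun h2 => hz ⟨Ioc_subset_Icc_self h1, Ioc_subset_Icc_self h2⟩
          have := iteratedDeriv_cutoff_eq_zero hQ 0 _ h2; rw [iteratedDeriv_zero] at this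
          simp only [uncurry, this, mul_zero]
        · have := iteratedDeriv_cutoff_eq_zero hP 0 _ h1; rw [iteratedDeriv_zero] at this
          simp only [uncurry, this, zero_mul])
  have hmix : ∀ x y, mixedDeriv a b (fun x y => (cutoff x * P x) * (cutoff y * Q y)) x y =
      iteratedDeriv a (fun x => cutoff x * P x) x * iteratedDeriv b (fun y => cutoff y * Q y) y := fun x y => by
    simp only [mixedDeriv, iteratedDeriv_const_mul_field]
    simp only [mul_comm _ (iteratedDeriv b (fun y => cutoff y * Q y) y), iteratedDeriv_const_mul_field]
  simp only [hmix] at key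
  rw [integral_unfold (hg.continuousOn.integrableOn_compact isCompact_square) hgp (hc hP a) (hc hQ b)
    (iteratedDeriv_cutoff_eq_zero hP a) (iteratedDeriv_cutoff_eq_zero hQ b)] at key
  have k0 := integral_unfold h.integrableOn h.periodic (hc hP 0) (hc hQ 0)
    (iteratedDeriv_cutoff_eq_zero hP 0) (iteratedDeriv_cutoff_eq_zero hQ 0)
  have hm := isCompact_square.measurableSet
  rw [setIntegral_congr_fun hm (g := fun z => d z.1 z.2 * (P z.1 * Q z.2)) fun z hz => by
    simp only [iteratedDeriv_cutoff_add hP hPp 0 hz.1, iteratedDeriv_cutoff_add hQ hQp 0 hz.2]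
    simp only [iteratedDeriv_zero]] at k0
  simp only [iteratedDeriv_zero] at k0; rw [← k0, ← key]; refine setIntegral_congr_fun hm fun z hz => ?_
  simp only [iteratedDeriv_cutoff_add hP hPp a hz.1, iteratedDeriv_cutoff_add hQ hQp b hz.2]

lemma coef_trig {G : Fn₂} (hG : IntegrableOn (uncurry G) square volume) (n : ℤ × ℤ) :
    coef G n = (((2 * π) ^ 2 : ℝ) : ℂ)⁻¹ * (((∫ z in square, G z.1 z.2 * (cos (n.1 * z.1) * cos (n.2 * z.2)) : ℝ) : ℂ)
      - ((∫ z in square, G z.1 z.2 * (sin (n.1 * z.1) * sin (n.2 * z.2)) : ℝ) : ℂ)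
      - I * (((∫ z in square, G z.1 z.2 * (sin (n.1 * z.1) * cos (n.2 * z.2)) : ℝ) : ℂ)
        + ((∫ z in square, G z.1 z.2 * (cos (n.1 * z.1) * sin (n.2 * z.2)) : ℝ) : ℂ))) := by
  have hi : ∀ {P Q : Fn}, Continuous P → Continuous Q →
      Integrable (fun z : ℝ × ℝ => ((G z.1 z.2 * (P z.1 * Q z.2) : ℝ) : ℂ)) (volume.restrict square) :=
    fun hP hQ => (IntegrableOn.mul_continuousOn hG fp! isCompact_square).ofReal
  have c1 : Continuous fun x : ℝ => cos (n.1 * x) := fp!; have c2 : Continuous fun x : ℝ => cos (n.2 * x) := fp!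
  have s1 : Continuous fun x : ℝ => sin (n.1 * x) := fp!; have s2 : Continuous fun x : ℝ => sin (n.2 * x) := fp!
  have he : ∀ (m : ℤ) (x : ℝ), e1 (-m) x = cos (m * x) - sin (m * x) * I := fun m x => by
    rw [e1, show I * ((-m : ℤ) : ℂ) * x = ((-(m * x) : ℝ) : ℂ) * I by push_cast; ring,
      Complex.exp_mul_I, ← Complex.ofReal_cos, ← Complex.ofReal_sin, Real.cos_neg, Real.sin_neg]
    push_cast; ring
  have e : ∀ z : ℝ × ℝ, (G z.1 z.2 : ℂ) * (e1 (-n.1) z.1 * e1 (-n.2) z.2) =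
      ((G z.1 z.2 * (cos (n.1 * z.1) * cos (n.2 * z.2)) : ℝ) : ℂ)
      - ((G z.1 z.2 * (sin (n.1 * z.1) * sin (n.2 * z.2)) : ℝ) : ℂ)
      - I * (((G z.1 z.2 * (sin (n.1 * z.1) * cos (n.2 * z.2)) : ℝ) : ℂ)
        + ((G z.1 z.2 * (cos (n.1 * z.1) * sin (n.2 * z.2)) : ℝ) : ℂ)) := fun z => by
    rw [he, he]; push_cast
    linear_combination (G z.1 z.2 : ℂ) * Complex.sin (n.1 * z.1) * Complex.sin (n.2 * z.2) * Complex.I_sq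
  simp only [coef, e]
  rw [integral_sub, integral_sub (hi c1 c2) (hi s1 s2), integral_const_mul, integral_add (hi s1 c2) (hi c1 s2)]
  · simp only [integral_complex_ofReal]
  · exact (hi c1 c2).sub (hi s1 s2)
  · exact ((hi s1 c2).add (hi c1 s2)).const_mul _

lemma iteratedDeriv_cos_even (a : ℕ) (n : ℤ) : iteratedDeriv (2 * a) (fun x : ℝ => cos (n * x)) =
    fun x => (n : ℝ) ^ (2 * a) * (-1) ^ a * cos (n * x) := by
  rw [iteratedDeriv_comp_const_mul (Real.contDiff_cos.of_le le_top), Real.iteratedDeriv_even_cos]; funext x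
  simp [mul_assoc]

lemma iteratedDeriv_sin_even (a : ℕ) (n : ℤ) : iteratedDeriv (2 * a) (fun x : ℝ => sin (n * x)) =
    fun x => (n : ℝ) ^ (2 * a) * (-1) ^ a * sin (n * x) := by
  rw [iteratedDeriv_comp_const_mul (Real.contDiff_sin.of_le le_top), Real.iteratedDeriv_even_sin]; funext x
  simp [mul_assoc]

lemma IsWeakDeriv.norm_coef {a b : ℕ} {g d : Fn₂} (h : IsWeakDeriv (2 * a) (2 * b) g d)
    (hg : C₂ g) (hgp : Periodic2 g) (n : ℤ × ℤ) :
    |(n.1 : ℝ)| ^ (2 * a) * |(n.2 : ℝ)| ^ (2 * b) * ‖coef g n‖ = ‖coef d n‖ := by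
  have hp : ∀ (m : ℤ) (x : ℝ), cos (m * (x + 2 * π)) = cos (m * x) ∧
      sin (m * (x + 2 * π)) = sin (m * x) := fun m x => by
    rw [mul_add]; exact ⟨Real.cos_add_int_mul_two_pi _ m, Real.sin_add_int_mul_two_pi _ m⟩
  have cc : ∀ m : ℤ, C∞ fun x : ℝ => cos (m * x) := fun m => by fun_prop
  have cs : ∀ m : ℤ, C∞ fun x : ℝ => sin (m * x) := fun m => by fun_prop
  set L : ℝ := (n.1 : ℝ) ^ (2 * a) * (-1) ^ a * ((n.2 : ℝ) ^ (2 * b) * (-1) ^ b) with hL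
  have key : ∀ {P Q : Fn}, C∞ P → C∞ Q → (∀ x, P (x + 2 * π) = P x) → (∀ x, Q (x + 2 * π) = Q x) →
      iteratedDeriv (2 * a) P = (fun x => (n.1 : ℝ) ^ (2 * a) * (-1) ^ a * P x) →
      iteratedDeriv (2 * b) Q = (fun x => (n.2 : ℝ) ^ (2 * b) * (-1) ^ b * Q x) →
      ∫ z in square, d z.1 z.2 * (P z.1 * Q z.2) = L * ∫ z in square, g z.1 z.2 * (P z.1 * Q z.2) := by
    intro P Q hP hQ hPp hQp hP' hQ'; have := h.integral_mul hg hgp hP hQ hPp hQp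
    rw [hP', hQ', ← mul_add, (even_two_mul (a + b)).neg_one_pow, one_mul] at this
    rw [← this, ← integral_const_mul]; congr 1; funext z; rw [hL]; ring
  have e : coef d n = L * coef g n := by
    rw [coef_trig h.integrableOn, coef_trig (hg.continuousOn.integrableOn_compact isCompact_square),
      key (cc n.1) (cc n.2) (fun x => (hp _ x).1) (fun x => (hp _ x).1) (iteratedDeriv_cos_even a n.1)
        (iteratedDeriv_cos_even b n.2),
      key (cs n.1) (cs n.2) (fun x => (hp _ x).2) (fun x => (hp _ x).2) (iteratedDeriv_sin_even a n.1)
        (iteratedDeriv_sin_even b n.2),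
      key (cs n.1) (cc n.2) (fun x => (hp _ x).2) (fun x => (hp _ x).1) (iteratedDeriv_sin_even a n.1)
        (iteratedDeriv_cos_even b n.2),
      key (cc n.1) (cs n.2) (fun x => (hp _ x).1) (fun x => (hp _ x).2) (iteratedDeriv_cos_even a n.1)
        (iteratedDeriv_sin_even b n.2)]
    push_cast; ring
  rw [e, norm_mul, norm_real, norm_eq_abs, hL]; simp [abs_mul, abs_pow]

lemma IsWeakDeriv.norm_coef_le {a b : ℕ} {g d : Fn₂} (h : IsWeakDeriv a b g d) {s : ℝ} (hs : 0 < s)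
    (n : ℤ × ℤ) : ‖coef d n‖ ≤ s + (∫ z in square, d z.1 z.2 ^ 2) / s := by
  have := isFiniteMeasure_square; have hπ := Real.pi_gt_three
  have i1 : Integrable (fun z : ℝ × ℝ => d z.1 z.2 ^ 2) (volume.restrict square) := h.memLp.integrable_sq
  have h1 : ‖∫ z in square, (d z.1 z.2 : ℂ) * (e1 (-n.1) z.1 * e1 (-n.2) z.2)‖ ≤
      ∫ z in square, (s + d z.1 z.2 ^ 2 / s) := by
    refine norm_integral_le_of_norm_le ((integrable_const s).add (i1.div_const s))
      (Filter.Eventually.of_forall fun z => ?_)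
    rw [norm_mul, norm_mul, norm_e1, norm_e1, mul_one, mul_one, norm_real, norm_eq_abs, ← sq_abs]
    have : |d z.1 z.2| * s ≤ s * s + |d z.1 z.2| ^ 2 := by
      nlinarith [sq_nonneg (|d z.1 z.2| - s), abs_nonneg (d z.1 z.2), mul_nonneg (abs_nonneg (d z.1 z.2)) hs.le]
    rw [show s + |d z.1 z.2| ^ 2 / s = (s * s + |d z.1 z.2| ^ 2) / s by field_simp, le_div_iff₀ hs]; exact this
  rw [integral_add (integrable_const s) (i1.div_const s), integral_const, integral_div, measureReal_restrict_apply_univ,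
    volume_square, smul_eq_mul] at h1
  have h2 : 0 ≤ (∫ z in square, d z.1 z.2 ^ 2) / s := div_nonneg (integral_nonneg fun z => sq_nonneg _) hs.le
  rw [coef, norm_mul, norm_inv, norm_real, norm_of_nonneg pos!, inv_mul_le_iff₀ pos!]
  have h3 : 1 ≤ (2 * π) ^ 2 := one_le_pow₀ (by linarith); linarith [le_mul_of_one_le_left h2 h3]

lemma MemH.norm_coef_le (hm : MemH m g) (hg : C₂ g)
    {a b : ℕ} (hab : 2 * a + 2 * b ≤ m) {s : ℝ} (hs : 0 < s) (n : ℤ × ℤ) :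
    |(n.1 : ℝ)| ^ (2 * a) * |(n.2 : ℝ)| ^ (2 * b) * ‖coef g n‖ ≤ s + normH m g ^ 2 / s := by
  have hw : IsWeakDeriv (2 * a) (2 * b) g (weakDeriv (2 * a) (2 * b) g) := Classical.epsilon_spec (hm.2.2 _ _ hab)
  have n0 : ∀ a b, 0 ≤ ∫ p in square, weakDeriv a b g p.1 p.2 ^ 2 := fun a b => integral_nonneg fun p => sq_nonneg _
  rw [hw.norm_coef hg hm.1]; refine (hw.norm_coef_le hs n).trans ?_; gcongr
  rw [normH, Real.sq_sqrt (sum_nonneg fun a _ => sum_nonneg fun b _ => n0 a b)]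
  exact (single_le_sum (f := fun b => ∫ p in square, weakDeriv (2 * a) b g p.1 p.2 ^ 2)
    (s := Finset.range (m + 1 - 2 * a)) (fun b _ => n0 _ b) (Finset.mem_range.2 om!)).trans
    (single_le_sum (f := fun a => ∑ b ∈ Finset.range (m + 1 - a), ∫ p in square, weakDeriv a b g p.1 p.2 ^ 2)
      (fun a _ => sum_nonneg fun b _ => n0 a b) (Finset.mem_range.2 om!))

lemma MemH.dec (hm6 : 6 ≤ m) (hm : MemH m g) (hg : C₂ g) : Dec 6 (3 ^ 7 * (1 + normH m g ^ 2)) (coef g) := fun n => by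
  have h0 := hm.norm_coef_le hg (a := 0) (b := 0) om! one_pos n
  have h1 := hm.norm_coef_le hg (a := 3) (b := 0) om! one_pos n
  have h2 := hm.norm_coef_le hg (a := 0) (b := 3) om! one_pos n; norm_num at h0 h1 h2
  have hr : rho n ^ 6 ≤ 3 ^ 6 * (1 + |(n.1 : ℝ)| ^ 6 + |(n.2 : ℝ)| ^ 6) := by
    have a1 := abs_nonneg (n.1 : ℝ); have a2 := abs_nonneg (n.2 : ℝ)
    have : rho n ≤ 3 * max 1 (max |(n.1 : ℝ)| |(n.2 : ℝ)|) := by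
      rw [rho]
      linarith [le_max_left 1 (max |(n.1 : ℝ)| |(n.2 : ℝ)|), le_max_right 1 (max |(n.1 : ℝ)| |(n.2 : ℝ)|),
        le_max_left |(n.1 : ℝ)| |(n.2 : ℝ)|, le_max_right |(n.1 : ℝ)| |(n.2 : ℝ)|]
    refine (pow_le_pow_left₀ (rho_pos n).le this 6).trans ?_; rw [mul_pow]; gcongr
    rcases max_choice 1 (max |(n.1 : ℝ)| |(n.2 : ℝ)|) with h | h <;> rw [h]
    · linarith [pow_nonneg a1 6, pow_nonneg a2 6]
    · rcases max_choice |(n.1 : ℝ)| |(n.2 : ℝ)| with h | h <;> rw [h] <;>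
      linarith [pow_nonneg a1 6, pow_nonneg a2 6]
  have := mul_le_mul_of_nonneg_right hr (norm_nonneg (coef g n)); linarith

lemma eq_zero_of_normH (hm : MemH m g) (hg : C₂ g) (h0 : normH m g = 0) : g = fun _ _ => 0 := by
  have hc : ∀ n, coef g n = 0 := fun n => by
    rw [← norm_le_zero_iff]; refine le_of_forall_pos_le_add fun s hs => ?_
    have := hm.norm_coef_le hg (a := 0) (b := 0) om! hs n; simpa [h0] using this
  have hd : Dec 3 0 (coef g) := fun n => by rw [hc n]; simp
  rw [← ser_coef hg hm.1 hd]; funext x y; simp [ser, serTerm, hc]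

/-- Decay of the Fourier coefficients of a family of functions, uniformly in the parameter. -/
def UDec (s : ℕ) (w : ℝ → Fn₂) : Prop := ∃ C, ∀ t, Dec s C (coef (w t))

lemma continuous_coef {w : ℝ → Fn₂} (hc : Continuous fun p : ℝ × ℝ × ℝ => w p.1 p.2.1 p.2.2)
    (n : ℤ × ℤ) : Continuous fun t => coef (w t) n := by
  refine continuous_const.mul (continuous_parametric_integral_of_continuous ?_ isCompact_square)
  unfold uncurry; have := continuous_e1; fun_prop

lemma continuous_section {w : ℝ → Fn₂} (hc : Continuous fun p : ℝ × ℝ × ℝ => w p.1 p.2.1 p.2.2)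
    (t : ℝ) : C₂ (w t) := hc.comp (Continuous.prodMk_right t)

/-- Decay of the coefficients of a smooth periodic function. -/
lemma dec_of_contDiff (hg : C∞ (uncurry g)) (hp : Periodic2 g) (s : ℕ) : ∃ C, Dec s C (coef g) := by
  induction s generalizing g with
  | zero =>
    refine ⟨((2 * π) ^ 2)⁻¹ * ∫ p in square, |g p.1 p.2|, fun n => ?_⟩
    rw [pow_zero, one_mul, coef, norm_mul, norm_inv, norm_real, norm_of_nonneg pos!]
    refine scale_le ((norm_integral_le_integral_norm _).trans_eq ?_) pos!
    simp only [norm_mul, norm_e1, mul_one, norm_real, norm_eq_abs]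
  | succ s ih =>
    have hd : ∀ v : ℝ × ℝ, C∞ fun p : ℝ × ℝ => fderiv ℝ (uncurry g) p v := fun v =>
      (hg.fderiv_right (m := ∞) (by norm_cast)).clm_apply contDiff_const
    have hf := fun p => (hg.differentiable (by simp) p).hasFDerivAt
    have hx : ∀ x y, HasDerivAt (fun x => g x y) (fderiv ℝ (uncurry g) (x, y) (1, 0)) x := fun x y =>
      (hf (x, y)).comp_hasDerivAt (f := fun x => (x, y)) x ((hasDerivAt_id x).prodMk (hasDerivAt_const x y))
    have hy : ∀ x y, HasDerivAt (fun y => g x y) (fderiv ℝ (uncurry g) (x, y) (0, 1)) y := fun x y =>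
      (hf (x, y)).comp_hasDerivAt (f := fun y => (x, y)) y ((hasDerivAt_const y x).prodMk (hasDerivAt_id y))
    have e : ∀ q : ℝ × ℝ, (∀ p : ℝ × ℝ, uncurry g (p + q) = uncurry g p) → ∀ p,
        fderiv ℝ (uncurry g) (p + q) = fderiv ℝ (uncurry g) p := fun q hq p => by
      rw [← fderiv_comp_add_right, funext hq]
    have hp' : ∀ v, Periodic2 fun x y => fderiv ℝ (uncurry g) (x, y) v := fun v x y => by
      have e1 := e (2 * π, 0) (fun p => by simpa [uncurry] using (hp p.1 p.2).1) (x, y)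
      have e2 := e (0, 2 * π) (fun p => by simpa [uncurry] using (hp p.1 p.2).2) (x, y)
      simp only [Prod.mk_add_mk, add_zero] at e1 e2; exact ⟨congrArg (· v) e1, congrArg (· v) e2⟩
    obtain ⟨C0, h0⟩ := ih hg hp
    obtain ⟨C1, h1⟩ := ih (g := fun x y => fderiv ℝ (uncurry g) (x, y) (1, 0)) (hd (1, 0)) (hp' _)
    obtain ⟨C2, h2⟩ := ih (g := fun x y => fderiv ℝ (uncurry g) (x, y) (0, 1)) (hd (0, 1)) (hp' _)
    exact ⟨_, Dec.of_gradient (gx := fun x y => fderiv ℝ (uncurry g) (x, y) (1, 0))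
      (gy := fun x y => fderiv ℝ (uncurry g) (x, y) (0, 1)) hg.continuous (hd (1, 0)).continuous
      (hd (0, 1)).continuous hx hy hp
      (C := max C0 (max C1 C2)) (fun n => (h0 n).trans (le_max_left _ _))
      (fun n => (h1 n).trans ((le_max_left _ _).trans (le_max_right _ _)))
      fun n => (h2 n).trans ((le_max_right _ _).trans (le_max_right _ _))⟩

/-- The Fourier coefficients of the right-hand side of the equation. -/
def rhsCoef (f1 f2 : Fn) (w : ℝ → Fn₂) (t : ℝ) (n : ℤ × ℤ) : ℂ :=
  -((n.1 ^ 2 + n.2 ^ 2 : ℝ) : ℂ) * coef (w t) n - I * n.1 * coef (fun x y => f1 (w t x y)) n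
    - I * n.2 * coef (fun x y => f2 (w t x y)) n

/-- The right-hand side of the equation. -/
def rhs (f1 f2 : Fn) (w : ℝ → Fn₂) (t x y : ℝ) : ℝ :=
  ser (coef (w t)) 2 0 x y + ser (coef (w t)) 0 2 x y - deriv f1 (w t x y) * ser (coef (w t)) 1 0 x y
    - deriv f2 (w t x y) * ser (coef (w t)) 0 1 x y

section
variable {w : ℝ → Fn₂} (hc : Continuous fun p : ℝ × ℝ × ℝ => w p.1 p.2.1 p.2.2)
    (hp : ∀ t, Periodic2 (w t)) (h6 : UDec 6 w)
include hc hp h6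

lemma hasDerivAt_flow (t x y : ℝ) : HasDerivAt (fun x => w t x y) (ser (coef (w t)) 1 0 x y) x ∧
    HasDerivAt (fun y => w t x y) (ser (coef (w t)) 0 1 x y) y := by
  obtain ⟨C, h⟩ := h6; have e := ser_coef (continuous_section hc t) (hp t) ((h t).mono (num! : 3 ≤ 6))
  have h1 := ser_dx (a := 0) (b := 0) ((h t).mono num!) x y
  have h2 := ser_dy (a := 0) (b := 0) ((h t).mono num!) x y; rw [e] at h1 h2; exact ⟨h1, h2⟩

lemma coef_flow (t : ℝ) (n : ℤ × ℤ) : coef (ser (coef (w t)) 1 0) n = I * n.1 * coef (w t) n ∧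
    coef (ser (coef (w t)) 0 1) n = I * n.2 * coef (w t) n := by
  obtain ⟨C, h⟩ := id h6; have hd := hasDerivAt_flow hc hp h6 t
  exact ⟨coef_dx (continuous_section hc t) (continuous_ser ((h t).mono num!)) (fun x y => (hd x y).1) (hp t) n,
    coef_dy (continuous_section hc t) (continuous_ser ((h t).mono num!)) (fun x y => (hd x y).2) (hp t) n⟩

lemma UDec.gradient {s : ℕ} (hs : UDec (s + 1) w) :
    UDec s (fun t => ser (coef (w t)) 1 0) ∧ UDec s (fun t => ser (coef (w t)) 0 1) := by
  obtain ⟨C, h⟩ := hs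
  have key : ∀ t (n : ℤ × ℤ) (m : ℤ), |(m : ℝ)| ≤ rho n → rho n ^ s * ‖I * m * coef (w t) n‖ ≤ C :=
    fun t n m hm => by
      rw [norm_mul, norm_mul, Complex.norm_I, one_mul, Complex.norm_intCast, ← mul_assoc]
      refine le_trans ?_ (h t n); rw [pow_succ]; have := rho_pos n; gcongr
  refine ⟨⟨C, fun t n => ?_⟩, C, fun t n => ?_⟩
  · rw [(coef_flow hc hp h6 t n).1]; exact key t n n.1 (by rw [rho]; linarith [abs_nonneg (n.2 : ℝ)])
  · rw [(coef_flow hc hp h6 t n).2]; exact key t n n.2 (by rw [rho]; linarith [abs_nonneg (n.1 : ℝ)])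

lemma flow_bounds (hf : C∞ f) : ∃ B, ∀ t x y, |f (w t x y)| ≤ B ∧
    |deriv f (w t x y)| ≤ B ∧ ∀ a b, a + b ≤ 3 → |ser (coef (w t)) a b x y| ≤ B := by
  obtain ⟨C, h⟩ := h6; obtain ⟨L, -, hL, -⟩ := smooth_flux_bounds hf (C * zsum)
  have hb : ∀ t x y a b, a + b ≤ 3 → |ser (coef (w t)) a b x y| ≤ C * zsum := fun t x y a b hab =>
    abs_ser_le ((h t).mono om!) x y
  refine ⟨max (C * zsum) L, fun t x y => ?_⟩; have h0 := hb t x y 0 0 num!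
  rw [ser_coef (continuous_section hc t) (hp t) ((h t).mono num!)] at h0
  exact ⟨(hL _ h0).1.trans (le_max_right _ _), (hL _ h0).2.1.trans (le_max_right _ _),
    fun a b hab => (hb t x y a b hab).trans (le_max_left _ _)⟩

lemma UDec.comp {s : ℕ} (hs : UDec s w) (hf : C∞ f) : UDec s fun t x y => f (w t x y) := by
  induction s generalizing f with
  | zero =>
    obtain ⟨B, hB⟩ := flow_bounds hc hp h6 hf
    exact ⟨B, fun t n => by rw [pow_zero, one_mul]; exact norm_coef_le (fun x y => (hB t x y).1) n⟩
  | succ s ih =>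
    have hw : UDec s w := hs.imp fun C h t => (h t).mono (Nat.le_succ s); have hf' := hf.drv
    obtain ⟨C0, h0⟩ := ih hw hf; obtain ⟨C1, h1⟩ := ih hw hf'; have hd := hasDerivAt_flow hc hp h6
    obtain ⟨C6, h6'⟩ := id h6
    have hcx : ∀ t, C₂ (ser (coef (w t)) 1 0) := fun t => continuous_ser ((h6' t).mono num!)
    have hcy : ∀ t, C₂ (ser (coef (w t)) 0 1) := fun t => continuous_ser ((h6' t).mono num!)
    have hcw := continuous_section hc
    have hfw : ∀ t, C₂ fun x y => deriv f (w t x y) := fun t => hf'.continuous.comp (hcw t)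
    have key : ∀ v : ℝ → Fn₂, (∀ t, C₂ (v t)) → (∀ t, Periodic2 (v t)) →
        UDec s v → UDec 5 v → UDec s fun t x y => deriv f (w t x y) * v t x y := by
      rintro v hv hvp ⟨A, hA⟩ ⟨A5, hA5⟩
      rcases lt_or_ge s 3 with h3 | h3
      · exact ⟨_, fun t => Dec.mul_of_le (hfw t) (hv t) (hvp t) (h1 t) ((hA5 t).mono om!)⟩
      · obtain ⟨r, rfl⟩ := Nat.exists_eq_add_of_le' h3
        exact ⟨_, fun t => Dec.mul (hfw t) (hv t) (hvp t) (h1 t) (hA t)⟩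
    obtain ⟨hx, hy⟩ := UDec.gradient hc hp h6 hs; obtain ⟨hx5, hy5⟩ := UDec.gradient hc hp h6 h6
    obtain ⟨Cx, kx⟩ := key _ hcx (fun t => ser_periodic _ _ _) hx hx5
    obtain ⟨Cy, ky⟩ := key _ hcy (fun t => ser_periodic _ _ _) hy hy5; have hdf := hf.hd
    refine ⟨3 * max C0 (max Cx Cy), fun t => Dec.of_gradient (g := fun x y => f (w t x y))
      (gx := fun x y => deriv f (w t x y) * ser (coef (w t)) 1 0 x y)
      (gy := fun x y => deriv f (w t x y) * ser (coef (w t)) 0 1 x y)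
      (hf.continuous.comp (hcw t)) ((hfw t).mul (hcx t)) ((hfw t).mul (hcy t)) (fun x y => (hdf _).comp x (hd t x y).1)
      (fun x y => (hdf _).comp y (hd t x y).2)
      (fun x y => ⟨by simp only [(hp t x y).1], by simp only [(hp t x y).2]⟩)
      (fun n => (h0 t n).trans (le_max_left _ _))
      (fun n => (kx t n).trans ((le_max_left _ _).trans (le_max_right _ _)))
      fun n => (ky t n).trans ((le_max_right _ _).trans (le_max_right _ _))⟩

variable {f1 f2 : Fn} (hf1 : C∞ f1) (hf2 : C∞ f2)
include hf1 hf2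

omit hp in
lemma continuous_rhs (t : ℝ) : C₂ (rhs f1 f2 w t) := by
  obtain ⟨C, h⟩ := h6
  have hs : ∀ a b, a + b ≤ 3 → Continuous fun p : ℝ × ℝ => ser (coef (w t)) a b p.1 p.2 := fun a b hab =>
    continuous_ser ((h t).mono om!)
  have hw := continuous_section hc t
  exact (((hs 2 0 num!).add (hs 0 2 num!)).sub ((hf1.drv.continuous.comp hw).mul (hs 1 0 num!))).sub
    ((hf2.drv.continuous.comp hw).mul (hs 0 1 num!))

lemma coef_rhs (t : ℝ) (n : ℤ × ℤ) : coef (rhs f1 f2 w t) n = rhsCoef f1 f2 w t n := by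
  obtain ⟨C, h⟩ := id h6
  have hs : ∀ a b, a + b ≤ 3 → C₂ (ser (coef (w t)) a b) := fun a b hab => continuous_ser ((h t).mono om!)
  have hw := continuous_section hc t; have hd := hasDerivAt_flow hc hp h6 t
  have hfp : ∀ f : Fn, Periodic2 fun x y => f (w t x y) := fun f x y =>
    ⟨by simp only [(hp t x y).1], by simp only [(hp t x y).2]⟩
  have c1 : C₂ fun x y => deriv f1 (w t x y) * ser (coef (w t)) 1 0 x y :=
    (hf1.drv.continuous.comp hw).mul (hs 1 0 num!)
  have c2 : C₂ fun x y => deriv f2 (w t x y) * ser (coef (w t)) 0 1 x y :=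
    (hf2.drv.continuous.comp hw).mul (hs 0 1 num!)
  have c0 : C₂ fun x y => ser (coef (w t)) 2 0 x y + ser (coef (w t)) 0 2 x y := (hs 2 0 num!).add (hs 0 2 num!)
  have e1 := coef_dx (g := fun x y => f1 (w t x y)) (hf1.continuous.comp hw) c1 (fun x y => (hf1.hd _).comp x (hd x y).1) (hfp f1) n
  have e2 := coef_dy (g := fun x y => f2 (w t x y)) (hf2.continuous.comp hw) c2 (fun x y => (hf2.hd _).comp y (hd x y).2) (hfp f2) n
  have e3 := coef_dx (hs 1 0 num!) (hs 2 0 num!) (fun x y => ser_dx ((h t).mono num!) x y) (ser_periodic _ _ _) n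
  have e4 := coef_dy (hs 0 1 num!) (hs 0 2 num!) (fun x y => ser_dy ((h t).mono num!) x y) (ser_periodic _ _ _) n
  rw [show rhs f1 f2 w t = fun x y => (ser (coef (w t)) 2 0 x y + ser (coef (w t)) 0 2 x y
      - deriv f1 (w t x y) * ser (coef (w t)) 1 0 x y) - deriv f2 (w t x y) * ser (coef (w t)) 0 1 x y from rfl,
    coef_sub (g := fun x y => ser (coef (w t)) 2 0 x y + ser (coef (w t)) 0 2 x y
      - deriv f1 (w t x y) * ser (coef (w t)) 1 0 x y) (c0.sub c1) c2, coef_sub c0 c1, coef_add (hs 2 0 num!) (hs 0 2 num!), e1, e2, e3,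
    e4, (coef_flow hc hp h6 t n).1, (coef_flow hc hp h6 t n).2, rhsCoef]
  push_cast; linear_combination (n.1 ^ 2 + n.2 ^ 2) * coef (w t) n * Complex.I_sq

variable {T : ℝ} (heq : ∀ t ∈ Ioo 0 T, ∀ x y, HasDerivAt (fun s => w s x y) (rhs f1 f2 w t x y) t)
include heq

lemma hasDerivAt_coef {t : ℝ} (ht : t ∈ Ioo 0 T) (n : ℤ × ℤ) :
    HasDerivAt (fun s => coef (w s) n) (rhsCoef f1 f2 w t n) t := by
  rw [← coef_rhs hc hp h6 hf1 hf2]; obtain ⟨B1, h1⟩ := flow_bounds hc hp h6 hf1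
  obtain ⟨B2, h2⟩ := flow_bounds hc hp h6 hf2
  refine HasDerivAt.const_mul _ (hasDerivAt_integral_of_dominated_loc_of_deriv_le
    (bound := fun _ => B1 + B1 + B1 * B1 + B2 * B2)
    (F' := fun s p => (rhs f1 f2 w s p.1 p.2 : ℂ) * (e1 (-n.1) p.1 * e1 (-n.2) p.2))
    (Ioo_mem_nhds ht.1 ht.2) (Filter.Eventually.of_forall fun s =>
      (coef_integrable (continuous_section hc s) n).1) (coef_integrable (continuous_section hc t) n)
    (coef_integrable (continuous_rhs hc h6 hf1 hf2 t) n).1 (Filter.Eventually.of_forall fun p s _ => ?_)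
    (integrableOn_const isCompact_square.measure_lt_top.ne)
    (Filter.Eventually.of_forall fun p s hs => (heq s hs p.1 p.2).ofReal_comp.mul_const _)).2
  obtain ⟨-, a1, a2⟩ := h1 s p.1 p.2; obtain ⟨-, b1, b2⟩ := h2 s p.1 p.2
  rw [norm_mul, norm_mul, norm_e1, norm_e1, mul_one, mul_one, norm_real, norm_eq_abs, rhs]
  refine (abs_sub _ _).trans (add_le_add ((abs_sub _ _).trans (add_le_add ((abs_add_le _ _).trans
    (add_le_add (a2 2 0 num!) (a2 0 2 num!))) ?_)) ?_)
  · rw [abs_mul]; exact mul_le_mul a1 (a2 1 0 num!) (abs_nonneg _) ((abs_nonneg _).trans a1)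
  · rw [abs_mul]; exact mul_le_mul b1 (b2 0 1 num!) (abs_nonneg _) ((abs_nonneg _).trans b1)

end

lemma norm_le_of_damped {c G : ℝ → ℂ} (hc : Continuous c) (hG : Continuous G) {T lam A : ℝ} (hl : 0 < lam)
    (hA : ∀ t, ‖G t‖ ≤ A) (hd : ∀ t ∈ Ioo 0 T, HasDerivAt c (-(lam : ℂ) * c t + G t) t) {t : ℝ}
    (ht : t ∈ Icc 0 T) : ‖c t‖ ≤ ‖c 0‖ + A / lam := by
  have he : ∀ s, HasDerivAt (fun s => exp (lam * s)) (exp (lam * s) * lam) s := fun s => by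
    simpa using ((hasDerivAt_id s).const_mul lam).exp
  have hcE : Continuous fun s => exp (lam * s) := fp!
  have h1 := intervalIntegral.integral_eq_sub_of_hasDerivAt_of_le (f := fun s => exp (lam * s) • c s)
    (f' := fun s => exp (lam * s) • G s) ht.1 (hcE.smul hc).continuousOn (fun s hs => by
      refine ((he s).smul (hd s ⟨hs.1, hs.2.trans_le ht.2⟩)).congr_deriv ?_
      simp only [Complex.real_smul]; push_cast; ring) (hcE.smul hG |>.intervalIntegrable _ _)
  have h2 := intervalIntegral.norm_integral_le_of_norm_le (μ := volume) (f := fun s => exp (lam * s) • G s)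
    (g := fun s => exp (lam * s) * A) ht.1 (Filter.Eventually.of_forall fun s _ => by
      rw [norm_smul, norm_of_nonneg (Real.exp_pos _).le]
      exact scale_le (hA s) (Real.exp_pos _).le) ((hcE.mul_const A).intervalIntegrable _ _)
  rw [h1, intervalIntegral.integral_eq_sub_of_hasDerivAt (f := fun s => exp (lam * s) * (A / lam))
    (fun s _ => ((he s).mul_const (A / lam)).congr_deriv (by field_simp)) ((hcE.mul_const A).intervalIntegrable _ _)] at h2
  simp only [mul_zero, Real.exp_zero, one_smul, one_mul] at h2; have h3 := (norm_sub_norm_le _ _).trans h2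
  rw [norm_smul, norm_of_nonneg (Real.exp_pos _).le] at h3
  have hA0 : 0 ≤ A / lam := div_nonneg ((norm_nonneg _).trans (hA 0)) hl.le
  have h4 := Real.one_le_exp (mul_nonneg hl.le ht.1); have := norm_nonneg (c 0); nlinarith

section
variable {w : ℝ → Fn₂} (hc : Continuous fun p : ℝ × ℝ × ℝ => w p.1 p.2.1 p.2.2)
    (hp : ∀ t, Periodic2 (w t)) (h6 : UDec 6 w)
    {f1 f2 : Fn} (hf1 : C∞ f1) (hf2 : C∞ f2)
    {T : ℝ} (heq : ∀ t ∈ Ioo 0 T, ∀ x y, HasDerivAt (fun s => w s x y) (rhs f1 f2 w t x y) t)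
    (hT : 0 ≤ T) (hcl : ∀ t, w t = w (max 0 (min t T)))
    (h0 : ∀ s, ∃ C, Dec s C (coef (w 0)))
include hc hp h6 hf1 hf2 heq hT hcl h0

lemma UDec.gain {s : ℕ} (hs : UDec s w) : UDec (s + 1) w := by
  obtain ⟨C6, k6⟩ := id h6; obtain ⟨C0, k0⟩ := h0 (s + 1); obtain ⟨A1, k1⟩ := UDec.comp hc hp h6 hs hf1
  obtain ⟨A2, k2⟩ := UDec.comp hc hp h6 hs hf2; have hA1 := (k1 0).nonneg; have hA2 := (k2 0).nonneg
  have hC0 := k0.nonneg; refine ⟨C6 + C0 + 6 * (A1 + A2), fun t n => ?_⟩; have hr := rho_pos n; rw [hcl]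
  set τ := max 0 (min t T); have hτ : τ ∈ Icc 0 T := ⟨le_max_left _ _, max_le hT (min_le_right _ _)⟩
  rcases eq_or_ne n 0 with rfl | hn
  · have := k6 τ 0
    have h1 : rho (0 : ℤ × ℤ) = 1 := by simp [rho]
    rw [h1, one_pow, one_mul] at this ⊢; linarith
  set lam : ℝ := (n.1 : ℝ) ^ 2 + (n.2 : ℝ) ^ 2 with hlam
  have hl : rho n ^ 2 ≤ 6 * lam := by
    have h1 : (1 : ℝ) ≤ lam := by
      have : (1 : ℤ) ≤ n.1 ^ 2 + n.2 ^ 2 := by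
        by_contra h
        have h1 : n.1 ^ 2 = 0 := by nlinarith [sq_nonneg n.1, sq_nonneg n.2]
        have h2 : n.2 ^ 2 = 0 := by nlinarith [sq_nonneg n.1, sq_nonneg n.2]
        exact hn (Prod.ext (pow_eq_zero_iff two_ne_zero |>.1 h1) (pow_eq_zero_iff two_ne_zero |>.1 h2))
      rw [hlam]; exact_mod_cast this
    rw [rho]
    nlinarith [sq_abs (n.1 : ℝ), sq_abs (n.2 : ℝ), sq_nonneg (|(n.1 : ℝ)| - |(n.2 : ℝ)|),
      sq_nonneg (|(n.1 : ℝ)| - 1), sq_nonneg (|(n.2 : ℝ)| - 1)]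
  have hl0 : 0 < lam := by nlinarith [pow_pos hr 2]
  have n1 : |(n.1 : ℝ)| ≤ rho n := by rw [rho]; linarith [abs_nonneg (n.2 : ℝ)]
  have n2 : |(n.2 : ℝ)| ≤ rho n := by rw [rho]; linarith [abs_nonneg (n.1 : ℝ)]
  have cF : ∀ {f : Fn}, C∞ f → Continuous fun t => coef (fun x y => f (w t x y)) n := fun hf =>
    continuous_coef (hf.continuous.comp hc) n
  have key : ∀ {f : Fn} {A : ℝ} {m : ℤ}, |(m : ℝ)| ≤ rho n → (∀ t, Dec s A (coef fun x y => f (w t x y))) →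
      ∀ t, ‖I * m * coef (fun x y => f (w t x y)) n‖ ≤ rho n * A / rho n ^ s := fun hm h t => by
    rw [norm_mul, norm_mul, Complex.norm_I, one_mul, Complex.norm_intCast, mul_div_assoc]
    refine mul_le_mul hm ?_ (norm_nonneg _) hr.le; rw [le_div_iff₀' pos!]; exact h t n
  have h := norm_le_of_damped (T := T) (A := rho n * A1 / rho n ^ s + rho n * A2 / rho n ^ s)
    (G := fun t => -(I * n.1 * coef (fun x y => f1 (w t x y)) n)
    - I * n.2 * coef (fun x y => f2 (w t x y)) n) (continuous_coef hc n)
    (((cF hf1).const_mul _).neg.sub ((cF hf2).const_mul _)) hl0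
    (fun t => (norm_sub_le _ _).trans (add_le_add (by rw [norm_neg]; exact key n1 k1 t) (key n2 k2 t)))
    (fun t ht => by
      convert hasDerivAt_coef hc hp h6 hf1 hf2 heq ht n using 1
      rw [rhsCoef, hlam]; ring) hτ
  have h3 := k0 n
  have e : rho n ^ (s + 1) * ((rho n * A1 / rho n ^ s + rho n * A2 / rho n ^ s) / lam) =
      rho n ^ 2 * (A1 + A2) / lam := by field_simp; ring
  have h4 : rho n ^ 2 * (A1 + A2) / lam ≤ 6 * (A1 + A2) := by rw [div_le_iff₀ hl0]; nlinarith [add_nonneg hA1 hA2]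
  calc rho n ^ (s + 1) * ‖coef (w τ) n‖ ≤ rho n ^ (s + 1) * _ := scale_le h pos!
    _ ≤ _ := by rw [mul_add, e]; linarith [(k6 0).nonneg]

lemma UDec.all (s : ℕ) : UDec s w := by
  induction s with
  | zero => exact h6.imp fun C h t => (h t).mono (Nat.zero_le _)
  | succ s ih => exact UDec.gain hc hp h6 hf1 hf2 heq hT hcl h0 ih

lemma rhsCoef_dec (s : ℕ) : ∃ C, ∀ t, Dec s C (rhsCoef f1 f2 w t) := by
  have ha := UDec.all hc hp h6 hf1 hf2 heq hT hcl h0; obtain ⟨C0, k0⟩ := ha (s + 2)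
  obtain ⟨C1, k1⟩ := UDec.comp hc hp h6 (ha (s + 1)) hf1
  obtain ⟨C2, k2⟩ := UDec.comp hc hp h6 (ha (s + 1)) hf2; refine ⟨C0 + C1 + C2, fun t n => ?_⟩; have hr := rho_pos n
  have n1 : |(n.1 : ℝ)| ≤ rho n := by rw [rho]; linarith [abs_nonneg (n.2 : ℝ)]
  have n2 : |(n.2 : ℝ)| ≤ rho n := by rw [rho]; linarith [abs_nonneg (n.1 : ℝ)]
  have hl : (n.1 : ℝ) ^ 2 + (n.2 : ℝ) ^ 2 ≤ rho n ^ 2 := by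
    rw [rho]
    nlinarith [sq_abs (n.1 : ℝ), sq_abs (n.2 : ℝ), abs_nonneg (n.1 : ℝ), abs_nonneg (n.2 : ℝ),
      mul_nonneg (abs_nonneg (n.1 : ℝ)) (abs_nonneg (n.2 : ℝ))]
  have a0 := k0 t n; have a1 := k1 t n; have a2 := k2 t n; rw [pow_add] at a0 a1 a2; rw [pow_one] at a1 a2
  have key : ∀ {m : ℤ} {z : ℂ} {C : ℝ}, |(m : ℝ)| ≤ rho n → rho n ^ s * rho n * ‖z‖ ≤ C →
      rho n ^ s * ‖I * m * z‖ ≤ C := fun hm h => by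
    rw [norm_mul, norm_mul, Complex.norm_I, one_mul, Complex.norm_intCast, ← mul_assoc]; refine le_trans ?_ h; gcongr
  have b0 : rho n ^ s * ‖-((n.1 ^ 2 + n.2 ^ 2 : ℝ) : ℂ) * coef (w t) n‖ ≤ C0 := by
    rw [norm_mul, norm_neg, norm_real, norm_of_nonneg pos!, ← mul_assoc]; refine le_trans ?_ a0; gcongr
  calc _ ≤ rho n ^ s * (‖-((n.1 ^ 2 + n.2 ^ 2 : ℝ) : ℂ) * coef (w t) n‖
        + ‖I * n.1 * coef (fun x y => f1 (w t x y)) n‖ + ‖I * n.2 * coef (fun x y => f2 (w t x y)) n‖) := by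
        refine scale_le ?_ pos!; exact (norm_sub_le _ _).trans (add_le_add_left (norm_sub_le _ _) _)
    _ ≤ _ := by rw [mul_add, mul_add]; exact add_le_add (add_le_add b0 (key n1 a1)) (key n2 a2)

omit hp h6 heq hT hcl h0 in
lemma continuous_rhsCoef (n : ℤ × ℤ) : Continuous fun t => rhsCoef f1 f2 w t n := by
  have cF : ∀ {f : Fn}, C∞ f → Continuous fun t => coef (fun x y => f (w t x y)) n := fun hf =>
    continuous_coef (hf.continuous.comp hc) n
  exact (((continuous_coef hc n).const_mul _).sub ((cF hf1).const_mul _)).sub ((cF hf2).const_mul _)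

/-- The flow extends to a smooth family beyond both end points of the time interval. -/
lemma exists_timeFamily (m : ℕ) : ∃ M U V, TimeFamily m (T + 2) M U V ∧ (∀ t ∈ Icc 0 T, U (t + 1) 0 0 = w t) ∧
    ∀ t ∈ Ioo 0 T, ∀ x y, V (t + 1) 0 0 x y = U (t + 1) 2 0 x y + U (t + 1) 0 2 x y
        - deriv f1 (U (t + 1) 0 0 x y) * U (t + 1) 1 0 x y
        - deriv f2 (U (t + 1) 0 0 x y) * U (t + 1) 0 1 x y := by
  have hR := rhsCoef_dec hc hp h6 hf1 hf2 heq hT hcl h0; have hcR := continuous_rhsCoef hc hf1 hf2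
  set c : ℝ → ℤ × ℤ → ℂ := fun t n => coef (w 0) n + ∫ s in (0 : ℝ)..t, rhsCoef f1 f2 w s n with hcdef
  have hcd : ∀ t n, HasDerivAt (fun t => c t n) (rhsCoef f1 f2 w t n) t := fun t n =>
    ((hcR n).integral_hasStrictDerivAt 0 t).hasDerivAt.const_add _
  have hcw : ∀ t ∈ Icc 0 T, c t = coef (w t) := fun t ht => funext fun n => by
    have := intervalIntegral.integral_eq_sub_of_hasDerivAt_of_le ht.1 (continuous_coef hc n).continuousOn
      (fun s hs => hasDerivAt_coef hc hp h6 hf1 hf2 heq ⟨hs.1, hs.2.trans_le ht.2⟩ n)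
      ((hcR n).intervalIntegrable _ _)
    simp only [hcdef, this]; ring
  have hcD : ∀ s, ∃ C, ∀ t ∈ Icc (-1) (T + 1), Dec s C (c t) := fun s => by
    obtain ⟨C0, k0⟩ := h0 s; obtain ⟨C, k⟩ := hR s; refine ⟨C0 + C * (T + 1), fun t ht n => ?_⟩
    have hr := pow_pos (rho_pos n) s
    have h1 := intervalIntegral.norm_integral_le_of_norm_le_const (a := 0) (b := t) (C := C / rho n ^ s)
      (f := fun s => rhsCoef f1 f2 w s n) fun τ _ => by rw [le_div_iff₀' hr]; exact k τ n
    have h2 : |t - 0| ≤ T + 1 := by rw [sub_zero, abs_le]; constructor <;> linarith [ht.1, ht.2]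
    have h3 := div_nonneg (k 0).nonneg hr.le
    calc rho n ^ s * ‖c t n‖ ≤ rho n ^ s * (‖coef (w 0) n‖ + C / rho n ^ s * (T + 1)) :=
          scale_le ((norm_add_le _ _).trans (add_le_add_right (h1.trans (scale_le h2 h3)) _)) hr.le
      _ ≤ _ := by rw [mul_add]; refine add_le_add (k0 n) (le_of_eq ?_); field_simp
  obtain ⟨M1, hM1⟩ := hcD (2 * m + 3); obtain ⟨M2, hM2⟩ := hR (2 * m + 3)
  have mono : ∀ {M M' : ℝ} {c : ℤ × ℤ → ℂ}, M ≤ M' → Dec (2 * m + 3) M c → Dec (2 * m + 3) M' c :=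
    fun h hd n => (hd n).trans h
  refine ⟨max M1 M2 * zsum, fun t => ser (c (t - 1)), fun t => ser (rhsCoef f1 f2 w (t - 1)),
    ⟨fun t ht => ?_, fun t _ => ?_, fun t ht a b x y => ?_⟩, fun t ht => ?_, fun t ht x y => ?_⟩
  · have ht' : t - 1 ∈ Icc (-1) (T + 1) := ⟨by linarith [ht.1], by linarith [ht.2]⟩
    exact smooth2_ser (fun s => (hcD s).imp fun C h => h _ ht') (mono (le_max_left _ _) (hM1 _ ht'))
  · exact smooth2_ser (fun s => (hR s).imp fun C h => h _) (mono (le_max_right _ _) (hM2 _))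
  · obtain ⟨C, k⟩ := hR (a + b + 3); obtain ⟨C', k'⟩ := hcD (a + b + 3)
    have := hasDerivAt_tsum (u := fun n => C * (rho n ^ 3)⁻¹) (g := fun n t => serTerm (c t) a b x y n)
      (g' := fun n t => serTerm (rhsCoef f1 f2 w t) a b x y n) (summable_rho.mul_left C)
      (fun n t => (((hcd t n).mul_const _).mul_const _).mul_const _)
      (fun n t => (norm_serTerm_le _ a b x y n).trans ((k t).le n))
      (serTerm_summable (k' 0 ⟨by linarith, by linarith⟩) x y) (t - 1)
    exact Complex.reCLM.hasFDerivAt.comp_hasDerivAt t (this.comp_sub_const t 1)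
  · simp only [add_sub_cancel_right, hcw t ht]; obtain ⟨C, k⟩ := h6
    exact ser_coef (continuous_section hc t) (hp t) ((k t).mono num!)
  · simp only [add_sub_cancel_right, hcw t ⟨ht.1.le, ht.2.le⟩]; obtain ⟨C, k⟩ := id h6; obtain ⟨C', k'⟩ := hR 3
    have e := funext (coef_rhs hc hp h6 hf1 hf2 t)
    have hper : Periodic2 (rhs f1 f2 w t) := fun x y => by
      have hs := fun a b => ser_periodic (coef (w t)) a b x y
      simp only [rhs, (hp t x y).1, (hp t x y).2, (hs _ _).1, (hs _ _).2, and_self]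
    rw [ser_coef (continuous_section hc t) (hp t) ((k t).mono num!), ← e,
      ser_coef (continuous_rhs hc h6 hf1 hf2 t) hper (by rw [e]; exact k' t), rhs]

end

lemma iteratedDeriv_two_eq (g : Fn) : iteratedDeriv 2 g = deriv (deriv g) := by
  rw [iteratedDeriv_succ, iteratedDeriv_one]

lemma IsSolution.exists_timeFamily {T : ℝ} (hT : 0 ≤ T) (hf1 : C∞ f1) (hf2 : C∞ f2) {u0 : Fn₂} (hu0 : C∞ (uncurry u0))
    {u : ℝ → Fn₂} (hu : IsSolution T f1 f2 u0 u) {r : ℕ} (hr : 6 ≤ r)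
    (huH : ∀ t ∈ Icc 0 T, MemH r (u t)) (huB : BddAbove ((fun s => normH r (u s)) '' Icc 0 T)) (m : ℕ) :
    ∃ M U V, TimeFamily m (T + 2) M U V ∧ (∀ t ∈ Icc 0 T, U (t + 1) 0 0 = u t) ∧
    ∀ t ∈ Ioo 0 T, ∀ x y, V (t + 1) 0 0 x y = U (t + 1) 2 0 x y + U (t + 1) 0 2 x y
        - deriv f1 (U (t + 1) 0 0 x y) * U (t + 1) 1 0 x y
        - deriv f2 (U (t + 1) 0 0 x y) * U (t + 1) 0 1 x y := by
  have hcl : ∀ t, max 0 (min t T) ∈ Icc 0 T := fun t => ⟨le_max_left _ _, max_le hT (min_le_right _ _)⟩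
  have hid : ∀ t ∈ Icc 0 T, max 0 (min t T) = t := fun t ht => by rw [min_eq_left ht.2, max_eq_right ht.1]
  set w : ℝ → Fn₂ := fun t => u (max 0 (min t T)) with hw
  have hwu : ∀ t ∈ Icc 0 T, w t = u t := fun t ht => by rw [hw]; simp only [hid t ht]
  have hc : Continuous fun p : ℝ × ℝ × ℝ => w p.1 p.2.1 p.2.2 :=
    hu.continuousOn.comp_continuous (f := fun p : ℝ × ℝ × ℝ => (max 0 (min p.1 T), p.2.1, p.2.2))
      fp! fun p => ⟨hcl _, mem_univ _⟩
  have hp : ∀ t, Periodic2 (w t) := fun t => hu.periodic _ (hcl t); obtain ⟨B, hB⟩ := huB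
  have h6 : UDec 6 w := ⟨3 ^ 7 * (1 + B ^ 2), fun t n => by
    refine ((huH _ (hcl t)).dec hr (continuous_section hc t) n).trans ?_
    have h1 : normH r (u (max 0 (min t T))) ≤ B := hB ⟨_, hcl t, rfl⟩
    have h2 : 0 ≤ normH r (u (max 0 (min t T))) := Real.sqrt_nonneg _
    gcongr⟩
  have h0 : w 0 = u0 := by rw [hwu 0 ⟨le_rfl, hT⟩, hu.initial]
  obtain ⟨C6, k6⟩ := id h6
  obtain ⟨M, U, V, h1, h2, h3⟩ := DDG.exists_timeFamily hc hp h6 hf1 hf2 (T := T) (fun t ht x y => by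
    have ht' : t ∈ Icc 0 T := ⟨ht.1.le, ht.2.le⟩
    have h := (hu.equation t ⟨ht.1, ht.2.le⟩ x y).hasDerivAt (Icc_mem_nhds ht.1 ht.2)
    have hd := hasDerivAt_flow hc hp h6 t; rw [← hwu t ht'] at h
    have e : (fun s => w s x y) =ᶠ[nhds t] fun s => u s x y :=
      Filter.eventually_of_mem (Icc_mem_nhds ht.1 ht.2) fun s hs => by simp only [hwu s hs]
    refine (h.congr_of_eventuallyEq e).congr_deriv ?_
    rw [iteratedDeriv_two_eq, iteratedDeriv_two_eq,
      show deriv (fun x => w t x y) = fun x => ser (coef (w t)) 1 0 x y from funext fun x => (hd x y).1.deriv,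
      show deriv (fun y => w t x y) = fun y => ser (coef (w t)) 0 1 x y from funext fun y => (hd x y).2.deriv,
      (ser_dx ((k6 t).mono num!) x y).deriv, (ser_dy ((k6 t).mono num!) x y).deriv,
      show deriv (fun x => f1 (w t x y)) x = _ from ((hf1.hd _).comp x (hd x y).1).deriv,
      show deriv (fun y => f2 (w t x y)) y = _ from ((hf2.hd _).comp y (hd x y).2).deriv, rhs]) hT
    (fun t => by simp only [hw, hid _ (hcl t)])
    (fun s => by rw [h0]; exact dec_of_contDiff hu0 (h0 ▸ hp 0) s) m
  exact ⟨M, U, V, h1, fun t ht => (h2 t ht).trans (hwu t ht), h3⟩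

lemma intervalIntegrable_of_bounded {v : Fn} (hv : Measurable v) {a b η : ℝ} (hab : a ≤ b)
    (h : ∀ x ∈ Icc a b, |v x| ≤ η) : IntervalIntegrable v volume a b := by
  rw [intervalIntegrable_iff_integrableOn_Icc_of_le hab]
  exact Measure.integrableOn_of_bounded (M := η) (by simp) hv.aestronglyMeasurable
    ((ae_restrict_iff' measurableSet_Icc).2 (Filter.Eventually.of_forall h))

section
variable {N k : ℕ} [NeZero N] (hk : 2 ≤ k) {j : Fin N} {v : Fn} {η : ℝ} (hv : Measurable v)
    (hη : ∀ y ∈ cell N j, |v y| ≤ η)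

include hv hη in
lemma intervalIntegrable_ref (q : ℝ[X]) : IntervalIntegrable (fun s => v (pt N j s) * q.eval s) volume (-1) 1 :=
  (intervalIntegrable_of_bounded (hv.comp (by unfold pt; fun_prop)) num!
    fun s hs => hη _ (pt_mem j hs)).mul_continuousOn fp!

include hv hη in
lemma IsLobattoProj.moment {p : ℝ[X]} (hp : IsLobattoProj k (left N j) (right N j) v p) {l : ℕ}
    (hl : l ≤ k - 2) : ∮₁ s, (toRef N j p).eval s * (legendre l).eval s =
      ∮₁ s, v (pt N j s) * (legendre l).eval s := by
  have h := hp.orth (fromRef N j (legendre l)) ((natDegree_fromRef_le _ _ _).trans (by rwa [natDegree_legendre]))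
  rw [integral_cell] at h; simp only [fromRef_eval, sub_mul] at h
  rw [ii_sub (intervalIntegrable_ref hv hη _) (by apply Continuous.intervalIntegrable; unfold pt; fun_prop)] at h
  simp only [toRef_eval]
  rcases mul_eq_zero.1 h with h | h <;> linarith [step_pos N]

include hk in
lemma lobatto_bound : ∃ B : ℝ, 0 < B ∧ ∀ (N : ℕ) [NeZero N] (j : Fin N) (v : Fn) (η : ℝ), Measurable v →
    (∀ y ∈ cell N j, |v y| ≤ η) → ∀ p, IsLobattoProj k (left N j) (right N j) v p →
    ∀ y ∈ cell N j, |p.eval y| ≤ B * η := by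
  obtain ⟨m, rfl⟩ : ∃ m, k = m + 2 := ⟨k - 2, by omega⟩; obtain ⟨B, hB, hb⟩ := legSum_bdd (m + 3)
  choose P hP hP' using fun l : ℕ => poly_bdd (legendre l)
  set Q := ∑ l : Fin (m + 3), 2 * P l / legSq l
  have hF0 : ∀ l : ℕ, 0 ≤ 2 * P l / legSq l := fun l => div_nonneg (mul_nonneg two_pos.le (hP l)) (legSq_pos l).le
  have hQl : ∀ l : Fin (m + 3), 2 * P l / legSq l ≤ Q := fun l =>
    single_le_sum (f := fun l : Fin (m + 3) => 2 * P l / legSq l) (fun i _ => hF0 i) (Finset.mem_univ l)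
  have hQ0 : 0 ≤ Q := sum_nonneg fun i _ => hF0 i
  refine ⟨B * (Q + (1 + B * Q)), pos!, fun N _ j v η hv hη p hp y hy => ?_⟩
  have hη0 : 0 ≤ η := (abs_nonneg _).trans (hη y hy)
  obtain ⟨z, hz⟩ := exists_legSum (k := m + 2) (toRef N j p) ((natDegree_toRef_le _ _ _).trans hp.degree)
  have low : ∀ l : Fin (m + 3), (l : ℕ) < m + 1 → |z l| ≤ Q * η := fun l hl => by
    have h1 := hp.moment hv hη (l := l) om!; rw [hz, integral_legSum_mul_legendre] at h1
    have h2 := abs_integral_ref_le (f := fun s => v (pt N j s) * (legendre l).eval s) (M := η * P l)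
      fun s hs => by rw [abs_mul]; exact mul_le_mul (hη _ (pt_mem j hs)) (hP' l s hs) (abs_nonneg _) hη0
    have h3 := legSq_pos l; rw [← h1, abs_mul, abs_of_pos h3, ← le_div_iff₀ h3] at h2
    calc |z l| ≤ 2 * P l / legSq l * η := h2.trans (le_of_eq (by ring))
      _ ≤ Q * η := mul_le_mul_of_nonneg_right (hQl l) hη0
  have hlow : ∀ l, |lowPart z l| ≤ Q * η := fun l => by
    rw [lowPart]; split_ifs with h
    · exact low l h
    · rw [abs_zero]; positivity
  have hb' := hb _ (Q * η) pos! hlow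
  have e1 : (legSum z).eval 1 = v (right N j) := by rw [← hz, toRef_eval, pt_one, hp.eval_right]
  have e2 : (legSum z).eval (-1) = v (left N j) := by rw [← hz, toRef_eval, pt_neg_one, hp.eval_left]
  rw [legSum_split] at e1 e2; simp only [eval_add, eval_mul, eval_C, legendre_one, legendre_neg_one, mul_one] at e1 e2
  have b1 := hη _ (right_mem j); have b2 := hη _ (left_mem j); have b3 := (hb' 1 num!).1
  have b4 := (hb' (-1) num!).1; set a := z ⟨m + 1, by omega⟩; set b := z (Fin.last (m + 2))
  set R := (1 + B * Q) * η with hR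
  have c1 : |a + b| ≤ R := by
    rw [show a + b = v (right N j) - (legSum (lowPart z)).eval 1 by linarith]
    exact (abs_sub _ _).trans (by rw [hR]; linarith)
  have c2 : |a - b| ≤ R := by
    have h2 : |a * (-1) ^ (m + 1) + b * (-1) ^ (m + 2)| = |a - b| := by
      rw [show a * (-1) ^ (m + 1) + b * (-1) ^ (m + 2) = (a - b) * (-1) ^ (m + 1) by ring, abs_mul, abs_pow]; simp
    rw [← h2, show a * (-1) ^ (m + 1) + b * (-1) ^ (m + 2) =
      v (left N j) - (legSum (lowPart z)).eval (-1) by linarith]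
    exact (abs_sub _ _).trans (by rw [hR]; linarith)
  have all : ∀ l, |z l| ≤ (Q + (1 + B * Q)) * η := fun l => by
    have hR0 : 0 ≤ R := (abs_nonneg _).trans c1; rw [add_mul]
    rcases lt_trichotomy (l : ℕ) (m + 1) with h | h | h
    · linarith [low l h]
    · rw [show l = ⟨m + 1, by omega⟩ from Fin.ext h]
      rw [abs_le] at *
      constructor <;> nlinarith [mul_nonneg hQ0 hη0]
    · rw [show l = Fin.last (m + 2) from Fin.ext (by simp; omega)]
      rw [abs_le] at *
      constructor <;> nlinarith [mul_nonneg hQ0 hη0]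
  obtain ⟨s, hs, rfl⟩ := exists_pt j hy; rw [← toRef_eval, hz]
  exact (hb z _ pos! all s hs).1.trans (le_of_eq (by ring))

include hk hv hη in
lemma isLobattoProj_lobattoProj :
    IsLobattoProj k (left N j) (right N j) v (lobattoProj k (left N j) (right N j) v) := by
  refine Classical.epsilon_spec (p := IsLobattoProj k (left N j) (right N j) v) ?_
  obtain ⟨m, rfl⟩ : ∃ m, k = m + 2 := ⟨k - 2, by omega⟩
  set μ : Fin (m + 3) → ℝ := fun l => (∮₁ s, v (pt N j s) * (legendre l).eval s) / legSq l with hμ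
  set A := v (right N j) - (legSum (lowPart μ)).eval 1 with hA
  set B := (-1) ^ (m + 1) * (v (left N j) - (legSum (lowPart μ)).eval (-1)) with hB
  set z : Fin (m + 3) → ℝ := fun l => if (l : ℕ) < m + 1 then μ l else if (l : ℕ) = m + 1 then (A + B) / 2
    else (A - B) / 2 with hz
  have hlow : lowPart z = lowPart μ := by funext l; simp only [lowPart, hz]; split_ifs <;> rfl
  have hza : z ⟨m + 1, by omega⟩ = (A + B) / 2 := by simp [hz]
  have hzb : z (Fin.last _) = (A - B) / 2 := by simp [hz]
  have hsq : ((-1 : ℝ) ^ (m + 1)) ^ 2 = 1 := by rw [← pow_mul, mul_comm, pow_mul]; norm_num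
  have hev : ∀ s, (fromRef N j (legSum z)).eval (pt N j s) = (legSum z).eval s := fromRef_eval j _
  refine ⟨fromRef N j (legSum z), (natDegree_fromRef_le _ _ _).trans (natDegree_legSum_le z), ?_, ?_, ?_⟩
  · rw [← pt_neg_one, hev, legSum_split, hlow, hza, hzb]
    simp only [eval_add, eval_mul, eval_C, legendre_neg_one, pt_neg_one]; rw [hB]
    linear_combination (v (left N j) - (legSum (lowPart μ)).eval (-1)) * hsq
  · rw [← pt_one, hev, legSum_split, hlow, hza, hzb]
    simp only [eval_add, eval_mul, eval_C, legendre_one, pt_one]; rw [hA]; ring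
  · intro q hq; obtain ⟨y, hy⟩ := exists_legSum (k := m) (toRef N j q) ((natDegree_toRef_le _ _ _).trans hq)
    have hqe : ∀ s, q.eval (pt N j s) = ∑ l, y l * (legendre l).eval s := fun s => by
      rw [← toRef_eval, hy, legSum_eval]
    rw [integral_cell]; simp only [hev, hqe, mul_sum, sub_mul]
    have hi : ∀ l : Fin (m + 1), IntervalIntegrable (fun s => v (pt N j s) * (y l * (legendre l).eval s)
        - (legSum z).eval s * (y l * (legendre l).eval s)) volume (-1) 1 := fun l => by
      refine IntervalIntegrable.sub ?_ (ii fp!); simpa using intervalIntegrable_ref hv hη (C (y l) * legendre l)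
    rw [ii_sum fun l _ => hi l, Finset.sum_eq_zero fun l _ => ?_, mul_zero]
    simp only [mul_left_comm _ (y _), ← mul_sub]; have h3 := legSq_pos l
    rw [ii_const_mul, ii_sub (intervalIntegrable_ref hv hη _) (ii fp!), integral_legSum_mul_legendre z ⟨l, by omega⟩]
    have hl := l.2; simp only [hz, hl, if_true, hμ]; field_simp; ring

end

lemma lobattoProj_family (hk : 2 ≤ k) : ∃ B : ℝ, 0 < B ∧ ∀ (Nx Ny : ℕ) [NeZero Nx] [NeZero Ny]
    (i : Fin Nx) (j : Fin Ny) (F : ℝ → ℝ[X]) (η : ℝ), (∀ y, (F y).natDegree ≤ k) →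
    (∀ x, Measurable fun y => (F y).eval x) →
    (∀ x ∈ cell Nx i, ∀ y ∈ cell Ny j, |(F y).eval x| ≤ η) →
    ∃ c : Coef k, ∀ x ∈ cell Nx i, ∀ y ∈ cell Ny j,
      (lobattoProj k (left Ny j) (right Ny j) fun y' => (F y').eval x).eval y = val c x y ∧
      |val c x y| ≤ B * η := by
  obtain ⟨B, hB, hb⟩ := lobatto_bound hk; refine ⟨B, hB, fun Nx Ny _ _ i j F η hd hm hη => ?_⟩
  have hs := step_pos Nx; set X : Fin (k + 1) → ℝ := fun r => left Nx i + step Nx * (r / (k + 1)) with hX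
  have hXm : ∀ r, X r ∈ cell Nx i := fun r => by
    have h1 : ((r : ℕ) : ℝ) / (k + 1) ≤ 1 := by rw [div_le_one pos!]; exact_mod_cast r.2.le
    have h0 : 0 ≤ ((r : ℕ) : ℝ) / (k + 1) := pos!; have := right_sub_left Nx i
    constructor <;> simp only [hX] <;> nlinarith
  have hXi : Set.InjOn X (Finset.univ : Finset (Fin (k + 1))) := fun r _ s _ h => by
    simp only [hX, add_right_inj] at h; have h2 := mul_left_cancel₀ hs.ne' h; rw [div_left_inj' pos!] at h2
    exact Fin.ext (by exact_mod_cast h2)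
  set ℓ := Lagrange.basis (Finset.univ : Finset (Fin (k + 1))) X with hℓ
  have hℓd : ∀ r, (ℓ r).natDegree ≤ k := fun r => by
    rw [natDegree_le_iff_degree_le, Lagrange.degree_basis hXi (Finset.mem_univ r)]; simp
  have hF : ∀ x y, (F y).eval x = ∑ r, (F y).eval (X r) * (ℓ r).eval x := fun x y => by
    have := Lagrange.eq_interpolate hXi (f := F y) (by
      rw [Finset.card_univ, Fintype.card_fin]
      exact degree_le_natDegree.trans_lt (by exact_mod_cast Nat.lt_succ_of_le (hd y)))
    conv_lhs => rw [this]; simp only [Lagrange.interpolate_apply, eval_finsetSum, eval_mul, eval_C, hℓ]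
  have hP := fun x hx => isLobattoProj_lobattoProj hk (j := j) (hm x) (hη x hx)
  set P : ℝ → ℝ[X] := fun x => lobattoProj k (left Ny j) (right Ny j) fun y' => (F y').eval x
  set c : Coef k := fun a b => ∑ r, (ℓ r).coeff a * (P (X r)).coeff b with hc; refine ⟨c, fun x hx y hy => ?_⟩
  have e1 : val c x y = ∑ r, (P (X r)).eval y * (ℓ r).eval x := by
    simp only [val, hc, sum_mul]; rw [sum_congr rfl fun a _ => sum_comm, sum_comm]; refine sum_congr rfl fun r _ => ?_
    rw [eval_eq_sum_coeff (hℓd _), eval_eq_sum_coeff (hP _ (hXm _)).degree, Finset.sum_mul_sum, sum_comm]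
    exact sum_congr rfl fun a _ => sum_congr rfl fun b _ => by ring
  have hle := (left_lt_right Ny j).le
  have hi : ∀ x ∈ cell Nx i, ∀ q : ℝ[X],
      IntervalIntegrable (fun y => ((F y).eval x - (P x).eval y) * q.eval y) volume (left Ny j) (right Ny j) :=
    fun x hx q => ((intervalIntegrable_of_bounded (hm x) hle (hη x hx)).sub (ii fp!)).mul_continuousOn fp!
  have hD : IsLobattoProj k (left Ny j) (right Ny j) (fun _ => 0) (P x - ∑ r, C ((ℓ r).eval x) * P (X r)) := by
    have hv : ∀ y, (∀ x ∈ cell Nx i, (P x).eval y = (F y).eval x) →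
        (P x - ∑ r, C ((ℓ r).eval x) * P (X r)).eval y = 0 := fun y h => by
      simp only [eval_sub, eval_finsetSum, eval_mul, eval_C, h x hx, h _ (hXm _), hF x y]
      simp only [mul_comm, sub_self]
    refine ⟨(natDegree_sub_le _ _).trans (max_le (hP x hx).degree (natDegree_sum_le_of_forall_le _ _ fun r _ =>
        (natDegree_C_mul_le _ _).trans (hP _ (hXm r)).degree)), hv _ fun x hx => (hP x hx).eval_left,
      hv _ fun x hx => (hP x hx).eval_right, fun q hq => ?_⟩
    have e : ∀ y, (0 - (P x - ∑ r, C ((ℓ r).eval x) * P (X r)).eval y) * q.eval y =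
        ((F y).eval x - (P x).eval y) * q.eval y
        - ∑ r, (ℓ r).eval x * (((F y).eval (X r) - (P (X r)).eval y) * q.eval y) := fun y => by
      have e3 : ∑ r, (ℓ r).eval x * (((F y).eval (X r) - (P (X r)).eval y) * q.eval y) =
          (∑ r, (F y).eval (X r) * (ℓ r).eval x - ∑ r, (ℓ r).eval x * (P (X r)).eval y) * q.eval y := by
        rw [← sum_sub_distrib, sum_mul]
        exact sum_congr rfl fun r _ => by ring
      rw [e3, hF x y]; simp only [eval_sub, eval_finsetSum, eval_mul, eval_C]; ring
    simp only [e]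
    rw [ii_sub (hi x hx q) (by
        simpa only [Finset.sum_fn] using IntervalIntegrable.sum Finset.univ fun r _ => (hi _ (hXm r) q).const_mul _),
      ii_sum fun r _ => (hi _ (hXm r) q).const_mul _, (hP x hx).orth q hq,
      Finset.sum_eq_zero fun r _ => by rw [ii_const_mul, (hP _ (hXm r)).orth q hq, mul_zero], sub_zero]
  have h0 := hb Ny j _ 0 measurable_const (fun _ _ => by simp) _ hD y hy
  rw [mul_zero, abs_nonpos_iff, eval_sub, sub_eq_zero] at h0
  have e2 : (P x).eval y = val c x y := by
    rw [h0, e1, eval_finsetSum]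
    exact sum_congr rfl fun r _ => by rw [eval_mul, eval_C, mul_comm]
  exact ⟨e2, e2 ▸ hb Ny j _ η (hm x) (hη x hx) _ (hP x hx) y hy⟩

/-- The coefficient of `v` in the form defining the correction. -/
def corrA (f2 : Fn) (U V : Jet) (i : Fin N) (x y : ℝ) : ℝ := prErr V 0 i x y - prErr U 2 i x y
    + (deriv (deriv f2) (U 0 0 x y) * U 0 1 x y * prErr U 0 i x y + deriv f2 (U 0 0 x y) * prErr U 1 i x y)

/-- The data of the correction. -/
def omData (β θ : ℝ) (f1 f2 : Fn) (g1 : Fn₂)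
    (U V : Jet) (w : Vh Nx Ny k) (j : Fin Ny) (y : ℝ) : Fin Nx → Fin (k + 1) → ℝ :=
  mkData k (fun i v => ∮ x Nx i, (corrA f2 U V i x y * v.eval x
      - deriv f1 (U 0 0 x y) * prErr U 0 i x y * (𝒟 v).eval x))
    (fun i => alpha f1 g1 (traceL (lineX w j y) i) (traceR (lineX w j y) i) * jump (fun m x => prErr U 0 m x y) i) 0

section
variable {f1 f2 : Fn} (hf1 : C∞ f1) (hf2 : C∞ f2)

include hf2 in
lemma continuous_corrA {M M' : ℝ} {U V : Jet} (hU : Smooth2 m M U) (hV : Smooth2 m M' V)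
    (i : Fin N) : C₂ (corrA f2 U V i) := by
  have h1 := hf2.drv; have h2 := h1.drv
  exact ((continuous_prErr hV 0 i).sub (continuous_prErr hU 2 i)).add
    ((((h2.continuous.comp (hU.cont 0 0)).mul (hU.cont 0 1)).mul (continuous_prErr hU 0 i)).add
      ((h1.continuous.comp (hU.cont 0 0)).mul (continuous_prErr hU 1 i)))

include hf1 in
lemma continuous_corrB {U : Jet} (hU : Smooth2 m M U)
    (i : Fin N) : C₂ fun x y => deriv f1 (U 0 0 x y) * prErr U 0 i x y :=
  (hf1.drv.continuous.comp (hU.cont 0 0)).mul (continuous_prErr hU 0 i)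

include hf1 hf2 in
lemma measurable_omData {M M' : ℝ} {U V : Jet} (hU : Smooth2 m M U) (hV : Smooth2 m M' V) {g1 : Fn₂} (hg : C₂ g1)
    (w : Vh Nx Ny k) (j : Fin Ny) : Measurable (omData β θ f1 f2 g1 U V w j) := by
  rw [measurable_pi_iff]; intro i; rw [measurable_pi_iff]; intro l; simp only [omData, mkData]; split_ifs
  · refine (Continuous.const_mul ?_ _).measurable; apply continuous_ii
    have h1 := continuous_corrA (k := k) (β := β) (θ := θ) hf2 hU hV i
    have h2 := continuous_corrB (k := k) (β := β) (θ := θ) hf1 hU i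
    unfold uncurry at *
    exact ((h1.comp continuous_swap).mul fp!).sub ((h2.comp continuous_swap).mul fp!)
  · have ht : ∀ i x, Continuous fun y => val (w i j) x y := fun i x => by unfold val; fun_prop
    have hp : ∀ (i : Fin Nx) x, Continuous fun y => prErr U 0 i x y := fun i x =>
      (continuous_prErr hU 0 i).comp (Continuous.prodMk_right x)
    simp only [alpha, traceL, traceR, jump, lineX]
    have hg' : Continuous fun y => g1 (val (w i j) (right Nx i) y) (val (w (i + 1) j) (left Nx (i + 1)) y) :=
      hg.comp ((ht _ _).prodMk (ht _ _))
    have hf := hf1.continuous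
    exact (((hg'.sub (hf.comp (((ht _ _).add (ht _ _)).div_const 2))).measurable.div
      ((ht _ _).sub (ht _ _)).measurable).mul ((hp _ _).sub (hp _ _)).measurable).const_mul _
  · exact measurable_const

variable {T M : ℝ} (hT : 0 < T) {U V : ℝ → Jet} (fam : TimeFamily (k + 2) (T + 2) M U V)
    {u : ℝ → Fn₂} (huU : ∀ t ∈ Icc 0 T, U (t + 1) 0 0 = u t)
include fam huU

lemma projErr_eq (i : Fin N) {s : ℝ} (hs : s ∈ Icc 0 T) (x y : ℝ) :
    projErr N k β θ (u s) i x y = prErr (U (s + 1)) 0 i x y := by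
  have sm := fam.smooth (s + 1) ⟨by linarith [hs.1], by linarith [hs.2]⟩
  rw [projErr, prErr, ← huU s hs, proj_eq_pr (v' := fun x => U (s + 1) 1 0 x y)
    (sm.cx 0 0 y) (fun i => (sm.dx 0 0 _ y).deriv)]

include hT hf2

lemma corrForm_eq (y : ℝ) (i : Fin N) (v : ℝ[X]) :
    corrForm N k T β θ f1 f2 u 0 y i v = ∮ x N i, (corrA f2 (U 1) (V 1) i x y * v.eval x
        - deriv f1 (U 1 0 0 x y) * prErr (U 1) 0 i x y * (𝒟 v).eval x) := by
  have h0 : (0 : ℝ) ∈ Icc 0 T := ⟨le_rfl, hT.le⟩; have sm := fam.smooth 1 ⟨by linarith, by linarith⟩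
  have pe := fun x y => projErr_eq fam huU i h0 x y
  have hu0 : u 0 = U 1 0 0 := by rw [← huU 0 h0, zero_add]
  rw [zero_add] at pe; simp only [corrForm, pe]; simp only [hu0]; congr 1; funext x
  have d1 : derivWithin (fun s => projErr N k β θ (u s) i x y) (Icc 0 T) 0 = prErr (V 1) 0 i x y := by
    have h := hasDerivAt_prErr_time fam N (t := 0 + 1) (b := 0) ⟨by linarith, by linarith⟩ (Nat.zero_le _) i x y
    have h' := (h.comp_add_const 0 1).hasDerivWithinAt (s := Icc 0 T); rw [zero_add] at h'
    exact (h'.congr (fun s hs => projErr_eq fam huU i hs x y)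
      (projErr_eq fam huU i h0 x y)).derivWithin (uniqueDiffOn_Icc hT 0 h0)
  have dp := fun b y => hasDerivAt_prErr (k := k) (β := β) (θ := θ) sm b i x y
  have d2 : iteratedDeriv 2 (fun y => prErr (U 1) 0 i x y) y = prErr (U 1) 2 i x y := by
    rw [iteratedDeriv_two_eq, funext fun y => (dp 0 y).deriv, (dp 1 y).deriv]
  have hdf := hf2.drv.hd (U 1 0 0 x y); have d3 := ((hdf.comp y (sm.dy 0 0 x y)).mul (dp 0 y)).deriv
  rw [d1, d2, show deriv (fun y => deriv f2 (U 1 0 0 x y) * prErr (U 1) 0 i x y) y = _ from d3, corrA]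
  simp only [Function.comp]; ring

include hf1

lemma omega_eq (g1 : Fn₂) (w : Vh Nx Ny k) (j : Fin Ny) (y : ℝ) :
    omega T β θ f1 f2 g1 u w 0 j y = sol (omData β θ f1 f2 g1 (U 1) (V 1) w j y) := by
  have h0 : (0 : ℝ) ∈ Icc 0 T := ⟨le_rfl, hT.le⟩; have pe := fun i x => projErr_eq fam huU (N := Nx) i h0 x y
  rw [zero_add] at pe
  have hB : corrForm Nx k T β θ f1 f2 u 0 y = _ := funext fun i => funext fun v =>
    corrForm_eq hf2 hT fam huU (f1 := f1) y i v
  have cA : ∀ i : Fin Nx, Continuous fun x => corrA f2 (U 1) (V 1) i x y := fun i =>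
    (continuous_corrA hf2 (fam.smooth 1 ⟨by linarith, by linarith⟩)
      (fam.smooth' 1 ⟨by linarith, by linarith⟩) i).comp (Continuous.prodMk_left y)
  have cB : ∀ i : Fin Nx, Continuous fun x => deriv f1 (U 1 0 0 x y) * prErr (U 1) 0 i x y := fun i =>
    (continuous_corrB hf1 (fam.smooth 1 ⟨by linarith, by linarith⟩) i).comp (Continuous.prodMk_left y)
  have hex := isSol_sol (N := Nx) (fun i v => ∮ x Nx i, (corrA f2 (U 1) (V 1) i x y * v.eval x
      - deriv f1 (U 1 0 0 x y) * prErr (U 1) 0 i x y * (𝒟 v).eval x))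
    (fun i => alpha f1 g1 (traceL (lineX w j y) i) (traceR (lineX w j y) i)
      * jump (fun m x => prErr (U 1) 0 m x y) i) 0 (fun i z => form_dblPrim i
      (fun v => ∮ x Nx i, (corrA f2 (U 1) (V 1) i x y * v.eval x
        - deriv f1 (U 1 0 0 x y) * prErr (U 1) 0 i x y * (𝒟 v).eval x))
      (fun p q => by
        have c1 := cA i; have c2 := cB i; rw [← ii_add (ii fp!) (ii fp!)]; simp only [derivative_add, eval_add]
        congr 1; funext x; ring)
      (fun c p => by
        rw [← ii_const_mul]; simp only [derivative_C_mul, eval_mul, eval_C]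
        congr 1; funext x; ring) z)
  rw [omega, hB]; simp only [pe]
  have h := Classical.epsilon_spec (p := IsCorrection k β θ _ _) ⟨_, hex.degree, hex.form, hex.flux, hex.average⟩
  exact IsSol.eq_sol ⟨h.degree, h.form, h.flux, h.average⟩

end

lemma abs_alpha_le (hd : ∀ a, g a a = f a) {K L : ℝ} (hL : 0 ≤ L)
    (h : ∀ a b c d, |a| ≤ K → |b| ≤ K → |c| ≤ K → |d| ≤ K → |g a b - g c d| ≤ L * (|a - c| + |b - d|))
    {a b : ℝ} (ha : |a| ≤ K) (hb : |b| ≤ K) : |alpha f g a b| ≤ L := by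
  have hm : |(a + b) / 2| ≤ K := by rw [abs_le] at *; constructor <;> linarith
  have := h a b _ _ ha hb hm hm
  rw [hd, show a - (a + b) / 2 = -((b - a) / 2) by ring, show b - (a + b) / 2 = (b - a) / 2 by ring, abs_neg,
    ← two_mul, abs_div, abs_two, mul_div_cancel₀ _ (two_ne_zero' ℝ)] at this
  rw [alpha, abs_div]; exact div_le_of_le_mul₀ (abs_nonneg _) hL this

section
variable {f1 f2 : Fn} (hf1 : C∞ f1) (hf2 : C∞ f2)
    {g1 : Fn₂} (hg1 : IsEFlux f1 g1) (hg1' : LocallyLipschitz (uncurry g1))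
include hf1 hf2 hg1 hg1'

lemma corrX_val {T : ℝ} (hT : 0 < T) (M K : ℝ) : ∃ C : ℝ, 0 < C ∧ ∀ (U V : ℝ → Jet)
    (u : ℝ → Fn₂) (M0 M' : ℝ), TimeFamily (k + 2) (T + 2) M0 U V → (∀ t ∈ Icc 0 T, U (t + 1) 0 0 = u t) →
    M' ≤ M → Smooth2 (k + 2) M' (U 1) → Smooth2 (k + 2) M' (V 1) → ∀ (Nx Ny : ℕ) [NeZero Nx] [NeZero Ny]
    (w : Vh Nx Ny k), (∀ i j, ∀ x ∈ cell Nx i, ∀ y ∈ cell Ny j,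
      |val (w i j) x y| ≤ K) → ∀ i j, ∃ c : Coef k, ∀ x ∈ cell Nx i,
      ∀ y ∈ cell Ny j, corrX T β θ f1 f2 g1 u w 0 i j x y = val c x y ∧
        |val c x y| ≤ C * M' * step Nx ^ (k + 2) := by
  obtain ⟨B1, hB1, h1⟩ := sol_form_bound; obtain ⟨B2, hB2, h2⟩ := smooth1_prErr
  obtain ⟨B3, hB3, h3⟩ := lobattoProj_family H.hk; obtain ⟨L1, hL1, hl1, -⟩ := smooth_flux_bounds hf1 M
  obtain ⟨L2, hL2, hl2, -⟩ := smooth_flux_bounds hf2 M; obtain ⟨L3, hL3, hl3⟩ := locallyLipschitz_bound hg1' K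
  by_cases hM : 0 ≤ M
  swap
  · exact ⟨1, one_pos, fun U V u M0 M' _ _ h hU => absurd (hU.nonneg.trans h) hM⟩
  set Q := B2 * (2 + L2 * M + L2 + L1 + 2 * L3) with hQ; have hQ0 : 0 < Q := pos!
  refine ⟨B3 * (B1 * Q), pos!, ?_⟩; intro U V u M0 M' fam huU hM' hU hV Nx Ny _ _ w hw i j
  have hs := step_pos Nx; have hM0 := hU.nonneg; set e := B2 * M' * step Nx ^ (k + 1) with he
  have he0 : 0 ≤ e := pos!
  have hp : ∀ W, Smooth2 (k + 2) M' W → ∀ n ≤ 2, ∀ i, ∀ x ∈ cell Nx i, ∀ y,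
      |prErr W n i x y| ≤ e := fun W hW n hn i x hx y =>
    (h2 Nx W M' hW i x hx).bd n (hn.trans om!) y
  have hQe : Q * M' * step Nx ^ (k + 1) = (2 + L2 * M + L2 + L1 + 2 * L3) * e := by rw [hQ, he]; ring
  have hub : ∀ x y, |U 1 0 0 x y| ≤ M := fun x y => (hU.bd 0 om! 0 om! x y).trans hM'
  have n1 : 0 ≤ L2 * M * e := pos!; have n2 : 0 ≤ L1 * e := pos!; have n3 : 0 ≤ L2 * e := pos!
  have n4 : 0 ≤ L3 * e := pos!
  have hF : ∀ x ∈ cell Nx i, ∀ y ∈ cell Ny j,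
      |(sol (omData β θ f1 f2 g1 (U 1) (V 1) w j y) i).eval x| ≤ B1 * (Q * M' * step Nx ^ (k + 1)) * step Nx := by
    intro x hx y hy
    refine (h1 Nx _ _ _ (Q * M' * step Nx ^ (k + 1)) (fun i x hx => ⟨?_, ?_⟩) (fun i => ?_) i x hx _ rfl).1
    · have q0 := hp _ hV 0 om! i x hx y; have q1 := hp _ hU 2 le_rfl i x hx y
      have q2 : |deriv (deriv f2) (U 1 0 0 x y) * U 1 0 1 x y * prErr (U 1) 0 i x y| ≤ L2 * M * e := by
        rw [abs_mul, abs_mul]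
        exact mul_le_mul (mul_le_mul (hl2 _ (hub x y)).2.2.1 ((hU.bd 0 om! 1 om! x y).trans hM')
          (abs_nonneg _) hL2.le) (hp _ hU 0 om! i x hx y) (abs_nonneg _) pos!
      have q3 : |deriv f2 (U 1 0 0 x y) * prErr (U 1) 1 i x y| ≤ L2 * e := by
        rw [abs_mul]; exact mul_le_mul (hl2 _ (hub x y)).2.1 (hp _ hU 1 om! i x hx y) (abs_nonneg _) hL2.le
      rw [hQe, corrA]; refine (abs_add_le _ _).trans ((add_le_add (abs_sub _ _) (abs_add_le _ _)).trans ?_); linarith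
    · rw [hQe, abs_mul]
      have := mul_le_mul (hl1 _ (hub x y)).2.1 (hp _ hU 0 om! i x hx y) (abs_nonneg _) hL1.le; linarith
    · have a1 := abs_alpha_le (eFlux_diag hg1 hg1'.continuous) hL3 hl3
        (hw i j _ (right_mem i) y hy) (hw (i + 1) j _ (left_mem _) y hy)
      have a2 : |jump (fun m x => prErr (U 1) 0 m x y) i| ≤ 2 * e := by
        refine (abs_sub _ _).trans ?_; simp only [traceL, traceR]
        linarith [hp _ hU 0 om! (i + 1) _ (left_mem _) y, hp _ hU 0 om! i _ (right_mem _) y]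
      rw [hQe, abs_mul]; have := mul_le_mul a1 a2 (abs_nonneg _) hL3
      simp only [traceL, traceR, lineX] at this ⊢; linarith
  obtain ⟨c, hc⟩ := h3 Nx Ny i j (fun y => sol (omData β θ f1 f2 g1 (U 1) (V 1) w j y) i) _
    (fun y => natDegree_sol_le _ _) (fun x => ((solEval Nx (leval x) i).continuous_of_finiteDimensional
      |>.measurable).comp (measurable_omData hf1 hf2 hU hV hg1'.continuous w j)) hF
  refine ⟨c, fun x hx y hy => ?_⟩; simp only [corrX, omega_eq hf1 hf2 hT fam huU]
  exact ⟨(hc x hx y hy).1, (hc x hx y hy).2.trans (le_of_eq (by ring))⟩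

omit hf1 hf2 hg1 hg1' in
lemma tensorProj_eq {U : Jet} (hU : Smooth2 m M U) [NeZero Ny] (i : Fin Nx) (j : Fin Ny) (x y : ℝ) :
    tensorProj Nx Ny k β θ (U 0 0) i j x y = val (tens Nx Ny U i j) x y := by
  have hin : ∀ x, proj Ny k β θ (fun y => U 0 0 x y) = pr Ny (U 0 0 x) (U 0 1 x) := fun x =>
    proj_eq_pr (hU.cy 0 0 x) fun j => (hU.dy 0 0 x _).deriv
  have hd : ∀ x, HasDerivAt (fun x => (pr Ny (U 0 0 x) (U 0 1 x) j).eval y)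
      ((pr Ny (U 1 0 x) (U 1 1 x) j).eval y) x := fun x =>
    hasDerivAt_pr_param hU.swap (leval y) 0 j x
  rw [← polyX_eval, polyX_tens hU, tensorProj]; simp only [hin]
  rw [proj_eq_pr (v' := fun x => (pr Ny (U 1 0 x) (U 1 1 x) j).eval y)
    (continuous_iff_continuousAt.2 fun x => (hd x).continuousAt) fun i => (hd _).deriv]

lemma uI_val {g2 : Fn₂} (hg2 : IsEFlux f2 g2) (hg2' : LocallyLipschitz (uncurry g2))
    {T : ℝ} (hT : 0 < T) (M K : ℝ) : ∃ C : ℝ, 0 < C ∧ ∀ (U V : ℝ → Jet)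
    (u : ℝ → Fn₂) (M0 M' : ℝ), TimeFamily (k + 2) (T + 2) M0 U V → (∀ t ∈ Icc 0 T, U (t + 1) 0 0 = u t) →
    M' ≤ M → Smooth2 (k + 2) M' (U 1) → Smooth2 (k + 2) M' (V 1) → ∀ (Nx Ny : ℕ) [NeZero Nx] [NeZero Ny]
    (w : Vh Nx Ny k), (∀ i j, ∀ x ∈ cell Nx i, ∀ y ∈ cell Ny j,
      |val (w i j) x y| ≤ K) → ∃ W : Vh Nx Ny k, ∀ i j, ∀ x ∈ cell Nx i,
      ∀ y ∈ cell Ny j, uI T β θ f1 f2 g1 g2 u w 0 i j x y = val (W i j) x y ∧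
        |val (W i j) x y - val (tens Nx Ny (U 1) i j) x y| ≤ C * M' * (step Nx ^ (k + 2) + step Ny ^ (k + 2)) := by
  obtain ⟨C1, hC1, h1⟩ := corrX_val hf1 hf2 hg1 hg1' hT M K
  obtain ⟨C2, hC2, h2⟩ := corrX_val hf2 hf1 hg2 hg2' hT M K; refine ⟨C1 + C2, pos!, ?_⟩
  intro U V u M0 M' fam huU hM' hU hV Nx Ny _ _ w hw; have hsx := step_pos Nx; have hsy := step_pos Ny
  have hM0 := hU.nonneg
  choose cX hX using fun i j => h1 U V u M0 M' fam huU hM' hU hV Nx Ny w hw i j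
  choose cY hY using fun j i => h2 _ _ (fun s y x => u s x y) M0 M' fam.swap
    (fun t ht => by funext y x; exact congrFun (congrFun (huU t ht) x) y) hM' hU.swap hV.swap Ny Nx (swapV w)
    (fun j i y hy x hx => by rw [swapV, val_swapC]; exact hw i j x hx y hy) j i
  have hu0 : u 0 = U 1 0 0 := by rw [← huU 0 ⟨le_rfl, hT.le⟩, zero_add]
  refine ⟨fun i j => tens Nx Ny (U 1) i j - cX i j - swapC (cY j i), fun i j x hx y hy => ?_⟩
  obtain ⟨x1, x2⟩ := hX i j x hx y hy; obtain ⟨y1, y2⟩ := hY j i y hy x hx; rw [val_sub, val_sub, val_swapC]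
  refine ⟨?_, ?_⟩
  · rw [uI, hu0, tensorProj_eq hU, x1, show corrY T β θ f1 f2 g2 u w 0 i j x y = val (cY j i) y x from y1]; ring
  · rw [show ∀ a b c : ℝ, a - b - c - a = -(b + c) by intros; ring, abs_neg]
    refine (abs_add_le _ _).trans ((add_le_add x2 y2).trans ?_)
    have p1 : 0 ≤ C1 * M' * step Ny ^ (k + 2) := pos!; have p2 : 0 ≤ C2 * M' * step Nx ^ (k + 2) := pos!; linarith

end

lemma val_zero (x y : ℝ) : val (0 : Coef k) x y = 0 := by simp [val]

lemma dval_zero (x y : ℝ) : dval (0 : Coef k) x y = 0 := by rw [← sub_self (0 : Coef k), dval_sub, sub_self]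

lemma sq_meshSize (Nx Ny : ℕ) : meshSize Nx Ny ^ 2 = step Nx ^ 2 + step Ny ^ 2 := Real.sq_sqrt pos!

section

lemma sq_normL2 {F : Fin Nx → Fin Ny → Fn₂} {c : Vh Nx Ny k}
    (h : ∀ i j, ∀ x ∈ cell Nx i, ∀ y ∈ cell Ny j, F i j x y = val (c i j) x y) : normL2 F ^ 2 = sqNorm c := by
  have : normL2 F = √(sqNorm c) := by
    rw [normL2, sqNorm, rsum_eq fun i j => by unfold uncurry; fun_prop]
    refine congrArg _ (sum_congr rfl fun i _ => sum_congr rfl fun j _ => ?_)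
    refine ii_congr fun x hx => ii_congr fun y hy => ?_; rw [uIcc_of_le (left_lt_right _ _).le] at hx hy
    simp only [h i j x hx y hy]
  rw [this, Real.sq_sqrt (sqNorm_nonneg c)]

lemma sqNorm_le_of_abs_le {c : Vh Nx Ny k} {δ : ℝ} (h : ∀ i j, ∀ x ∈ cell Nx i,
    ∀ y ∈ cell Ny j, |val (c i j) x y| ≤ δ) : sqNorm c ≤ (2 * π) ^ 2 * δ ^ 2 := by
  rw [← rsum_const (Nx := Nx) (Ny := Ny)]
  refine rsum_le (fun i j => cont₂ fp!) (fun i j => cont₂ fp!) fun i j x hx y hy => ?_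
  exact sq_le_sq' (by linarith [abs_le.1 (h i j x hx y hy)]) (abs_le.1 (h i j x hx y hy)).2

lemma sqNorm_sub_le (a b c : Vh Nx Ny k) : sqNorm (a - c) ≤ 2 * sqNorm (a - b) + 2 * sqNorm (b - c) := by
  have hc : ∀ e : Vh Nx Ny k, ∀ i j, C₂ fun x y => 2 * val (e i j) x y ^ 2 := fun e i j => cont₂ fp!
  simp only [sqNorm]; rw [← rsum_const_mul, ← rsum_const_mul, ← rsum_add (hc _) (hc _)]
  refine rsum_le (fun i j => cont₂ fp!) (fun i j => cont₂ fp!) fun i j x _ y _ => ?_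
  simp only [Pi.sub_apply, val_sub]; nlinarith [sq_nonneg (val (a i j) x y - 2 * val (b i j) x y + val (c i j) x y)]

variable (Nx Ny) in
lemma meshSize_bounds : step Nx ≤ meshSize Nx Ny ∧ step Ny ≤ meshSize Nx Ny ∧
    meshSize Nx Ny ≤ step Nx + step Ny ∧ 0 < meshSize Nx Ny := by
  have hx := step_pos Nx; have hy := step_pos Ny
  refine ⟨Real.le_sqrt_of_sq_le (by nlinarith), Real.le_sqrt_of_sq_le (by nlinarith),
    Real.sqrt_le_iff.2 ⟨pos!, by nlinarith [mul_pos hx hy]⟩, Real.sqrt_pos.2 pos!⟩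

lemma inv_sq_step_le {ρ : ℝ} (h₁ : step Nx ≤ ρ * step Ny) (h₂ : step Ny ≤ ρ * step Nx) :
    (step Nx ^ 2)⁻¹ + (step Ny ^ 2)⁻¹ ≤ 2 * (1 + ρ ^ 2) * (meshSize Nx Ny ^ 2)⁻¹ := by
  have hx := step_pos Nx; have hy := step_pos Ny
  have key : ∀ a b : ℝ, 0 < a → 0 < b → b ≤ ρ * a → (a ^ 2)⁻¹ ≤ (1 + ρ ^ 2) * (a ^ 2 + b ^ 2)⁻¹ := by
    intro a b ha hb h; rw [← div_eq_mul_inv, inv_eq_one_div, div_le_div_iff₀ pos! pos!]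
    nlinarith [pow_le_pow_left₀ hb.le h 2]
  have k1 := key _ _ hx hy h₂; have k2 := key _ _ hy hx h₁; rw [add_comm (step Ny ^ 2)] at k2
  rw [sq_meshSize]; linarith

end

lemma Smooth2.eq_zero {U : Jet} (hU : Smooth2 m M U) (h : ∀ x y, U 0 0 x y = 0) : ∀ a b x y, U a b x y = 0 := by
  have hb : ∀ b x y, U 0 b x y = 0 := by
    intro b
    induction b with
    | zero => exact h
    | succ b ih => exact fun x y => (hU.dy 0 b x y).unique (by simpa only [ih] using hasDerivAt_const y (0 : ℝ))
  intro a b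
  induction a with
  | zero => exact hb b
  | succ a ih => exact fun x y => (hU.dx a b x y).unique (by simpa only [ih] using hasDerivAt_const x (0 : ℝ))

lemma Smooth2.of_eq_zero {U : Jet} (hU : Smooth2 m M U) (h : ∀ x y, U 0 0 x y = 0) : Smooth2 m 0 U :=
  { hU with bd := fun a _ b _ x y => by rw [hU.eq_zero h, abs_zero] }

section
variable {T : ℝ} (hT : 0 < T)
    {f1 f2 : Fn} (hf1 : C∞ f1) (hf2 : C∞ f2)
    {g1 g2 : Fn₂} (hg1 : IsEFlux f1 g1) (hg2 : IsEFlux f2 g2)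
    (hg1' : LocallyLipschitz (uncurry g1)) (hg2' : LocallyLipschitz (uncurry g2))
    {U V : ℝ → Jet} (fam : TimeFamily (k + 2) (T + 2) M U V)
    {u : ℝ → Fn₂} (huU : ∀ t ∈ Icc 0 T, U (t + 1) 0 0 = u t)
include hT hf1 hf2 hg1 hg2 hg1' hg2' fam huU

/-- Where the exact solution vanishes, the discrete one does. -/
lemma errors_of_zero {t : ℝ} (ht : t ∈ Ioc 0 T) (hz : ∀ s ∈ Icc 0 t, ∀ x y, u s x y = 0) (K : ℝ)
    {uh : ℝ → Vh Nx Ny k} (huh : IsDDGSolution T β θ f1 f2 g1 g2 uh)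
    (hK : ∀ i j, ∀ x ∈ cell Nx i, ∀ y ∈ cell Ny j,
      |val (uh 0 i j) x y| ≤ K)
    (h0 : normL2 (fun i j x y => val (uh 0 i j) x y - uI T β θ f1 f2 g1 g2 u (uh 0) 0 i j x y) ≤ 0) :
    errGauss (u t) (uh t) = 0 ∧ errLobatto (u t) (uh t) = 0 := by
  have h1 : (1 : ℝ) ∈ Ioo 0 (T + 2) := ⟨one_pos, by linarith⟩
  have hUz : ∀ s ∈ Icc 1 (1 + t), ∀ x y, U s 0 0 x y = 0 := by
    intro s hs x y; have := congrFun (congrFun (huU (s - 1) ⟨by linarith [hs.1], by linarith [hs.2, ht.2]⟩) x) y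
    rw [sub_add_cancel] at this; rw [this, hz _ ⟨by linarith [hs.1], by linarith [hs.2]⟩]
  have hm : (1 : ℝ) ∈ Icc 1 (1 + t) := ⟨le_rfl, by linarith [ht.1]⟩
  have hU := fam.smooth 1 (Ioo_subset_Icc_self h1); have hV := fam.smooth' 1 h1
  have hVz : ∀ x y, V 1 0 0 x y = 0 := fun x y =>
    (uniqueDiffOn_Icc (by linarith [ht.1] : (1 : ℝ) < 1 + t) 1 hm).eq_deriv _ (fam.der 1 h1 0 0 x y).hasDerivWithinAt
      ((hasDerivWithinAt_const 1 _ (0 : ℝ)).congr (fun s hs => hUz s hs x y) (hUz 1 hm x y))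
  have hU0 := hU.of_eq_zero (hUz 1 hm); obtain ⟨C, -, hC⟩ := uI_val hf1 hf2 hg1 hg1' hg2 hg2' hT M K
  obtain ⟨W, hW⟩ := hC U V u M 0 fam huU hU.nonneg hU0 (hV.of_eq_zero hVz) Nx Ny (uh 0) hK
  have ht0 : ∀ i j x y, val (tens Nx Ny (U 1) i j) x y = 0 := by
    intro i j x y
    have hd : (fun (i' : Fin Nx) l => solEval Ny (leval y) j fun j' q => dataXY k (U 1) i' l j' q) = 0 := by
      have he : ∀ a b, U 1 a b = fun _ _ => 0 := fun a b => funext₂ (hU.eq_zero (hUz 1 hm) a b)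
      have hp : ∀ N : ℕ, ∀ [NeZero N], projData (N := N) k (fun _ : ℝ => (0 : ℝ)) (fun _ => 0) = 0 := by
        intro N _; funext i l; simp [projData, mkData]
      funext i' l; simp only [dataXY, he, hp, Pi.zero_apply]; exact map_zero _
    rw [val_tens, hd, map_zero]
  have hn : normL2 (fun i j x y => val (uh 0 i j) x y - uI T β θ f1 f2 g1 g2 u (uh 0) 0 i j x y) = 0 :=
    h0.antisymm (Real.sqrt_nonneg _)
  have hs0 := sq_normL2 (c := uh 0) (F := fun i j x y =>
    val (uh 0 i j) x y - uI T β θ f1 f2 g1 g2 u (uh 0) 0 i j x y) fun i j x hx y hy => by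
      obtain ⟨e1, e2⟩ := hW i j x hx y hy; rw [ht0, mul_zero, zero_mul, sub_zero] at e2
      rw [e1, abs_nonpos_iff.1 e2, sub_zero]
  rw [hn, zero_pow two_ne_zero] at hs0
  have hst := ((stability hf1 hf2 hg1 hg2 hg1' hg2' huh
    (Ioc_subset_Icc_self ht)).trans hs0.ge).antisymm (sqNorm_nonneg _)
  obtain ⟨D, -, hD⟩ := point_errors H.hk; have hut : u t = fun _ _ => 0 := funext₂ (hz t ⟨ht.1.le, le_rfl⟩)
  obtain ⟨p1, p2⟩ := hD Nx Ny (u t) (fun _ _ => 0) (fun _ _ => 0) (uh t) 0 0 0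
    (fun x y => by rw [hut]; exact hasDerivAt_const _ _) (fun x y => by rw [hut]; exact hasDerivAt_const _ _)
    (fun i j r _ s _ => by rw [hut]; simp [val_zero])
    (fun i j r _ s _ => by
      have : swapC (0 : Coef k) = 0 := rfl
      simp [dval_zero, this])
  rw [sub_zero, hst] at p1 p2; norm_num at p1 p2; exact ⟨p2, p1⟩

lemma exists_initial_bound (A K : ℝ) : ∃ B : ℝ, 0 ≤ B ∧ ∀ (Nx Ny : ℕ) [NeZero Nx] [NeZero Ny] (uh : ℝ → Vh Nx Ny k),
      (∀ i j, ∀ x ∈ cell Nx i, ∀ y ∈ cell Ny j, |val (uh 0 i j) x y| ≤ K) →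
      normL2 (fun i j x y => val (uh 0 i j) x y - uI T β θ f1 f2 g1 g2 u (uh 0) 0 i j x y)
        ≤ A * meshSize Nx Ny ^ (k + 2) →
      sqNorm (uh 0 - cmp Nx Ny f1 f2 (U 1)) ≤ B * (step Nx ^ (2 * k + 4) + step Ny ^ (2 * k + 4)) := by
  obtain ⟨C1, hC1, h1⟩ := uI_val hf1 hf2 hg1 hg1' hg2 hg2' hT M K; obtain ⟨C2, hC2, h2⟩ := corX_bound hf1 M
  obtain ⟨C3, hC3, h3⟩ := corX_bound hf2 M; have h1m : (1 : ℝ) ∈ Ioo 0 (T + 2) := ⟨one_pos, by linarith⟩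
  have hU := fam.smooth 1 (Ioo_subset_Icc_self h1m); set B := C1 * M + C2 + C3 with hB
  refine ⟨2 * (A ^ 2 * 2 ^ (2 * k + 3)) + 4 * ((2 * π) ^ 2 * B ^ 2), pos!, ?_⟩; intro Nx Ny _ _ uh hK hini
  obtain ⟨-, -, ms, mp⟩ := meshSize_bounds Nx Ny; have hX := step_pos Nx; have hY := step_pos Ny
  obtain ⟨W, hW⟩ := h1 U V u M M fam huU le_rfl hU (fam.smooth' 1 h1m) Nx Ny (uh 0) hK
  have i1 : sqNorm (uh 0 - W) ≤ A ^ 2 * 2 ^ (2 * k + 3) * (step Nx ^ (2 * k + 4) + step Ny ^ (2 * k + 4)) := by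
    rw [← sq_normL2 (F := fun i j x y => val (uh 0 i j) x y - uI T β θ f1 f2 g1 g2 u (uh 0) 0 i j x y)
      fun i j x hx y hy => by rw [(hW i j x hx y hy).1, Pi.sub_apply, Pi.sub_apply, val_sub]]
    refine (pow_le_pow_left₀ (Real.sqrt_nonneg _) hini 2).trans ?_
    rw [mul_pow, ← pow_mul, mul_assoc, show (k + 2) * 2 = 2 * k + 4 by ring]; gcongr
    exact (pow_le_pow_left₀ mp.le ms _).trans (add_pow_le hX.le hY.le _)
  have i2 : sqNorm (W - cmp Nx Ny f1 f2 (U 1)) ≤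
      2 * ((2 * π) ^ 2 * B ^ 2) * (step Nx ^ (2 * k + 4) + step Ny ^ (2 * k + 4)) := by
    refine (sqNorm_le_of_abs_le (δ := B * (step Nx ^ (k + 2) + step Ny ^ (k + 2))) fun i j x hx y hy => ?_).trans ?_
    · have a1 := (hW i j x hx y hy).2; have a2 := (h2 Nx (U 1) hU i x hx (mid Ny j)).1
      have a3 := (h3 Ny _ hU.swap j y hy (mid Nx i)).1
      simp only [Pi.sub_apply, cmp, val_sub, val_swapC, val_ofX (natDegree_corX_le ..)]
      rw [show ∀ a b c d : ℝ, a - (b - c - d) = (a - b) + c + d by intros; ring]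
      refine (abs_add_three _ _ _).trans ?_; have q1 : 0 ≤ C2 * step Ny ^ (k + 2) := pos!
      have q2 : 0 ≤ C3 * step Nx ^ (k + 2) := pos!; rw [hB]; linarith
    · have e : ∀ z : ℝ, z ^ (2 * k + 4) = (z ^ (k + 2)) ^ 2 := fun z => by rw [← pow_mul]; ring_nf
      rw [e, e]
      nlinarith [scale_le (add_sq_le (a := step Nx ^ (k + 2)) (b := step Ny ^ (k + 2)))
        (by positivity : 0 ≤ (2 * π) ^ 2 * B ^ 2)]
  refine (sqNorm_sub_le _ W _).trans ?_; linarith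

lemma exists_error_bound (hpde : ∀ t ∈ Ioo 0 T, ∀ x y, V (t + 1) 0 0 x y =
      U (t + 1) 2 0 x y + U (t + 1) 0 2 x y - deriv f1 (U (t + 1) 0 0 x y) * U (t + 1) 1 0 x y -
        deriv f2 (U (t + 1) 0 0 x y) * U (t + 1) 0 1 x y) (ρ A K : ℝ) {t : ℝ} (ht : t ∈ Ioc 0 T) :
    ∃ D : ℝ, 0 ≤ D ∧ ∀ (Nx Ny : ℕ) [NeZero Nx] [NeZero Ny], step Nx ≤ ρ * step Ny → step Ny ≤ ρ * step Nx →
      ∀ uh : ℝ → Vh Nx Ny k, IsDDGSolution T β θ f1 f2 g1 g2 uh →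
      (∀ i j, ∀ x ∈ cell Nx i, ∀ y ∈ cell Ny j, |val (uh 0 i j) x y| ≤ K) →
      normL2 (fun i j x y => val (uh 0 i j) x y - uI T β θ f1 f2 g1 g2 u (uh 0) 0 i j x y)
        ≤ A * meshSize Nx Ny ^ (k + 2) →
      errGauss (u t) (uh t) ^ 2 ≤ D * (meshSize Nx Ny ^ (k + 1)) ^ 2 ∧
        errLobatto (u t) (uh t) ^ 2 ≤ D * (meshSize Nx Ny ^ (k + 2)) ^ 2 := by
  obtain ⟨B, hB, hI⟩ := exists_initial_bound hT hf1 hf2 hg1 hg2 hg1' hg2' fam huU A K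
  obtain ⟨C, h₀, hC, hh0, hen⟩ := energy_bound (T := T) hf1 hf2 hg1 hg2 hg1' hg2' M ρ hB
  obtain ⟨P, hP, hp⟩ := point_errors H.hk; obtain ⟨E1, hE1, he1⟩ := cmp_error hf1 hf2 M ρ
  obtain ⟨E2, hE2, he2⟩ := cmp_error hf2 hf1 M ρ; set S := (2 * π) ^ 2 * K ^ 2
  have htm : t + 1 ∈ Icc 0 (T + 2) := ⟨by linarith [ht.1], by linarith [ht.2]⟩; have hUt := fam.smooth _ htm
  have hM := hUt.nonneg; have hut := huU t (Ioc_subset_Icc_self ht); set G := 2 * (1 + ρ ^ 2)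
  have hG0 : 0 < G := pos!
  have hG1 : 1 ≤ G := by nlinarith [sq_nonneg ρ]
  refine ⟨P * (4 * (E1 + E2) ^ 2 + G * (2 * C)) + P * (M ^ 2 + (1 + G * (h₀ ^ 2)⁻¹) * S) * ((h₀ ^ (k + 1)) ^ 2)⁻¹ +
    P * (M ^ 2 + (1 + G * (h₀ ^ 2)⁻¹) * S) * ((h₀ ^ (k + 2)) ^ 2)⁻¹, pos!, ?_⟩
  intro Nx Ny _ _ hr1 hr2 uh huh hK hini; obtain ⟨mx, my, ms, mp⟩ := meshSize_bounds Nx Ny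
  have hinv := inv_sq_step_le hr1 hr2; have hX := step_pos Nx; have hY := step_pos Ny; set h := meshSize Nx Ny
  set D1 := P * (4 * (E1 + E2) ^ 2 + G * (2 * C)) with hD1
  set D2 := P * (M ^ 2 + (1 + G * (h₀ ^ 2)⁻¹) * S) with hD2; have hD10 : 0 ≤ D1 := pos!; have hD20 : 0 ≤ D2 := pos!
  have hdx : ∀ x y, HasDerivAt (fun x => u t x y) (U (t + 1) 1 0 x y) x := by
    intro x y; simpa only [hut] using hUt.dx 0 0 x y
  have hdy : ∀ x y, HasDerivAt (fun y => u t x y) (U (t + 1) 0 1 x y) y := by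
    intro x y; simpa only [hut] using hUt.dy 0 0 x y
  by_cases hfine : h ≤ h₀
  · suffices hs : errGauss (u t) (uh t) ^ 2 ≤ D1 * (h ^ (k + 1)) ^ 2 ∧
        errLobatto (u t) (uh t) ^ 2 ≤ D1 * (h ^ (k + 2)) ^ 2 by
      have q1 : 0 ≤ D2 * ((h₀ ^ (k + 1)) ^ 2)⁻¹ := pos!; have q2 : 0 ≤ D2 * ((h₀ ^ (k + 2)) ^ 2)⁻¹ := pos!
      exact ⟨hs.1.trans (by gcongr; linarith), hs.2.trans (by gcongr; linarith)⟩
    have i3 := hen Nx Ny hr1 hr2 (mx.trans hfine) (my.trans hfine) U V fam hpde uh huh (hI Nx Ny uh hK hini) t ht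
    have i4 : sqNorm (uh t - cmp Nx Ny f1 f2 (U (t + 1))) ≤ 2 * C * (h ^ (k + 2)) ^ 2 := by
      refine i3.trans ?_; rw [← pow_mul, show (k + 2) * 2 = 2 * k + 4 by ring]
      nlinarith [pow_le_pow_left₀ hX.le mx (2 * k + 4), pow_le_pow_left₀ hY.le my (2 * k + 4)]
    have pw : ∀ n, step Nx ^ n + step Ny ^ n ≤ 2 * h ^ n := fun n => by
      linarith [pow_le_pow_left₀ hX.le mx n, pow_le_pow_left₀ hY.le my n]
    obtain ⟨p1, p2⟩ := hp Nx Ny (u t) _ _ (uh t) (cmp Nx Ny f1 f2 (U (t + 1)))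
      ((E1 + E2) * (2 * h ^ (k + 2))) ((E1 + E2) * (2 * h ^ (k + 1))) hdx hdy
      (fun i j r hr s hs => by
        rw [← hut]; refine ((he1 Nx Ny hr2 _ hUt i j).1 r hr s hs).trans ?_; gcongr
        exacts [le_add_of_nonneg_right hE2.le, pw _])
      (fun i j r hr s hs => ⟨by
        refine ((he1 Nx Ny hr2 _ hUt i j).2 r hr s hs).trans ?_; gcongr
        exacts [le_add_of_nonneg_right hE2.le, pw _], by
        have := (he2 Ny Nx hr1 _ hUt.swap j i).2 s hs r hr; rw [← swapV_cmp hUt] at this; refine this.trans ?_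
        rw [add_comm (step Ny ^ _)]; gcongr
        exacts [le_add_of_nonneg_left hE1.le, pw _]⟩)
    constructor
    · refine p2.trans ?_; have := mul_le_mul hinv i4 (sqNorm_nonneg _) pos!
      rw [show G * (h ^ 2)⁻¹ * (2 * C * (h ^ (k + 2)) ^ 2) = G * (2 * C) * (h ^ (k + 1)) ^ 2 by
        field_simp; ring] at this
      rw [hD1, mul_assoc P]; gcongr; linarith
    · refine p1.trans ?_; rw [hD1, mul_assoc P]; gcongr
      have : 2 * C * (h ^ (k + 2)) ^ 2 ≤ G * (2 * C * (h ^ (k + 2)) ^ 2) := le_mul_of_one_le_left pos! hG1; linarith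
  · have hlt := (not_le.1 hfine).le
    suffices hs : errGauss (u t) (uh t) ^ 2 ≤ D2 ∧ errLobatto (u t) (uh t) ^ 2 ≤ D2 by
      have key : ∀ n, D2 ≤ D2 * ((h₀ ^ n) ^ 2)⁻¹ * (h ^ n) ^ 2 := by
        intro n; rw [mul_assoc]; refine le_mul_of_one_le_right hD20 ?_; rw [inv_mul_eq_div, one_le_div pos!]; gcongr
      have q : ∀ n, 0 ≤ D2 * ((h₀ ^ n) ^ 2)⁻¹ := fun n => pos!; constructor
      · refine (hs.1.trans (key (k + 1))).trans ?_; gcongr; linarith [q (k + 2)]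
      · refine (hs.2.trans (key (k + 2))).trans ?_; gcongr; linarith [q (k + 1)]
    have hst := (stability hf1 hf2 hg1 hg2 hg1' hg2' huh (Ioc_subset_Icc_self ht)).trans (sqNorm_le_of_abs_le hK)
    obtain ⟨p1, p2⟩ := hp Nx Ny (u t) _ _ (uh t) 0 M M hdx hdy (fun i j r _ s _ => by
        rw [← hut, Pi.zero_apply, Pi.zero_apply, val_zero, sub_zero]
        exact hUt.bd 0 om! 0 om! _ _)
      (fun i j r _ s _ => by
        have : swapC (0 : Coef k) = 0 := rfl
        rw [Pi.zero_apply, Pi.zero_apply, this, dval_zero, dval_zero, sub_zero, sub_zero]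
        exact ⟨hUt.bd 1 om! 0 om! _ _, hUt.bd 0 om! 1 om! _ _⟩)
    rw [sub_zero] at p1 p2; have hS0 : 0 ≤ S := pos!
    have hq : G * (h ^ 2)⁻¹ ≤ G * (h₀ ^ 2)⁻¹ := by gcongr
    have q : 0 ≤ G * (h₀ ^ 2)⁻¹ * S := pos!; constructor
    · refine p2.trans ?_; rw [hD2]; have := mul_le_mul (hinv.trans hq) hst (sqNorm_nonneg _) pos!
      refine scale_le ?_ hP.le; linarith
    · refine p1.trans ?_; rw [hD2]; refine scale_le ?_ hP.le; linarith

end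

end DDG

end

theorem theorem4p3 (k : ℕ) (hk : 2 ≤ k) (T : ℝ) (hT : 0 < T)
    (f₁ f₂ : ℝ → ℝ) (hf₁ : ContDiff ℝ ∞ f₁) (hf₂ : ContDiff ℝ ∞ f₂)
    (g₁ g₂ : ℝ → ℝ → ℝ) (hg₁ : DDG.IsEFlux f₁ g₁) (hg₂ : DDG.IsEFlux f₂ g₂)
    (hg₁' : LocallyLipschitz (Function.uncurry g₁)) (hg₂' : LocallyLipschitz (Function.uncurry g₂))
    (β₀ β₁ : ℝ) (hβ₁ : β₁ = 1 / (2 * (k : ℝ) * ((k : ℝ) + 1))) (hβ₀ : DDG.Gam k β₁ ≤ β₀)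
    (u₀ : ℝ → ℝ → ℝ) (hu₀ : ContDiff ℝ ∞ (Function.uncurry u₀))
    (u : ℝ → ℝ → ℝ → ℝ) (hu : DDG.IsSolution T f₁ f₂ u₀ u)
    (huH : ∀ t ∈ Set.Icc 0 T, DDG.MemH (k + 4) (u t))
    (huB : BddAbove ((fun s => DDG.normH (k + 4) (u s)) '' Set.Icc 0 T))
    (ρ C₀ K : ℝ) :
    ∀ t ∈ Set.Ioc 0 T, ∃ C : ℝ, ∀ (Nx Ny : ℕ) [NeZero Nx] [NeZero Ny],
      DDG.step Nx ≤ ρ * DDG.step Ny → DDG.step Ny ≤ ρ * DDG.step Nx →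
      ∀ uh : ℝ → DDG.Vh Nx Ny k, DDG.IsDDGSolution T β₀ β₁ f₁ f₂ g₁ g₂ uh →
      (∀ i j, ∀ x ∈ Set.Icc (DDG.left Nx i) (DDG.right Nx i),
        ∀ y ∈ Set.Icc (DDG.left Ny j) (DDG.right Ny j), |DDG.val (uh 0 i j) x y| ≤ K) →
      DDG.normL2 (fun i j x y => DDG.val (uh 0 i j) x y
          - DDG.uI T β₀ β₁ f₁ f₂ g₁ g₂ u (uh 0) 0 i j x y)
        ≤ C₀ * DDG.meshSize Nx Ny ^ (k + 2) * DDG.normH (k + 4) u₀ →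
      DDG.errGauss (u t) (uh t)
          ≤ C * DDG.meshSize Nx Ny ^ (k + 1) * DDG.supNormH (k + 4) u t ∧
        DDG.errLobatto (u t) (uh t)
          ≤ C * DDG.meshSize Nx Ny ^ (k + 2) * DDG.supNormH (k + 4) u t := by
  have hr : 6 ≤ k + 4 := by omega
  obtain ⟨M, U, V, fam, huU, hpde⟩ := hu.exists_timeFamily hT.le hf₁ hf₂ hu₀ hr huH huB (k + 2)
  intro t ht
  have hsub : Set.Icc 0 t ⊆ Set.Icc 0 T := Set.Icc_subset_Icc_right ht.2
  have hS : 0 ≤ DDG.supNormH (k + 4) u t :=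
    Real.sSup_nonneg (by rintro _ ⟨s, -, rfl⟩; exact Real.sqrt_nonneg _)
  have : DDG.Params k β₀ β₁ := ⟨hk, hβ₁, hβ₀⟩
  rcases hS.eq_or_lt with h0 | hpos
  · have hn : ∀ s ∈ Set.Icc 0 t, DDG.normH (k + 4) (u s) = 0 := fun s hs =>
      le_antisymm (h0 ▸ le_csSup (huB.mono (Set.image_mono hsub)) ⟨s, hs, rfl⟩) (Real.sqrt_nonneg _)
    have hz : ∀ s ∈ Set.Icc 0 t, ∀ x y, u s x y = 0 := fun s hs x y => by
      rw [DDG.eq_zero_of_normH (huH s (hsub hs)) (huU s (hsub hs) ▸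
        (fam.smooth (s + 1) ⟨by linarith [hs.1], by linarith [(hsub hs).2]⟩).cont 0 0) (hn s hs)]
    refine ⟨0, fun Nx Ny _ _ _ _ uh huh hK hini => ?_⟩
    rw [← hu.initial, hn 0 ⟨le_rfl, ht.1.le⟩, mul_zero] at hini
    obtain ⟨h1, h2⟩ := DDG.errors_of_zero hT hf₁ hf₂ hg₁ hg₂ hg₁' hg₂' fam huU ht hz K huh hK hini
    rw [h1, h2]
    simp
  · obtain ⟨D, hD, h⟩ := DDG.exists_error_bound hT hf₁ hf₂ hg₁ hg₂ hg₁' hg₂' fam huU hpde ρ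
      (C₀ * DDG.normH (k + 4) u₀) K ht
    refine ⟨√D / DDG.supNormH (k + 4) u t, fun Nx Ny _ _ h₁ h₂ uh huh hK hini => ?_⟩
    obtain ⟨e₁, e₂⟩ := h Nx Ny h₁ h₂ uh huh hK (hini.trans (le_of_eq (by ring)))
    have hm := (DDG.meshSize_bounds Nx Ny).2.2.2
    have key : ∀ (e : ℝ) (n : ℕ), e ^ 2 ≤ D * (DDG.meshSize Nx Ny ^ n) ^ 2 →
        e ≤ √D / DDG.supNormH (k + 4) u t * DDG.meshSize Nx Ny ^ n * DDG.supNormH (k + 4) u t := by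
      intro e n he
      rw [mul_right_comm, div_mul_cancel₀ _ hpos.ne']
      refine le_of_sq_le_sq ?_ (by positivity)
      rwa [mul_pow, Real.sq_sqrt hD]
    exact ⟨key _ _ e₁, key _ _ e₂⟩
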